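/- Let $K$ be a field of characteristic $0$. All complexes are $\mathbb Z$-graded $K$-complexes with differential of degree $-1$. Let $\mathcal C$ be a (symmetric) dg cooperad with $\mathcal C(0)=0$, $\mathcal C(1)=K$, let $\mathcal P$ be a dg operad with $\mathcal P(0)=0$, $\mathcal P(1)=K$, and let $\tau:\mathcal C\to\mathcal P$ be an operadic twisting morphism, i.e. an equivariant map of degree $-1$ with $\partial\tau+\tau\star\tau=0$ in the convolution pre-Lie algebra $\mathrm{Hom}(\mathcal C,\mathcal P)$. For a conilpotent $\mathcal C$-coalgebra $C$ and a $\mathcal P$-algebra $A$, write $\Delta_n:C\to(\mathcal C(n)\otimes C^{\otimes n})^{\Sigma_n}$ for the structure maps of $C$ (the component of the structure map $\Delta_C:C\to\mathcal C\circ C=\bigoplus_n(\mathcal C(n)\otimes C^{\otimes n})_{\Sigma_n}$ is the class of $\frac1{n!}\Delta_n$), and let $F_rC=\{x:\Delta_n(x)=0\text{ for all }n>r\}$ be the coradical filtration. On $L=\mathrm{Hom}_K(C,A)$ put $$l_1(f)=\partial f=d_A f-(-1)^{|f|}f d_C,\qquad l_n(f_1,\dots,f_n)=\mu_A\circ(\tau\otimes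 f_1\otimes\cdots\otimes f_n)\circ\Delta_n\quad(n\ge2),$$ and let $L$ be filtered by the subspaces $\{f: f|_{F_rC}=0\}$. Then: 1. These operations, which are graded symmetric of degree $-1$, make $\mathrm{Hom}_K(C,A)$ a complete filtered $L_\infty$-algebra (in the convention in which all operations $l_n$ are symmetric of degree $-1$), natural in $C$ and in $A$: composition with a morphism of $\mathcal P$-algebras $A\to B$ or of $\mathcal C$-coalgebras $C'\to C$ is a strict filtered $L_\infty$-morphism. 2. The Maurer–Cartan elements, i.e. the elements $\varphi$ of degree $0$ with $\sum_{n\ge1}\frac1{n!}l_n(\varphi,\dots,\varphi)=0$, are exactly the twisting morphisms relative to $\tau$, i.e. the degree $0$ maps $\varphi:C\to A$ with $\partial\varphi+\star_\tau(\varphi)=0$, where $\star_\tau(\varphi)$ is the composite $C\xrightarrow{\Delta_C}\mathcal C\circ C\xrightarrow{\tau\circ\varphi}\mathcal P\circ A\xrightarrow{\mu_A}A$. 3. The cobar construction $\Omega_\tau C$ exists: it is the free graded $\mathcal P$-algebra $\mathcal P(C)$ with the differential $d_1-d_2$, where $d_1$ is induced by $d_C$ and $d_{\mathcal P}$, and $d_2$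 is the derivation extending $C\xrightarrow{\Delta_C}\mathcal C\circ C\xrightarrow{\tau\circ\mathrm{id}}\mathcal P\circ C$. Restriction to the generators $\iota:C\to\Omega_\tau C$ is a bijection from the morphisms of $\mathcal P$-algebras $\Omega_\tau C\to A$ to the Maurer–Cartan elements of $\mathrm{Hom}_K(C,A)$. 4. Two morphisms of $\mathcal P$-algebras $f,g:\Omega_\tau C\to A$ are homotopic in the model category of $\mathcal P$-algebras (weak equivalences: quasi-isomorphisms; homotopic means right homotopic, through some path object of $A$) if and only if the corresponding Maurer–Cartan elements $f\iota$ and $g\iota$ are gauge equivalent, i.e. there is a Maurer–Cartan element $z(t)$ of the completed extension of scalars $L\,\widehat\otimes\,\Omega_1=\varprojlim_r\,(L/\{f: f|_{F_rC}=0\})\otimes\Omega_1$ with $z(0)=f\iota$ and $z(1)=g\iota$, where $\Omega_1=K[t]\oplus K[t]\,dt$ is the algebra of polynomial de Rham forms on the interval. -/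

import Mathlib

open scoped TensorProduct
open CategoryTheory

universe u

noncomputable section

namespace ConvLInf

/-! ### Graded and differential graded vector spaces, Koszul signs -/

/-- A `ℤ`-graded vector space, as a vector space with an internal direct sum decomposition. -/
structure GrMod (K : Type u) [Field K] where
  carrier : Type u
  [addCommGroup : AddCommGroup carrier]
  [module : Module K carrier]
  gr : ℤ → Submodule K carrier
  internal : DirectSum.IsInternal gr

instance (K : Type u) [Field K] : CoeSort (GrMod K) (Type u) := ⟨GrMod.carrier⟩
attribute [instance] GrMod.addCommGroup GrMod.module

variable {K : Type u} [Field K]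

theorem GrMod.bijective_coeLinearMap (V : GrMod K) :
    Function.Bijective (DirectSum.coeLinearMap V.gr) := V.internal

/-- The projection onto the even (`b = 0`) or odd (`b = 1`) part of a graded vector space. -/
def GrMod.part (V : GrMod K) (b : ZMod 2) : V →ₗ[K] V :=
  DirectSum.toModule K ℤ V (fun k => if (k : ZMod 2) = b then (V.gr k).subtype else 0) ∘ₗ
    (LinearEquiv.ofBijective (DirectSum.coeLinearMap V.gr) V.bijective_coeLinearMap).symm.toLinearMap

/-- The sign involution `v ↦ (-1)^{|v|} v`. -/
def GrMod.sgn (V : GrMod K) : V →ₗ[K] V := V.part 0 - V.part 1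

/-- A chain complex of vector spaces, graded homologically: the differential has degree `-1`. -/
structure DGMod (K : Type u) [Field K] extends GrMod K where
  d : carrier →ₗ[K] carrier
  d_mem : ∀ (k : ℤ) (x : carrier), x ∈ gr k → d x ∈ gr (k - 1)
  d_d : ∀ x : carrier, d (d x) = 0

instance (K : Type u) [Field K] : CoeSort (DGMod K) (Type u) := ⟨fun V => V.toGrMod.carrier⟩

/-- The degree `k` part of `V ⊗ W`. -/
def tensorGr (V W : GrMod K) (k : ℤ) : Submodule K (V ⊗[K] W) :=
  Submodule.span K {t | ∃ (i j : ℤ) (v : V) (w : W),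
    i + j = k ∧ v ∈ V.gr i ∧ w ∈ W.gr j ∧ t = v ⊗ₜ[K] w}

/-- The differential `d ⊗ 1 + (-1)^{|·|} ⊗ d` of `V ⊗ W`. -/
def tensorD (V W : DGMod K) : V ⊗[K] W →ₗ[K] V ⊗[K] W :=
  TensorProduct.map V.d LinearMap.id + TensorProduct.map V.toGrMod.sgn W.d

/-- The symmetry `v ⊗ w ↦ (-1)^{|v||w|} w ⊗ v`. -/
def braid (V W : GrMod K) : V ⊗[K] W →ₗ[K] W ⊗[K] V :=
  (TensorProduct.comm K V W).toLinearMap ∘ₗ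
    (TensorProduct.map LinearMap.id (W.part 0) + TensorProduct.map V.sgn (W.part 1))

/-- The degree `k` part of `M ⊗ V^{⊗ n}`. -/
def opGr (M V : GrMod K) (n : ℕ) (k : ℤ) : Submodule K (M ⊗[K] (⨂[K]^n V)) :=
  Submodule.span K {t | ∃ (p : ℤ) (e : Fin n → ℤ) (m : M) (v : Fin n → V),
    p + ∑ i, e i = k ∧ m ∈ M.gr p ∧ (∀ i, v i ∈ V.gr (e i)) ∧
      t = m ⊗ₜ[K] PiTensorProduct.tprod K v}

/-- The differential of `V^{⊗ n}`. -/
def powD (V : DGMod K) (n : ℕ) : (⨂[K]^n V) →ₗ[K] (⨂[K]^n V) :=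
  ∑ i : Fin n, PiTensorProduct.map
    (fun j : Fin n => if j < i then V.toGrMod.sgn else if j = i then V.d else LinearMap.id)

/-- The differential of `M ⊗ V^{⊗ n}`. -/
def opD (M V : DGMod K) (n : ℕ) : M ⊗[K] (⨂[K]^n V) →ₗ[K] M ⊗[K] (⨂[K]^n V) :=
  TensorProduct.map M.d LinearMap.id + TensorProduct.map M.toGrMod.sgn (powD V n)

/-- The Koszul sign of the permutation `σ` (the factor in position `i` moves to position `σ i`)
on a tensor product of factors of parities `p i`. -/
def koszulSign {n : ℕ} (σ : Equiv.Perm (Fin n)) (p : Fin n → ZMod 2) : ℤ :=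
  ∏ i, ∏ j, if i < j ∧ σ j < σ i ∧ p i = 1 ∧ p j = 1 then -1 else 1

/-- The action of a permutation on `V^{⊗ n}` with Koszul signs. -/
def koszulPerm (V : GrMod K) {n : ℕ} (σ : Equiv.Perm (Fin n)) :
    (⨂[K]^n V) →ₗ[K] (⨂[K]^n V) :=
  ∑ p : Fin n → ZMod 2, koszulSign σ p •
    ((PiTensorProduct.reindex K (fun _ : Fin n => (V : Type u)) σ).toLinearMap ∘ₗ
      PiTensorProduct.map (fun i => V.part (p i)))

/-- The isomorphism `V^{⊗ (m+1)} → V ⊗ V^{⊗ m}` splitting off the first factor. -/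
def uncons (V : GrMod K) (m : ℕ) : (⨂[K]^(m + 1) V) →ₗ[K] V ⊗[K] (⨂[K]^m V) :=
  TensorProduct.map
      (PiTensorProduct.subsingletonEquiv (R := K) (s := fun _ : Fin 1 => (V : Type u))
        (0 : Fin 1)).toLinearMap LinearMap.id ∘ₗ
    (TensorPower.mulEquiv (R := K) (M := V) (n := 1) (m := m)).symm.toLinearMap ∘ₗ
    (TensorPower.cast K V (Nat.add_comm m 1)).toLinearMap

/-! ### Bijections between finite sets of inputs -/

def optSumL (J I : Type) : Option J ⊕ I ≃ Option (J ⊕ I) where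
  toFun
    | .inl none => none
    | .inl (some j) => some (.inl j)
    | .inr i => some (.inr i)
  invFun
    | none => .inl none
    | some (.inl j) => .inl (some j)
    | some (.inr i) => .inr i
  left_inv := by rintro ((_ | _) | _) <;> rfl
  right_inv := by rintro (_ | (_ | _)) <;> rfl

def optSumR (J I : Type) : J ⊕ Option I ≃ Option (J ⊕ I) where
  toFun
    | .inr none => none
    | .inl j => some (.inl j)
    | .inr (some i) => some (.inr i)
  invFun
    | none => .inr none
    | some (.inl j) => .inl j
    | some (.inr i) => .inr (some i)
  left_inv := by rintro (_ | (_ | _)) <;> rfl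
  right_inv := by rintro (_ | (_ | _)) <;> rfl

def optSwap (I : Type) : Option (Option I) ≃ Option (Option I) where
  toFun
    | none => some none
    | some none => none
    | some (some i) => some (some i)
  invFun
    | none => some none
    | some none => none
    | some (some i) => some (some i)
  left_inv := by rintro (_ | (_ | _)) <;> rfl
  right_inv := by rintro (_ | (_ | _)) <;> rfl

def sumLeftComm (J L I : Type) : J ⊕ (L ⊕ I) ≃ L ⊕ (J ⊕ I) where
  toFun
    | .inl j => .inr (.inl j)
    | .inr (.inl l) => .inl l
    | .inr (.inr i) => .inr (.inr i)
  invFun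
    | .inl l => .inr (.inl l)
    | .inr (.inl j) => .inl j
    | .inr (.inr i) => .inr (.inr i)
  left_inv := by rintro (_ | (_ | _)) <;> rfl
  right_inv := by rintro (_ | (_ | _)) <;> rfl

def unitSum (I : Type) : Unit ⊕ I ≃ Option I where
  toFun
    | .inl _ => none
    | .inr i => some i
  invFun
    | none => .inl ()
    | some i => .inr i
  left_inv := by rintro (_ | _) <;> rfl
  right_inv := by rintro (_ | _) <;> rfl

def optEmpty : Option Empty ≃ Unit where
  toFun _ := ()
  invFun _ := none
  left_inv := by rintro (_ | x) <;> first | rfl | exact x.elim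
  right_inv := fun _ => rfl

def finOneUnit : Fin 1 ≃ Unit where
  toFun _ := ()
  invFun _ := 0
  left_inv := fun _ => Subsingleton.elim _ _
  right_inv := fun _ => rfl

/-! ### Operads and cooperads -/

/-- A (symmetric) dg operad, in its coordinate-free partial form: `obj I` is the complex of
operations whose inputs are labelled by the finite set `I` (so `P(n)` is `obj (Fin n)`), bijections
relabel the inputs, and `comp (μ ⊗ ν)` inserts `ν` (inputs `J`) into the distinguished input `none`
of `μ` (inputs `Option I`). Every partial composition `∘ᵢ` is obtained by relabelling. -/
structure Operad (K : Type u) [Field K] where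
  obj : (I : Type) → [Finite I] → DGMod K
  map : {I J : Type} → [Finite I] → [Finite J] → (I ≃ J) → (obj I →ₗ[K] obj J)
  map_refl : ∀ (I : Type) [Finite I] (x : obj I), map (Equiv.refl I) x = x
  map_trans : ∀ (I J L : Type) [Finite I] [Finite J] [Finite L] (e : I ≃ J) (f : J ≃ L) (x : obj I),
    map (e.trans f) x = map f (map e x)
  map_mem : ∀ (I J : Type) [Finite I] [Finite J] (e : I ≃ J) (k : ℤ) (x : obj I),
    x ∈ (obj I).gr k → map e x ∈ (obj J).gr k
  map_d : ∀ (I J : Type) [Finite I] [Finite J] (e : I ≃ J) (x : obj I),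
    map e ((obj I).d x) = (obj J).d (map e x)
  comp : {I J : Type} → [Finite I] → [Finite J] →
    (obj (Option I) ⊗[K] obj J →ₗ[K] obj (J ⊕ I))
  comp_mem : ∀ (I J : Type) [Finite I] [Finite J] (k : ℤ) (t : obj (Option I) ⊗[K] obj J),
    t ∈ tensorGr (obj (Option I)).toGrMod (obj J).toGrMod k → comp t ∈ (obj (J ⊕ I)).gr k
  comp_d : ∀ (I J : Type) [Finite I] [Finite J] (t : obj (Option I) ⊗[K] obj J),
    (obj (J ⊕ I)).d (comp t) = comp (tensorD (obj (Option I)) (obj J) t)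
  comp_map : ∀ (I I' J J' : Type) [Finite I] [Finite I'] [Finite J] [Finite J']
    (e : I ≃ I') (f : J ≃ J') (x : obj (Option I)) (y : obj J),
    comp (map (Equiv.optionCongr e) x ⊗ₜ[K] map f y) = map (Equiv.sumCongr f e) (comp (x ⊗ₜ[K] y))
  /-- sequential composition -/
  assoc_seq : ∀ (I J L : Type) [Finite I] [Finite J] [Finite L]
    (x : obj (Option I)) (y : obj (Option J)) (z : obj L),
    comp (map (optSumL J I) (comp (x ⊗ₜ[K] y)) ⊗ₜ[K] z) =
      map (Equiv.sumAssoc L J I) (comp (x ⊗ₜ[K] comp (y ⊗ₜ[K] z)))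
  /-- parallel composition -/
  assoc_par : ∀ (I J L : Type) [Finite I] [Finite J] [Finite L] (p q : ℤ)
    (x : obj (Option (Option I))) (y : obj J) (z : obj L),
    y ∈ (obj J).gr p → z ∈ (obj L).gr q →
    comp (map (optSumR J I) (comp (x ⊗ₜ[K] y)) ⊗ₜ[K] z) =
      ((p * q).negOnePow : ℤ) • map (sumLeftComm J L I)
        (comp (map (optSumR L I) (comp (map (optSwap I) x ⊗ₜ[K] z)) ⊗ₜ[K] y))
  one : obj Unit
  one_mem : one ∈ (obj Unit).gr 0
  one_d : (obj Unit).d one = 0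
  comp_one : ∀ (I : Type) [Finite I] (x : obj (Option I)),
    map (unitSum I) (comp (x ⊗ₜ[K] one)) = x
  one_comp : ∀ (J : Type) [Finite J] (y : obj J),
    map (Equiv.sumEmpty J Empty) (comp (map optEmpty.symm one ⊗ₜ[K] y)) = y

/-- `P(0) = 0` and `P(1) = K`. -/
structure Operad.IsConnected (P : Operad K) : Prop where
  zero : Subsingleton (P.obj Empty)
  one : Function.Bijective (fun a : K => a • P.one)

/-- A dg cooperad, in the form dual to `Operad`: `decomp` is the partial decomposition map which
separates the inputs `J` from the inputs `I`. -/
structure Cooperad (K : Type u) [Field K] where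
  obj : (I : Type) → [Finite I] → DGMod K
  map : {I J : Type} → [Finite I] → [Finite J] → (I ≃ J) → (obj I →ₗ[K] obj J)
  map_refl : ∀ (I : Type) [Finite I] (x : obj I), map (Equiv.refl I) x = x
  map_trans : ∀ (I J L : Type) [Finite I] [Finite J] [Finite L] (e : I ≃ J) (f : J ≃ L) (x : obj I),
    map (e.trans f) x = map f (map e x)
  map_mem : ∀ (I J : Type) [Finite I] [Finite J] (e : I ≃ J) (k : ℤ) (x : obj I),
    x ∈ (obj I).gr k → map e x ∈ (obj J).gr k
  map_d : ∀ (I J : Type) [Finite I] [Finite J] (e : I ≃ J) (x : obj I),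
    map e ((obj I).d x) = (obj J).d (map e x)
  decomp : {I J : Type} → [Finite I] → [Finite J] →
    (obj (J ⊕ I) →ₗ[K] obj (Option I) ⊗[K] obj J)
  decomp_mem : ∀ (I J : Type) [Finite I] [Finite J] (k : ℤ) (x : obj (J ⊕ I)),
    x ∈ (obj (J ⊕ I)).gr k → decomp x ∈ tensorGr (obj (Option I)).toGrMod (obj J).toGrMod k
  decomp_d : ∀ (I J : Type) [Finite I] [Finite J] (x : obj (J ⊕ I)),
    decomp ((obj (J ⊕ I)).d x) = tensorD (obj (Option I)) (obj J) (decomp x)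
  decomp_map : ∀ (I I' J J' : Type) [Finite I] [Finite I'] [Finite J] [Finite J']
    (e : I ≃ I') (f : J ≃ J') (x : obj (J ⊕ I)),
    decomp (map (Equiv.sumCongr f e) x) =
      TensorProduct.map (map (Equiv.optionCongr e)) (map f) (decomp x)
  coassoc_seq : ∀ (I J L : Type) [Finite I] [Finite J] [Finite L] (x : obj (L ⊕ (J ⊕ I))),
    TensorProduct.assoc K _ _ _ (TensorProduct.map (decomp ∘ₗ map (optSumL J I).symm)
        (LinearMap.id : obj L →ₗ[K] obj L) (decomp x)) =
      TensorProduct.map (LinearMap.id : obj (Option I) →ₗ[K] obj (Option I))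
        (decomp : obj (L ⊕ J) →ₗ[K] _)
        (decomp (map (Equiv.sumAssoc L J I).symm x))
  coassoc_par : ∀ (I J L : Type) [Finite I] [Finite J] [Finite L] (x : obj (L ⊕ (J ⊕ I))),
    TensorProduct.assoc K _ _ _ (TensorProduct.map (decomp ∘ₗ map (optSumR J I).symm)
        (LinearMap.id : obj L →ₗ[K] obj L) (decomp x)) =
      TensorProduct.map (map (optSwap I)) (braid (obj L).toGrMod (obj J).toGrMod)
        (TensorProduct.assoc K _ _ _ (TensorProduct.map (decomp ∘ₗ map (optSumR L I).symm)
          (LinearMap.id : obj J →ₗ[K] obj J) (decomp (map (sumLeftComm J L I).symm x))))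
  counit : obj Unit →ₗ[K] K
  counit_gr : ∀ (k : ℤ) (x : obj Unit), k ≠ 0 → x ∈ (obj Unit).gr k → counit x = 0
  counit_d : ∀ x : obj Unit, counit ((obj Unit).d x) = 0
  decomp_counit : ∀ (I : Type) [Finite I] (x : obj (Unit ⊕ I)),
    TensorProduct.rid K _ (TensorProduct.map
        (LinearMap.id : obj (Option I) →ₗ[K] obj (Option I)) counit (decomp x)) =
      map (unitSum I) x
  counit_decomp : ∀ (J : Type) [Finite J] (x : obj (J ⊕ Empty)),
    TensorProduct.lid K _ (TensorProduct.map (counit ∘ₗ map optEmpty)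
        (LinearMap.id : obj J →ₗ[K] obj J) (decomp x)) =
      map (Equiv.sumEmpty J Empty) x

/-- `𝒞(0) = 0` and `𝒞(1) = K`. -/
structure Cooperad.IsConnected (𝒞 : Cooperad K) : Prop where
  zero : Subsingleton (𝒞.obj Empty)
  one : Function.Bijective 𝒞.counit

/-- An operadic twisting morphism: an equivariant map of degree `-1` with
`∂ τ + τ ⋆ τ = 0` for the convolution pre-Lie product. The product `τ ⋆ τ` is the sum over all
ways to separate a subset `S` of the inputs. -/
structure TwistingMorphism (𝒞 : Cooperad K) (P : Operad K) where
  toFun : (I : Type) → [Finite I] → (𝒞.obj I →ₗ[K] P.obj I)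
  natural : ∀ (I J : Type) [Finite I] [Finite J] (e : I ≃ J) (x : 𝒞.obj I),
    toFun J (𝒞.map e x) = P.map e (toFun I x)
  degree : ∀ (I : Type) [Finite I] (k : ℤ) (x : 𝒞.obj I),
    x ∈ (𝒞.obj I).gr k → toFun I x ∈ (P.obj I).gr (k - 1)
  maurerCartan : ∀ (n : ℕ) (x : 𝒞.obj (Fin n)),
    (P.obj (Fin n)).d (toFun (Fin n) x) + toFun (Fin n) ((𝒞.obj (Fin n)).d x) +
      ∑ S : Finset (Fin n), P.map (Equiv.sumCompl (· ∈ S)) (P.comp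
        (TensorProduct.map
          (toFun (Option {i // i ∉ S}) ∘ₗ (𝒞.obj (Option {i // i ∉ S})).toGrMod.sgn)
          (toFun {i // i ∈ S})
          (𝒞.decomp (𝒞.map (Equiv.sumCompl (· ∈ S)).symm x)))) = 0

/-! ### Algebras over operads -/

/-- A graded algebra over (the graded operad underlying) `P`. The operations are given by
equivariant maps `P(n) ⊗ A^{⊗ n} → A`. -/
structure GrAlg (P : Operad K) extends GrMod K where
  act : (n : ℕ) → (P.obj (Fin n) ⊗[K] (⨂[K]^n carrier) →ₗ[K] carrier)
  act_mem : ∀ (n : ℕ) (k : ℤ) (t : P.obj (Fin n) ⊗[K] (⨂[K]^n carrier)),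
    t ∈ opGr (P.obj (Fin n)).toGrMod toGrMod n k → act n t ∈ gr k
  act_perm : ∀ (n : ℕ) (σ : Equiv.Perm (Fin n)) (t : P.obj (Fin n) ⊗[K] (⨂[K]^n carrier)),
    act n (TensorProduct.map (P.map σ) (koszulPerm toGrMod σ) t) = act n t
  act_one : ∀ a : carrier,
    act 1 (P.map finOneUnit.symm P.one ⊗ₜ[K] PiTensorProduct.tprod K (fun _ => a)) = a
  /-- `(μ ∘₁ ν)(b₁, …, bₙ, a₁, …, aₘ) = μ(ν(b₁, …, bₙ), a₁, …, aₘ)` -/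
  act_comp : ∀ (m n : ℕ) (μ : P.obj (Fin (m + 1))) (ν : P.obj (Fin n))
    (b : Fin n → carrier) (a : Fin m → carrier),
    act (n + m) (P.map finSumFinEquiv (P.comp (P.map (finSuccEquiv m) μ ⊗ₜ[K] ν)) ⊗ₜ[K]
        PiTensorProduct.tprod K (Fin.append b a)) =
      act (m + 1) (μ ⊗ₜ[K] PiTensorProduct.tprod K
        (Fin.cons (act n (ν ⊗ₜ[K] PiTensorProduct.tprod K b)) a : Fin (m + 1) → carrier))

/-- A (dg) algebra over the dg operad `P`. -/
structure DGAlg (P : Operad K) extends GrAlg P where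
  d : carrier →ₗ[K] carrier
  d_mem : ∀ (k : ℤ) (x : carrier), x ∈ gr k → d x ∈ gr (k - 1)
  d_d : ∀ x : carrier, d (d x) = 0
  act_d : ∀ (n : ℕ) (t : P.obj (Fin n) ⊗[K] (⨂[K]^n carrier)),
    d (act n t) = act n (opD (P.obj (Fin n))
      { toGrMod := toGrMod, d := d, d_mem := d_mem, d_d := d_d } n t)

/-- A morphism of graded `P`-algebras. -/
structure GrAlg.Hom {P : Operad K} (A B : GrAlg P) where
  toLin : A.carrier →ₗ[K] B.carrier
  map_mem : ∀ (k : ℤ) (x : A.carrier), x ∈ A.gr k → toLin x ∈ B.gr k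
  map_act : ∀ (n : ℕ) (t : P.obj (Fin n) ⊗[K] (⨂[K]^n A.carrier)),
    toLin (A.act n t) =
      B.act n (TensorProduct.map LinearMap.id (PiTensorProduct.map (fun _ => toLin)) t)

/-- A morphism of dg `P`-algebras. -/
@[ext]
structure DGAlg.Hom {P : Operad K} (A B : DGAlg P) where
  toLin : A.carrier →ₗ[K] B.carrier
  map_mem : ∀ (k : ℤ) (x : A.carrier), x ∈ A.gr k → toLin x ∈ B.gr k
  map_d : ∀ x : A.carrier, toLin (A.d x) = B.d (toLin x)
  map_act : ∀ (n : ℕ) (t : P.obj (Fin n) ⊗[K] (⨂[K]^n A.carrier)),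
    toLin (A.act n t) =
      B.act n (TensorProduct.map LinearMap.id (PiTensorProduct.map (fun _ => toLin)) t)

instance (P : Operad K) : Category (DGAlg P) where
  Hom A B := DGAlg.Hom A B
  id A :=
    { toLin := LinearMap.id
      map_mem := fun _ _ h => h
      map_d := fun _ => rfl
      map_act := fun n t => by simp [PiTensorProduct.map_id] }
  comp f g :=
    { toLin := g.toLin ∘ₗ f.toLin
      map_mem := fun k x h => g.map_mem k _ (f.map_mem k x h)
      map_d := fun x => by simp [f.map_d, g.map_d]
      map_act := fun n t => by
        have h : (TensorProduct.map (LinearMap.id : P.obj (Fin n) →ₗ[K] P.obj (Fin n))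
            (PiTensorProduct.map (fun _ : Fin n => g.toLin ∘ₗ f.toLin))) =
            TensorProduct.map LinearMap.id (PiTensorProduct.map (fun _ => g.toLin)) ∘ₗ
              TensorProduct.map LinearMap.id (PiTensorProduct.map (fun _ => f.toLin)) := by
          rw [PiTensorProduct.map_comp, ← TensorProduct.map_comp, LinearMap.id_comp]
        rw [h, LinearMap.comp_apply, LinearMap.comp_apply, f.map_act, g.map_act] }

/-- A morphism is a quasi-isomorphism if it is injective and surjective on homology. -/
def DGAlg.Hom.IsQuasiIso {P : Operad K} {A B : DGAlg P} (f : DGAlg.Hom A B) : Prop :=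
  (∀ x, A.d x = 0 → (∃ y, f.toLin x = B.d y) → ∃ z, x = A.d z) ∧
  (∀ y, B.d y = 0 → ∃ x z, A.d x = 0 ∧ y = f.toLin x + B.d z)

/-- The weak equivalences of the model category of `P`-algebras are the quasi-isomorphisms. The
right homotopy relation `HomotopicalAlgebra.RightHomotopyRel` only depends on them. -/
instance (P : Operad K) : HomotopicalAlgebra.CategoryWithWeakEquivalences (DGAlg P) where
  weakEquivalences := fun _ _ f => DGAlg.Hom.IsQuasiIso f

/-! ### Coalgebras over cooperads -/

/-- A conilpotent (dg) coalgebra over the cooperad `𝒞`. The structure is given by the maps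
`Δ n : C → (𝒞(n) ⊗ C^{⊗ n})^{Sₙ} ⊆ 𝒞(n) ⊗ C^{⊗ n}` dual to the structure maps
`P(n) ⊗ A^{⊗ n} → A` of an algebra. In terms of `𝒞 ∘ C = ⨁ₙ (𝒞(n) ⊗ C^{⊗ n})_{Sₙ}`, the component
of the structure map `C → 𝒞 ∘ C` is the class of `(1 / n!) Δ n`, since coinvariants are identified
with invariants by the norm map `[t] ↦ ∑ σ, σ t`. -/
structure Coalg (𝒞 : Cooperad K) extends DGMod K where
  Δ : (n : ℕ) → (carrier →ₗ[K] 𝒞.obj (Fin n) ⊗[K] (⨂[K]^n carrier))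
  Δ_mem : ∀ (n : ℕ) (k : ℤ) (x : carrier), x ∈ gr k →
    Δ n x ∈ opGr (𝒞.obj (Fin n)).toGrMod toGrMod n k
  Δ_d : ∀ (n : ℕ) (x : carrier), Δ n (d x) = opD (𝒞.obj (Fin n)) toDGMod n (Δ n x)
  Δ_perm : ∀ (n : ℕ) (σ : Equiv.Perm (Fin n)) (x : carrier),
    TensorProduct.map (𝒞.map σ) (koszulPerm toGrMod σ) (Δ n x) = Δ n x
  Δ_counit : ∀ x : carrier,
    TensorProduct.lid K carrier (TensorProduct.map (𝒞.counit ∘ₗ 𝒞.map finOneUnit)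
      (PiTensorProduct.subsingletonEquiv (R := K) (s := fun _ : Fin 1 => carrier)
        (0 : Fin 1)).toLinearMap (Δ 1 x)) = x
  Δ_coassoc : ∀ (m n : ℕ) (x : carrier),
    TensorProduct.assoc K _ _ _ (TensorProduct.map
        (TensorProduct.map (𝒞.map (finSuccEquiv m).symm)
          (LinearMap.id : 𝒞.obj (Fin n) →ₗ[K] 𝒞.obj (Fin n)) ∘ₗ
            𝒞.decomp ∘ₗ 𝒞.map finSumFinEquiv.symm)
        (TensorPower.mulEquiv (R := K) (M := carrier) (n := n) (m := m)).symm.toLinearMap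
        (Δ (n + m) x)) =
      TensorProduct.map (LinearMap.id : 𝒞.obj (Fin (m + 1)) →ₗ[K] 𝒞.obj (Fin (m + 1)))
        ((TensorProduct.assoc K _ _ _).toLinearMap ∘ₗ
          TensorProduct.map (Δ n) LinearMap.id ∘ₗ uncons toGrMod m)
        (Δ (m + 1) x)
  conilpotent : ∀ x : carrier, ∃ r : ℕ, ∀ n, r < n → Δ n x = 0

/-- The coradical filtration `F_r C = {x | Δ n x = 0 for all n > r}`. -/
def Coalg.coradical {𝒞 : Cooperad K} (C : Coalg 𝒞) (r : ℕ) : Submodule K C.carrier :=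
  ⨅ n ∈ Set.Ioi r, LinearMap.ker (C.Δ n)

/-- A morphism of `𝒞`-coalgebras. -/
structure Coalg.Hom {𝒞 : Cooperad K} (C D : Coalg 𝒞) where
  toLin : C.carrier →ₗ[K] D.carrier
  map_mem : ∀ (k : ℤ) (x : C.carrier), x ∈ C.gr k → toLin x ∈ D.gr k
  map_d : ∀ x : C.carrier, toLin (C.d x) = D.d (toLin x)
  map_Δ : ∀ (n : ℕ) (x : C.carrier),
    D.Δ n (toLin x) =
      TensorProduct.map LinearMap.id (PiTensorProduct.map (fun _ => toLin)) (C.Δ n x)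

/-! ### Complete `L∞`-algebras -/

/-- The data of a filtered graded vector space with operations `l n` of `n` variables. The
underlying graded vector space is the family `gr k` of subspaces of the ambient space `M`, and
`sgn` is the sign involution. -/
structure LInftyData (K : Type u) [Field K] (M : Type u) [AddCommGroup M] [Module K M] where
  gr : ℤ → Submodule K M
  fil : ℕ → Submodule K M
  sgn : M →ₗ[K] M
  l : (n : ℕ) → (Fin n → M) → M

/-- The Koszul sign of the unshuffle which moves the positions in `S` to the front. -/
def unshuffleSign {n : ℕ} (e : Fin n → ℤ) (S : Finset (Fin n)) : ℤ :=
  ∏ i ∈ Sᶜ, ∏ j ∈ S, if i < j ∧ Odd (e i) ∧ Odd (e j) then -1 else 1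

/-- A complete (filtered) `L∞`-algebra, with the convention that all operations are graded symmetric
of degree `-1`, so that the higher Jacobi identities read
`∑_S ± l (l (x_S), x_{Sᶜ}) = 0`. The differential is `l 1`. The last fields say that the filtration
is complete and compatible with the operations, and that series `∑ₙ l n (x, …, x) / n!` converge. -/
structure IsCompleteLInfty {M : Type u} [AddCommGroup M] [Module K M] (D : LInftyData K M) :
    Prop where
  gr_indep : iSupIndep D.gr
  sgn_apply : ∀ (k : ℤ) (x : M), x ∈ D.gr k → D.sgn x = (k.negOnePow : ℤ) • x
  multilinear : ∀ n, ∃ φ : MultilinearMap K (fun _ : Fin n => M) M, ∀ x, D.l n x = φ x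
  l_zero : ∀ x, D.l 0 x = 0
  l_mem : ∀ (n : ℕ) (e : Fin n → ℤ) (x : Fin n → M), (∀ i, x i ∈ D.gr (e i)) →
    D.l n x ∈ D.gr (∑ i, e i - 1)
  l_symm : ∀ (n : ℕ) (e : Fin n → ℤ) (x : Fin n → M) (σ : Equiv.Perm (Fin n)),
    (∀ i, x i ∈ D.gr (e i)) →
    D.l n (fun i => x (σ.symm i)) = koszulSign σ (fun i => (e i : ZMod 2)) • D.l n x
  jacobi : ∀ (n : ℕ) (e : Fin n → ℤ) (x : Fin n → M), (∀ i, x i ∈ D.gr (e i)) →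
    ∑ S : Finset (Fin n) with S.Nonempty, unshuffleSign e S •
      D.l (Sᶜ.card + 1) (Fin.cons (D.l S.card (fun i => x (S.orderEmbOfFin rfl i)))
        (fun i => x (Sᶜ.orderEmbOfFin rfl i)) : Fin (Sᶜ.card + 1) → M) = 0
  fil_anti : Antitone D.fil
  fil_zero : D.fil 0 = ⊤
  fil_separated : ⨅ N, D.fil N = ⊥
  fil_complete : ∀ (k : ℤ) (x : ℕ → M), (∀ N, x N ∈ D.gr k) →
    (∀ N, x (N + 1) - x N ∈ D.fil N) → ∃ y ∈ D.gr k, ∀ N, x N - y ∈ D.fil N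
  l_fil : ∀ (n N : ℕ) (x : Fin n → M), (∃ i, x i ∈ D.fil N) → D.l n x ∈ D.fil N
  l_conv : ∀ N : ℕ, ∃ n₀ : ℕ, ∀ n, n₀ ≤ n → ∀ x, D.l n x ∈ D.fil N

/-- A strict morphism of filtered `L∞`-algebras. -/
structure IsStrictMorphism {M N : Type u} [AddCommGroup M] [Module K M] [AddCommGroup N]
    [Module K N] (D : LInftyData K M) (E : LInftyData K N) (φ : M →ₗ[K] N) : Prop where
  map_gr : ∀ (k : ℤ) (x : M), x ∈ D.gr k → φ x ∈ E.gr k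
  map_fil : ∀ (r : ℕ) (x : M), x ∈ D.fil r → φ x ∈ E.fil r
  map_l : ∀ (n : ℕ) (x : Fin n → M), φ (D.l n x) = E.l n (fun i => φ (x i))

/-- Maurer–Cartan elements: elements `x` of degree `0` with `∑_{n ≥ 1} l n (x, …, x) / n! = 0`,
the series converging to `0` in the topology of the filtration. -/
def IsMaurerCartan {M : Type u} [AddCommGroup M] [Module K M] (D : LInftyData K M) (x : M) :
    Prop :=
  x ∈ D.gr 0 ∧ ∀ N : ℕ, ∃ n₀ : ℕ, ∀ n, n₀ ≤ n →
    ∑ k ∈ Finset.range n, ((k + 1).factorial : K)⁻¹ • D.l (k + 1) (fun _ => x) ∈ D.fil N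

/-- Sequences in `M` which tend to `0` in the topology of the filtration. -/
def LInftyData.IsNull {M : Type u} [AddCommGroup M] [Module K M] (D : LInftyData K M)
    (a : ℕ → M) : Prop :=
  ∀ N : ℕ, ∃ j₀ : ℕ, ∀ j, j₀ ≤ j → a j ∈ D.fil N

theorem LInftyData.IsNull.add {M : Type u} [AddCommGroup M] [Module K M] {D : LInftyData K M}
    {a b : ℕ → M} (ha : D.IsNull a) (hb : D.IsNull b) : D.IsNull (a + b) := fun N => by
  obtain ⟨i, hi⟩ := ha N
  obtain ⟨j, hj⟩ := hb N
  exact ⟨max i j, fun k hk => (D.fil N).add_mem (hi k (le_trans (le_max_left _ _) hk))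
    (hj k (le_trans (le_max_right _ _) hk))⟩

theorem LInftyData.IsNull.smul {M : Type u} [AddCommGroup M] [Module K M] {D : LInftyData K M}
    {a : ℕ → M} (c : K) (ha : D.IsNull a) : D.IsNull (c • a) := fun N => by
  obtain ⟨i, hi⟩ := ha N
  exact ⟨i, fun k hk => (D.fil N).smul_mem c (hi k hk)⟩

/-- The (completed) extension of scalars `L ⊗̂ Ω₁ = lim_N (L / fil N) ⊗ Ω₁` of a complete
`L∞`-algebra `L` by the polynomial de Rham forms `Ω₁ = K[t] ⊕ K[t] dt` on the interval, with `t` of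
degree `0` and `dt` of degree `-1`. The pair `(a, b)` stands for
`∑ₖ aₖ ⊗ tᵏ + ∑ₖ bₖ ⊗ tᵏ dt`; in an element of the completed tensor product `aₖ` and `bₖ` tend
to `0`. The operations are
`l n (x₁ ⊗ ω₁, …, xₙ ⊗ ωₙ) = ± l n (x₁, …, xₙ) ⊗ ω₁ ⋯ ωₙ`, with the Koszul sign for moving each `ωᵢ`
past the `xⱼ` with `j > i`, plus the de Rham differential `x ⊗ ω ↦ (-1)^{|x|} x ⊗ dω` for `n = 1`. -/
def LInftyData.interval {M : Type u} [AddCommGroup M] [Module K M] (D : LInftyData K M) :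
    LInftyData K ((ℕ → M) × (ℕ → M)) where
  gr k :=
    { carrier := {z | ((∀ j, z.1 j ∈ D.gr k) ∧ ∀ j, z.2 j ∈ D.gr (k + 1)) ∧
        D.IsNull z.1 ∧ D.IsNull z.2}
      add_mem' := fun {y z} hy hz =>
        ⟨⟨fun j => (D.gr k).add_mem (hy.1.1 j) (hz.1.1 j),
          fun j => (D.gr (k + 1)).add_mem (hy.1.2 j) (hz.1.2 j)⟩,
          hy.2.1.add hz.2.1, hy.2.2.add hz.2.2⟩
      zero_mem' := ⟨⟨fun _ => (D.gr k).zero_mem, fun _ => (D.gr (k + 1)).zero_mem⟩,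
        fun N => ⟨0, fun _ _ => (D.fil N).zero_mem⟩, fun N => ⟨0, fun _ _ => (D.fil N).zero_mem⟩⟩
      smul_mem' := fun c z hz =>
        ⟨⟨fun j => (D.gr k).smul_mem c (hz.1.1 j), fun j => (D.gr (k + 1)).smul_mem c (hz.1.2 j)⟩,
          hz.2.1.smul c, hz.2.2.smul c⟩ }
  fil N :=
    { carrier := {z | (∀ j, z.1 j ∈ D.fil N) ∧ ∀ j, z.2 j ∈ D.fil N}
      add_mem' := fun {y z} hy hz =>
        ⟨fun j => (D.fil N).add_mem (hy.1 j) (hz.1 j), fun j => (D.fil N).add_mem (hy.2 j) (hz.2 j)⟩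
      zero_mem' := ⟨fun _ => (D.fil N).zero_mem, fun _ => (D.fil N).zero_mem⟩
      smul_mem' := fun c z hz =>
        ⟨fun j => (D.fil N).smul_mem c (hz.1 j), fun j => (D.fil N).smul_mem c (hz.2 j)⟩ }
  sgn :=
    { toFun := fun z => (fun j => D.sgn (z.1 j), fun j => - D.sgn (z.2 j))
      map_add' := fun y z => by ext j <;> simp [add_comm]
      map_smul' := fun c z => by ext j <;> simp }
  l n z :=
    (fun m => ∑ k ∈ Finset.piAntidiag (Finset.univ : Finset (Fin n)) m,
        D.l n (fun i => (z i).1 (k i)),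
      fun m => (∑ j : Fin n, ∑ k ∈ Finset.piAntidiag (Finset.univ : Finset (Fin n)) m,
          D.l n (fun i => if i < j then (z i).1 (k i) else
            if i = j then (z i).2 (k i) else D.sgn ((z i).1 (k i)))) +
        if h : n = 1 then (m + 1) • D.sgn ((z ⟨0, by omega⟩).1 (m + 1)) else 0)

/-- Gauge (homotopy) equivalence of Maurer–Cartan elements: there is a Maurer–Cartan element of
`L ⊗̂ Ω₁` whose value at `t = 0` is `x` and whose value at `t = 1` is `y`. -/
def GaugeEquiv {M : Type u} [AddCommGroup M] [Module K M] (D : LInftyData K M) (x y : M) : Prop :=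
  ∃ z : (ℕ → M) × (ℕ → M), IsMaurerCartan D.interval z ∧ z.1 0 = x ∧
    D.IsNull (fun j => ∑ i ∈ Finset.range j, z.1 i - y)

/-! ### The convolution algebra -/

section Convolution

variable {𝒞 : Cooperad K} {P : Operad K} (τ : TwistingMorphism 𝒞 P) (C : Coalg 𝒞) (A : DGAlg P)

/-- The even or odd part of a linear map between graded vector spaces. -/
def homPart (V W : GrMod K) (b : ZMod 2) (f : V →ₗ[K] W) : V →ₗ[K] W :=
  W.part b ∘ₗ f ∘ₗ V.part 0 + W.part (b + 1) ∘ₗ f ∘ₗ V.part 1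

/-- The sign involution `f ↦ (-1)^{|f|} f` on linear maps. -/
def homSgn (V W : GrMod K) : (V →ₗ[K] W) →ₗ[K] (V →ₗ[K] W) :=
  LinearMap.llcomp K V W W W.sgn ∘ₗ LinearMap.lcomp K W V.sgn

/-- The differential `∂ f = d_A ∘ f - (-1)^{|f|} f ∘ d_C`. -/
def homD (f : C.carrier →ₗ[K] A.carrier) : C.carrier →ₗ[K] A.carrier :=
  A.d ∘ₗ f - homSgn C.toGrMod A.toGrMod f ∘ₗ C.d

/-- The map `τ ⊗ f₁ ⊗ ⋯ ⊗ fₙ : 𝒞(n) ⊗ C^{⊗ n} → P(n) ⊗ A^{⊗ n}`, with the Koszul sign rule: a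
homogeneous `fᵢ` of parity `p i` is moved past the element of `𝒞(n)` and past the first `i - 1`
factors of `C^{⊗ n}`. -/
def convTensor (n : ℕ) (f : Fin n → (C.carrier →ₗ[K] A.carrier)) :
    𝒞.obj (Fin n) ⊗[K] (⨂[K]^n C.carrier) →ₗ[K] P.obj (Fin n) ⊗[K] (⨂[K]^n A.carrier) :=
  ∑ p : Fin n → ZMod 2, TensorProduct.map
    (τ.toFun (Fin n) ∘ₗ (𝒞.obj (Fin n)).toGrMod.sgn ^ (∑ i, (p i).val))
    (PiTensorProduct.map (fun j => homPart C.toGrMod A.toGrMod (p j) (f j) ∘ₗ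
      C.toGrMod.sgn ^ (∑ i ∈ Finset.Ioi j, (p i).val)))

/-- The `L∞`-structure on `Hom(C, A)`: `l n (f₁, …, fₙ)` is the composite of `Δ n`,
`τ ⊗ f₁ ⊗ ⋯ ⊗ fₙ` and the action of `P`, plus `∂ f₁` for `n = 1`. A homogeneous map of degree `k`
raises degrees by `k`, and the filtration consists of the maps vanishing on the coradical
filtration of `C`. -/
def convLInfty : LInftyData K (C.carrier →ₗ[K] A.carrier) where
  gr k :=
    { carrier := {f | ∀ (i : ℤ) (x : C.carrier), x ∈ C.gr i → f x ∈ A.gr (i + k)}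
      add_mem' := fun hf hg i x hx => (A.gr (i + k)).add_mem (hf i x hx) (hg i x hx)
      zero_mem' := fun i _ _ => (A.gr (i + k)).zero_mem
      smul_mem' := fun c _ hf i x hx => (A.gr (i + k)).smul_mem c (hf i x hx) }
  fil N :=
    { carrier := {f | ∀ x ∈ C.coradical N, f x = 0}
      add_mem' := fun hf hg x hx => by simp [hf x hx, hg x hx]
      zero_mem' := fun x _ => rfl
      smul_mem' := fun c f hf x hx => by simp [hf x hx] }
  sgn := homSgn C.toGrMod A.toGrMod
  l n f := A.act n ∘ₗ convTensor τ C A n f ∘ₗ C.Δ n +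
    if h : n = 1 then homD C A (f ⟨0, by omega⟩) else 0

/-- The Maurer–Cartan operator `⋆_τ(φ) : C → 𝒞 ∘ C → P ∘ A → A` for `φ` of degree `0`; the factor
`1 / n!` is the one relating `Δ n` to the structure map `C → 𝒞 ∘ C`. The sum is finite. -/
def mcOperator (φ : C.carrier →ₗ[K] A.carrier) (c : C.carrier) : A.carrier :=
  ∑ᶠ n : ℕ, (n.factorial : K)⁻¹ • A.act n
    (TensorProduct.map (τ.toFun (Fin n)) (PiTensorProduct.map (fun _ => φ)) (C.Δ n c))

/-- Twisting morphisms relative to `τ`: maps `φ : C → A` of degree `0` with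
`∂ φ + ⋆_τ(φ) = 0`. -/
def IsTwisting (φ : C.carrier →ₗ[K] A.carrier) : Prop :=
  (∀ (k : ℤ) (x : C.carrier), x ∈ C.gr k → φ x ∈ A.gr k) ∧
    ∀ c : C.carrier, A.d (φ c) - φ (C.d c) + mcOperator τ C A φ c = 0

/-- A cobar construction `Ω_τ C = (P(C), d_Ω)`: a `P`-algebra which, as a graded `P`-algebra, is
free on the graded vector space underlying `C`, and whose differential is given on the generators
by `d_C` and by `C → 𝒞 ∘ C → P ∘ C` through `τ`. (Since the differential of a `P`-algebra is
a derivation, it is determined by its values on generators.) -/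
structure CobarConstruction where
  alg : DGAlg P
  ι : C.carrier →ₗ[K] alg.carrier
  ι_mem : ∀ (k : ℤ) (x : C.carrier), x ∈ C.gr k → ι x ∈ alg.gr k
  free : ∀ (B : GrAlg P) (f : C.carrier →ₗ[K] B.carrier),
    (∀ (k : ℤ) (x : C.carrier), x ∈ C.gr k → f x ∈ B.gr k) →
      ∃! g : GrAlg.Hom alg.toGrAlg B, g.toLin ∘ₗ ι = f
  d_ι : ∀ c : C.carrier, alg.d (ι c) = ι (C.d c) - mcOperator τ C alg ι c

end Convolution

end ConvLInf

end

open ConvLInf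

/-!
The operations of the convolution algebra are built from `τ`, the decompositions `Δ n` of the
coalgebra and the structure maps of the algebra. For inputs of degree `0` no signs occur in them,
and the Jacobi identities are a rewriting of the Maurer–Cartan equation of `τ` (`jacobi_even`). To
reach inputs of arbitrary degrees, the algebra `A` is enlarged to the square-zero extension `A + ε
A` by an odd variable (`GrAlg.eps`): if `f` has odd degree then `ε f` is even, and `ε` can be
pulled out of the operations at the cost of a Koszul sign (`convOp_eps_single`). Hence the
symmetry of the operations and the Jacobi identities follow by induction on the number of odd
inputs (`jacobi_par`). All this is done for algebras with an odd derivation `d` that need not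
square to zero, with `d²` as the right-hand side of the Jacobi identity for one input; the cobar
construction depends on this.

Coassociativity implies that for `x` in the step `F_M C` of the coradical filtration all factors
of `Δ n x` are in `F_{M - n + 1} C` (`Coalg.map_Δ_eq_zero`). Therefore the operations are
compatible with the filtration of `Hom(C, A)`, which is complete as `C` is the union of the `F_r
C` (`isCompleteLInfty_conv`), and on each `F_r C` the Maurer–Cartan series of a map `φ` of degree
`0` is a finite sum. Its value is the curvature `∂ φ + ⋆_τ(φ)`, so that Maurer–Cartan elements and
twisting morphisms agree (`isMaurerCartan_iff`).

The free graded algebra on `C` consists of the formal expressions in elements of `C`, up to the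
identities which hold for all maps from `C` to algebras (`freeAlg`). A derivation is the same as a
homomorphism `x ↦ x + ε d x` to the square-zero extension, so it can be prescribed on generators
(`freeDer`). The differential of the cobar construction is chosen such that the inclusion of the
generators has curvature zero. By the Bianchi identity (`bianchi`), a consequence of the Jacobi
identities, this forces its square to vanish on generators and hence everywhere (`cobarDer_d_d`).
A homomorphism of graded algebras on the cobar construction commutes with the differentials if and
only if its restriction to the generators has curvature zero, which gives the bijection of
morphisms and Maurer–Cartan elements (`CobarConstruction.existsUnique_hom`).

The path algebra `A ⊗ Ω₁` (`DGAlg.path`) consists of the polynomials in `t` with coefficients in a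
square-zero extension of `A` by `dt`. Integration of polynomials shows that the inclusion of
constant paths is a quasi-isomorphism, so that it is a path object (`DGAlg.pathObject`). An
element of degree `0` of the completed tensor product `Hom(C, A) ⊗ Ω₁` is a map `C → A ⊗ Ω₁` whose
values on each `F_r C` have bounded degree in `t`; gauge equivalences are thus bounded twisting
morphisms to the path algebra (`gaugeEquiv_iff`). By the universal property they are morphisms
`Ω_τ C → A ⊗ Ω₁`, which are homotopies.

Conversely, let `B` be a path object of `A` with maps `s : A → B` and `p₀, p₁ : B → A`, and let `φ
: C → B` correspond to a homotopy. As `s` is a quasi-isomorphism, the complex `ker p₀` has a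
contraction. It is used to deform the linear path from `s p₀ φ` to `φ` into a twisting morphism to
`B ⊗ Ω₁` with the same end points and the same image under `p₀`. This is done by successive
approximation along the coradical filtration: at each stage the curvature `R` vanishes on `F_k C`,
is closed on `F_{k+1} C` by the Bianchi identity, and is removed there by subtracting the
contraction of `R` (`exists_curv_eq_zero`). As the contraction acts on coefficients, the degree in
`t` remains bounded on each `F_r C`. The image of this path under `p₁` joins `p₀ φ` to `p₁ φ`, as
`p₁ s` is the identity (`exists_path_of_pathObject`). No factorization into cofibrations and
fibrations is needed.
-/

noncomputable section

namespace ConvLInf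

variable {K : Type u} [Field K]

/-! ### Parity calculus on graded vector spaces -/

theorem GrMod.homogeneous_induction (V : GrMod K) {p : V → Prop} (x : V)
    (hom : ∀ k, ∀ x ∈ V.gr k, p x) (add : ∀ x y, p x → p y → p (x + y)) : p x := by
  have hx : x ∈ ⨆ k, V.gr k := by
    rw [((DirectSum.isInternal_submodule_iff_iSupIndep_and_iSup_eq_top _).1 V.internal).2]
    trivial
  exact Submodule.iSup_induction V.gr (motive := p) hx hom (hom 0 0 (Submodule.zero_mem _)) add

theorem GrMod.hom_ext {V : GrMod K} {W : Type*} [AddCommGroup W] [Module K W] {f g : V →ₗ[K] W}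
    (h : ∀ k, ∀ x ∈ V.gr k, f x = g x) : f = g := by
  ext x
  induction x using V.homogeneous_induction with
  | hom k x hx => exact h k x hx
  | add x y hx hy => rw [map_add, map_add, hx, hy]

theorem GrMod.part_of_mem (V : GrMod K) (b : ZMod 2) {k : ℤ} {x : V} (hx : x ∈ V.gr k) :
    V.part b x = if (k : ZMod 2) = b then x else 0 := by
  have : (LinearEquiv.ofBijective (DirectSum.coeLinearMap V.gr) V.bijective_coeLinearMap).symm x
      = DirectSum.lof K ℤ (fun k => V.gr k) k ⟨x, hx⟩ := by
    rw [LinearEquiv.symm_apply_eq]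
    simp [DirectSum.coeLinearMap_lof]
  simp only [GrMod.part, LinearMap.comp_apply, LinearEquiv.coe_coe, this, DirectSum.toModule_lof]
  split_ifs <;> simp

theorem GrMod.sgn_of_mem (V : GrMod K) {k : ℤ} {x : V} (hx : x ∈ V.gr k) :
    V.sgn x = (k.negOnePow : ℤ) • x := by
  rw [GrMod.sgn, LinearMap.sub_apply, V.part_of_mem 0 hx, V.part_of_mem 1 hx]
  rcases Int.even_or_odd k with h | h
  · have h2 : (k : ZMod 2) = 0 := (ZMod.intCast_zmod_eq_zero_iff_dvd k 2).2 (by exact_mod_cast h.two_dvd)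
    simp [h2, Int.negOnePow_even k h]
  · have h2 : (k : ZMod 2) = 1 := by
      obtain ⟨m, rfl⟩ := h
      have : (2 : ZMod 2) = 0 := rfl
      push_cast; rw [this]; simp
    simp [h2, Int.negOnePow_odd k h]

theorem GrMod.part_mem (V : GrMod K) (b : ZMod 2) {k : ℤ} {x : V} (hx : x ∈ V.gr k) :
    V.part b x ∈ V.gr k := by
  rw [V.part_of_mem b hx]; split_ifs
  exacts [hx, Submodule.zero_mem _]

theorem GrMod.sgn_mem (V : GrMod K) {k : ℤ} {x : V} (hx : x ∈ V.gr k) : V.sgn x ∈ V.gr k :=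
  Submodule.sub_mem _ (V.part_mem 0 hx) (V.part_mem 1 hx)

theorem zmod_two_cases (b : ZMod 2) : b = 0 ∨ b = 1 := by revert b; decide

theorem GrMod.part_add_part (V : GrMod K) : V.part 0 + V.part 1 = LinearMap.id := by
  refine GrMod.hom_ext fun k x hx => ?_
  rw [LinearMap.add_apply, V.part_of_mem 0 hx, V.part_of_mem 1 hx]
  rcases zmod_two_cases (k : ZMod 2) with h | h <;> simp [h]

@[simp] theorem GrMod.sgn_sgn (V : GrMod K) (x : V) : V.sgn (V.sgn x) = x := by
  induction x using V.homogeneous_induction with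
  | hom k x hx =>
    rw [V.sgn_of_mem hx, map_zsmul, V.sgn_of_mem hx, smul_smul]
    simp [← Units.val_mul]
  | add x y hx hy => rw [map_add, map_add, hx, hy]

theorem GrMod.two_part_zero (V : GrMod K) (x : V) : (2 : K) • V.part 0 x = x + V.sgn x := by
  have := LinearMap.congr_fun V.part_add_part x
  simp only [LinearMap.add_apply, LinearMap.id_apply] at this
  rw [GrMod.sgn, LinearMap.sub_apply]
  nth_rw 2 [← this]
  rw [two_smul]; abel

theorem GrMod.two_part_one (V : GrMod K) (x : V) : (2 : K) • V.part 1 x = x - V.sgn x := by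
  have := LinearMap.congr_fun V.part_add_part x
  simp only [LinearMap.add_apply, LinearMap.id_apply] at this
  rw [GrMod.sgn, LinearMap.sub_apply]
  nth_rw 2 [← this]
  rw [two_smul]; abel

/-- The sign `(-1)^b` of a parity. -/
def psgn (b : ZMod 2) : ℤ := if b = 0 then 1 else -1

@[simp] theorem psgn_zero : psgn 0 = 1 := rfl
@[simp] theorem psgn_one : psgn 1 = -1 := rfl
theorem psgn_add (a b : ZMod 2) : psgn (a + b) = psgn a * psgn b := by revert a b; decide
@[simp] theorem psgn_mul_self (a : ZMod 2) : psgn a * psgn a = 1 := by revert a; decide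
theorem psgn_sum {ι : Type*} (s : Finset ι) (f : ι → ZMod 2) :
    psgn (∑ i ∈ s, f i) = ∏ i ∈ s, psgn (f i) := by
  classical
  induction s using Finset.induction_on with
  | empty => rfl
  | insert a s ha ih => rw [Finset.sum_insert ha, Finset.prod_insert ha, psgn_add, ih]
theorem psgn_intCast (k : ℤ) : psgn (k : ZMod 2) = (k.negOnePow : ℤ) := by
  rcases Int.even_or_odd' k with ⟨m, rfl | rfl⟩
  · have : ((2 * m : ℤ) : ZMod 2) = 0 := by push_cast; rw [show (2 : ZMod 2) = 0 from rfl]; simp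
    rw [this, Int.negOnePow_even _ (even_two_mul m)]; rfl
  · have : ((2 * m + 1 : ℤ) : ZMod 2) = 1 := by
      push_cast; rw [show (2 : ZMod 2) = 0 from rfl]; simp
    rw [this, Int.negOnePow_odd _ (odd_two_mul_add_one m)]; rfl

/-- `f` is homogeneous of parity `p` with respect to the sign involutions. -/
def IsPar (V W : GrMod K) (p : ZMod 2) (f : V →ₗ[K] W) : Prop :=
  ∀ x, W.sgn (f x) = psgn p • f (V.sgn x)

theorem IsPar.of_degree {V W : GrMod K} {e : ℤ} {f : V →ₗ[K] W}
    (h : ∀ k, ∀ x ∈ V.gr k, f x ∈ W.gr (k + e)) : IsPar V W e f := fun x => by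
  induction x using V.homogeneous_induction with
  | hom k x hx =>
    rw [W.sgn_of_mem (h k x hx), V.sgn_of_mem hx, map_zsmul, smul_smul, psgn_intCast, Int.negOnePow_add,
      Units.val_mul, mul_comm]
  | add x y hx hy => simp only [map_add, hx, hy, smul_add]

theorem IsPar.comp {U V W : GrMod K} {p q : ZMod 2} {f : U →ₗ[K] V} {g : V →ₗ[K] W}
    (hg : IsPar V W q g) (hf : IsPar U V p f) : IsPar U W (q + p) (g ∘ₗ f) := fun x => by
  rw [LinearMap.comp_apply, hg, hf, map_zsmul, smul_smul, psgn_add]; rfl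

theorem IsPar.add {V W : GrMod K} {p : ZMod 2} {f g : V →ₗ[K] W} (hf : IsPar V W p f)
    (hg : IsPar V W p g) : IsPar V W p (f + g) := fun x => by
  simp only [LinearMap.add_apply, map_add, hf x, hg x, smul_add]

theorem IsPar.sub {V W : GrMod K} {p : ZMod 2} {f g : V →ₗ[K] W} (hf : IsPar V W p f)
    (hg : IsPar V W p g) : IsPar V W p (f - g) := fun x => by
  simp only [LinearMap.sub_apply, map_sub, hf x, hg x, smul_sub]

theorem IsPar.smul {V W : GrMod K} {p : ZMod 2} {f : V →ₗ[K] W} (c : K) (hf : IsPar V W p f) :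
    IsPar V W p (c • f) := fun x => by
  simp only [LinearMap.smul_apply, map_smul, hf x]
  rw [smul_comm]

theorem IsPar.zero {V W : GrMod K} {p : ZMod 2} : IsPar V W p (0 : V →ₗ[K] W) := fun x => by simp

theorem IsPar.id {V : GrMod K} : IsPar V V 0 LinearMap.id := fun x => by simp

theorem IsPar.sgn_comp {V W : GrMod K} {p : ZMod 2} {f : V →ₗ[K] W} (hf : IsPar V W p f) :
    W.sgn ∘ₗ f = psgn p • (f ∘ₗ V.sgn) := LinearMap.ext hf

theorem GrMod.part_part (V : GrMod K) (b c : ZMod 2) (x : V) :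
    V.part b (V.part c x) = if b = c then V.part c x else 0 := by
  induction x using V.homogeneous_induction with
  | hom k x hx =>
    rw [V.part_of_mem b (V.part_mem c hx), V.part_of_mem c hx]
    split_ifs <;> simp_all
  | add x y hx hy =>
    rw [map_add, map_add, hx, hy]
    split_ifs <;> simp

section CharZero

variable [CharZero K]

theorem IsPar.part_apply {V W : GrMod K} {p : ZMod 2} {f : V →ₗ[K] W} (hf : IsPar V W p f)
    (b : ZMod 2) (x : V) : W.part (b + p) (f x) = f (V.part b x) := by
  have h2 : (2 : K) ≠ 0 := two_ne_zero
  refine smul_right_injective _ h2 ?_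
  change (2 : K) • _ = (2 : K) • _
  rw [← map_smul f]
  have := hf x
  have h0 := W.two_part_zero (f x)
  have h1 := W.two_part_one (f x)
  have h3 := V.two_part_zero x
  have h4 := V.two_part_one x
  rw [hf x] at h0 h1
  rcases zmod_two_cases b with rfl | rfl <;> rcases zmod_two_cases p with rfl | rfl <;>
    simp only [h0, h1, h3, h4, map_add, map_sub, psgn_zero, psgn_one, one_smul, neg_smul, add_zero,
      zero_add, sub_neg_eq_add, ← sub_eq_add_neg, show (1 + 1 : ZMod 2) = 0 from rfl]

theorem GrMod.part_of_sgn (V : GrMod K) {b : ZMod 2} {x : V} (h : V.sgn x = psgn b • x)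
    (c : ZMod 2) : V.part c x = if c = b then x else 0 := by
  have h2 : (2 : K) ≠ 0 := two_ne_zero
  refine smul_right_injective _ h2 ?_
  change (2 : K) • _ = (2 : K) • _
  have h0 := V.two_part_zero x
  have h1 := V.two_part_one x
  rw [h] at h0 h1
  rcases zmod_two_cases c with rfl | rfl <;> rcases zmod_two_cases b with rfl | rfl <;>
    simp [h0, h1, two_smul]

theorem homPart_of_isPar {V W : GrMod K} {p : ZMod 2} {f : V →ₗ[K] W} (hf : IsPar V W p f)
    (q : ZMod 2) : homPart V W q f = if q = p then f else 0 := by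
  ext x
  have h0 := hf.part_apply 0 x
  have h1 := hf.part_apply 1 x
  have h2 := LinearMap.congr_fun W.part_add_part (f x)
  simp only [LinearMap.add_apply, LinearMap.id_apply] at h2
  simp only [homPart, LinearMap.add_apply, LinearMap.comp_apply, ← h0, ← h1, W.part_part]
  rcases zmod_two_cases q with rfl | rfl <;> rcases zmod_two_cases p with rfl | rfl <;>
    simp [show (1 + 1 : ZMod 2) = 0 from rfl, h2]
  rw [add_comm, h2]

end CharZero

/-! ### Tensor powers: extensionality, Koszul permutations, insertions -/

theorem MultilinearMap.mem_of_mem_span {ι : Type*} [Finite ι] {V W : Type*} [AddCommGroup V]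
    [Module K V] [AddCommGroup W] [Module K W] {H : Set V}
    (f : MultilinearMap K (fun _ : ι => V) W) (P : Submodule K W)
    (h : ∀ v : ι → V, (∀ i, v i ∈ H) → f v ∈ P) (v : ι → V)
    (hv : ∀ i, v i ∈ Submodule.span K H) : f v ∈ P := by
  classical
  cases nonempty_fintype ι
  suffices ∀ (s : Finset ι) (v : ι → V), (∀ i ∉ s, v i ∈ H) → (∀ i, v i ∈ Submodule.span K H) →
      f v ∈ P from this Finset.univ v (by simp) hv
  intro s
  induction s using Finset.induction_on with
  | empty => exact fun v hv _ => h v (by simpa using hv)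
  | insert a s ha ih =>
    intro v hv hv'
    have key : ∀ x ∈ Submodule.span K H, f (Function.update v a x) ∈ P := fun x hx => by
      induction hx using Submodule.span_induction with
      | mem x hx =>
        refine ih _ (fun i hi => ?_) (fun i => ?_)
        · by_cases hia : i = a
          · subst hia; simpa using hx
          · rw [Function.update_of_ne hia]
            exact hv i (by simp [hia, hi])
        · by_cases hia : i = a
          · subst hia; simpa using Submodule.subset_span hx
          · rw [Function.update_of_ne hia]
            exact hv' i
      | zero => rw [f.map_update_zero]; exact P.zero_mem
      | add x y _ _ hx hy => rw [f.map_update_add]; exact P.add_mem hx hy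
      | smul c x _ hx => rw [f.map_update_smul]; exact P.smul_mem c hx
    have := key (v a) (hv' a)
    rwa [Function.update_eq_self] at this

theorem MultilinearMap.mem_of_span {ι : Type*} [Finite ι] {V W : Type*} [AddCommGroup V]
    [Module K V] [AddCommGroup W] [Module K W] {H : Set V} (hH : Submodule.span K H = ⊤)
    (f : MultilinearMap K (fun _ : ι => V) W) (P : Submodule K W)
    (h : ∀ v : ι → V, (∀ i, v i ∈ H) → f v ∈ P) (v : ι → V) : f v ∈ P :=
  MultilinearMap.mem_of_mem_span f P h v fun i => by rw [hH]; trivial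

theorem tens_ext {M V W : Type*} [AddCommGroup M] [Module K M] [AddCommGroup V] [Module K V]
    [AddCommGroup W] [Module K W] {n : ℕ} {f g : M ⊗[K] (⨂[K]^n V) →ₗ[K] W}
    (h : ∀ (m : M) (v : Fin n → V),
      f (m ⊗ₜ PiTensorProduct.tprod K v) = g (m ⊗ₜ PiTensorProduct.tprod K v)) : f = g := by
  refine TensorProduct.ext ?_
  ext m v
  exact h m v

theorem GrMod.span_homogeneous (V : GrMod K) :
    Submodule.span K {x : V | ∃ k, x ∈ V.gr k} = ⊤ := by
  rw [eq_top_iff]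
  intro x _
  induction x using V.homogeneous_induction with
  | hom k x hx => exact Submodule.subset_span ⟨k, hx⟩
  | add x y hx hy => exact Submodule.add_mem _ (hx trivial) (hy trivial)

/-- Linear maps on a tensor power agree if they agree on tensors of homogeneous vectors. -/
theorem tprod_ext_homogeneous {V : GrMod K} {W : Type*} [AddCommGroup W] [Module K W] {n : ℕ}
    {f g : (⨂[K]^n V) →ₗ[K] W}
    (h : ∀ (e : Fin n → ℤ) (v : Fin n → V), (∀ i, v i ∈ V.gr (e i)) →
      f (PiTensorProduct.tprod K v) = g (PiTensorProduct.tprod K v)) : f = g := by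
  refine PiTensorProduct.ext (MultilinearMap.ext fun v => ?_)
  have := MultilinearMap.mem_of_span V.span_homogeneous
    ((f - g).compMultilinearMap (PiTensorProduct.tprod K)) ⊥ (fun v hv => by
      choose e he using hv
      simpa [sub_eq_zero] using h e v he) v
  simpa [sub_eq_zero] using this

theorem tprod_ext_parity {V : GrMod K} {W : Type*} [AddCommGroup W] [Module K W] {n : ℕ}
    {f g : (⨂[K]^n V) →ₗ[K] W}
    (h : ∀ (p : Fin n → ZMod 2) (v : Fin n → V), (∀ i, V.sgn (v i) = psgn (p i) • v i) →
      f (PiTensorProduct.tprod K v) = g (PiTensorProduct.tprod K v)) : f = g :=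
  tprod_ext_homogeneous fun e v he => h (fun i => (e i : ZMod 2)) v fun i => by
    rw [V.sgn_of_mem (he i), psgn_intCast]

theorem tprod_zsmul {V : Type*} [AddCommGroup V] [Module K V] {n : ℕ} (c : Fin n → ℤ)
    (v : Fin n → V) : PiTensorProduct.tprod K (fun i => c i • v i) =
      ((∏ i, c i : ℤ) : K) • PiTensorProduct.tprod K v := by
  have h := (PiTensorProduct.tprod K (s := fun _ : Fin n => V)).map_smul_univ (fun i => (c i : K)) v
  simp only [Int.cast_smul_eq_zsmul] at h
  rw [h, ← Int.cast_prod]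

theorem zsmul_hom_tensorPower {V W : Type*} [AddCommGroup V] [Module K V] [AddCommGroup W]
    [Module K W] {n m : ℕ} (z : ℤ) (f : (⨂[K]^n V) →ₗ[K] (⨂[K]^m W)) : z • f = (z : K) • f :=
  (Int.cast_smul_eq_zsmul K z f).symm

theorem koszulPerm_tprod [CharZero K] (V : GrMod K) {n : ℕ} (σ : Equiv.Perm (Fin n))
    {p : Fin n → ZMod 2} {v : Fin n → V} (h : ∀ i, V.sgn (v i) = psgn (p i) • v i) :
    koszulPerm V σ (PiTensorProduct.tprod K v) =
      (koszulSign σ p : K) • PiTensorProduct.tprod K (fun i => v (σ.symm i)) := by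
  simp only [zsmul_hom_tensorPower, koszulPerm]
  rw [ LinearMap.sum_apply, Finset.sum_eq_single p]
  · simp only [LinearMap.smul_apply, LinearMap.comp_apply, PiTensorProduct.map_tprod,
      LinearEquiv.coe_coe, PiTensorProduct.reindex_tprod]
    simp only [fun i => V.part_of_sgn (h i), if_true]
  · intro q _ hq
    obtain ⟨i, hi⟩ := Function.ne_iff.1 hq
    simp only [LinearMap.smul_apply, LinearMap.comp_apply, PiTensorProduct.map_tprod]
    rw [MultilinearMap.map_coord_zero _ i, map_zero, smul_zero]
    rw [V.part_of_sgn (h i), if_neg hi]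
  · simp

/-- How the Koszul sign changes when the parity of one factor is flipped. -/
theorem koszulSign_update {n : ℕ} (σ : Equiv.Perm (Fin n)) (p : Fin n → ZMod 2) (i : Fin n) :
    (∏ j, if σ j < σ i then psgn (p j) else 1) * koszulSign σ p =
      (∏ j, if j < i then psgn (p j) else 1) *
        koszulSign σ (Function.update p i (p i + 1)) := by
  set q := Function.update p i (p i + 1) with hq
  have hqi : q i = p i + 1 := by simp [hq]
  have hqj : ∀ j, j ≠ i → q j = p j := fun j hj => by simp [hq, hj]
  set g : Fin n → Fin n → ℤ := fun a b =>
    (if a < b ∧ σ b < σ a ∧ p a = 1 ∧ p b = 1 then -1 else 1) *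
      (if a < b ∧ σ b < σ a ∧ q a = 1 ∧ q b = 1 then -1 else 1) with hg
  have sq : ∀ r : Fin n → ZMod 2, koszulSign σ r * koszulSign σ r = 1 := fun r => by
    simp only [koszulSign, ← Finset.prod_mul_distrib]
    refine Finset.prod_eq_one fun a _ => Finset.prod_eq_one fun b _ => ?_
    split_ifs <;> rfl
  have h1 : koszulSign σ p * koszulSign σ q = ∏ a, ∏ b, g a b := by
    simp only [koszulSign, ← Finset.prod_mul_distrib, hg]
  have h0 : ∀ a b, a ≠ i → b ≠ i → g a b = 1 := fun a b ha hb => by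
    simp only [hg, hqj a ha, hqj b hb]
    split_ifs <;> rfl
  have h2 : ∏ a, ∏ b, g a b = ∏ j, g i j * g j i := by
    have hii : g i i = 1 := by simp [hg]
    have : ∀ a, ∏ b, g a b = (if a = i then ∏ b, g i b else 1) * g a i := fun a => by
      by_cases ha : a = i
      · subst ha; simp [hii]
      · rw [if_neg ha, one_mul]
        exact Finset.prod_eq_single i (fun b _ hb => h0 a b ha hb) (by simp)
    rw [Finset.prod_congr rfl fun a _ => this a, Finset.prod_mul_distrib,
      Finset.prod_ite_eq' Finset.univ i, if_pos (Finset.mem_univ i), ← Finset.prod_mul_distrib]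
  have h3 : ∀ j, g i j * g j i =
      (if σ j < σ i then psgn (p j) else 1) * (if j < i then psgn (p j) else 1) := fun j => by
    by_cases hj : j = i
    · subst hj; simp [hg]
    · have hs : σ j ≠ σ i := fun h => hj (σ.injective h)
      simp only [hg, hqi, hqj j hj]
      rcases lt_or_gt_of_ne hj with h | h <;> rcases lt_or_gt_of_ne hs with h' | h' <;>
        rcases zmod_two_cases (p i) with hi | hi <;> rcases zmod_two_cases (p j) with hjj | hjj <;>
        simp [h, h', hi, hjj, not_lt_of_gt, show (1 + 1 : ZMod 2) = 0 from rfl]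
  have h4 : koszulSign σ p * koszulSign σ q =
      (∏ j, if σ j < σ i then psgn (p j) else 1) * ∏ j, if j < i then psgn (p j) else 1 := by
    rw [h1, h2, Finset.prod_congr rfl fun j _ => h3 j, Finset.prod_mul_distrib]
  have h5 : (∏ j, if j < i then psgn (p j) else 1) * (∏ j, if j < i then psgn (p j) else 1) = 1 := by
    rw [← Finset.prod_mul_distrib]
    refine Finset.prod_eq_one fun j _ => ?_
    split_ifs <;> simp
  have h6 : (∏ j, if σ j < σ i then psgn (p j) else 1) *
      (∏ j, if σ j < σ i then psgn (p j) else 1) = 1 := by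
    rw [← Finset.prod_mul_distrib]
    refine Finset.prod_eq_one fun j _ => ?_
    split_ifs <;> simp
  set x := ∏ j, if σ j < σ i then psgn (p j) else 1
  set y := ∏ j, if j < i then psgn (p j) else 1
  linear_combination x * koszulSign σ p * (-(sq q)) + x * koszulSign σ q * h4 +
    koszulSign σ q * y * h6

/-- The map `s ⊗ ⋯ ⊗ s ⊗ D ⊗ π ⊗ ⋯ ⊗ π` with `D` in position `i`. -/
def insTerm {V W : Type*} [AddCommGroup V] [Module K V] [AddCommGroup W] [Module K W]
    (s D π : V →ₗ[K] W) {n : ℕ} (i : Fin n) : (⨂[K]^n V) →ₗ[K] (⨂[K]^n W) :=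
  PiTensorProduct.map (fun j => if j < i then s else if j = i then D else π)

/-- The extension of `D` to tensor powers as a derivation along `π`. -/
def insSum {V W : Type*} [AddCommGroup V] [Module K V] [AddCommGroup W] [Module K W]
    (s D π : V →ₗ[K] W) (n : ℕ) : (⨂[K]^n V) →ₗ[K] (⨂[K]^n W) :=
  ∑ i : Fin n, insTerm s D π i

theorem powD_eq_insSum (V : DGMod K) (n : ℕ) :
    powD V n = insSum V.toGrMod.sgn V.d LinearMap.id n := rfl

theorem koszulPerm_map [CharZero K] {V W : GrMod K} {f : V →ₗ[K] W} (hf : IsPar V W 0 f) {n : ℕ}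
    (σ : Equiv.Perm (Fin n)) (t : ⨂[K]^n V) :
    koszulPerm W σ (PiTensorProduct.map (fun _ => f) t) =
      PiTensorProduct.map (fun _ => f) (koszulPerm V σ t) := by
  suffices h : koszulPerm W σ ∘ₗ PiTensorProduct.map (fun _ => f) =
      PiTensorProduct.map (fun _ => f) ∘ₗ koszulPerm V σ from LinearMap.congr_fun h t
  refine tprod_ext_parity fun p v hv => ?_
  simp only [LinearMap.comp_apply, PiTensorProduct.map_tprod]
  rw [koszulPerm_tprod V σ hv, koszulPerm_tprod W σ (p := p) (fun i => by
    rw [hf, hv, map_zsmul]; simp), map_smul, PiTensorProduct.map_tprod]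

/-- Odd derivations along an even map commute with the Koszul action of permutations. -/
theorem koszulPerm_insSum [CharZero K] {V W : GrMod K} {π D : V →ₗ[K] W} (hπ : IsPar V W 0 π)
    (hD : IsPar V W 1 D) {n : ℕ} (σ : Equiv.Perm (Fin n)) (t : ⨂[K]^n V) :
    koszulPerm W σ (insSum (W.sgn ∘ₗ π) D π n t) =
      insSum (W.sgn ∘ₗ π) D π n (koszulPerm V σ t) := by
  suffices h : koszulPerm W σ ∘ₗ insSum (W.sgn ∘ₗ π) D π n =
      insSum (W.sgn ∘ₗ π) D π n ∘ₗ koszulPerm V σ from LinearMap.congr_fun h t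
  refine tprod_ext_parity fun p v hv => ?_
  have hπv : ∀ i, W.sgn (π (v i)) = psgn (p i) • π (v i) := fun i => by
    rw [hπ, hv, map_zsmul]; simp
  have hDv : ∀ i, W.sgn (D (v i)) = psgn (p i + 1) • D (v i) := fun i => by
    rw [hD, hv, map_zsmul, smul_smul, psgn_add, mul_comm]
  set w : Fin n → Fin n → W := fun i j => if j = i then D (v j) else π (v j) with hw
  have hwp : ∀ i j, W.sgn (w i j) = psgn (Function.update p i (p i + 1) j) • w i j := fun i j => by
    by_cases h : j = i
    · subst h; simp [hw, hDv]
    · simp [hw, h, hπv]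
  have e1 : ∀ i, insTerm (W.sgn ∘ₗ π) D π i (PiTensorProduct.tprod K v) =
      ((∏ j, if j < i then psgn (p j) else 1 : ℤ) : K) • PiTensorProduct.tprod K (w i) := fun i => by
    rw [insTerm, PiTensorProduct.map_tprod, ← tprod_zsmul]
    congr 1; ext j
    by_cases h : j < i
    · simp [h, hw, h.ne, hπv]
    · by_cases h' : j = i <;> simp [h, h', hw]
  have e2 : ∀ i, insTerm (W.sgn ∘ₗ π) D π (σ i) (PiTensorProduct.tprod K (fun j => v (σ.symm j))) =
      ((∏ j, if σ j < σ i then psgn (p j) else 1 : ℤ) : K) •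
        PiTensorProduct.tprod K (fun j => w i (σ.symm j)) := fun i => by
    rw [insTerm, PiTensorProduct.map_tprod, ← Equiv.prod_comp σ.symm, ← tprod_zsmul]
    congr 1; ext j
    by_cases h : j < σ i
    · have : σ.symm j ≠ i := fun h' => by rw [← h'] at h; simp at h
      simp [h, hw, this, hπv]
    · by_cases h' : j = σ i
      · subst h'; simp [hw]
      · have : σ.symm j ≠ i := fun h'' => h' (by rw [← h'']; simp)
        simp [h, h', hw, this]
  simp only [LinearMap.comp_apply, koszulPerm_tprod V σ hv, map_smul]
  simp only [insSum, LinearMap.sum_apply, map_sum]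
  rw [← Equiv.sum_comp σ (fun i => insTerm (W.sgn ∘ₗ π) D π i _), Finset.smul_sum]
  refine Finset.sum_congr rfl fun i _ => ?_
  rw [e1, e2, map_smul, koszulPerm_tprod W σ (hwp i), smul_smul, smul_smul, ← Int.cast_mul,
    ← Int.cast_mul, ← koszulSign_update, mul_comm]

theorem insSum_comp {U V W : Type*} [AddCommGroup U] [Module K U] [AddCommGroup V] [Module K V]
    [AddCommGroup W] [Module K W] {s D π : V →ₗ[K] W} (f : U →ₗ[K] V) (n : ℕ) :
    insSum s D π n ∘ₗ PiTensorProduct.map (fun _ => f) = insSum (s ∘ₗ f) (D ∘ₗ f) (π ∘ₗ f) n := by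
  ext v
  simp only [insSum, insTerm, LinearMap.compMultilinearMap_apply, LinearMap.comp_apply,
    PiTensorProduct.map_tprod, LinearMap.sum_apply]
  refine Finset.sum_congr rfl fun i _ => congrArg _ (funext fun j => ?_)
  split_ifs <;> rfl

theorem comp_insSum {U V W : Type*} [AddCommGroup U] [Module K U] [AddCommGroup V] [Module K V]
    [AddCommGroup W] [Module K W] {s D π : U →ₗ[K] V} (f : V →ₗ[K] W) (n : ℕ) :
    PiTensorProduct.map (fun _ => f) ∘ₗ insSum s D π n = insSum (f ∘ₗ s) (f ∘ₗ D) (f ∘ₗ π) n := by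
  ext v
  simp only [insSum, insTerm, LinearMap.compMultilinearMap_apply, LinearMap.comp_apply,
    PiTensorProduct.map_tprod, LinearMap.sum_apply, map_sum]
  refine Finset.sum_congr rfl fun i _ => congrArg _ (funext fun j => ?_)
  split_ifs <;> rfl

/-! ### The square-zero extension by an odd variable -/

theorem isInternal_of_coordinates {V : Type*} [AddCommGroup V] [Module K V] {ι : Sort*}
    {gr : ℤ → Submodule K V} (W : ι → GrMod K) (f : ∀ i, V →ₗ[K] W i) (s : ι → ℤ)
    (hgr : ∀ i k x, x ∈ gr k → f i x ∈ (W i).gr (k + s i))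
    (inj : ∀ x, (∀ i, f i x = 0) → x = 0) (span : ∀ x, x ∈ ⨆ k, gr k) :
    DirectSum.IsInternal gr := by
  rw [DirectSum.isInternal_submodule_iff_iSupIndep_and_iSup_eq_top]
  refine ⟨fun k => ?_, eq_top_iff.2 fun x _ => span x⟩
  rw [Submodule.disjoint_def]
  intro x hx hx'
  refine inj x fun i => ?_
  have hd := ((DirectSum.isInternal_submodule_iff_iSupIndep_and_iSup_eq_top _).1
    (W i).internal).1 (k + s i)
  rw [Submodule.disjoint_def] at hd
  refine hd _ (hgr i k x hx) ?_
  have : (⨆ j, ⨆ (_ : j ≠ k), gr j) ≤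
      (⨆ j, ⨆ (_ : j ≠ k + s i), (W i).gr j).comap (f i) := by
    refine iSup_le fun j => iSup_le fun hj y hy => ?_
    exact Submodule.mem_iSup_of_mem (j + s i) (Submodule.mem_iSup_of_mem (by omega) (hgr i j y hy))
  exact this hx'

/-- `V ⊕ ε V` for an odd variable `ε` of degree `e`. The pair `(a, b)` stands for `a + ε b`. -/
def GrMod.eps (V : GrMod K) (e : ℤ) : GrMod K where
  carrier := V × V
  gr k := (V.gr k).prod (V.gr (k - e))
  internal := by
    refine isInternal_of_coordinates (ι := Bool) (fun _ => V)
      (fun b => match b with | false => LinearMap.fst K V V | true => LinearMap.snd K V V)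
      (fun b => match b with | false => 0 | true => -e) ?_ ?_ ?_
    · rintro (_ | _) k x hx
      · simpa using hx.1
      · exact hx.2
    · intro x hx
      exact Prod.ext (hx false) (hx true)
    · rintro ⟨a, b⟩
      have h1 : ∀ a : V, (a, (0 : V)) ∈ ⨆ k, (V.gr k).prod (V.gr (k - e)) := fun a => by
        induction a using V.homogeneous_induction with
        | hom k a ha => exact Submodule.mem_iSup_of_mem k ⟨ha, Submodule.zero_mem _⟩
        | add x y hx hy => simpa using Submodule.add_mem _ hx hy
      have h2 : ∀ a : V, ((0 : V), a) ∈ ⨆ k, (V.gr k).prod (V.gr (k - e)) := fun a => by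
        induction a using V.homogeneous_induction with
        | hom k a ha =>
          exact Submodule.mem_iSup_of_mem (k + e) ⟨Submodule.zero_mem _, by simpa using ha⟩
        | add x y hx hy => simpa using Submodule.add_mem _ hx hy
      simpa using Submodule.add_mem _ (h1 a) (h2 b)

/-- The coefficient `a` of `a + ε b`. -/
def epsFst (V : GrMod K) (e : ℤ) : V.eps e →ₗ[K] V := LinearMap.fst K V V
/-- The coefficient `b` of `a + ε b`. -/
def epsSnd (V : GrMod K) (e : ℤ) : V.eps e →ₗ[K] V := LinearMap.snd K V V
/-- `a ↦ a + ε 0`. -/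
def epsInl (V : GrMod K) (e : ℤ) : V →ₗ[K] V.eps e := LinearMap.inl K V V
/-- `b ↦ 0 + ε b`. -/
def epsInr (V : GrMod K) (e : ℤ) : V →ₗ[K] V.eps e := LinearMap.inr K V V

section

variable {V : GrMod K} {e : ℤ}

theorem eps_ext {x y : V.eps e} (h1 : epsFst V e x = epsFst V e y)
    (h2 : epsSnd V e x = epsSnd V e y) : x = y := Prod.ext h1 h2

@[simp] theorem epsFst_inl (x : V) : epsFst V e (epsInl V e x) = x := rfl
@[simp] theorem epsFst_inr (x : V) : epsFst V e (epsInr V e x) = 0 := rfl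
@[simp] theorem epsSnd_inl (x : V) : epsSnd V e (epsInl V e x) = 0 := rfl
@[simp] theorem epsSnd_inr (x : V) : epsSnd V e (epsInr V e x) = x := rfl

theorem mem_eps {k : ℤ} {x : V.eps e} :
    x ∈ (V.eps e).gr k ↔ epsFst V e x ∈ V.gr k ∧ epsSnd V e x ∈ V.gr (k - e) := Iff.rfl

theorem isPar_epsFst : IsPar (V.eps e) V 0 (epsFst V e) := by
  have := IsPar.of_degree (e := 0) (f := epsFst V e) (fun k x hx => by
    rw [add_zero]; exact (mem_eps.1 hx).1)
  simpa using this

theorem odd_cast (he : Odd e) : ((e : ℤ) : ZMod 2) = 1 := by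
  obtain ⟨m, rfl⟩ := he
  push_cast; rw [show (2 : ZMod 2) = 0 from rfl]; simp

theorem isPar_epsSnd (he : Odd e) : IsPar (V.eps e) V 1 (epsSnd V e) := by
  have := IsPar.of_degree (e := -e) (f := epsSnd V e) (fun k x hx => (mem_eps.1 hx).2)
  rwa [odd_cast he.neg] at this

theorem isPar_epsInl : IsPar V (V.eps e) 0 (epsInl V e) := by
  have := IsPar.of_degree (e := 0) (f := epsInl V e) (fun k x hx => by
    rw [add_zero]; exact mem_eps.2 ⟨hx, by simp⟩)
  simpa using this

theorem isPar_epsInr (he : Odd e) : IsPar V (V.eps e) 1 (epsInr V e) := by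
  have := IsPar.of_degree (e := e) (f := epsInr V e) (fun k x hx =>
    mem_eps.2 ⟨by simp, by simpa using hx⟩)
  rwa [odd_cast he] at this

end

theorem DGMod.isPar_d (V : DGMod K) : IsPar V.toGrMod V.toGrMod 1 V.d :=
  IsPar.of_degree (e := -1) V.d_mem

theorem opGr_le {M V : GrMod K} {n : ℕ} {k : ℤ} {W : Type*} [AddCommGroup W] [Module K W]
    {φ : M ⊗[K] (⨂[K]^n V) →ₗ[K] W} {S : Submodule K W}
    (h : ∀ (p : ℤ) (e : Fin n → ℤ) (m : M) (v : Fin n → V), p + ∑ i, e i = k → m ∈ M.gr p →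
      (∀ i, v i ∈ V.gr (e i)) → φ (m ⊗ₜ[K] PiTensorProduct.tprod K v) ∈ S)
    {t : M ⊗[K] (⨂[K]^n V)} (ht : t ∈ opGr M V n k) : φ t ∈ S := by
  have : opGr M V n k ≤ S.comap φ := by
    refine Submodule.span_le.2 ?_
    rintro _ ⟨p, e, m, v, h1, h2, h3, rfl⟩
    exact h p e m v h1 h2 h3
  exact this ht

theorem tmul_mem_opGr {M V : GrMod K} {n : ℕ} {k p : ℤ} {e : Fin n → ℤ} {m : M} {v : Fin n → V}
    (h : p + ∑ i, e i = k) (hm : m ∈ M.gr p) (hv : ∀ i, v i ∈ V.gr (e i)) :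
    m ⊗ₜ[K] PiTensorProduct.tprod K v ∈ opGr M V n k :=
  Submodule.subset_span ⟨p, e, m, v, h, hm, hv, rfl⟩

theorem map_map_comm {M M' N N' V V' W W' : Type*} [AddCommGroup M] [Module K M] [AddCommGroup M']
    [Module K M'] [AddCommGroup N] [Module K N] [AddCommGroup N'] [Module K N'] [AddCommMonoid V]
    [Module K V] [AddCommMonoid V'] [Module K V'] [AddCommMonoid W] [Module K W] [AddCommMonoid W']
    [Module K W']
    {f : M' →ₗ[K] N'} {a : M →ₗ[K] M'} {a' : N →ₗ[K] N'} {f' : M →ₗ[K] N}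
    {g : V' →ₗ[K] W'} {b : V →ₗ[K] V'} {b' : W →ₗ[K] W'} {g' : V →ₗ[K] W}
    (h1 : ∀ x, f (a x) = a' (f' x)) (h2 : ∀ x, g (b x) = b' (g' x)) (t : M ⊗[K] V) :
    TensorProduct.map f g (TensorProduct.map a b t) =
      TensorProduct.map a' b' (TensorProduct.map f' g' t) := by
  induction t using TensorProduct.induction_on with
  | zero => simp
  | tmul x y => simp [h1, h2]
  | add x y hx hy => simp only [map_add, hx, hy]

/-- The vectors `s v₀, …, D vᵢ, …, π vₙ`. -/
def insFun {V W : Type*} [AddCommGroup V] [Module K V] [AddCommGroup W] [Module K W]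
    (s D π : V →ₗ[K] W) {n : ℕ} (i : Fin n) (v : Fin n → V) (j : Fin n) : W :=
  if j < i then s (v j) else if j = i then D (v j) else π (v j)

section

variable {V W : Type*} [AddCommGroup V] [Module K V] [AddCommGroup W] [Module K W]
  (s D π : V →ₗ[K] W)

theorem insTerm_tprod {n : ℕ} (i : Fin n) (v : Fin n → V) :
    insTerm s D π i (PiTensorProduct.tprod K v) = PiTensorProduct.tprod K (insFun s D π i v) := by
  rw [insTerm, PiTensorProduct.map_tprod]
  congr 1; ext j
  unfold insFun
  split_ifs <;> rfl

theorem insSum_tprod {n : ℕ} (v : Fin n → V) :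
    insSum s D π n (PiTensorProduct.tprod K v) =
      ∑ i, PiTensorProduct.tprod K (insFun s D π i v) := by
  simp only [insSum, LinearMap.sum_apply, insTerm_tprod]

theorem insFun_append_left {n m : ℕ} (b : Fin n → V) (a : Fin m → V) (i : Fin n) :
    insFun s D π (Fin.castAdd m i) (Fin.append b a) =
      Fin.append (insFun s D π i b) (fun j => π (a j)) := by
  ext j
  refine Fin.addCases (fun j => ?_) (fun j => ?_) j
  · have h1 : Fin.castAdd m j < Fin.castAdd m i ↔ j < i := Iff.rfl
    simp [insFun, h1]
  · have h1 : ¬ (Fin.natAdd n j < Fin.castAdd m i) := by simp [Fin.lt_def]; omega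
    have h2 : Fin.natAdd n j ≠ Fin.castAdd m i := by simp [Fin.ext_iff]; omega
    simp [insFun, h1, h2]

theorem insFun_append_right {n m : ℕ} (b : Fin n → V) (a : Fin m → V) (i : Fin m) :
    insFun s D π (Fin.natAdd n i) (Fin.append b a) =
      Fin.append (fun j => s (b j)) (insFun s D π i a) := by
  ext j
  refine Fin.addCases (fun j => ?_) (fun j => ?_) j
  · have h1 : (Fin.castAdd m j < Fin.natAdd n i) := by simp [Fin.lt_def]; omega
    simp [insFun, h1]
  · simp [insFun]

theorem insFun_cons_zero {m : ℕ} (b : V) (a : Fin m → V) :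
    insFun s D π 0 (Fin.cons b a : Fin (m + 1) → V) = Fin.cons (D b) (fun j => π (a j)) := by
  ext j
  refine Fin.cases ?_ (fun j => ?_) j
  · simp [insFun]
  · simp [insFun, Fin.succ_ne_zero]

theorem insFun_cons_succ {m : ℕ} (b : V) (a : Fin m → V) (i : Fin m) :
    insFun s D π i.succ (Fin.cons b a : Fin (m + 1) → V) = Fin.cons (s b) (insFun s D π i a) := by
  ext j
  refine Fin.cases ?_ (fun j => ?_) j
  · simp [insFun]
  · simp [insFun]

end

theorem fin_append_comp {n m : ℕ} {V W : Type*} (f : V → W) (b : Fin n → V) (a : Fin m → V) :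
    (fun i => f (Fin.append b a i)) = Fin.append (fun i => f (b i)) (fun i => f (a i)) := by
  ext j
  refine Fin.addCases (fun j => ?_) (fun j => ?_) j <;> simp

theorem fin_cons_comp {m : ℕ} {V W : Type*} (f : V → W) (b : V) (a : Fin m → V) :
    (fun i => f ((Fin.cons b a : Fin (m + 1) → V) i)) = Fin.cons (f b) (fun i => f (a i)) := by
  ext j
  refine Fin.cases ?_ (fun j => ?_) j <;> simp

namespace Operad

variable (P : Operad K)

theorem isPar_map {I J : Type} [Finite I] [Finite J] (e : I ≃ J) :
    IsPar (P.obj I).toGrMod (P.obj J).toGrMod 0 (P.map e) := by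
  have := IsPar.of_degree (e := 0) (f := P.map e) (fun k x hx => by
    rw [add_zero]; exact P.map_mem I J e k x hx)
  simpa using this

theorem sgn_map {I J : Type} [Finite I] [Finite J] (e : I ≃ J) (x : P.obj I) :
    (P.obj J).sgn (P.map e x) = P.map e ((P.obj I).sgn x) := by
  rw [P.isPar_map e]; simp

theorem sgn_comp {I J : Type} [Finite I] [Finite J] (x : P.obj (Option I)) (y : P.obj J) :
    (P.obj (J ⊕ I)).sgn (P.comp (x ⊗ₜ[K] y)) =
      P.comp ((P.obj (Option I)).sgn x ⊗ₜ[K] (P.obj J).sgn y) := by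
  induction x using GrMod.homogeneous_induction with
  | hom k x hx =>
    induction y using GrMod.homogeneous_induction with
    | hom l y hy =>
      rw [GrMod.sgn_of_mem _ (k := k + l) (P.comp_mem _ _ _ _
        (Submodule.subset_span ⟨k, l, x, y, rfl, hx, hy, rfl⟩)),
        GrMod.sgn_of_mem _ hx, GrMod.sgn_of_mem _ hy, Int.negOnePow_add, Units.val_mul]
      simp only [← Int.cast_smul_eq_zsmul K, TensorProduct.smul_tmul_smul, map_smul, Int.cast_mul]
    | add x y hx hy => simp only [TensorProduct.tmul_add, map_add, hx, hy]
  | add x y hx hy => simp only [TensorProduct.add_tmul, map_add, hx, hy]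

theorem sgn_one : (P.obj Unit).sgn P.one = P.one := by
  rw [GrMod.sgn_of_mem _ P.one_mem]; simp

theorem d_comp {I J : Type} [Finite I] [Finite J] (x : P.obj (Option I)) (y : P.obj J) :
    (P.obj (J ⊕ I)).d (P.comp (x ⊗ₜ[K] y)) =
      P.comp ((P.obj (Option I)).d x ⊗ₜ[K] y) +
        P.comp ((P.obj (Option I)).sgn x ⊗ₜ[K] (P.obj J).d y) := by
  rw [P.comp_d, tensorD, LinearMap.add_apply, map_add]
  rfl

end Operad

section Eps

variable {P : Operad K}

/-- The operations of the square-zero extension `A + ε A`: `μ ∈ P(n)` acts as `μ + c ε dμ`. -/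
def epsAct (A : GrAlg P) (e : ℤ) (c : K) (n : ℕ) :
    P.obj (Fin n) ⊗[K] (⨂[K]^n (A.toGrMod.eps e)) →ₗ[K] A.toGrMod.eps e :=
  epsInl A.toGrMod e ∘ₗ A.act n ∘ₗ
      TensorProduct.map LinearMap.id (PiTensorProduct.map (fun _ => epsFst A.toGrMod e)) +
    epsInr A.toGrMod e ∘ₗ (c • A.act n ∘ₗ
        TensorProduct.map (P.obj (Fin n)).d (PiTensorProduct.map (fun _ => epsFst A.toGrMod e)) +
      A.act n ∘ₗ TensorProduct.map (P.obj (Fin n)).sgn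
        (insSum (A.sgn ∘ₗ epsFst A.toGrMod e) (epsSnd A.toGrMod e) (epsFst A.toGrMod e) n))

theorem fst_epsAct (A : GrAlg P) (e : ℤ) (c : K) (n : ℕ)
    (t : P.obj (Fin n) ⊗[K] (⨂[K]^n (A.toGrMod.eps e))) :
    epsFst A.toGrMod e (epsAct A e c n t) = A.act n
      (TensorProduct.map LinearMap.id (PiTensorProduct.map (fun _ => epsFst A.toGrMod e)) t) := by
  simp [epsAct]

theorem snd_epsAct (A : GrAlg P) (e : ℤ) (c : K) (n : ℕ)
    (t : P.obj (Fin n) ⊗[K] (⨂[K]^n (A.toGrMod.eps e))) :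
    epsSnd A.toGrMod e (epsAct A e c n t) =
      c • A.act n (TensorProduct.map (P.obj (Fin n)).d
        (PiTensorProduct.map (fun _ => epsFst A.toGrMod e)) t) +
      A.act n (TensorProduct.map (P.obj (Fin n)).sgn
        (insSum (A.sgn ∘ₗ epsFst A.toGrMod e) (epsSnd A.toGrMod e) (epsFst A.toGrMod e) n) t) := by
  simp [epsAct]

theorem snd_epsAct_tprod (A : GrAlg P) (e : ℤ) (c : K) (n : ℕ) (μ : P.obj (Fin n))
    (v : Fin n → A.toGrMod.eps e) :
    epsSnd A.toGrMod e (epsAct A e c n (μ ⊗ₜ[K] PiTensorProduct.tprod K v)) =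
      c • A.act n ((P.obj (Fin n)).d μ ⊗ₜ[K]
        PiTensorProduct.tprod K (fun i => epsFst A.toGrMod e (v i))) +
      ∑ i, A.act n ((P.obj (Fin n)).sgn μ ⊗ₜ[K] PiTensorProduct.tprod K
        (insFun (A.sgn ∘ₗ epsFst A.toGrMod e) (epsSnd A.toGrMod e) (epsFst A.toGrMod e) i v)) := by
  rw [snd_epsAct, TensorProduct.map_tmul, TensorProduct.map_tmul, PiTensorProduct.map_tprod,
    insSum_tprod, TensorProduct.tmul_sum, map_sum]

/-- `μ(-, a₁, …, aₘ)` as a linear map. -/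
def GrAlg.actCons (A : GrAlg P) {m : ℕ} (μ : P.obj (Fin (m + 1))) (a : Fin m → A.carrier) :
    A.carrier →ₗ[K] A.carrier :=
  A.act (m + 1) ∘ₗ TensorProduct.mk K _ _ μ ∘ₗ
    (PiTensorProduct.tprod K).toLinearMap (Fin.cons 0 a : Fin (m + 1) → A.carrier) 0

theorem GrAlg.actCons_apply (A : GrAlg P) {m : ℕ} (μ : P.obj (Fin (m + 1)))
    (a : Fin m → A.carrier) (x : A.carrier) :
    A.actCons μ a x = A.act (m + 1) (μ ⊗ₜ[K] PiTensorProduct.tprod K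
      (Fin.cons x a : Fin (m + 1) → A.carrier)) := by
  simp [actCons, Fin.update_cons_zero]

theorem GrAlg.sgn_act (A : GrAlg P) (n : ℕ) (t : P.obj (Fin n) ⊗[K] (⨂[K]^n A.carrier)) :
    A.sgn (A.act n t) = A.act n (TensorProduct.map (P.obj (Fin n)).sgn
      (PiTensorProduct.map (fun _ => A.sgn)) t) := by
  suffices h : A.sgn ∘ₗ A.act n = A.act n ∘ₗ TensorProduct.map (P.obj (Fin n)).sgn
      (PiTensorProduct.map (fun _ => A.sgn)) from LinearMap.congr_fun h t
  refine TensorProduct.ext (GrMod.hom_ext fun k x hx => tprod_ext_homogeneous fun e v hv => ?_)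
  change A.sgn (A.act n (x ⊗ₜ[K] PiTensorProduct.tprod K v)) = A.act n (TensorProduct.map _ _ (x ⊗ₜ[K] _))
  rw [TensorProduct.map_tmul, PiTensorProduct.map_tprod, A.sgn_of_mem (A.act_mem n _ _ (tmul_mem_opGr rfl hx hv)), GrMod.sgn_of_mem _ hx]
  simp only [fun i => A.sgn_of_mem (hv i)]
  rw [tprod_zsmul, ← Int.cast_smul_eq_zsmul K, ← Int.cast_smul_eq_zsmul K,
    TensorProduct.smul_tmul_smul, map_smul, ← Int.cast_mul]
  congr 2
  rw [← psgn_intCast, ← psgn_intCast, Int.cast_add, psgn_add, Int.cast_sum, psgn_sum]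
  simp only [psgn_intCast]

variable [CharZero K]

/-- The square-zero extension `A + ε A` of a graded `P`-algebra by an odd variable `ε` of degree
`e`, on which `μ ∈ P(n)` acts as `μ + c ε dμ`. For `c = 1` (and `e = 1`), a homomorphism
`x ↦ x + ε D x` into it is the same as a derivation `D`. -/
abbrev GrAlg.eps (A : GrAlg P) (e : ℤ) (he : Odd e) (c : K) (hc : c ≠ 0 → e = 1) : GrAlg P where
  toGrMod := A.toGrMod.eps e
  act := epsAct A e c
  act_mem n k t ht := by
    refine opGr_le (fun p q m v h hm hv => ?_) ht
    refine mem_eps.2 ⟨?_, ?_⟩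
    · rw [fst_epsAct, TensorProduct.map_tmul, PiTensorProduct.map_tprod]
      exact A.act_mem n _ _ (tmul_mem_opGr h hm fun i => (mem_eps.1 (hv i)).1)
    · rw [snd_epsAct_tprod]
      refine Submodule.add_mem _ ?_ (Submodule.sum_mem _ fun i _ => ?_)
      · by_cases h0 : c = 0
        · simp [h0]
        · refine Submodule.smul_mem _ _ (A.act_mem n _ _ (tmul_mem_opGr ?_
            (DGMod.d_mem _ p m hm) fun i => (mem_eps.1 (hv i)).1))
          rw [hc h0]; omega
      · refine A.act_mem n _ _ (tmul_mem_opGr (e := Function.update q i (q i - e)) ?_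
          (GrMod.sgn_mem _ hm) fun j => ?_)
        · rw [Finset.sum_update_of_mem (Finset.mem_univ i), ← h,
            ← Finset.add_sum_erase _ q (Finset.mem_univ i), Finset.sdiff_singleton_eq_erase]
          ring
        · unfold insFun
          by_cases h' : j = i
          · subst h'; simpa using (mem_eps.1 (hv j)).2
          · rw [Function.update_of_ne h', if_neg h']
            split_ifs
            · exact A.sgn_mem (mem_eps.1 (hv j)).1
            · exact (mem_eps.1 (hv j)).1
  act_perm n σ t := by
    have h1 : ∀ x, PiTensorProduct.map (fun _ => epsFst A.toGrMod e)
        (koszulPerm (A.toGrMod.eps e) σ x) =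
        koszulPerm A.toGrMod σ (PiTensorProduct.map (fun _ => epsFst A.toGrMod e) x) :=
      fun x => (koszulPerm_map isPar_epsFst σ x).symm
    refine eps_ext ?_ ?_
    · rw [fst_epsAct, fst_epsAct, map_map_comm (f := LinearMap.id) (a := P.map σ) (f' := LinearMap.id) (a' := P.map σ)
        (g' := PiTensorProduct.map (fun _ => epsFst A.toGrMod e)) (b' := koszulPerm A.toGrMod σ)
        (fun x => rfl) h1, A.act_perm]
    · rw [snd_epsAct, snd_epsAct, map_map_comm (f' := (P.obj (Fin n)).d) (a' := P.map σ)
        (fun x => (P.map_d _ _ σ x).symm) h1, A.act_perm,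
        map_map_comm (f' := (P.obj (Fin n)).sgn) (a' := P.map σ)
        (fun x => P.sgn_map σ x)
        (fun x => (koszulPerm_insSum isPar_epsFst (isPar_epsSnd he) σ x).symm), A.act_perm]
  act_one a := by
    refine eps_ext ?_ ?_
    · rw [fst_epsAct, TensorProduct.map_tmul, PiTensorProduct.map_tprod]
      exact A.act_one _
    · rw [snd_epsAct_tprod, ← P.map_d, P.one_d, map_zero, TensorProduct.zero_tmul, map_zero,
        smul_zero, zero_add, P.sgn_map, P.sgn_one, Fin.sum_univ_one]
      have : insFun (A.sgn ∘ₗ epsFst A.toGrMod e) (epsSnd A.toGrMod e) (epsFst A.toGrMod e) 0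
          (fun _ : Fin 1 => a) = fun _ => epsSnd A.toGrMod e a := by
        ext j; simp [insFun, Subsingleton.elim j 0]
      rw [this]; exact A.act_one _
  act_comp m n μ ν b a := by
    refine eps_ext ?_ ?_
    · rw [fst_epsAct, fst_epsAct]
      simp only [TensorProduct.map_tmul, PiTensorProduct.map_tprod, LinearMap.id_apply,
        fin_append_comp, fin_cons_comp]
      rw [A.act_comp, fst_epsAct, TensorProduct.map_tmul, PiTensorProduct.map_tprod]
      rfl
    · rw [snd_epsAct_tprod, snd_epsAct_tprod]
      simp only [fin_append_comp, fin_cons_comp]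
      rw [Fin.sum_univ_add, Fin.sum_univ_succ]
      simp only [insFun_append_left, insFun_append_right, insFun_cons_zero, insFun_cons_succ]
      rw [← P.map_d, P.d_comp, map_add, TensorProduct.add_tmul, map_add, ← P.map_d]
      simp only [P.sgn_map, P.sgn_comp, A.act_comp]
      simp only [← A.actCons_apply, snd_epsAct_tprod, fst_epsAct, LinearMap.comp_apply, A.sgn_act,
        TensorProduct.map_tmul, PiTensorProduct.map_tprod, LinearMap.id_apply, map_add, map_smul,
        map_sum, smul_add]
      abel

end Eps

/-! ### Algebras with a derivation -/

/-- A graded `P`-algebra with a derivation `d` of degree `-1` over the differential of `P`; the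
equation `d² = 0` is not required. -/
structure DerAlg (P : Operad K) extends GrAlg P where
  d : carrier →ₗ[K] carrier
  d_mem : ∀ (k : ℤ) (x : carrier), x ∈ gr k → d x ∈ gr (k - 1)
  act_d : ∀ (n : ℕ) (t : P.obj (Fin n) ⊗[K] (⨂[K]^n carrier)),
    d (act n t) = act n (TensorProduct.map (P.obj (Fin n)).d LinearMap.id t) +
      act n (TensorProduct.map (P.obj (Fin n)).sgn (insSum toGrMod.sgn d LinearMap.id n) t)

/-- A dg algebra, forgetting `d² = 0`. -/
abbrev DGAlg.toDerAlg {P : Operad K} (A : DGAlg P) : DerAlg P where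
  toGrAlg := A.toGrAlg
  d := A.d
  d_mem := A.d_mem
  act_d n t := by
    rw [A.act_d, opD, LinearMap.add_apply, map_add]
    rfl

theorem DerAlg.isPar_d {P : Operad K} (A : DerAlg P) : IsPar A.toGrMod A.toGrMod 1 A.d :=
  IsPar.of_degree (e := -1) A.d_mem

theorem tprod_neg_at {V : Type*} [AddCommGroup V] [Module K V] {n : ℕ} {u w : Fin n → V}
    (k : Fin n) (hk : u k = - w k) (h : ∀ j, j ≠ k → u j = w j) :
    PiTensorProduct.tprod K u = (-1 : K) • PiTensorProduct.tprod K w := by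
  have : u = Function.update w k ((-1 : K) • w k) := by
    ext j
    by_cases hj : j = k
    · subst hj; simp [hk]
    · simp [hj, h j hj]
  rw [this, MultilinearMap.map_update_smul, Function.update_eq_self]

/-- Odd derivations of tensor powers anticommute if they do so on the factors. -/
theorem insSum_insSum_tprod {V W : GrMod K} {π D : V →ₗ[K] W} {δV : V →ₗ[K] V} {δW : W →ₗ[K] W}
    (hπ : IsPar V W 0 π) (hD : IsPar V W 1 D) (hδ : IsPar W W 1 δW) {n : ℕ}
    (v : Fin n → V) (h1 : ∀ i, π (δV (v i)) = δW (π (v i)))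
    (h2 : ∀ i, D (δV (v i)) = - δW (D (v i))) :
    insSum (W.sgn ∘ₗ π) D π n (insSum V.sgn δV LinearMap.id n (PiTensorProduct.tprod K v)) =
      (-1 : K) • insSum W.sgn δW LinearMap.id n
        (insSum (W.sgn ∘ₗ π) D π n (PiTensorProduct.tprod K v)) := by
  have hπ' : ∀ x, π (V.sgn x) = W.sgn (π x) := fun x => by rw [hπ]; simp
  have hD' : ∀ x, D (V.sgn x) = - W.sgn (D x) := fun x => by rw [hD]; simp
  have hδ' : ∀ x, W.sgn (δW x) = - δW (W.sgn x) := fun x => by rw [hδ]; simp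
  rw [insSum_tprod, map_sum, insSum_tprod, map_sum]
  simp only [insSum_tprod]
  rw [Finset.smul_sum, Finset.sum_comm]
  refine Finset.sum_congr rfl fun i _ => ?_
  rw [Finset.smul_sum]
  refine Finset.sum_congr rfl fun j _ => ?_
  refine tprod_neg_at (min i j) ?_ fun k hk => ?_
  · rcases lt_trichotomy i j with h | rfl | h
    · rw [min_eq_left h.le]
      simp [insFun, h, hD']
    · simp [insFun, h2]
    · rw [min_eq_right h.le]
      simp [insFun, h, h1, hδ']
  · rcases lt_trichotomy i j with h | rfl | h
    · rw [min_eq_left h.le] at hk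
      rcases lt_trichotomy k i with h' | h' | h'
      · simp [insFun, h', h'.trans h, hπ']
      · exact absurd h' hk
      · rcases lt_trichotomy k j with h'' | rfl | h''
        · simp [insFun, h'', h'.not_gt, h'.ne', hπ']
        · simp [insFun, h'.not_gt, h'.ne', h1]
        · simp [insFun, h'.not_gt, h'.ne', h''.not_gt, h''.ne']
    · rw [min_self] at hk
      rcases lt_or_gt_of_ne hk with h' | h'
      · simp [insFun, h', hπ']
      · simp [insFun, h'.not_gt, h'.ne']
    · rw [min_eq_right h.le] at hk
      rcases lt_trichotomy k j with h' | h' | h'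
      · simp [insFun, h', h'.trans h, hπ']
      · exact absurd h' hk
      · rcases lt_trichotomy k i with h'' | rfl | h''
        · simp [insFun, h'', h'.not_gt, h'.ne']
        · simp [insFun, h'.not_gt, h'.ne']
        · simp [insFun, h'.not_gt, h'.ne', h''.not_gt, h''.ne']

theorem insSum_insSum {V W : GrMod K} {π D : V →ₗ[K] W} {δV : V →ₗ[K] V} {δW : W →ₗ[K] W}
    (hπ : IsPar V W 0 π) (hD : IsPar V W 1 D) (hδ : IsPar W W 1 δW) (n : ℕ)
    (h1 : ∀ x, π (δV x) = δW (π x)) (h2 : ∀ x, D (δV x) = - δW (D x)) :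
    insSum (W.sgn ∘ₗ π) D π n ∘ₗ insSum V.sgn δV LinearMap.id n =
      (-1 : K) • insSum W.sgn δW LinearMap.id n ∘ₗ insSum (W.sgn ∘ₗ π) D π n := by
  ext v
  exact insSum_insSum_tprod hπ hD hδ v (fun i => h1 _) fun i => h2 _

section

variable {P : Operad K}

/-- The map `d (a + ε b) = d a - ε d b`. -/
def epsD {V : GrMod K} (e : ℤ) (d : V →ₗ[K] V) : V.eps e →ₗ[K] V.eps e :=
  epsInl V e ∘ₗ d ∘ₗ epsFst V e - epsInr V e ∘ₗ d ∘ₗ epsSnd V e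

@[simp] theorem epsFst_epsD {V : GrMod K} (e : ℤ) (d : V →ₗ[K] V) (x : V.eps e) :
    epsFst V e (epsD e d x) = d (epsFst V e x) := by simp [epsD]

@[simp] theorem epsSnd_epsD {V : GrMod K} (e : ℤ) (d : V →ₗ[K] V) (x : V.eps e) :
    epsSnd V e (epsD e d x) = - d (epsSnd V e x) := by simp [epsD]

theorem epsFst_sgn {V : GrMod K} {e : ℤ} (x : V.eps e) :
    epsFst V e ((V.eps e).sgn x) = V.sgn (epsFst V e x) := by
  rw [isPar_epsFst]; simp

theorem epsD_mem {V : GrMod K} {e : ℤ} {d : V →ₗ[K] V}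
    (hd : ∀ (k : ℤ) (x : V), x ∈ V.gr k → d x ∈ V.gr (k - 1)) (k : ℤ) (x : V.eps e)
    (hx : x ∈ (V.eps e).gr k) : epsD e d x ∈ (V.eps e).gr (k - 1) := by
  refine mem_eps.2 ⟨?_, ?_⟩
  · rw [epsFst_epsD]
    exact hd _ _ (mem_eps.1 hx).1
  · rw [epsSnd_epsD, show k - 1 - e = k - e - 1 by ring]
    exact Submodule.neg_mem _ (hd _ _ (mem_eps.1 hx).2)

theorem insSum_congr {V W : Type*} [AddCommGroup V] [Module K V] [AddCommGroup W] [Module K W]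
    {s D π s' D' π' : V →ₗ[K] W} (hs : ∀ x, s x = s' x) (hD : ∀ x, D x = D' x)
    (hπ : ∀ x, π x = π' x) (n : ℕ) : insSum s D π n = insSum s' D' π' n := by
  rw [LinearMap.ext hs, LinearMap.ext hD, LinearMap.ext hπ]

/-- A map intertwining even and odd structure also intertwines the induced derivations of tensor
powers. -/
theorem map_insSum {V W : GrMod K} {f : V →ₗ[K] W} (hf : IsPar V W 0 f) {d : V →ₗ[K] V}
    {d' : W →ₗ[K] W} (h : ∀ x, f (d x) = d' (f x)) (n : ℕ) (t : ⨂[K]^n V) :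
    PiTensorProduct.map (fun _ => f) (insSum V.sgn d LinearMap.id n t) =
      insSum W.sgn d' LinearMap.id n (PiTensorProduct.map (fun _ => f) t) := by
  have h1 := LinearMap.congr_fun (insSum_comp (s := W.sgn) (D := d') (π := LinearMap.id) f n) t
  have h2 := LinearMap.congr_fun (comp_insSum (s := V.sgn) (D := d) (π := LinearMap.id) f n) t
  rw [LinearMap.comp_apply] at h1 h2
  rw [h1, h2]
  refine congrFun (congrArg _ (insSum_congr (fun x => ?_) h (fun x => rfl) n)) t
  have := hf x
  simp only [psgn_zero, one_smul] at this
  exact this.symm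

theorem map_id_comm {M V V' W W' : Type*} [AddCommGroup M] [Module K M] [AddCommMonoid V]
    [Module K V] [AddCommMonoid V'] [Module K V'] [AddCommMonoid W] [Module K W] [AddCommMonoid W']
    [Module K W'] (s : M →ₗ[K] M) {g : V' →ₗ[K] W'} {b : V →ₗ[K] V'} {b' : W →ₗ[K] W'}
    {g' : V →ₗ[K] W} (h : ∀ x, g (b x) = b' (g' x)) (t : M ⊗[K] V) :
    TensorProduct.map s g (TensorProduct.map LinearMap.id b t) =
      TensorProduct.map LinearMap.id b' (TensorProduct.map s g' t) :=
  map_map_comm (f := s) (a := LinearMap.id) (a' := LinearMap.id) (f' := s) (fun _ => rfl) h t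

theorem epsAct_d [CharZero K] (A : DerAlg P) (e : ℤ) (he : Odd e) (n : ℕ)
    (t : P.obj (Fin n) ⊗[K] (⨂[K]^n (A.toGrMod.eps e))) :
    epsD e A.d (epsAct A.toGrAlg e 0 n t) =
      epsAct A.toGrAlg e 0 n (TensorProduct.map (P.obj (Fin n)).d LinearMap.id t) +
      epsAct A.toGrAlg e 0 n (TensorProduct.map (P.obj (Fin n)).sgn
        (insSum (A.toGrMod.eps e).sgn (epsD e A.d) LinearMap.id n) t) := by
  refine eps_ext ?_ ?_
  · rw [epsFst_epsD, fst_epsAct, map_add, fst_epsAct, fst_epsAct, A.act_d]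
    congr 2
    · refine map_id_comm _ (fun x => ?_) t
      rfl
    · exact map_id_comm _ (fun x => (map_insSum isPar_epsFst (fun x => epsFst_epsD e A.d x) n x).symm) t
  · rw [epsSnd_epsD, map_add (epsSnd _ _), snd_epsAct, snd_epsAct, snd_epsAct]
    simp only [zero_smul, zero_add, A.act_d]
    induction t using TensorProduct.induction_on with
    | zero => simp
    | add x y hx hy =>
      simp only [map_add, neg_add] at hx hy ⊢
      refine Eq.trans ?_ (Eq.trans (congrArg₂ (· + ·) hx hy) ?_) <;> abel
    | tmul m u =>
      have h1 : (P.obj (Fin n)).d ((P.obj (Fin n)).sgn m) =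
          - (P.obj (Fin n)).sgn ((P.obj (Fin n)).d m) := by
        have := (P.obj (Fin n)).isPar_d m
        rw [this]; simp
      have h2 := LinearMap.congr_fun (insSum_insSum (isPar_epsFst (V := A.toGrMod) (e := e))
        (isPar_epsSnd he) A.isPar_d n (δV := epsD e A.d) (fun x => epsFst_epsD e A.d x)
        (fun x => epsSnd_epsD e A.d x)) u
      simp only [LinearMap.comp_apply, LinearMap.smul_apply] at h2
      simp only [TensorProduct.map_tmul, LinearMap.id_apply]
      rw [h2, h1, TensorProduct.neg_tmul, TensorProduct.tmul_smul, map_smul, map_neg, neg_add,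
        neg_neg, GrMod.sgn_sgn, neg_one_smul]

/-- The extension of the derivation `d` of `A` to `A + ε A`, by `d (a + ε b) = d a - ε d b`. -/
abbrev DerAlg.eps [CharZero K] (A : DerAlg P) (e : ℤ) (he : Odd e) : DerAlg P where
  toGrAlg := A.toGrAlg.eps e he 0 (by simp)
  d := epsD e A.d
  d_mem := epsD_mem A.d_mem
  act_d := epsAct_d A e he

end

/-! ### The convolution operations -/

theorem ptMap_zero {V W : Type*} [AddCommGroup V] [Module K V] [AddCommGroup W] [Module K W] {n : ℕ}
    {f : Fin n → (V →ₗ[K] W)} (i : Fin n) (h : f i = 0) : PiTensorProduct.map f = 0 := by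
  ext v
  simp only [LinearMap.compMultilinearMap_apply, PiTensorProduct.map_tprod, LinearMap.zero_apply]
  exact MultilinearMap.map_coord_zero _ i (by simp [h])

/-- The even or odd part of a linear map, as a linear operator. -/
def homPartL (V W : GrMod K) (b : ZMod 2) : (V →ₗ[K] W) →ₗ[K] (V →ₗ[K] W) where
  toFun := homPart V W b
  map_add' f g := by ext x; simp only [homPart, LinearMap.add_apply, LinearMap.comp_apply, map_add]; abel
  map_smul' c f := by ext x; simp [homPart]

section Conv

variable {𝒞 : Cooperad K} {P : Operad K} (τ : TwistingMorphism 𝒞 P) (C : Coalg 𝒞)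

/-- `convTensor` for a graded algebra. -/
def grConvTensor (A : GrAlg P) (n : ℕ) (f : Fin n → (C.carrier →ₗ[K] A.carrier)) :
    𝒞.obj (Fin n) ⊗[K] (⨂[K]^n C.carrier) →ₗ[K] P.obj (Fin n) ⊗[K] (⨂[K]^n A.carrier) :=
  ∑ p : Fin n → ZMod 2, TensorProduct.map
    (τ.toFun (Fin n) ∘ₗ (𝒞.obj (Fin n)).toGrMod.sgn ^ (∑ i, (p i).val))
    (PiTensorProduct.map (fun j => homPart C.toGrMod A.toGrMod (p j) (f j) ∘ₗ
      C.toGrMod.sgn ^ (∑ i ∈ Finset.Ioi j, (p i).val)))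

/-- The composite of `Δ n`, `τ ⊗ f₁ ⊗ ⋯ ⊗ fₙ` and the action of `P` on `A`. -/
def convOp (A : GrAlg P) (n : ℕ) (f : Fin n → (C.carrier →ₗ[K] A.carrier)) :
    C.carrier →ₗ[K] A.carrier :=
  A.act n ∘ₗ grConvTensor τ C A n f ∘ₗ C.Δ n

/-- `∂ f = d f - (-1)^{|f|} f d`. -/
def derD (A : DerAlg P) (f : C.carrier →ₗ[K] A.carrier) : C.carrier →ₗ[K] A.carrier :=
  A.d ∘ₗ f - homSgn C.toGrMod A.toGrMod f ∘ₗ C.d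

/-- The operations of the convolution algebra, for a target whose derivation need not square to
zero. -/
def convL (A : DerAlg P) (n : ℕ) (f : Fin n → (C.carrier →ₗ[K] A.carrier)) :
    C.carrier →ₗ[K] A.carrier :=
  convOp τ C A.toGrAlg n f + if h : n = 1 then derD C A (f ⟨0, by omega⟩) else 0

theorem convLInfty_l (A : DGAlg P) (n : ℕ) (f : Fin n → (C.carrier →ₗ[K] A.carrier)) :
    (convLInfty τ C A).l n f = convL τ C A.toDerAlg n f := rfl

/-- The power `sgn ^ b` for a parity `b`. -/
def GrMod.sgnP (V : GrMod K) (b : ZMod 2) : V →ₗ[K] V := if b = 0 then LinearMap.id else V.sgn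

theorem GrMod.sgn_pow (V : GrMod K) (n : ℕ) : V.sgn ^ n = V.sgnP (n : ZMod 2) := by
  have h2 : V.sgn ^ 2 = 1 := by ext x; simp [pow_two]
  rcases Nat.even_or_odd' n with ⟨m, rfl | rfl⟩
  · have : ((2 * m : ℕ) : ZMod 2) = 0 := by push_cast; rw [show (2 : ZMod 2) = 0 from rfl]; simp
    rw [this, pow_mul, h2, one_pow]; rfl
  · have : ((2 * m + 1 : ℕ) : ZMod 2) = 1 := by
      push_cast; rw [show (2 : ZMod 2) = 0 from rfl]; simp
    rw [this, pow_succ, pow_mul, h2, one_pow, one_mul]; rfl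

@[simp] theorem GrMod.sgnP_zero (V : GrMod K) : V.sgnP 0 = LinearMap.id := rfl
@[simp] theorem GrMod.sgnP_one (V : GrMod K) : V.sgnP 1 = V.sgn := rfl

theorem GrMod.sgnP_mem (V : GrMod K) (b : ZMod 2) {k : ℤ} {x : V} (hx : x ∈ V.gr k) :
    V.sgnP b x ∈ V.gr k := by
  rcases zmod_two_cases b with rfl | rfl
  exacts [hx, V.sgn_mem hx]

theorem GrMod.sgn_sgnP (V : GrMod K) (b : ZMod 2) (x : V) : V.sgn (V.sgnP b x) = V.sgnP (b + 1) x := by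
  rcases zmod_two_cases b with rfl | rfl <;> simp [show (1 + 1 : ZMod 2) = 0 from rfl]

theorem GrMod.sgnP_sgn (V : GrMod K) (b : ZMod 2) (x : V) : V.sgnP b (V.sgn x) = V.sgnP (b + 1) x := by
  rcases zmod_two_cases b with rfl | rfl <;> simp [show (1 + 1 : ZMod 2) = 0 from rfl]

theorem Coalg.Δ_sgn (n : ℕ) (x : C.carrier) : C.Δ n (C.sgn x) = TensorProduct.map
    (𝒞.obj (Fin n)).sgn (PiTensorProduct.map (fun _ => C.sgn)) (C.Δ n x) := by
  induction x using GrMod.homogeneous_induction with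
  | hom k x hx =>
    rw [C.sgn_of_mem hx, map_zsmul, ← sub_eq_zero]
    refine opGr_le (φ := (k.negOnePow : ℤ) • LinearMap.id - TensorProduct.map
      (𝒞.obj (Fin n)).sgn (PiTensorProduct.map (fun _ => C.sgn))) (S := ⊥) ?_ (C.Δ_mem n k x hx)
    intro p e m v h hm hv
    rw [Submodule.mem_bot, LinearMap.sub_apply, LinearMap.smul_apply, LinearMap.id_apply,
      TensorProduct.map_tmul, PiTensorProduct.map_tprod, GrMod.sgn_of_mem _ hm]
    simp only [fun i => C.sgn_of_mem (hv i)]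
    rw [tprod_zsmul, ← Int.cast_smul_eq_zsmul K, ← Int.cast_smul_eq_zsmul K,
      TensorProduct.smul_tmul_smul, ← Int.cast_mul, sub_eq_zero, ← h]
    congr 2
    rw [← psgn_intCast, ← psgn_intCast, Int.cast_add, psgn_add, Int.cast_sum, psgn_sum]
    simp only [psgn_intCast]
  | add x y hx hy => rw [map_add, map_add, hx, hy, map_add, map_add]

theorem TwistingMorphism.isPar {τ : TwistingMorphism 𝒞 P} {I : Type} [Finite I] :
    IsPar (𝒞.obj I).toGrMod (P.obj I).toGrMod 1 (τ.toFun I) :=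
  IsPar.of_degree (e := -1) (τ.degree I)

variable [CharZero K]

theorem grConvTensor_of_isPar (A : GrAlg P) {n : ℕ} {f : Fin n → (C.carrier →ₗ[K] A.carrier)}
    {p : Fin n → ZMod 2} (hf : ∀ i, IsPar C.toGrMod A.toGrMod (p i) (f i)) :
    grConvTensor τ C A n f = TensorProduct.map
      (τ.toFun (Fin n) ∘ₗ (𝒞.obj (Fin n)).toGrMod.sgnP (∑ i, p i))
      (PiTensorProduct.map (fun j => f j ∘ₗ C.toGrMod.sgnP (∑ i ∈ Finset.Ioi j, p i))) := by
  rw [grConvTensor, Finset.sum_eq_single p]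
  · simp only [GrMod.sgn_pow, Nat.cast_sum, ZMod.natCast_val, ZMod.cast_id', id_eq]
    simp only [homPart_of_isPar (hf _), if_true]
  · intro q _ hq
    obtain ⟨i, hi⟩ := Function.ne_iff.1 hq
    rw [ptMap_zero i, TensorProduct.map_zero_right]
    rw [homPart_of_isPar (hf i), if_neg hi, LinearMap.zero_comp]
  · simp

theorem convOp_of_isPar (A : GrAlg P) {n : ℕ} {f : Fin n → (C.carrier →ₗ[K] A.carrier)}
    {p : Fin n → ZMod 2} (hf : ∀ i, IsPar C.toGrMod A.toGrMod (p i) (f i)) :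
    convOp τ C A n f = A.act n ∘ₗ TensorProduct.map
      (τ.toFun (Fin n) ∘ₗ (𝒞.obj (Fin n)).toGrMod.sgnP (∑ i, p i))
      (PiTensorProduct.map (fun j => f j ∘ₗ C.toGrMod.sgnP (∑ i ∈ Finset.Ioi j, p i))) ∘ₗ C.Δ n := by
  rw [convOp, grConvTensor_of_isPar τ C A hf]

theorem convOp_of_even (A : GrAlg P) {n : ℕ} {f : Fin n → (C.carrier →ₗ[K] A.carrier)}
    (hf : ∀ i, IsPar C.toGrMod A.toGrMod 0 (f i)) :
    convOp τ C A n f = A.act n ∘ₗ TensorProduct.map (τ.toFun (Fin n)) (PiTensorProduct.map f) ∘ₗ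
      C.Δ n := by
  rw [convOp_of_isPar τ C A hf]
  simp

omit [CharZero K] in
theorem isPar_derD (A : DerAlg P) {p : ZMod 2} {f : C.carrier →ₗ[K] A.carrier}
    (hf : IsPar C.toGrMod A.toGrMod p f) :
    IsPar C.toGrMod A.toGrMod (p + 1) (derD C A f) := by
  have h1 : homSgn C.toGrMod A.toGrMod f = psgn p • f := by
    ext x
    change A.sgn (f (C.sgn x)) = _
    rw [hf]; simp
  rw [derD, h1]
  refine IsPar.sub ?_ ?_
  · have := A.isPar_d.comp hf; rwa [add_comm] at this
  · rw [← Int.cast_smul_eq_zsmul K, LinearMap.smul_comp]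
    exact (hf.comp C.isPar_d).smul _

omit [CharZero K] in
theorem homSgn_of_isPar {V W : GrMod K} {p : ZMod 2} {f : V →ₗ[K] W}
    (hf : IsPar V W p f) : homSgn V W f = psgn p • f := by
  ext x
  change W.sgn (f (V.sgn x)) = _
  rw [hf]; simp

theorem isPar_convOp (A : GrAlg P) {n : ℕ} {f : Fin n → (C.carrier →ₗ[K] A.carrier)}
    {p : Fin n → ZMod 2} (hf : ∀ i, IsPar C.toGrMod A.toGrMod (p i) (f i)) :
    IsPar C.toGrMod A.toGrMod (∑ i, p i + 1) (convOp τ C A n f) := by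
  have hΔ : ∀ x, C.Δ n (C.sgn x) = TensorProduct.map (𝒞.obj (Fin n)).sgn
      (PiTensorProduct.map (fun _ => C.sgn)) (C.Δ n x) := C.Δ_sgn n
  intro x
  rw [convOp_of_isPar τ C A hf]
  simp only [LinearMap.comp_apply]
  rw [hΔ, A.sgn_act]
  refine LinearMap.congr_fun (f := A.act n ∘ₗ TensorProduct.map (P.obj (Fin n)).sgn
    (PiTensorProduct.map fun _ => A.sgn) ∘ₗ TensorProduct.map
      (τ.toFun (Fin n) ∘ₗ (𝒞.obj (Fin n)).toGrMod.sgnP (∑ i, p i))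
      (PiTensorProduct.map (fun j => f j ∘ₗ C.toGrMod.sgnP (∑ i ∈ Finset.Ioi j, p i))))
    (g := psgn (∑ i, p i + 1) • (A.act n ∘ₗ TensorProduct.map
      (τ.toFun (Fin n) ∘ₗ (𝒞.obj (Fin n)).toGrMod.sgnP (∑ i, p i))
      (PiTensorProduct.map (fun j => f j ∘ₗ C.toGrMod.sgnP (∑ i ∈ Finset.Ioi j, p i))) ∘ₗ
      TensorProduct.map (𝒞.obj (Fin n)).sgn (PiTensorProduct.map (fun _ => C.sgn)))) ?_ (C.Δ n x)
  refine tens_ext fun m v => ?_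
  simp only [LinearMap.comp_apply, LinearMap.smul_apply, TensorProduct.map_tmul,
    PiTensorProduct.map_tprod]
  rw [τ.isPar]
  simp only [hf _ _]
  rw [tprod_zsmul, TensorProduct.tmul_smul, map_smul, psgn_one, neg_one_smul,
    TensorProduct.neg_tmul, map_neg, psgn_add, psgn_one, mul_neg_one, neg_smul, smul_neg, psgn_sum,
    Int.cast_smul_eq_zsmul]
  simp only [GrMod.sgn_sgnP, GrMod.sgnP_sgn]

/-- `convOp` as a multilinear map. -/
def convOpM (A : GrAlg P) (n : ℕ) :
    MultilinearMap K (fun _ : Fin n => C.carrier →ₗ[K] A.carrier) (C.carrier →ₗ[K] A.carrier) :=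
  ((LinearMap.llcomp K C.carrier _ A.carrier (A.act n)) ∘ₗ
    LinearMap.lcomp K _ (C.Δ n)).compMultilinearMap
  (∑ p : Fin n → ZMod 2, (TensorProduct.mapBilinear (RingHom.id K) _ _ _ _
      (τ.toFun (Fin n) ∘ₗ (𝒞.obj (Fin n)).toGrMod.sgn ^ (∑ i, (p i).val))).compMultilinearMap
    ((PiTensorProduct.mapMultilinear K (fun _ : Fin n => C.carrier) (fun _ => A.carrier)).compLinearMap
      (fun j => LinearMap.lcomp K _ (C.toGrMod.sgn ^ (∑ i ∈ Finset.Ioi j, (p i).val)) ∘ₗ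
        homPartL C.toGrMod A.toGrMod (p j))))

omit [CharZero K] in
theorem convOpM_apply (A : GrAlg P) (n : ℕ) (f : Fin n → (C.carrier →ₗ[K] A.carrier)) :
    convOpM τ C A n f = convOp τ C A n f := by
  simp only [convOpM, LinearMap.compMultilinearMap_apply, sum_apply]
  rfl

theorem convOp_eps_inl (A : GrAlg P) {e : ℤ} (he : Odd e) {n : ℕ}
    {f : Fin n → (C.carrier →ₗ[K] A.carrier)} {p : Fin n → ZMod 2}
    (hf : ∀ i, IsPar C.toGrMod A.toGrMod (p i) (f i)) :
    convOp τ C (A.eps e he 0 (by simp)) n (fun j => epsInl A.toGrMod e ∘ₗ f j) =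
      epsInl A.toGrMod e ∘ₗ convOp τ C A n f := by
  have hg : ∀ i, IsPar C.toGrMod (A.toGrMod.eps e) (p i) (epsInl A.toGrMod e ∘ₗ f i) := fun i => by
    simpa using isPar_epsInl.comp (hf i)
  rw [convOp_of_isPar τ C (A.eps e he 0 (by simp)) hg, convOp_of_isPar τ C A hf]
  ext x
  refine LinearMap.congr_fun (f := epsAct A e 0 n ∘ₗ TensorProduct.map
      (τ.toFun (Fin n) ∘ₗ (𝒞.obj (Fin n)).toGrMod.sgnP (∑ i, p i))
      (PiTensorProduct.map (fun j => (epsInl A.toGrMod e ∘ₗ f j) ∘ₗ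
        C.toGrMod.sgnP (∑ i ∈ Finset.Ioi j, p i))))
    (g := epsInl A.toGrMod e ∘ₗ A.act n ∘ₗ TensorProduct.map
      (τ.toFun (Fin n) ∘ₗ (𝒞.obj (Fin n)).toGrMod.sgnP (∑ i, p i))
      (PiTensorProduct.map (fun j => f j ∘ₗ C.toGrMod.sgnP (∑ i ∈ Finset.Ioi j, p i))))
    (tens_ext fun m v => ?_) (C.Δ n x)
  simp only [LinearMap.comp_apply, TensorProduct.map_tmul, PiTensorProduct.map_tprod]
  refine eps_ext ?_ ?_
  · rw [fst_epsAct, TensorProduct.map_tmul, PiTensorProduct.map_tprod]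
    rfl
  · rw [snd_epsAct_tprod, zero_smul, zero_add, epsSnd_inl]
    refine Finset.sum_eq_zero fun i _ => ?_
    rw [MultilinearMap.map_coord_zero _ i, TensorProduct.tmul_zero, map_zero]
    simp [insFun]

/-- A single odd variable can be pulled out of the operations. As `ε f i` has the opposite parity of
`f i`, this reduces identities between the operations to inputs of degree `0`, up to the sign of
moving `ε` past the inputs before `f i`. -/
theorem convOp_eps_single (A : GrAlg P) {e : ℤ} (he : Odd e) {n : ℕ}
    {f : Fin n → (C.carrier →ₗ[K] A.carrier)} {p : Fin n → ZMod 2}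
    (hf : ∀ i, IsPar C.toGrMod A.toGrMod (p i) (f i)) (i : Fin n) :
    convOp τ C (A.eps e he 0 (by simp)) n
        (fun j => if j = i then epsInr A.toGrMod e ∘ₗ f j else epsInl A.toGrMod e ∘ₗ f j) =
      (- ∏ j, if j < i then psgn (p j) else 1) • (epsInr A.toGrMod e ∘ₗ convOp τ C A n f) := by
  set g : Fin n → (C.carrier →ₗ[K] A.toGrMod.eps e) :=
    fun j => if j = i then epsInr A.toGrMod e ∘ₗ f j else epsInl A.toGrMod e ∘ₗ f j with hgdef
  set q := Function.update p i (p i + 1) with hq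
  have hg : ∀ j, IsPar C.toGrMod (A.toGrMod.eps e) (q j) (g j) := fun j => by
    by_cases h : j = i
    · subst h
      have := (isPar_epsInr he).comp (hf j)
      rw [add_comm] at this
      simpa [hgdef, hq] using this
    · simpa [hgdef, hq, h] using isPar_epsInl.comp (hf j)
  have hqs : ∑ j, q j = ∑ j, p j + 1 := by
    rw [hq, Finset.sum_update_of_mem (Finset.mem_univ i),
      ← Finset.add_sum_erase _ p (Finset.mem_univ i), Finset.sdiff_singleton_eq_erase]
    ring
  have hq1 : ∀ j, j < i → ∑ k ∈ Finset.Ioi j, q k = ∑ k ∈ Finset.Ioi j, p k + 1 := fun j hj => by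
    rw [hq, Finset.sum_update_of_mem (Finset.mem_Ioi.2 hj),
      ← Finset.add_sum_erase _ p (Finset.mem_Ioi.2 hj), Finset.sdiff_singleton_eq_erase]
    ring
  have hq2 : ∀ j, ¬ j < i → ∑ k ∈ Finset.Ioi j, q k = ∑ k ∈ Finset.Ioi j, p k := fun j hj => by
    rw [hq, Finset.sum_update_of_notMem (by simpa using hj)]
  rw [convOp_of_isPar τ C (A.eps e he 0 (by simp)) hg, convOp_of_isPar τ C A hf]
  ext x
  refine LinearMap.congr_fun (f := epsAct A e 0 n ∘ₗ TensorProduct.map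
      (τ.toFun (Fin n) ∘ₗ (𝒞.obj (Fin n)).toGrMod.sgnP (∑ i, q i))
      (PiTensorProduct.map (fun j => g j ∘ₗ
        C.toGrMod.sgnP (∑ i ∈ Finset.Ioi j, q i))))
    (g := (- ∏ j, if j < i then psgn (p j) else 1) • (epsInr A.toGrMod e ∘ₗ A.act n ∘ₗ TensorProduct.map
      (τ.toFun (Fin n) ∘ₗ (𝒞.obj (Fin n)).toGrMod.sgnP (∑ i, p i))
      (PiTensorProduct.map (fun j => f j ∘ₗ C.toGrMod.sgnP (∑ i ∈ Finset.Ioi j, p i)))))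
    (tens_ext fun m v => ?_) (C.Δ n x)
  simp only [LinearMap.comp_apply, LinearMap.smul_apply, TensorProduct.map_tmul,
    PiTensorProduct.map_tprod]
  refine eps_ext ?_ ?_
  · rw [fst_epsAct, TensorProduct.map_tmul, PiTensorProduct.map_tprod, map_zsmul, epsFst_inr,
      MultilinearMap.map_coord_zero _ i, TensorProduct.tmul_zero, map_zero, smul_zero]
    simp [hgdef]
  · rw [snd_epsAct_tprod, zero_smul, zero_add, Finset.sum_eq_single i, map_zsmul, epsSnd_inr]
    · rw [τ.isPar, psgn_one, neg_one_smul, GrMod.sgn_sgnP, hqs, add_assoc,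
        show (1 + 1 : ZMod 2) = 0 from rfl, add_zero, neg_smul, TensorProduct.neg_tmul, map_neg,
        ← Int.cast_smul_eq_zsmul K, ← map_smul, ← TensorProduct.tmul_smul, ← tprod_zsmul]
      congr 4
      ext j
      unfold insFun
      rcases lt_trichotomy j i with h | rfl | h
      · simp only [h, if_true, LinearMap.comp_apply, hgdef, h.ne, if_false, epsFst_inl]
        rw [hf, GrMod.sgn_sgnP, hq1 j h, add_assoc, show (1 + 1 : ZMod 2) = 0 from rfl, add_zero]
      · simp [hgdef, hq2]
      · simp [hgdef, hq2, h.not_gt, h.ne']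
    · intro k _ hk
      rw [MultilinearMap.map_coord_zero _ k, TensorProduct.tmul_zero, map_zero]
      simp [insFun, hgdef, hk]
    · simp

end Conv

/-! ### Symmetry of the convolution operations -/

section Symm

variable {𝒞 : Cooperad K} {P : Operad K} (τ : TwistingMorphism 𝒞 P) (C : Coalg 𝒞)

theorem koszulPerm_map_family [CharZero K] {V W : GrMod K} {n : ℕ} {f : Fin n → (V →ₗ[K] W)}
    (hf : ∀ i, IsPar V W 0 (f i)) (σ : Equiv.Perm (Fin n)) (t : ⨂[K]^n V) :
    PiTensorProduct.map (fun i => f (σ.symm i)) (koszulPerm V σ t) =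
      koszulPerm W σ (PiTensorProduct.map f t) := by
  suffices h : PiTensorProduct.map (fun i => f (σ.symm i)) ∘ₗ koszulPerm V σ =
      koszulPerm W σ ∘ₗ PiTensorProduct.map f from LinearMap.congr_fun h t
  refine tprod_ext_parity fun p v hv => ?_
  simp only [LinearMap.comp_apply, PiTensorProduct.map_tprod]
  rw [koszulPerm_tprod V σ hv, koszulPerm_tprod W σ (p := p) (fun i => by
    rw [hf, hv, map_zsmul]; simp), map_smul, PiTensorProduct.map_tprod]

variable [CharZero K]

/-- The effect of a permutation on an operation of the form `act ∘ (α ⊗ f₁ ⊗ ⋯ ⊗ fₙ) ∘ Δ` with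
even `fᵢ`. -/
theorem act_perm_conj (A : GrAlg P) {n : ℕ} {f : Fin n → (C.carrier →ₗ[K] A.carrier)}
    (hf : ∀ i, IsPar C.toGrMod A.toGrMod 0 (f i)) (σ : Equiv.Perm (Fin n))
    {α β : 𝒞.obj (Fin n) →ₗ[K] P.obj (Fin n)} (h : ∀ x, P.map σ (α x) = β (𝒞.map σ x))
    (c : C.carrier) :
    A.act n (TensorProduct.map β (PiTensorProduct.map (fun i => f (σ.symm i))) (C.Δ n c)) =
      A.act n (TensorProduct.map α (PiTensorProduct.map f) (C.Δ n c)) := by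
  rw [← A.act_perm n σ (TensorProduct.map α _ _)]
  nth_rw 1 [← C.Δ_perm n σ c]
  congr 1
  exact map_map_comm (fun x => (h x).symm) (fun x => koszulPerm_map_family hf σ x) _

/-- Induction on the number of odd entries of a parity vector: the step makes an odd entry even. -/
theorem parity_induction {n : ℕ} {motive : (Fin n → ZMod 2) → Prop} (p : Fin n → ZMod 2)
    (zero : motive 0)
    (step : ∀ p i, p i = 1 → motive (Function.update p i (p i + 1)) → motive p) : motive p := by
  induction hk : (Finset.univ.filter fun i => p i = 1).card generalizing p with
  | zero =>
    have : p = 0 := by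
      ext i
      rcases zmod_two_cases (p i) with h | h
      · rw [h]; rfl
      · have : i ∈ Finset.univ.filter fun i => p i = 1 := by simp [h]
        rw [Finset.card_eq_zero.1 hk] at this
        simp at this
    rw [this]; exact zero
  | succ k ih =>
    obtain ⟨i, hi⟩ := Finset.card_pos.1 (by rw [hk]; omega : 0 < _)
    have hi' : p i = 1 := by simpa using hi
    refine step p i hi' (ih _ ?_)
    have : (Finset.univ.filter fun j => Function.update p i (p i + 1) j = 1) =
        (Finset.univ.filter fun i => p i = 1).erase i := by
      ext j
      by_cases h : j = i
      · subst h; simp [hi', show (1 + 1 : ZMod 2) = 0 from rfl]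
      · simp [h]
    rw [this, Finset.card_erase_of_mem hi, hk]; rfl

omit [CharZero K] in
theorem isPar_single {A : GrAlg P} {e : ℤ} (he : Odd e) {n : ℕ}
    {f : Fin n → (C.carrier →ₗ[K] A.carrier)} {p : Fin n → ZMod 2}
    (hf : ∀ i, IsPar C.toGrMod A.toGrMod (p i) (f i)) (i j : Fin n) :
    IsPar C.toGrMod (A.toGrMod.eps e) (Function.update p i (p i + 1) j)
      (if j = i then epsInr A.toGrMod e ∘ₗ f j else epsInl A.toGrMod e ∘ₗ f j) := by
  by_cases h : j = i
  · subst h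
    have := (isPar_epsInr he).comp (hf j)
    rw [add_comm] at this
    simpa using this
  · simpa [h] using isPar_epsInl.comp (hf j)

theorem convOp_symm (n : ℕ) (p : Fin n → ZMod 2) (σ : Equiv.Perm (Fin n)) :
    ∀ (A : GrAlg P) (f : Fin n → (C.carrier →ₗ[K] A.carrier)),
    (∀ i, IsPar C.toGrMod A.toGrMod (p i) (f i)) →
    convOp τ C A n (fun i => f (σ.symm i)) = koszulSign σ p • convOp τ C A n f := by
  induction p using parity_induction with
  | zero =>
    intro A f hf
    rw [convOp_of_even τ C A hf, convOp_of_even τ C A (fun i => hf (σ.symm i))]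
    have : koszulSign σ (0 : Fin n → ZMod 2) = 1 := by simp [koszulSign]
    rw [this, one_smul]
    ext c
    exact act_perm_conj C A hf σ (fun x => (τ.natural _ _ σ x).symm) c
  | step p i hi ih =>
    intro A f hf
    have h1 := ih (A.eps 1 odd_one 0 (by simp)) _ (isPar_single C odd_one hf i)
    have h2 := convOp_eps_single τ C A odd_one hf i
    have h3 := convOp_eps_single τ C A odd_one (f := fun j => f (σ.symm j)) (fun j => hf (σ.symm j)) (σ i)
    rw [h2] at h1
    have h4 : (fun j => if j = σ i then epsInr A.toGrMod 1 ∘ₗ f (σ.symm j) else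
        epsInl A.toGrMod 1 ∘ₗ f (σ.symm j)) = fun j => if σ.symm j = i then
        epsInr A.toGrMod 1 ∘ₗ f (σ.symm j) else epsInl A.toGrMod 1 ∘ₗ f (σ.symm j) := by
      ext1 j
      simp only [Equiv.symm_apply_eq]
    rw [h4, h1] at h3
    have hx : (∏ j, if j < σ i then psgn (p (σ.symm j)) else 1) =
        ∏ j, if σ j < σ i then psgn (p j) else 1 := by
      rw [← Equiv.prod_comp σ]; simp
    rw [hx] at h3
    have hk := koszulSign_update σ p i
    have hx2 : (∏ j, if σ j < σ i then psgn (p j) else 1) *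
        (∏ j, if σ j < σ i then psgn (p j) else 1) = 1 := by
      rw [← Finset.prod_mul_distrib]
      refine Finset.prod_eq_one fun j _ => ?_
      split_ifs <;> simp
    set x := ∏ j, if σ j < σ i then psgn (p j) else 1
    set y := ∏ j, if j < i then psgn (p j) else 1
    ext c
    have h5 := congrArg (epsSnd A.toGrMod 1) (LinearMap.congr_fun h3 c)
    simp only [LinearMap.smul_apply, LinearMap.comp_apply, map_zsmul, epsSnd_inr, smul_smul] at h5
    have h6 := congrArg (fun z => (-x) • z) h5
    simp only [smul_smul, neg_mul_neg, hx2, one_smul] at h6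
    rw [LinearMap.smul_apply, ← h6]
    congr 1
    linear_combination (-x) * hk + koszulSign σ p * hx2

theorem derD_eps_inl (A : DerAlg P) {e : ℤ} (he : Odd e) {p : ZMod 2}
    {f : C.carrier →ₗ[K] A.carrier} (hf : IsPar C.toGrMod A.toGrMod p f) :
    derD C (A.eps e he) (epsInl A.toGrMod e ∘ₗ f) = epsInl A.toGrMod e ∘ₗ derD C A f := by
  have hg : IsPar C.toGrMod (A.toGrMod.eps e) p (epsInl A.toGrMod e ∘ₗ f) := by
    simpa using isPar_epsInl.comp hf
  ext c
  have h1 := homSgn_of_isPar hf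
  have h2 := homSgn_of_isPar hg
  simp only [derD, h1]
  change epsD e A.d (epsInl A.toGrMod e (f c)) - (homSgn C.toGrMod (A.toGrMod.eps e)
    (epsInl A.toGrMod e ∘ₗ f)) (C.d c) = _
  rw [h2]
  refine eps_ext ?_ ?_ <;> simp

theorem derD_eps_inr (A : DerAlg P) {e : ℤ} (he : Odd e) {p : ZMod 2}
    {f : C.carrier →ₗ[K] A.carrier} (hf : IsPar C.toGrMod A.toGrMod p f) :
    derD C (A.eps e he) (epsInr A.toGrMod e ∘ₗ f) = (-1 : ℤ) • (epsInr A.toGrMod e ∘ₗ derD C A f) := by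
  have hg : IsPar C.toGrMod (A.toGrMod.eps e) (1 + p) (epsInr A.toGrMod e ∘ₗ f) :=
    (isPar_epsInr he).comp hf
  ext c
  have h1 := homSgn_of_isPar hf
  have h2 := homSgn_of_isPar hg
  simp only [derD, h1]
  change epsD e A.d (epsInr A.toGrMod e (f c)) - (homSgn C.toGrMod (A.toGrMod.eps e)
    (epsInr A.toGrMod e ∘ₗ f)) (C.d c) = _
  rw [h2]
  refine eps_ext ?_ ?_ <;> simp [psgn_add]
  abel

theorem convL_eps_inl (A : DerAlg P) {e : ℤ} (he : Odd e) {n : ℕ}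
    {f : Fin n → (C.carrier →ₗ[K] A.carrier)} {p : Fin n → ZMod 2}
    (hf : ∀ i, IsPar C.toGrMod A.toGrMod (p i) (f i)) :
    convL τ C (A.eps e he) n (fun j => epsInl A.toGrMod e ∘ₗ f j) =
      epsInl A.toGrMod e ∘ₗ convL τ C A n f := by
  rw [convL, convL, LinearMap.comp_add]
  refine congrArg₂ (· + ·) (convOp_eps_inl τ C A.toGrAlg he hf) ?_
  by_cases h : n = 1
  · rw [dif_pos h, dif_pos h]
    exact derD_eps_inl C A he (hf _)
  · rw [dif_neg h, dif_neg h, LinearMap.comp_zero]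

theorem convL_eps_single (A : DerAlg P) {e : ℤ} (he : Odd e) {n : ℕ}
    {f : Fin n → (C.carrier →ₗ[K] A.carrier)} {p : Fin n → ZMod 2}
    (hf : ∀ i, IsPar C.toGrMod A.toGrMod (p i) (f i)) (i : Fin n) :
    convL τ C (A.eps e he) n
        (fun j => if j = i then epsInr A.toGrMod e ∘ₗ f j else epsInl A.toGrMod e ∘ₗ f j) =
      (- ∏ j, if j < i then psgn (p j) else 1) • (epsInr A.toGrMod e ∘ₗ convL τ C A n f) := by
  rw [convL, convL, LinearMap.comp_add, smul_add]
  refine congrArg₂ (· + ·) (convOp_eps_single τ C A.toGrAlg he hf i) ?_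
  by_cases h : n = 1
  · subst h
    rw [dif_pos rfl, dif_pos rfl]
    have hi : i = 0 := Subsingleton.elim _ _
    subst hi
    simpa using derD_eps_inr C A he (hf 0)
  · rw [dif_neg h, dif_neg h, LinearMap.comp_zero, smul_zero]

theorem isPar_convL (A : DerAlg P) {n : ℕ} {f : Fin n → (C.carrier →ₗ[K] A.carrier)}
    {p : Fin n → ZMod 2} (hf : ∀ i, IsPar C.toGrMod A.toGrMod (p i) (f i)) :
    IsPar C.toGrMod A.toGrMod (∑ i, p i + 1) (convL τ C A n f) := by
  refine (isPar_convOp τ C A.toGrAlg hf).add ?_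
  by_cases h : n = 1
  · subst h
    rw [dif_pos rfl]
    simpa using isPar_derD C A (hf 0)
  · rw [dif_neg h]; exact IsPar.zero

/-- `∂` as a linear operator. -/
def derDL (A : DerAlg P) : (C.carrier →ₗ[K] A.carrier) →ₗ[K] (C.carrier →ₗ[K] A.carrier) :=
  LinearMap.llcomp K C.carrier A.carrier A.carrier A.d -
    LinearMap.lcomp K A.carrier C.d ∘ₗ homSgn C.toGrMod A.toGrMod

omit [CharZero K] in
theorem derDL_apply (A : DerAlg P) (f : C.carrier →ₗ[K] A.carrier) : derDL C A f = derD C A f := rfl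

/-- `convL` as a multilinear map. -/
def convLM (A : DerAlg P) (n : ℕ) :
    MultilinearMap K (fun _ : Fin n => C.carrier →ₗ[K] A.carrier) (C.carrier →ₗ[K] A.carrier) :=
  convOpM τ C A.toGrAlg n + if h : n = 1 then
    haveI : Subsingleton (Fin n) := by subst h; infer_instance
    MultilinearMap.ofSubsingleton K _ _ (⟨0, by omega⟩ : Fin n) (derDL C A) else 0

omit [CharZero K] in
theorem convLM_apply (A : DerAlg P) (n : ℕ) (f : Fin n → (C.carrier →ₗ[K] A.carrier)) :
    convLM τ C A n f = convL τ C A n f := by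
  rw [convLM, add_apply, convOpM_apply, convL]
  congr 1
  split_ifs <;> rfl

end Symm

/-! ### Composites of convolution operations -/

/-- The map `v ⊗ (v₁ ⊗ ⋯ ⊗ vₘ) ↦ v ⊗ v₁ ⊗ ⋯ ⊗ vₘ`. -/
def consT (V : Type*) [AddCommGroup V] [Module K V] (m : ℕ) :
    V ⊗[K] (⨂[K]^m V) →ₗ[K] (⨂[K]^(m + 1) V) :=
  TensorProduct.lift ((PiTensorProduct.lift (R := K) (s := fun _ : Fin m => V)).toLinearMap ∘ₗ
    (PiTensorProduct.tprod K (s := fun _ : Fin (m + 1) => V)).curryLeft)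

theorem consT_tprod {V : Type*} [AddCommGroup V] [Module K V] {m : ℕ} (x : V) (v : Fin m → V) :
    consT V m (x ⊗ₜ[K] PiTensorProduct.tprod K v) =
      PiTensorProduct.tprod K (Fin.cons x v : Fin (m + 1) → V) := by
  simp [consT]

theorem mulEquiv_symm_append {V : Type*} [AddCommGroup V] [Module K V] {n m : ℕ} (b : Fin n → V)
    (a : Fin m → V) : (TensorPower.mulEquiv (R := K) (M := V) (n := n) (m := m)).symm
      (PiTensorProduct.tprod K (Fin.append b a)) =
      PiTensorProduct.tprod K b ⊗ₜ[K] PiTensorProduct.tprod K a := by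
  rw [LinearEquiv.symm_apply_eq, ← TensorPower.gMul_def, TensorPower.tprod_mul_tprod]

theorem uncons_tprod (V : GrMod K) {m : ℕ} (v : Fin (m + 1) → V) :
    uncons V m (PiTensorProduct.tprod K v) = v 0 ⊗ₜ[K] PiTensorProduct.tprod K (Fin.tail v) := by
  have h : (TensorPower.cast K V (Nat.add_comm m 1)) (PiTensorProduct.tprod K v) =
      PiTensorProduct.tprod K (Fin.append (fun _ : Fin 1 => v 0) (Fin.tail v)) := by
    rw [TensorPower.cast_tprod]
    congr 1
    ext j
    refine Fin.addCases (fun j => ?_) (fun j => ?_) j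
    · rw [Fin.append_left, Function.comp_apply, Subsingleton.elim j 0]; rfl
    · rw [Fin.append_right, Function.comp_apply, Fin.tail]
      congr 1
      ext; simp
  simp only [uncons, LinearMap.comp_apply, LinearEquiv.coe_coe]
  rw [h, mulEquiv_symm_append, TensorProduct.map_tmul]
  simp

theorem exists_append {V : Type*} {n m : ℕ} (v : Fin (n + m) → V) :
    ∃ (b : Fin n → V) (a : Fin m → V), v = Fin.append b a :=
  ⟨fun i => v (Fin.castAdd m i), fun i => v (Fin.natAdd n i), (Fin.append_castAdd_natAdd).symm⟩

section Comp

variable {𝒞 : Cooperad K} {P : Operad K} (τ : TwistingMorphism 𝒞 P) (C : Coalg 𝒞)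

theorem Cooperad.isPar_map {I J : Type} [Finite I] [Finite J] (e : I ≃ J) :
    IsPar (𝒞.obj I).toGrMod (𝒞.obj J).toGrMod 0 (𝒞.map e) := by
  have := IsPar.of_degree (e := 0) (f := 𝒞.map e) (fun k x hx => by
    rw [add_zero]; exact 𝒞.map_mem I J e k x hx)
  simpa using this

/-- The summand of `τ ⋆ τ` which separates the inputs `J` from the inputs `I`. -/
def TwistingMorphism.infComp (I J : Type) [Finite I] [Finite J] :
    𝒞.obj (J ⊕ I) →ₗ[K] P.obj (J ⊕ I) :=
  P.comp ∘ₗ TensorProduct.map (τ.toFun (Option I) ∘ₗ (𝒞.obj (Option I)).sgn) (τ.toFun J) ∘ₗ 𝒞.decomp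

theorem TwistingMorphism.infComp_map {I I' J J' : Type} [Finite I] [Finite I'] [Finite J]
    [Finite J'] (e : I ≃ I') (f : J ≃ J') (x : 𝒞.obj (J ⊕ I)) :
    τ.infComp I' J' (𝒞.map (Equiv.sumCongr f e) x) =
      P.map (Equiv.sumCongr f e) (τ.infComp I J x) := by
  simp only [TwistingMorphism.infComp, LinearMap.comp_apply]
  rw [𝒞.decomp_map]
  induction 𝒞.decomp x using TensorProduct.induction_on with
  | zero => simp
  | add x y hx hy => simp only [map_add, hx, hy]
  | tmul x y =>
    simp only [TensorProduct.map_tmul, LinearMap.comp_apply]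
    rw [Cooperad.isPar_map (Equiv.optionCongr e), psgn_zero, one_smul, τ.natural, τ.natural, P.comp_map]

/-- The summand of `τ ⋆ τ` on `Fin (s + t)` which separates the first `s` inputs. -/
def TwistingMorphism.blockComp (s t : ℕ) : 𝒞.obj (Fin (s + t)) →ₗ[K] P.obj (Fin (s + t)) :=
  P.map finSumFinEquiv ∘ₗ τ.infComp (Fin t) (Fin s) ∘ₗ 𝒞.map finSumFinEquiv.symm

/-- The summand of `τ ⋆ τ` which separates the inputs `S`. -/
def TwistingMorphism.subsetComp {n : ℕ} (S : Finset (Fin n)) :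
    𝒞.obj (Fin n) →ₗ[K] P.obj (Fin n) :=
  P.map (Equiv.sumCompl (· ∈ S)) ∘ₗ τ.infComp {i // i ∉ S} {i // i ∈ S} ∘ₗ
    𝒞.map (Equiv.sumCompl (· ∈ S)).symm

theorem TwistingMorphism.sum_subsetComp (n : ℕ) :
    (P.obj (Fin n)).d ∘ₗ τ.toFun (Fin n) + τ.toFun (Fin n) ∘ₗ (𝒞.obj (Fin n)).d +
      ∑ S : Finset (Fin n), τ.subsetComp S = 0 := by
  ext x
  refine Eq.trans ?_ (τ.maurerCartan n x)
  rw [LinearMap.add_apply, LinearMap.sum_apply]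
  rfl

/-- The permutation which takes the first `s` positions to `S` and the others to the complement,
in order. -/
def blockPerm {s t : ℕ} {S : Finset (Fin (s + t))} (hs : S.card = s) (ht : Sᶜ.card = t) :
    Equiv.Perm (Fin (s + t)) :=
  finSumFinEquiv.symm.trans (finSumEquivOfFinset hs ht)

theorem blockPerm_apply {s t : ℕ} {S : Finset (Fin (s + t))} (hs : S.card = s) (ht : Sᶜ.card = t)
    {X : Type*} (f : Fin (s + t) → X) : (fun i => f (blockPerm hs ht i)) =
      Fin.append (fun i => f (S.orderEmbOfFin hs i)) (fun i => f (Sᶜ.orderEmbOfFin ht i)) := by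
  ext i
  refine Fin.addCases (fun i => ?_) (fun i => ?_) i <;> simp [blockPerm]

theorem TwistingMorphism.map_blockPerm {s t : ℕ} {S : Finset (Fin (s + t))} (hs : S.card = s)
    (ht : Sᶜ.card = t) (x : 𝒞.obj (Fin (s + t))) :
    P.map (blockPerm hs ht) (τ.blockComp s t x) = τ.subsetComp S (𝒞.map (blockPerm hs ht) x) := by
  set e1 : Fin s ≃ {i // i ∈ S} := (S.orderIsoOfFin hs).toEquiv
  set e2 : Fin t ≃ {i // i ∉ S} := (Sᶜ.orderIsoOfFin ht).toEquiv.trans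
    (Equiv.subtypeEquivRight (fun i => by simp))
  have h1 : finSumEquivOfFinset hs ht = (Equiv.sumCongr e1 e2).trans (Equiv.sumCompl (· ∈ S)) := by
    ext i
    rcases i with i | i <;> rfl
  simp only [TwistingMorphism.blockComp, TwistingMorphism.subsetComp, LinearMap.comp_apply]
  rw [← P.map_trans, ← 𝒞.map_trans]
  have h2 : finSumFinEquiv.trans (blockPerm hs ht) =
      (Equiv.sumCongr e1 e2).trans (Equiv.sumCompl (· ∈ S)) := by
    rw [← h1]; ext i; simp [blockPerm]
  have h3 : (blockPerm hs ht).trans (Equiv.sumCompl (· ∈ S)).symm =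
      finSumFinEquiv.symm.trans (Equiv.sumCongr e1 e2) := by
    ext1 i
    simp [blockPerm, h1]
  rw [h2, h3, P.map_trans, 𝒞.map_trans, τ.infComp_map]

variable [CharZero K]

/-- The composite of two operations, by coassociativity. -/
theorem convOp_convOp_append (A : GrAlg P) {s t : ℕ} {b : Fin s → (C.carrier →ₗ[K] A.carrier)}
    {a : Fin t → (C.carrier →ₗ[K] A.carrier)} (hb : ∀ i, IsPar C.toGrMod A.toGrMod 0 (b i))
    (ha : ∀ i, IsPar C.toGrMod A.toGrMod 0 (a i)) :
    convOp τ C A (t + 1) (Fin.cons (convOp τ C A s b) a : Fin (t + 1) → _) =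
      A.act (s + t) ∘ₗ TensorProduct.map (τ.blockComp s t) (PiTensorProduct.map (Fin.append b a)) ∘ₗ
        C.Δ (s + t) := by
  have hu : IsPar C.toGrMod A.toGrMod 1 (convOp τ C A s b) := by
    simpa using isPar_convOp τ C A hb
  have hq : ∀ i, IsPar C.toGrMod A.toGrMod ((Fin.cons 1 0 : Fin (t + 1) → ZMod 2) i)
      ((Fin.cons (convOp τ C A s b) a : Fin (t + 1) → _) i) := by
    intro i
    refine Fin.cases hu (fun i => ?_) i
    simpa using ha i
  ext x
  have key := congrArg (A.act (t + 1) ∘ₗ TensorProduct.map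
      (τ.toFun (Fin (t + 1)) ∘ₗ (𝒞.obj (Fin (t + 1))).sgn)
      (consT A.carrier t ∘ₗ TensorProduct.map (A.act s ∘ₗ TensorProduct.map (τ.toFun (Fin s))
        (PiTensorProduct.map b)) (PiTensorProduct.map a) ∘ₗ
        (TensorProduct.assoc K _ _ _).symm.toLinearMap)) (C.Δ_coassoc t s x)
  refine Eq.trans ?_ (key.symm.trans ?_)
  · rw [convOp_of_isPar τ C A hq]
    refine LinearMap.congr_fun (f := A.act (t + 1) ∘ₗ TensorProduct.map (τ.toFun (Fin (t + 1)) ∘ₗ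
        (𝒞.obj (Fin (t + 1))).sgnP (∑ i, (Fin.cons 1 0 : Fin (t + 1) → ZMod 2) i))
        (PiTensorProduct.map (fun j => (Fin.cons (convOp τ C A s b) a : Fin (t + 1) → _) j ∘ₗ
          C.toGrMod.sgnP (∑ i ∈ Finset.Ioi j, (Fin.cons 1 0 : Fin (t + 1) → ZMod 2) i))))
      (g := A.act (t + 1) ∘ₗ TensorProduct.map
      (τ.toFun (Fin (t + 1)) ∘ₗ (𝒞.obj (Fin (t + 1))).sgn)
      (consT A.carrier t ∘ₗ TensorProduct.map (A.act s ∘ₗ TensorProduct.map (τ.toFun (Fin s))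
        (PiTensorProduct.map b)) (PiTensorProduct.map a) ∘ₗ
        (TensorProduct.assoc K _ _ _).symm.toLinearMap) ∘ₗ
        TensorProduct.map LinearMap.id ((TensorProduct.assoc K _ _ _).toLinearMap ∘ₗ
          TensorProduct.map (C.Δ s) LinearMap.id ∘ₗ uncons C.toGrMod t))
      (tens_ext fun m v => ?_) (C.Δ (t + 1) x)
    have h1 : ∀ j, ∑ i ∈ Finset.Ioi j, (Fin.cons 1 0 : Fin (t + 1) → ZMod 2) i = 0 := fun j => by
      refine Finset.sum_eq_zero fun i hi => ?_
      obtain ⟨k, rfl⟩ := Fin.eq_succ_of_ne_zero (Fin.ne_zero_of_lt (Finset.mem_Ioi.1 hi))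
      simp
    have h2 : ∑ i, (Fin.cons 1 0 : Fin (t + 1) → ZMod 2) i = 1 := by
      simp [Fin.sum_univ_succ]
    simp only [LinearMap.comp_apply, TensorProduct.map_tmul, PiTensorProduct.map_tprod, h1, h2,
      GrMod.sgnP_zero, GrMod.sgnP_one, LinearMap.id_apply, uncons_tprod, LinearEquiv.coe_coe,
      LinearEquiv.symm_apply_apply, consT_tprod]
    congr 3
    ext j
    refine Fin.cases ?_ (fun j => ?_) j
    · simp only [Fin.cons_zero]
      rw [convOp_of_even τ C A hb]; rfl
    · rfl
  · refine LinearMap.congr_fun (f := A.act (t + 1) ∘ₗ TensorProduct.map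
      (τ.toFun (Fin (t + 1)) ∘ₗ (𝒞.obj (Fin (t + 1))).sgn)
      (consT A.carrier t ∘ₗ TensorProduct.map (A.act s ∘ₗ TensorProduct.map (τ.toFun (Fin s))
        (PiTensorProduct.map b)) (PiTensorProduct.map a) ∘ₗ
        (TensorProduct.assoc K _ _ _).symm.toLinearMap) ∘ₗ
        (TensorProduct.assoc K _ _ _).toLinearMap ∘ₗ (TensorProduct.map
        (TensorProduct.map (𝒞.map (finSuccEquiv t).symm)
          (LinearMap.id : 𝒞.obj (Fin s) →ₗ[K] 𝒞.obj (Fin s)) ∘ₗ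
            𝒞.decomp ∘ₗ 𝒞.map finSumFinEquiv.symm)
        (TensorPower.mulEquiv (R := K) (M := C.carrier) (n := s) (m := t)).symm.toLinearMap))
      (g := A.act (s + t) ∘ₗ TensorProduct.map (τ.blockComp s t)
        (PiTensorProduct.map (Fin.append b a)))
      (tens_ext fun m v => ?_) (C.Δ (s + t) x)
    obtain ⟨w, v, rfl⟩ := exists_append v
    simp only [LinearMap.comp_apply, TensorProduct.map_tmul, LinearEquiv.coe_coe,
      mulEquiv_symm_append, PiTensorProduct.map_tprod, TwistingMorphism.blockComp,
      TwistingMorphism.infComp]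
    have h3 : (fun i => Fin.append b a i (Fin.append w v i)) =
        Fin.append (fun i => b i (w i)) (fun i => a i (v i)) := by
      ext i
      refine Fin.addCases (fun i => ?_) (fun i => ?_) i <;> simp
    rw [h3]
    induction 𝒞.decomp (𝒞.map finSumFinEquiv.symm m) using TensorProduct.induction_on with
    | zero => simp
    | add x y hx hy => simp only [map_add, TensorProduct.add_tmul, hx, hy]
    | tmul μ ν =>
      simp only [TensorProduct.map_tmul, TensorProduct.assoc_tmul, LinearMap.comp_apply,
        LinearMap.id_apply, LinearEquiv.coe_coe, TensorProduct.assoc_symm_tmul,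
        PiTensorProduct.map_tprod, consT_tprod]
      rw [← A.act_comp, Cooperad.isPar_map (finSuccEquiv t).symm, psgn_zero, one_smul, τ.natural,
        ← P.map_trans]
      simp [P.map_refl]

/-- The composite of two operations, the inner one on the inputs `S`. -/
theorem convOp_convOp_subset (A : GrAlg P) {n : ℕ} {f : Fin n → (C.carrier →ₗ[K] A.carrier)}
    (hf : ∀ i, IsPar C.toGrMod A.toGrMod 0 (f i)) (S : Finset (Fin n)) {s t : ℕ}
    (hs : S.card = s) (ht : Sᶜ.card = t) :
    convOp τ C A (t + 1) (Fin.cons (convOp τ C A s (fun i => f (S.orderEmbOfFin hs i)))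
      (fun i => f (Sᶜ.orderEmbOfFin ht i)) : Fin (t + 1) → _) =
      A.act n ∘ₗ TensorProduct.map (τ.subsetComp S) (PiTensorProduct.map f) ∘ₗ C.Δ n := by
  obtain rfl : n = s + t := by
    rw [← hs, ← ht, Finset.card_add_card_compl, Fintype.card_fin]
  rw [convOp_convOp_append τ C A (fun i => hf _) (fun i => hf _)]
  ext c
  have := act_perm_conj C A (f := fun i => f (blockPerm hs ht i)) (fun i => hf _)
    (blockPerm hs ht) (τ.map_blockPerm hs ht) c
  simp only [Equiv.apply_symm_apply] at this
  rw [← blockPerm_apply hs ht f]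
  exact this.symm

end Comp

/-! ### The higher Jacobi identities -/

section Jacobi

variable {𝒞 : Cooperad K} {P : Operad K} (τ : TwistingMorphism 𝒞 P) (C : Coalg 𝒞)

theorem derD_of_even (A : DerAlg P) {f : C.carrier →ₗ[K] A.carrier}
    (hf : IsPar C.toGrMod A.toGrMod 0 f) (c : C.carrier) :
    derD C A f c = A.d (f c) - f (C.d c) := by
  rw [derD, homSgn_of_isPar hf]; simp

theorem derD_of_odd (A : DerAlg P) {f : C.carrier →ₗ[K] A.carrier}
    (hf : IsPar C.toGrMod A.toGrMod 1 f) (c : C.carrier) :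
    derD C A f c = A.d (f c) + f (C.d c) := by
  rw [derD, homSgn_of_isPar hf]; simp

theorem derD_derD (A : DerAlg P) {f : C.carrier →ₗ[K] A.carrier}
    (hf : IsPar C.toGrMod A.toGrMod 0 f) : derD C A (derD C A f) = A.d ∘ₗ A.d ∘ₗ f := by
  ext c
  have h := isPar_derD C A hf
  rw [zero_add] at h
  rw [derD_of_odd C A h, derD_of_even C A hf, derD_of_even C A hf, C.d_d]
  simp

variable [CharZero K]

omit [CharZero K] in
theorem isPar_update {A : GrAlg P} {n : ℕ} {f : Fin n → (C.carrier →ₗ[K] A.carrier)}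
    (hf : ∀ i, IsPar C.toGrMod A.toGrMod 0 (f i)) (i : Fin n) {u : C.carrier →ₗ[K] A.carrier}
    (hu : IsPar C.toGrMod A.toGrMod 1 u) (j : Fin n) :
    IsPar C.toGrMod A.toGrMod ((Pi.single i 1 : Fin n → ZMod 2) j) (Function.update f i u j) := by
  by_cases h : j = i
  · subst h; simpa using hu
  · simpa [h] using hf j

theorem convOp_update (A : GrAlg P) {n : ℕ} {f : Fin n → (C.carrier →ₗ[K] A.carrier)}
    (hf : ∀ i, IsPar C.toGrMod A.toGrMod 0 (f i)) (i : Fin n) {u : C.carrier →ₗ[K] A.carrier}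
    (hu : IsPar C.toGrMod A.toGrMod 1 u) :
    convOp τ C A n (Function.update f i u) = A.act n ∘ₗ TensorProduct.map
      (τ.toFun (Fin n) ∘ₗ (𝒞.obj (Fin n)).sgn)
      (PiTensorProduct.map (fun j => if j < i then f j ∘ₗ C.sgn else if j = i then u else f j)) ∘ₗ
        C.Δ n := by
  rw [convOp_of_isPar τ C A (isPar_update C hf i hu)]
  have h1 : ∑ j, (Pi.single i 1 : Fin n → ZMod 2) j = 1 := by simp
  rw [h1, GrMod.sgnP_one]
  congr 3
  congr 1
  ext1 j
  rw [Finset.sum_pi_single']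
  rcases lt_trichotomy j i with h | rfl | h
  · simp [h, h.ne]
  · simp
  · simp [h.not_gt, h.ne']

/-- The differential of an operation. -/
theorem derD_convOp (A : DerAlg P) {n : ℕ} {f : Fin n → (C.carrier →ₗ[K] A.carrier)}
    (hf : ∀ i, IsPar C.toGrMod A.toGrMod 0 (f i)) :
    derD C A (convOp τ C A.toGrAlg n f) = A.act n ∘ₗ TensorProduct.map
      ((P.obj (Fin n)).d ∘ₗ τ.toFun (Fin n) + τ.toFun (Fin n) ∘ₗ (𝒞.obj (Fin n)).d)
        (PiTensorProduct.map f) ∘ₗ C.Δ n -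
      ∑ i, convOp τ C A.toGrAlg n (Function.update f i (derD C A (f i))) := by
  ext c
  have h := isPar_convOp τ C A.toGrAlg hf
  simp only [Finset.sum_const_zero, zero_add] at h
  rw [derD_of_odd C A h, LinearMap.sub_apply, LinearMap.sum_apply, convOp_of_even τ C A.toGrAlg hf]
  simp only [LinearMap.comp_apply]
  have hd : ∀ i, IsPar C.toGrMod A.toGrMod 1 (derD C A (f i)) := fun i => by
    simpa using isPar_derD C A (hf i)
  simp only [fun i => convOp_update τ C A.toGrAlg hf i (hd i)]
  rw [A.act_d, C.Δ_d, opD, powD_eq_insSum]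
  simp only [LinearMap.comp_apply]
  refine LinearMap.congr_fun (f := (A.act n ∘ₗ TensorProduct.map (P.obj (Fin n)).d LinearMap.id ∘ₗ
      TensorProduct.map (τ.toFun (Fin n)) (PiTensorProduct.map f) +
      A.act n ∘ₗ TensorProduct.map (P.obj (Fin n)).sgn (insSum A.sgn A.d LinearMap.id n) ∘ₗ
      TensorProduct.map (τ.toFun (Fin n)) (PiTensorProduct.map f)) +
      A.act n ∘ₗ TensorProduct.map (τ.toFun (Fin n)) (PiTensorProduct.map f) ∘ₗ
      (TensorProduct.map (𝒞.obj (Fin n)).d LinearMap.id +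
        TensorProduct.map (𝒞.obj (Fin n)).sgn (insSum C.sgn C.d LinearMap.id n)))
    (g := A.act n ∘ₗ TensorProduct.map
      ((P.obj (Fin n)).d ∘ₗ τ.toFun (Fin n) + τ.toFun (Fin n) ∘ₗ (𝒞.obj (Fin n)).d)
        (PiTensorProduct.map f) - ∑ i, A.act n ∘ₗ TensorProduct.map
      (τ.toFun (Fin n) ∘ₗ (𝒞.obj (Fin n)).sgn)
      (PiTensorProduct.map (fun j => if j < i then f j ∘ₗ C.sgn else if j = i then derD C A (f i) else f j)))
    (tens_ext fun m v => ?_) (C.Δ n c) |>.trans ?_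
  · simp only [LinearMap.add_apply, LinearMap.sub_apply, LinearMap.sum_apply, LinearMap.comp_apply,
      TensorProduct.map_tmul, PiTensorProduct.map_tprod, LinearMap.id_apply, map_add, insSum_tprod,
      TensorProduct.tmul_sum, map_sum, TensorProduct.add_tmul]
    rw [τ.isPar, psgn_one]
    have key : ∀ i, A.act n (((-1 : ℤ) • (τ.toFun (Fin n)) ((𝒞.obj (Fin n)).sgn m)) ⊗ₜ[K]
          PiTensorProduct.tprod K (insFun A.sgn A.d LinearMap.id i fun i => f i (v i))) +
        A.act n (τ.toFun (Fin n) ((𝒞.obj (Fin n)).sgn m) ⊗ₜ[K] PiTensorProduct.tprod K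
          (fun j => f j (insFun C.sgn C.d LinearMap.id i v j))) =
        - A.act n (τ.toFun (Fin n) ((𝒞.obj (Fin n)).sgn m) ⊗ₜ[K] PiTensorProduct.tprod K
          (fun j => (if j < i then f j ∘ₗ C.sgn else if j = i then derD C A (f i) else f j) (v j))) := by
      intro i
      set w : Fin n → A.carrier := fun j => if j < i then f j (C.sgn (v j)) else f j (v j) with hw
      have e1 : insFun A.sgn A.d LinearMap.id i (fun i => f i (v i)) =
          Function.update w i (A.d (f i (v i))) := by
        ext j
        rcases lt_trichotomy j i with h | rfl | h
        · simp only [insFun, h, if_true, Function.update_of_ne h.ne, hw]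
          rw [hf]; simp
        · simp [insFun]
        · simp [insFun, h.not_gt, h.ne', hw]
      have e2 : (fun j => f j (insFun C.sgn C.d LinearMap.id i v j)) =
          Function.update w i (f i (C.d (v i))) := by
        ext j
        rcases lt_trichotomy j i with h | rfl | h
        · simp [insFun, h, h.ne, hw]
        · simp [insFun]
        · simp [insFun, h.not_gt, h.ne', hw]
      have e3 : (fun j => (if j < i then f j ∘ₗ C.sgn else if j = i then derD C A (f i) else f j)
          (v j)) = Function.update w i (A.d (f i (v i)) - f i (C.d (v i))) := by
        ext j
        rcases lt_trichotomy j i with h | rfl | h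
        · simp [h, h.ne, hw]
        · simp [derD_of_even C A (hf j)]
        · simp [h.not_gt, h.ne', hw]
      rw [e1, e2, e3, MultilinearMap.map_update_sub, TensorProduct.tmul_sub, map_sub, neg_one_smul,
        TensorProduct.neg_tmul, map_neg]
      abel
    have hs := Finset.sum_congr rfl fun i (_ : i ∈ Finset.univ) => key i
    rw [Finset.sum_add_distrib, Finset.sum_neg_distrib] at hs
    rw [sub_eq_add_neg, ← hs]
    abel
  · rw [LinearMap.sub_apply, LinearMap.sum_apply]
    rfl

/-- Moving an odd input to the front. -/
theorem convOp_cons_singleton (A : GrAlg P) {n : ℕ} {f : Fin n → (C.carrier →ₗ[K] A.carrier)}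
    (hf : ∀ i, IsPar C.toGrMod A.toGrMod 0 (f i)) (i : Fin n) {u : C.carrier →ₗ[K] A.carrier}
    (hu : IsPar C.toGrMod A.toGrMod 1 u) {t : ℕ} (ht : ({i}ᶜ : Finset (Fin n)).card = t) :
    convOp τ C A (t + 1) (Fin.cons u (fun j => f (({i}ᶜ : Finset (Fin n)).orderEmbOfFin ht j)) :
      Fin (t + 1) → _) = convOp τ C A n (Function.update f i u) := by
  have hn : n = t + 1 := by
    have := Finset.card_add_card_compl ({i} : Finset (Fin n))
    rw [ht, Fintype.card_fin, Finset.card_singleton] at this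
    omega
  subst hn
  have h := convOp_symm τ C (t + 1) _ i.cycleRange A _ (isPar_update C hf i hu)
  have h1 : koszulSign i.cycleRange (Pi.single i 1 : Fin (t + 1) → ZMod 2) = 1 := by
    refine Finset.prod_eq_one fun a _ => Finset.prod_eq_one fun b _ => if_neg ?_
    rintro ⟨hab, -, ha, hb⟩
    have h2 : ∀ c, (Pi.single i 1 : Fin (t + 1) → ZMod 2) c = 1 → c = i := fun c hc => by
      by_contra h; simp [h] at hc
    exact hab.ne ((h2 a ha).trans (h2 b hb).symm)
  rw [h1, one_smul] at h
  rw [← h]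
  congr 1
  ext1 j
  refine Fin.cases ?_ (fun j => ?_) j
  · simp
  · simp [Fin.succAbove_ne]

omit [CharZero K] in
theorem Operad.IsConnected.subsingleton_zero (hP : P.IsConnected) :
    Subsingleton (P.obj (Fin 0)) := by
  have e : Fin 0 ≃ Empty := Equiv.equivOfIsEmpty _ _
  have := hP.zero
  refine ⟨fun x y => ?_⟩
  have h : ∀ x : P.obj (Fin 0), x = P.map e.symm (P.map e x) := fun x => by
    rw [← P.map_trans]; simp [P.map_refl]
  rw [h x, h y, Subsingleton.elim (P.map e x) (P.map e y)]

omit [CharZero K] in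
theorem convOp_zero (hP : P.IsConnected) (A : GrAlg P) (f : Fin 0 → (C.carrier →ₗ[K] A.carrier)) :
    convOp τ C A 0 f = 0 := by
  have := hP.subsingleton_zero
  ext c
  refine LinearMap.congr_fun (f := A.act 0 ∘ₗ grConvTensor τ C A 0 f) (g := 0)
    (tens_ext fun m v => ?_) (C.Δ 0 c)
  simp only [grConvTensor, LinearMap.comp_apply, LinearMap.sum_apply, TensorProduct.map_tmul,
    LinearMap.zero_apply, map_sum]
  exact Finset.sum_eq_zero fun p _ => by rw [Subsingleton.elim (τ.toFun _ _) 0]; simp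

omit [CharZero K] in
theorem convL_cast (A : DerAlg P) {n m : ℕ} (h : m = n)
    (f : Fin n → (C.carrier →ₗ[K] A.carrier)) :
    convL τ C A m (fun i => f (Fin.cast h i)) = convL τ C A n f := by
  subst h; rfl

theorem orderEmbOfFin_univ_apply {n m : ℕ} (h : (Finset.univ : Finset (Fin n)).card = m)
    (i : Fin m) : (Finset.univ : Finset (Fin n)).orderEmbOfFin h i =
      Fin.cast (by rw [← h]; simp) i := by
  have : (fun i : Fin m => Fin.cast (show m = n by rw [← h]; simp) i) =
      (Finset.univ : Finset (Fin n)).orderEmbOfFin h :=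
    Finset.orderEmbOfFin_unique h (fun _ => Finset.mem_univ _) fun _ _ h => h
  exact (congrFun this i).symm

/-- The summand of the higher Jacobi identity for the subset `S`, without its sign. -/
def jacTerm (A : DerAlg P) {n : ℕ} (f : Fin n → (C.carrier →ₗ[K] A.carrier)) (S : Finset (Fin n)) :
    C.carrier →ₗ[K] A.carrier :=
  convL τ C A (Sᶜ.card + 1) (Fin.cons (convL τ C A S.card (fun i => f (S.orderEmbOfFin rfl i)))
    (fun i => f (Sᶜ.orderEmbOfFin rfl i)) : Fin (Sᶜ.card + 1) → _)

/-- The term of the Jacobi identity for `S` has a part given by the composite of `τ` with itself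
in the inputs `S`, and parts involving `l₁` if `S` is a singleton or everything. -/
theorem jacTerm_expand (A : DerAlg P) {n : ℕ}
    {f : Fin n → (C.carrier →ₗ[K] A.carrier)}
    (hf : ∀ i, IsPar C.toGrMod A.toGrMod 0 (f i)) (S : Finset (Fin n)) :
    jacTerm τ C A f S = A.act n ∘ₗ TensorProduct.map (τ.subsetComp S) (PiTensorProduct.map f) ∘ₗ C.Δ n +
      (∑ i, if S = {i} then convOp τ C A.toGrAlg n (Function.update f i (derD C A (f i))) else 0) +
      if S = Finset.univ then derD C A (convL τ C A n f) else 0 := by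
  have hd : ∀ i, IsPar C.toGrMod A.toGrMod 1 (derD C A (f i)) := fun i => by
    simpa using isPar_derD C A (hf i)
  rw [jacTerm, convL]
  refine congrArg₂ (· + ·) ?_ ?_
  · rw [convL, ← convOp_convOp_subset τ C A.toGrAlg hf S rfl rfl]
    set a := fun i => f (Sᶜ.orderEmbOfFin rfl i)
    have hlin : ∀ x y, convOp τ C A.toGrAlg (Sᶜ.card + 1) (Fin.cons (x + y) a : Fin (Sᶜ.card + 1) → _) =
        convOp τ C A.toGrAlg (Sᶜ.card + 1) (Fin.cons x a : Fin (Sᶜ.card + 1) → _) +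
        convOp τ C A.toGrAlg (Sᶜ.card + 1) (Fin.cons y a : Fin (Sᶜ.card + 1) → _) := fun x y => by
      rw [← convOpM_apply, ← convOpM_apply, ← convOpM_apply, MultilinearMap.cons_add]
    have h0 : convOp τ C A.toGrAlg (Sᶜ.card + 1) (Fin.cons 0 a : Fin (Sᶜ.card + 1) → _) = 0 := by
      rw [← convOpM_apply]
      exact MultilinearMap.map_coord_zero _ 0 rfl
    rw [hlin]
    congr 1
    by_cases h : S.card = 1
    · obtain ⟨i, rfl⟩ := Finset.card_eq_one.1 h
      rw [Finset.sum_eq_single i, if_pos rfl, dif_pos h]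
      · have : ({i} : Finset (Fin n)).orderEmbOfFin rfl ⟨0, by rw [h]; omega⟩ = i :=
          Finset.mem_singleton.1 (Finset.orderEmbOfFin_mem _ _ _)
        rw [this]
        exact convOp_cons_singleton τ C A.toGrAlg hf i (hd i) rfl
      · intro j _ hj
        rw [if_neg]
        intro h
        exact hj (Finset.singleton_injective h.symm)
      · simp
    · rw [dif_neg h, Finset.sum_eq_zero, h0]
      intro i _
      rw [if_neg]
      rintro rfl
      simp at h
  · by_cases h : S = Finset.univ
    · subst h
      rw [if_pos rfl, dif_pos (by simp)]
      congr 1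
      rw [← convL_cast τ C A (show (Finset.univ : Finset (Fin n)).card = n by simp) f]
      change convL τ C A _ _ = _
      congr 1
      ext1 i
      rw [orderEmbOfFin_univ_apply]
    · rw [if_neg h, dif_neg]
      intro h'
      apply h
      rw [← Finset.compl_eq_empty_iff, ← Finset.card_eq_zero]
      omega

/-- For inputs of degree parity `0`, the quadratic terms of the Jacobi identity add up to the
convolution operation for `τ ⋆ τ = - ∂ τ`, which cancels against the terms involving `l₁` since
`∂` is a derivation of the convolution operations. The right-hand side is zero if the derivation
of `A` is a differential. -/
theorem jacobi_even (hP : P.IsConnected) (A : DerAlg P) {n : ℕ}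
    {f : Fin n → (C.carrier →ₗ[K] A.carrier)}
    (hf : ∀ i, IsPar C.toGrMod A.toGrMod 0 (f i)) :
    ∑ S : Finset (Fin n) with S.Nonempty, jacTerm τ C A f S =
      if h : n = 1 then A.d ∘ₗ A.d ∘ₗ f ⟨0, by omega⟩ else 0 := by
  rcases Nat.eq_zero_or_pos n with rfl | hn
  · rw [Finset.sum_eq_zero, dif_neg (by omega)]
    intro S hS
    simp [Finset.eq_empty_of_isEmpty S] at hS
  have hne : (Finset.univ : Finset (Fin n)) ≠ ∅ := by
    rw [← Finset.nonempty_iff_ne_empty]; exact ⟨⟨0, hn⟩, Finset.mem_univ _⟩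
  have hz : A.act n ∘ₗ TensorProduct.map (τ.subsetComp (∅ : Finset (Fin n))) (PiTensorProduct.map f) ∘ₗ
      C.Δ n = 0 := by
    rw [← convOp_convOp_subset τ C A.toGrAlg hf ∅ Finset.card_empty rfl, convOp_zero τ C hP,
      ← convOpM_apply]
    exact MultilinearMap.map_coord_zero _ 0 rfl
  have h1 : ∑ S : Finset (Fin n) with S.Nonempty, jacTerm τ C A f S = ∑ S : Finset (Fin n),
      (A.act n ∘ₗ TensorProduct.map (τ.subsetComp S) (PiTensorProduct.map f) ∘ₗ C.Δ n +
      (∑ i, if S = {i} then convOp τ C A.toGrAlg n (Function.update f i (derD C A (f i))) else 0) +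
      if S = Finset.univ then derD C A (convL τ C A n f) else 0) := by
    rw [Finset.sum_filter]
    refine Finset.sum_congr rfl fun S _ => ?_
    rcases S.eq_empty_or_nonempty with rfl | hS
    · rw [if_neg (by simp), hz, if_neg hne.symm, Finset.sum_eq_zero]
      · simp
      · intro i _
        rw [if_neg (Finset.singleton_ne_empty i).symm]
    · rw [if_pos hS, jacTerm_expand τ C A hf]
  rw [h1, Finset.sum_add_distrib, Finset.sum_add_distrib, Finset.sum_comm]
  simp only [Finset.sum_ite_eq', Finset.mem_univ, if_true]
  have h2 : ∑ S : Finset (Fin n), A.act n ∘ₗ TensorProduct.map (τ.subsetComp S)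
      (PiTensorProduct.map f) ∘ₗ C.Δ n = - (A.act n ∘ₗ TensorProduct.map
      ((P.obj (Fin n)).d ∘ₗ τ.toFun (Fin n) + τ.toFun (Fin n) ∘ₗ (𝒞.obj (Fin n)).d)
        (PiTensorProduct.map f) ∘ₗ C.Δ n) := by
    rw [eq_neg_iff_add_eq_zero, add_comm]
    ext c
    have h3 := congrArg (fun α => A.act n (TensorProduct.mapBilinear (RingHom.id K) _ _ _ _ α
      (PiTensorProduct.map f) (C.Δ n c))) (τ.sum_subsetComp n)
    simp only [map_add, map_sum, LinearMap.add_apply, LinearMap.sum_apply, map_zero,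
      LinearMap.zero_apply] at h3
    rw [TensorProduct.map_add_left, LinearMap.add_comp, LinearMap.comp_add]
    simp only [LinearMap.add_apply, LinearMap.sum_apply]
    exact h3
  rw [h2]
  have h4 : derD C A (convL τ C A n f) = derD C A (convOp τ C A.toGrAlg n f) +
      if h : n = 1 then A.d ∘ₗ A.d ∘ₗ f ⟨0, by omega⟩ else 0 := by
    rw [convL, ← derDL_apply, map_add, derDL_apply, derDL_apply]
    congr 1
    split_ifs
    · exact derD_derD C A (hf _)
    · rw [← derDL_apply, map_zero]
  rw [h4, derD_convOp τ C A hf]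
  abel

end Jacobi

/-! ### The higher Jacobi identities with signs -/

/-- The sign of the unshuffle which moves the positions in `S` to the front. -/
def unshSign {n : ℕ} (p : Fin n → ZMod 2) (S : Finset (Fin n)) : ℤ :=
  ∏ i ∈ Sᶜ, ∏ j ∈ S, if i < j ∧ p i = 1 ∧ p j = 1 then -1 else 1

theorem prod_orderEmbOfFin {n : ℕ} (S : Finset (Fin n)) {s : ℕ} (hs : S.card = s) (F : Fin n → ℤ) :
    ∏ i, F (S.orderEmbOfFin hs i) = ∏ j ∈ S, F j := by
  conv_rhs => rw [← S.map_orderEmbOfFin_univ hs, Finset.prod_map]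
  rfl

theorem prod_ite_sq {n : ℕ} (S : Finset (Fin n)) (p : Fin n → ZMod 2) (q : Fin n → Prop)
    [DecidablePred q] :
    (∏ j ∈ S, if q j then psgn (p j) else 1) * (∏ j ∈ S, if q j then psgn (p j) else 1) = 1 := by
  rw [← Finset.prod_mul_distrib]
  refine Finset.prod_eq_one fun j _ => ?_
  split_ifs <;> simp

theorem psgn_eq_ite (a : ZMod 2) : psgn a = if a = 1 then -1 else 1 := by revert a; decide

/-- How the unshuffle sign changes when an odd factor outside of the front block becomes even. -/
theorem unshSign_update_notMem {n : ℕ} {p : Fin n → ZMod 2} {i : Fin n} (hi : p i = 1)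
    {S : Finset (Fin n)} (hS : i ∉ S) :
    unshSign p S = (∏ j ∈ S, if i < j then psgn (p j) else 1) *
      unshSign (Function.update p i (p i + 1)) S := by
  have hi' : i ∈ Sᶜ := Finset.mem_compl.2 hS
  have hj : ∀ j ∈ S, Function.update p i (p i + 1) j = p j := fun j hj =>
    Function.update_of_ne (by rintro rfl; exact hS hj) _ _
  rw [unshSign, unshSign, ← Finset.mul_prod_erase _ _ hi', ← Finset.mul_prod_erase Sᶜ _ hi']
  have h1 : (∏ j ∈ S, if i < j ∧ Function.update p i (p i + 1) i = 1 ∧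
      Function.update p i (p i + 1) j = 1 then (-1 : ℤ) else 1) = 1 :=
    Finset.prod_eq_one fun j _ => if_neg (by simp [hi, show (1 + 1 : ZMod 2) = 0 from rfl])
  rw [h1, one_mul]
  congr 1
  · refine Finset.prod_congr rfl fun j _ => ?_
    rw [psgn_eq_ite]
    by_cases h : i < j <;> simp [h, hi]
  · refine Finset.prod_congr rfl fun a ha => Finset.prod_congr rfl fun j hj' => ?_
    rw [hj j hj', Function.update_of_ne (Finset.ne_of_mem_erase ha)]

/-- How the unshuffle sign changes when an odd factor in the front block becomes even. -/
theorem unshSign_update_mem {n : ℕ} {p : Fin n → ZMod 2} {i : Fin n} (hi : p i = 1)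
    {S : Finset (Fin n)} (hS : i ∈ S) :
    unshSign p S = (∏ j ∈ Sᶜ, if j < i then psgn (p j) else 1) *
      unshSign (Function.update p i (p i + 1)) S := by
  have hj : ∀ j ∈ Sᶜ, Function.update p i (p i + 1) j = p j := fun j hj =>
    Function.update_of_ne (by rintro rfl; exact Finset.mem_compl.1 hj hS) _ _
  rw [unshSign, unshSign, ← Finset.prod_mul_distrib]
  refine Finset.prod_congr rfl fun a ha => ?_
  rw [← Finset.mul_prod_erase _ _ hS, ← Finset.mul_prod_erase S _ hS]
  have h1 : (if a < i ∧ Function.update p i (p i + 1) a = 1 ∧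
      Function.update p i (p i + 1) i = 1 then (-1 : ℤ) else 1) = 1 :=
    if_neg (by simp [hi, show (1 + 1 : ZMod 2) = 0 from rfl])
  rw [h1, one_mul]
  congr 1
  · rw [psgn_eq_ite]
    by_cases h : a < i <;> simp [h, hi]
  · refine Finset.prod_congr rfl fun j hj' => ?_
    rw [hj a ha, Function.update_of_ne (Finset.ne_of_mem_erase hj')]

theorem prod_compl_mul_prod {n : ℕ} (S : Finset (Fin n)) (F : Fin n → ℤ) :
    (∏ j ∈ S, F j) * ∏ j ∈ Sᶜ, F j = ∏ j, F j := Finset.prod_mul_prod_compl S F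

section Jacobi

variable {𝒞 : Cooperad K} {P : Operad K} (τ : TwistingMorphism 𝒞 P) (C : Coalg 𝒞) [CharZero K]

omit [CharZero K] in
theorem convL_cons_zsmul (A : DerAlg P) {m : ℕ} (z : ℤ) (u : C.carrier →ₗ[K] A.carrier)
    (a : Fin m → (C.carrier →ₗ[K] A.carrier)) :
    convL τ C A (m + 1) (Fin.cons (z • u) a : Fin (m + 1) → _) =
      z • convL τ C A (m + 1) (Fin.cons u a : Fin (m + 1) → _) := by
  rw [← Int.cast_smul_eq_zsmul K, ← convLM_apply, MultilinearMap.cons_smul, Int.cast_smul_eq_zsmul,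
    convLM_apply]

/-- The effect on a summand of the Jacobi identity of pulling out an odd variable. -/
theorem jacTerm_eps_single (A : DerAlg P) {e : ℤ} (he : Odd e) {n : ℕ}
    {f : Fin n → (C.carrier →ₗ[K] A.carrier)} {p : Fin n → ZMod 2}
    (hf : ∀ i, IsPar C.toGrMod A.toGrMod (p i) (f i)) (i : Fin n) (hi : p i = 1)
    (S : Finset (Fin n)) :
    unshSign (Function.update p i (p i + 1)) S • jacTerm τ C (A.eps e he)
        (fun j => if j = i then epsInr A.toGrMod e ∘ₗ f j else epsInl A.toGrMod e ∘ₗ f j) S =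
      (∏ j, if j < i then psgn (p j) else 1) •
        (epsInr A.toGrMod e ∘ₗ (unshSign p S • jacTerm τ C A f S)) := by
  set g : Fin n → (C.carrier →ₗ[K] A.toGrMod.eps e) :=
    fun j => if j = i then epsInr A.toGrMod e ∘ₗ f j else epsInl A.toGrMod e ∘ₗ f j with hg
  have hsmul : ∀ z : ℤ, epsInr A.toGrMod e ∘ₗ (z • jacTerm τ C A f S) =
      z • (epsInr A.toGrMod e ∘ₗ jacTerm τ C A f S) := fun z => by
    ext x; simp
  rw [hsmul, smul_smul, ← prod_compl_mul_prod S]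
  have hu := isPar_convL τ C A (f := fun j => f (S.orderEmbOfFin rfl j)) (fun j => hf _)
  have hcons : ∀ j, IsPar C.toGrMod A.toGrMod
      ((Fin.cons (∑ j, p (S.orderEmbOfFin rfl j) + 1) (fun j => p (Sᶜ.orderEmbOfFin rfl j)) :
        Fin (Sᶜ.card + 1) → ZMod 2) j)
      ((Fin.cons (convL τ C A S.card (fun j => f (S.orderEmbOfFin rfl j)))
        (fun j => f (Sᶜ.orderEmbOfFin rfl j)) : Fin (Sᶜ.card + 1) → _) j) := fun j => by
    refine Fin.cases ?_ (fun j => ?_) j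
    · exact hu
    · exact hf _
  by_cases hS : i ∈ S
  · obtain ⟨k, hk⟩ : ∃ k, S.orderEmbOfFin rfl k = i := by
      have : i ∈ Set.range (S.orderEmbOfFin rfl) := by rw [Finset.range_orderEmbOfFin]; exact hS
      exact this
    have e1 : (fun j => g (S.orderEmbOfFin rfl j)) = fun j => if j = k then
        epsInr A.toGrMod e ∘ₗ f (S.orderEmbOfFin rfl j) else
        epsInl A.toGrMod e ∘ₗ f (S.orderEmbOfFin rfl j) := by
      ext1 j
      have : S.orderEmbOfFin rfl j = i ↔ j = k := by
        rw [← hk]; exact (S.orderEmbOfFin rfl).injective.eq_iff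
      simp only [hg, this]
    have e2 : (fun j => g (Sᶜ.orderEmbOfFin rfl j)) =
        fun j => epsInl A.toGrMod e ∘ₗ f (Sᶜ.orderEmbOfFin rfl j) := by
      ext1 j
      have : Sᶜ.orderEmbOfFin rfl j ≠ i := fun h => by
        have := Finset.orderEmbOfFin_mem Sᶜ rfl j
        rw [h] at this
        exact Finset.mem_compl.1 this hS
      simp only [hg, this, if_false]
    have e3 := convL_eps_single τ C A he (f := fun j => f (S.orderEmbOfFin rfl j)) (fun j => hf _) k
    have e4 := convL_eps_single τ C A he hcons 0
    have e5 : (fun j => if j = 0 then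
        epsInr A.toGrMod e ∘ₗ (Fin.cons (convL τ C A S.card (fun j => f (S.orderEmbOfFin rfl j)))
        (fun j => f (Sᶜ.orderEmbOfFin rfl j)) : Fin (Sᶜ.card + 1) → _) j else
        epsInl A.toGrMod e ∘ₗ (Fin.cons (convL τ C A S.card (fun j => f (S.orderEmbOfFin rfl j)))
        (fun j => f (Sᶜ.orderEmbOfFin rfl j)) : Fin (Sᶜ.card + 1) → _) j) =
        (Fin.cons (epsInr A.toGrMod e ∘ₗ convL τ C A S.card (fun j => f (S.orderEmbOfFin rfl j)))
          (fun j => epsInl A.toGrMod e ∘ₗ f (Sᶜ.orderEmbOfFin rfl j)) : Fin (Sᶜ.card + 1) → _) := by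
      ext1 j
      refine Fin.cases ?_ (fun j => ?_) j
      · rfl
      · simp
    rw [e5] at e4
    rw [jacTerm, e1, e2, e3, convL_cons_zsmul, e4, smul_smul, smul_smul]
    change _ = _ • (epsInr A.toGrMod e ∘ₗ convL τ C A _ _)
    congr 1
    simp only [Fin.not_lt_zero, if_false, Finset.prod_const_one]
    have h2 : (∏ j, if j < k then psgn (p (S.orderEmbOfFin rfl j)) else 1) =
        ∏ j ∈ S, if j < i then psgn (p j) else 1 := by
      rw [← prod_orderEmbOfFin S rfl]
      refine Finset.prod_congr rfl fun j _ => ?_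
      have : S.orderEmbOfFin rfl j < i ↔ j < k := by
        rw [← hk]; exact (S.orderEmbOfFin rfl).lt_iff_lt
      simp only [this]
    rw [h2, unshSign_update_mem hi hS]
    linear_combination (-unshSign (Function.update p i (p i + 1)) S *
      ∏ j ∈ S, if j < i then psgn (p j) else 1) * prod_ite_sq Sᶜ p (· < i)
  · obtain ⟨k, hk⟩ : ∃ k, Sᶜ.orderEmbOfFin rfl k = i := by
      have : i ∈ Set.range (Sᶜ.orderEmbOfFin rfl) := by
        rw [Finset.range_orderEmbOfFin]; simpa using hS
      exact this
    have e1 : (fun j => g (S.orderEmbOfFin rfl j)) =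
        fun j => epsInl A.toGrMod e ∘ₗ f (S.orderEmbOfFin rfl j) := by
      ext1 j
      have : S.orderEmbOfFin rfl j ≠ i := fun h => hS (by
        rw [← h]; exact Finset.orderEmbOfFin_mem S rfl j)
      simp only [hg, this, if_false]
    have e2 : (fun j => g (Sᶜ.orderEmbOfFin rfl j)) = fun j => if j = k then
        epsInr A.toGrMod e ∘ₗ f (Sᶜ.orderEmbOfFin rfl j) else
        epsInl A.toGrMod e ∘ₗ f (Sᶜ.orderEmbOfFin rfl j) := by
      ext1 j
      have : Sᶜ.orderEmbOfFin rfl j = i ↔ j = k := by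
        rw [← hk]; exact (Sᶜ.orderEmbOfFin rfl).injective.eq_iff
      simp only [hg, this]
    have e3 := convL_eps_inl τ C A he (f := fun j => f (S.orderEmbOfFin rfl j)) (fun j => hf _)
    have e4 := convL_eps_single τ C A he hcons k.succ
    have e5 : (fun j => if j = k.succ then
        epsInr A.toGrMod e ∘ₗ (Fin.cons (convL τ C A S.card (fun j => f (S.orderEmbOfFin rfl j)))
        (fun j => f (Sᶜ.orderEmbOfFin rfl j)) : Fin (Sᶜ.card + 1) → _) j else
        epsInl A.toGrMod e ∘ₗ (Fin.cons (convL τ C A S.card (fun j => f (S.orderEmbOfFin rfl j)))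
        (fun j => f (Sᶜ.orderEmbOfFin rfl j)) : Fin (Sᶜ.card + 1) → _) j) =
        (Fin.cons (epsInl A.toGrMod e ∘ₗ convL τ C A S.card (fun j => f (S.orderEmbOfFin rfl j)))
          (fun j => if j = k then epsInr A.toGrMod e ∘ₗ f (Sᶜ.orderEmbOfFin rfl j) else
            epsInl A.toGrMod e ∘ₗ f (Sᶜ.orderEmbOfFin rfl j)) : Fin (Sᶜ.card + 1) → _) := by
      ext1 j
      refine Fin.cases ?_ (fun j => ?_) j
      · simp [(Fin.succ_ne_zero k).symm]
      · simp
    rw [e5] at e4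
    rw [jacTerm, e1, e2, e3, e4, smul_smul]
    change _ = _ • (epsInr A.toGrMod e ∘ₗ convL τ C A _ _)
    congr 1
    rw [Fin.prod_univ_succ]
    simp only [Fin.cons_zero, Fin.cons_succ, Fin.succ_pos, if_true, Fin.succ_lt_succ_iff]
    have h2 : (∏ j, if j < k then psgn (p (Sᶜ.orderEmbOfFin rfl j)) else 1) =
        ∏ j ∈ Sᶜ, if j < i then psgn (p j) else 1 := by
      rw [← prod_orderEmbOfFin Sᶜ rfl]
      refine Finset.prod_congr rfl fun j _ => ?_
      have : Sᶜ.orderEmbOfFin rfl j < i ↔ j < k := by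
        rw [← hk]; exact (Sᶜ.orderEmbOfFin rfl).lt_iff_lt
      simp only [this]
    rw [h2, psgn_add, psgn_one, psgn_sum, prod_orderEmbOfFin S rfl (fun j => psgn (p j)),
      unshSign_update_notMem hi hS]
    have h3 : ∏ j ∈ S, psgn (p j) = (∏ j ∈ S, if j < i then psgn (p j) else 1) *
        ∏ j ∈ S, if i < j then psgn (p j) else 1 := by
      rw [← Finset.prod_mul_distrib]
      refine Finset.prod_congr rfl fun j hj => ?_
      have : j ≠ i := by rintro rfl; exact hS hj
      rcases lt_or_gt_of_ne this with h | h <;> simp [h, h.not_gt]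
    rw [h3]
    ring

/-- The Jacobi identity with Koszul signs. In the induction step an odd input `f i` is replaced by
the even input `ε f i` with values in `A + ε A`. -/
theorem jacobi_par (hP : P.IsConnected) {n : ℕ} (p : Fin n → ZMod 2) :
    ∀ (A : DerAlg P) (f : Fin n → (C.carrier →ₗ[K] A.carrier)),
    (∀ i, IsPar C.toGrMod A.toGrMod (p i) (f i)) →
    ∑ S : Finset (Fin n) with S.Nonempty, unshSign p S • jacTerm τ C A f S =
      if h : n = 1 then A.d ∘ₗ A.d ∘ₗ f ⟨0, by omega⟩ else 0 := by
  induction p using parity_induction with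
  | zero =>
    intro A f hf
    rw [← jacobi_even τ C hP A hf]
    refine Finset.sum_congr rfl fun S _ => ?_
    have : unshSign (0 : Fin n → ZMod 2) S = 1 :=
      Finset.prod_eq_one fun a _ => Finset.prod_eq_one fun b _ => if_neg (by simp)
    rw [this, one_smul]
  | step p i hi ih =>
    intro A f hf
    have h1 := ih (A.eps 1 odd_one) _ (isPar_single C odd_one hf i)
    rw [Finset.sum_congr rfl fun S _ => jacTerm_eps_single τ C A odd_one hf i hi S] at h1
    have h2 := prod_ite_sq Finset.univ p (· < i)
    set x := ∏ j, if j < i then psgn (p j) else 1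
    ext c
    have h3 := congrArg (fun u => x • epsSnd A.toGrMod 1 (u c)) h1
    simp only [LinearMap.sum_apply, LinearMap.smul_apply, LinearMap.comp_apply, map_sum, map_zsmul,
      epsSnd_inr, Finset.smul_sum, smul_smul, ← mul_assoc, h2, one_mul] at h3
    rw [LinearMap.sum_apply]
    simp only [LinearMap.smul_apply]
    rw [h3]
    by_cases h : n = 1
    · subst h
      have hi0 : i = 0 := Subsingleton.elim _ _
      subst hi0
      have hx : x = 1 := by simp [x]
      rw [hx, one_smul, dif_pos rfl, dif_pos rfl]
      simp
    · rw [dif_neg h, dif_neg h]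
      simp

end Jacobi

/-! ### The coradical filtration -/

section Coradical

variable {𝒞 : Cooperad K} {P : Operad K} (C : Coalg 𝒞)

theorem Coalg.mem_coradical {r : ℕ} {x : C.carrier} :
    x ∈ C.coradical r ↔ ∀ n, r < n → C.Δ n x = 0 := by
  simp [Coalg.coradical, Submodule.mem_iInf]

theorem Coalg.coradical_mono : Monotone C.coradical := fun _ _ h _ hx =>
  C.mem_coradical.2 fun n hn => C.mem_coradical.1 hx n (h.trans_lt hn)

theorem Coalg.exists_mem_coradical (x : C.carrier) : ∃ r, x ∈ C.coradical r := by
  obtain ⟨r, hr⟩ := C.conilpotent x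
  exact ⟨r, C.mem_coradical.2 hr⟩

theorem Coalg.eq_zero_of_mem_coradical_zero {x : C.carrier} (hx : x ∈ C.coradical 0) : x = 0 := by
  rw [← C.Δ_counit x, C.mem_coradical.1 hx 1 zero_lt_one, map_zero, map_zero]

theorem Coalg.sgn_mem_coradical {r : ℕ} {x : C.carrier} (hx : x ∈ C.coradical r) :
    C.sgn x ∈ C.coradical r :=
  C.mem_coradical.2 fun n hn => by rw [C.Δ_sgn, C.mem_coradical.1 hx n hn, map_zero]

theorem Coalg.sgn_pow_mem_coradical {r : ℕ} {x : C.carrier} (hx : x ∈ C.coradical r) (m : ℕ) :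
    (C.sgn ^ m) x ∈ C.coradical r := by
  induction m with
  | zero => exact hx
  | succ m ih => rw [pow_succ']; exact C.sgn_mem_coradical ih

theorem Coalg.d_mem_coradical {r : ℕ} {x : C.carrier} (hx : x ∈ C.coradical r) :
    C.d x ∈ C.coradical r :=
  C.mem_coradical.2 fun n hn => by rw [C.Δ_d, C.mem_coradical.1 hx n hn, map_zero]

theorem Coalg.part_mem_coradical [CharZero K] {r : ℕ} {x : C.carrier} (hx : x ∈ C.coradical r)
    (b : ZMod 2) : C.part b x ∈ C.coradical r := by
  have h2 : (2 : K) ≠ 0 := two_ne_zero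
  rw [← inv_smul_smul₀ h2 (C.part b x)]
  refine Submodule.smul_mem _ _ ?_
  rcases zmod_two_cases b with rfl | rfl
  · rw [C.two_part_zero]; exact Submodule.add_mem _ hx (C.sgn_mem_coradical hx)
  · rw [C.two_part_one]; exact Submodule.sub_mem _ hx (C.sgn_mem_coradical hx)

/-- Over a field, the kernel of `φ ⊗ 1` is `ker φ ⊗ Y`, and so are intersections of such kernels. -/
theorem rTensor_eq_zero_of_forall {ι : Type*} {X Y W : Type*} {Z : ι → Type*} [AddCommGroup X]
    [Module K X] [AddCommGroup Y] [Module K Y] [AddCommGroup W] [Module K W]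
    [∀ i, AddCommGroup (Z i)] [∀ i, Module K (Z i)] (φ : ∀ i, X →ₗ[K] Z i) (g : X →ₗ[K] W)
    (hg : ∀ x, (∀ i, φ i x = 0) → g x = 0) (t : X ⊗[K] Y) (ht : ∀ i, (φ i).rTensor Y t = 0) :
    g.rTensor Y t = 0 := by
  obtain ⟨b, rfl⟩ := TensorProduct.eq_repr_basis_right (Module.Free.chooseBasis K Y) t
  rw [Finsupp.sum, map_sum]
  refine Finset.sum_eq_zero fun j _ => ?_
  rw [LinearMap.rTensor_tmul, hg, TensorProduct.zero_tmul]
  intro i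
  have h := ht i
  rw [Finsupp.sum, map_sum] at h
  simp only [LinearMap.rTensor_tmul] at h
  have h' : (b.mapRange (φ i) (map_zero _)).sum
      (fun j m => m ⊗ₜ[K] Module.Free.chooseBasis K Y j) = 0 := by
    rw [Finsupp.sum_mapRange_index (by simp)]
    exact h
  have := TensorProduct.sum_tmul_basis_right_eq_zero (Module.Free.chooseBasis K Y) _ h'
  simpa using DFunLike.congr_fun this j

theorem ptMap_eq_cons {V : GrMod K} {W : Type*} [AddCommGroup W] [Module K W] {m : ℕ}
    (g : Fin (m + 1) → (V →ₗ[K] W)) : PiTensorProduct.map g =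
      consT W m ∘ₗ TensorProduct.map (g 0) (PiTensorProduct.map (Fin.tail g)) ∘ₗ uncons V m := by
  ext v
  simp only [LinearMap.compMultilinearMap_apply, LinearMap.comp_apply, PiTensorProduct.map_tprod,
    uncons_tprod, TensorProduct.map_tmul, consT_tprod]
  congr 1
  ext j
  refine Fin.cases ?_ (fun j => ?_) j <;> rfl

theorem rTensor_leftComm {M X X' Y : Type*} [AddCommGroup M] [Module K M] [AddCommGroup X]
    [Module K X] [AddCommGroup X'] [Module K X'] [AddCommGroup Y] [Module K Y] (φ : X →ₗ[K] X')
    (t : M ⊗[K] (X ⊗[K] Y)) : φ.rTensor _ (TensorProduct.leftComm K _ _ _ t) =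
      TensorProduct.leftComm K _ _ _ (TensorProduct.map LinearMap.id
        (TensorProduct.map φ LinearMap.id) t) := by
  induction t using TensorProduct.induction_on with
  | zero => simp
  | add a b ha hb => simp only [map_add, ha, hb]
  | tmul a b =>
    induction b using TensorProduct.induction_on with
    | zero => simp
    | add b c hb hc => simp only [map_add, TensorProduct.tmul_add, hb, hc]
    | tmul b c => simp

/-- The first factor of `Δ (m + 1) x` lies in `F_{M - m} C` for `x ∈ F_M C`: for `s > M - m`,
coassociativity rewrites the application of `Δ s` to this factor as a decomposition of `Δ (s + m)
x = 0`, and over a field the kernel of `Δ s ⊗ 1` is the tensor product with the kernel of `Δ s`.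
-/
theorem Coalg.map_Δ_eq_zero_of_zero {W : Type*} [AddCommGroup W] [Module K W] {m N M : ℕ}
    (h : M ≤ m + N) {g : Fin (m + 1) → (C.carrier →ₗ[K] W)}
    (hg : ∀ x ∈ C.coradical N, g 0 x = 0) {x : C.carrier} (hx : x ∈ C.coradical M) :
    TensorProduct.map (LinearMap.id : 𝒞.obj (Fin (m + 1)) →ₗ[K] _) (PiTensorProduct.map g)
      (C.Δ (m + 1) x) = 0 := by
  set t := TensorProduct.map (LinearMap.id : 𝒞.obj (Fin (m + 1)) →ₗ[K] _) (uncons C.toGrMod m)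
    (C.Δ (m + 1) x) with ht
  set u := TensorProduct.leftComm K _ _ _ t with hu
  have hcomm : ∀ {X : Type u} [AddCommGroup X] [Module K X] (φ : C.carrier →ₗ[K] X),
      φ.rTensor _ u = TensorProduct.leftComm K _ _ _ (TensorProduct.map LinearMap.id
        (TensorProduct.map φ LinearMap.id) t) := fun φ => rTensor_leftComm φ t
  have h0 : (g 0).rTensor _ u = 0 := by
    refine rTensor_eq_zero_of_forall (ι := {s : ℕ // N < s}) (fun s => C.Δ s) (g 0)
      (fun y hy => hg y (C.mem_coradical.2 fun n hn => hy ⟨n, hn⟩)) u fun s => ?_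
    rw [hcomm, LinearEquiv.map_eq_zero_iff]
    have hco := C.Δ_coassoc m s x
    rw [C.mem_coradical.1 hx (s + m) (by have := s.2; omega), map_zero, map_zero] at hco
    have h3 := congrArg (TensorProduct.map (LinearMap.id : 𝒞.obj (Fin (m + 1)) →ₗ[K] _)
      (TensorProduct.assoc K _ _ _).symm.toLinearMap) hco
    rw [map_zero] at h3
    rw [h3, ht]
    refine LinearMap.congr_fun (f := TensorProduct.map (LinearMap.id : 𝒞.obj (Fin (m + 1)) →ₗ[K] _)
      (TensorProduct.map (C.Δ s) LinearMap.id) ∘ₗ TensorProduct.map LinearMap.id (uncons C.toGrMod m))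
      (g := TensorProduct.map (LinearMap.id : 𝒞.obj (Fin (m + 1)) →ₗ[K] _)
      (TensorProduct.assoc K _ _ _).symm.toLinearMap ∘ₗ TensorProduct.map LinearMap.id
        ((TensorProduct.assoc K _ _ _).toLinearMap ∘ₗ
          TensorProduct.map (C.Δ s) LinearMap.id ∘ₗ uncons C.toGrMod m)) ?_ _
    rw [← TensorProduct.map_comp, ← TensorProduct.map_comp]
    congr 1
    ext v
    simp
  have h1 : TensorProduct.map (LinearMap.id : 𝒞.obj (Fin (m + 1)) →ₗ[K] _)
        (TensorProduct.map (g 0) LinearMap.id) t = 0 := by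
    rwa [hu, rTensor_leftComm, LinearEquiv.map_eq_zero_iff] at h0
  have h2 := congrArg (TensorProduct.map (LinearMap.id : 𝒞.obj (Fin (m + 1)) →ₗ[K] _)
    (consT W m ∘ₗ TensorProduct.map LinearMap.id (PiTensorProduct.map (Fin.tail g)))) h1
  rw [map_zero] at h2
  rw [← h2, ht, ptMap_eq_cons]
  refine LinearMap.congr_fun (g := TensorProduct.map (LinearMap.id : 𝒞.obj (Fin (m + 1)) →ₗ[K] _)
    (consT W m ∘ₗ TensorProduct.map LinearMap.id (PiTensorProduct.map (Fin.tail g))) ∘ₗ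
    TensorProduct.map LinearMap.id (TensorProduct.map (g 0) LinearMap.id) ∘ₗ
    TensorProduct.map LinearMap.id (uncons C.toGrMod m)) ?_ _
  rw [← TensorProduct.map_comp, ← TensorProduct.map_comp]
  have h3 : TensorProduct.map (g 0) (PiTensorProduct.map (Fin.tail g)) =
      TensorProduct.map LinearMap.id (PiTensorProduct.map (Fin.tail g)) ∘ₗ
        TensorProduct.map (g 0) (LinearMap.id : (⨂[K]^m C.carrier) →ₗ[K] _) := by
    rw [← TensorProduct.map_comp, LinearMap.id_comp, LinearMap.comp_id]
  rw [h3]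
  rfl

/-- If `x ∈ F_M C` then each factor of `Δ n x` lies in `F_{M - n + 1} C`. -/
theorem Coalg.map_Δ_eq_zero [CharZero K] {W : Type*} [AddCommGroup W] [Module K W] {n N M : ℕ}
    (h : M < n + N) {g : Fin n → (C.carrier →ₗ[K] W)} (i : Fin n)
    (hg : ∀ x ∈ C.coradical N, g i x = 0) {x : C.carrier} (hx : x ∈ C.coradical M) :
    TensorProduct.map (LinearMap.id : 𝒞.obj (Fin n) →ₗ[K] _) (PiTensorProduct.map g)
      (C.Δ n x) = 0 := by
  obtain ⟨m, rfl⟩ : ∃ m, n = m + 1 := ⟨n - 1, by have := i.2; omega⟩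
  set σ := Equiv.swap 0 i
  have h1 : ∀ p : Fin (m + 1) → ZMod 2, TensorProduct.map
      (LinearMap.id : 𝒞.obj (Fin (m + 1)) →ₗ[K] _)
      (PiTensorProduct.map (fun j => g (σ j) ∘ₗ C.part (p j))) (C.Δ (m + 1) x) = 0 := fun p =>
    C.map_Δ_eq_zero_of_zero (N := N) (by omega) (fun y hy => by
      simpa [σ] using hg _ (C.part_mem_coradical hy (p 0))) hx
  have h2 : TensorProduct.map (LinearMap.id : 𝒞.obj (Fin (m + 1)) →ₗ[K] _) (PiTensorProduct.map g) ∘ₗ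
      TensorProduct.map (𝒞.map σ) (koszulPerm C.toGrMod σ) =
      ∑ p : Fin (m + 1) → ZMod 2, (koszulSign σ p : K) • (TensorProduct.map (𝒞.map σ)
        (PiTensorProduct.reindex K (fun _ : Fin (m + 1) => W) σ).toLinearMap ∘ₗ
        TensorProduct.map (LinearMap.id : 𝒞.obj (Fin (m + 1)) →ₗ[K] _)
          (PiTensorProduct.map (fun j => g (σ j) ∘ₗ C.part (p j)))) := by
    refine tens_ext fun μ v => ?_
    simp only [LinearMap.comp_apply, TensorProduct.map_tmul, koszulPerm, LinearMap.sum_apply,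
      zsmul_hom_tensorPower, LinearMap.smul_apply, PiTensorProduct.map_tprod, map_sum, map_smul,
      TensorProduct.tmul_sum, TensorProduct.tmul_smul, LinearEquiv.coe_coe,
      PiTensorProduct.reindex_tprod, LinearMap.id_apply]
    refine Finset.sum_congr rfl fun p _ => ?_
    congr 4
    ext j
    simp
  rw [← C.Δ_perm (m + 1) σ x, ← LinearMap.comp_apply, h2, LinearMap.sum_apply]
  refine Finset.sum_eq_zero fun p _ => ?_
  rw [LinearMap.smul_apply, LinearMap.comp_apply, h1, map_zero, smul_zero]

theorem Coalg.map_map_Δ_eq_zero [CharZero K] {M' W : Type*} [AddCommGroup M'] [Module K M']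
    [AddCommGroup W] [Module K W] {n N M : ℕ}
    (h : M < n + N) (α : 𝒞.obj (Fin n) →ₗ[K] M') {g : Fin n → (C.carrier →ₗ[K] W)} (i : Fin n)
    (hg : ∀ x ∈ C.coradical N, g i x = 0) {x : C.carrier} (hx : x ∈ C.coradical M) :
    TensorProduct.map α (PiTensorProduct.map g) (C.Δ n x) = 0 := by
  have := congrArg (TensorProduct.map α LinearMap.id) (C.map_Δ_eq_zero h i hg hx)
  rwa [map_zero, ← LinearMap.comp_apply, ← TensorProduct.map_comp, LinearMap.comp_id,
    LinearMap.id_comp] at this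

/-- Compatible maps on the terms of the coradical filtration can be glued. -/
theorem Coalg.exists_glue {W : Type*} [AddCommGroup W] [Module K W]
    (f : ℕ → (C.carrier →ₗ[K] W)) (hf : ∀ N, ∀ x ∈ C.coradical N, f (N + 1) x = f N x) :
    ∃ g : C.carrier →ₗ[K] W, ∀ N, ∀ x ∈ C.coradical N, g x = f N x := by
  choose r hr using C.exists_mem_coradical
  have h : ∀ N M, N ≤ M → ∀ x ∈ C.coradical N, f M x = f N x := fun N M hM x hx => by
    induction M, hM using Nat.le_induction with
    | base => rfl
    | succ M hM ih => rw [hf M x (C.coradical_mono hM hx), ih]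
  have h' : ∀ N, ∀ x ∈ C.coradical N, f (r x) x = f N x := fun N x hx => by
    rcases le_total N (r x) with h1 | h1
    · exact h _ _ h1 x hx
    · exact (h _ _ h1 x (hr x)).symm
  refine ⟨{ toFun := fun x => f (r x) x, map_add' := fun x y => ?_, map_smul' := fun c x => ?_ }, h'⟩
  · have hx := C.coradical_mono (le_max_left (r x) (r y)) (hr x)
    have hy := C.coradical_mono (le_max_right (r x) (r y)) (hr y)
    rw [h' _ _ (Submodule.add_mem _ hx hy), h' _ _ hx, h' _ _ hy, map_add]
  · rw [h' _ _ (Submodule.smul_mem _ c (hr x)), map_smul]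
    rfl

end Coradical

/-! ### The complete `L∞`-structure and its Maurer–Cartan elements -/

theorem zmod_cast_eq_one_iff (k : ℤ) : (k : ZMod 2) = 1 ↔ Odd k := by
  constructor
  · intro h
    by_contra hk
    rw [Int.not_odd_iff_even] at hk
    rw [(ZMod.intCast_zmod_eq_zero_iff_dvd k 2).2 (by exact_mod_cast hk.two_dvd)] at h
    exact absurd h (by decide)
  · exact odd_cast

section Structure

variable {𝒞 : Cooperad K} {P : Operad K} (τ : TwistingMorphism 𝒞 P) (C : Coalg 𝒞)

theorem isPar_of_mem_gr {V W : GrMod K} {k : ℤ} {f : V →ₗ[K] W}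
    (hf : ∀ i, ∀ x ∈ V.gr i, f x ∈ W.gr (i + k)) : IsPar V W k f := IsPar.of_degree hf

variable [CharZero K]

theorem convOp_mem (A : GrAlg P) {n : ℕ} {e : Fin n → ℤ}
    {f : Fin n → (C.carrier →ₗ[K] A.carrier)}
    (hf : ∀ j i, ∀ x ∈ C.gr i, f j x ∈ A.gr (i + e j)) (i : ℤ) (x : C.carrier) (hx : x ∈ C.gr i) :
    convOp τ C A n f x ∈ A.gr (i + (∑ j, e j - 1)) := by
  rw [convOp_of_isPar τ C A (fun j => isPar_of_mem_gr (hf j))]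
  simp only [LinearMap.comp_apply]
  refine A.act_mem n _ _ (opGr_le (fun p q m v h hm hv => ?_) (C.Δ_mem n i x hx))
  rw [TensorProduct.map_tmul, PiTensorProduct.map_tprod]
  refine tmul_mem_opGr (e := fun j => q j + e j) ?_ (τ.degree _ _ _ (GrMod.sgnP_mem _ _ hm))
    (fun j => hf j _ _ (GrMod.sgnP_mem _ _ (hv j)))
  rw [Finset.sum_add_distrib]
  omega

omit [CharZero K] in
theorem derD_mem (A : DerAlg P) {e : ℤ} {f : C.carrier →ₗ[K] A.carrier}
    (hf : ∀ i, ∀ x ∈ C.gr i, f x ∈ A.gr (i + e)) (i : ℤ) (x : C.carrier) (hx : x ∈ C.gr i) :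
    derD C A f x ∈ A.gr (i + (e - 1)) := by
  rw [derD]
  refine Submodule.sub_mem _ ?_ ?_
  · have := A.d_mem _ _ (hf i x hx)
    rwa [add_sub_assoc] at this
  · refine A.sgn_mem ?_
    have := hf _ _ (C.sgn_mem (C.d_mem i x hx))
    rwa [show i - 1 + e = i + (e - 1) by ring] at this

theorem convL_mem (A : DerAlg P) {n : ℕ} {e : Fin n → ℤ}
    {f : Fin n → (C.carrier →ₗ[K] A.carrier)}
    (hf : ∀ j i, ∀ x ∈ C.gr i, f j x ∈ A.gr (i + e j)) (i : ℤ) (x : C.carrier) (hx : x ∈ C.gr i) :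
    convL τ C A n f x ∈ A.gr (i + (∑ j, e j - 1)) := by
  refine Submodule.add_mem _ (convOp_mem τ C A.toGrAlg hf i x hx) ?_
  by_cases h : n = 1
  · subst h
    rw [dif_pos rfl, Fin.sum_univ_one]
    exact derD_mem C A (hf 0) i x hx
  · rw [dif_neg h]; exact Submodule.zero_mem _

/-- The operations only depend on one of their arguments through its values on a smaller term of the
coradical filtration. -/
theorem convOp_eq_zero (A : GrAlg P) {n N M : ℕ} (h : M < n + N)
    {f : Fin n → (C.carrier →ₗ[K] A.carrier)} (i : Fin n) (hf : ∀ x ∈ C.coradical N, f i x = 0)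
    {x : C.carrier} (hx : x ∈ C.coradical M) : convOp τ C A n f x = 0 := by
  rw [convOp, LinearMap.comp_apply, LinearMap.comp_apply, grConvTensor, LinearMap.sum_apply]
  rw [Finset.sum_eq_zero, map_zero]
  intro p _
  refine C.map_map_Δ_eq_zero h _ i (fun y hy => ?_) hx
  have hy' := C.sgn_pow_mem_coradical hy (∑ k ∈ Finset.Ioi i, (p k).val)
  simp only [LinearMap.comp_apply, homPart, LinearMap.add_apply]
  rw [hf _ (C.part_mem_coradical hy' 0), hf _ (C.part_mem_coradical hy' 1), map_zero, map_zero,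
    add_zero]

omit [CharZero K] in
theorem convOp_eq_zero_of_lt (A : GrAlg P) {n r : ℕ} (h : r < n)
    (f : Fin n → (C.carrier →ₗ[K] A.carrier)) {x : C.carrier} (hx : x ∈ C.coradical r) :
    convOp τ C A n f x = 0 := by
  rw [convOp, LinearMap.comp_apply, LinearMap.comp_apply, C.mem_coradical.1 hx n h, map_zero,
    map_zero]

omit [CharZero K] in
theorem derD_eq_zero (A : DerAlg P) {N : ℕ} {f : C.carrier →ₗ[K] A.carrier}
    (hf : ∀ x ∈ C.coradical N, f x = 0) {x : C.carrier} (hx : x ∈ C.coradical N) :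
    derD C A f x = 0 := by
  have h : f (C.sgn (C.d x)) = 0 := hf _ (C.sgn_mem_coradical (C.d_mem_coradical hx))
  change A.d (f x) - A.sgn (f (C.sgn (C.d x))) = 0
  rw [hf x hx, h, map_zero, map_zero, sub_zero]

theorem convL_eq_zero (A : DerAlg P) {n N : ℕ} {f : Fin n → (C.carrier →ₗ[K] A.carrier)} (i : Fin n)
    (hf : ∀ x ∈ C.coradical N, f i x = 0) {x : C.carrier} (hx : x ∈ C.coradical N) :
    convL τ C A n f x = 0 := by
  have hn : 0 < n := i.pos
  rw [convL, LinearMap.add_apply, convOp_eq_zero τ C A.toGrAlg (by omega) i hf hx, zero_add]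
  by_cases h : n = 1
  · subst h
    rw [dif_pos rfl]
    rw [Subsingleton.elim i 0] at hf
    exact derD_eq_zero C A hf hx
  · rw [dif_neg h]; rfl

theorem isCompleteLInfty_conv (hP : P.IsConnected) (A : DGAlg P) :
    IsCompleteLInfty (convLInfty τ C A) where
  gr_indep k := by
    rw [Submodule.disjoint_def]
    intro f hf hf'
    refine GrMod.hom_ext fun i x hx => ?_
    have hd := ((DirectSum.isInternal_submodule_iff_iSupIndep_and_iSup_eq_top _).1
      A.internal).1 (i + k)
    rw [Submodule.disjoint_def] at hd
    refine hd _ (hf i x hx) ?_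
    have : (⨆ j, ⨆ (_ : j ≠ k), (convLInfty τ C A).gr j) ≤
        (⨆ j, ⨆ (_ : j ≠ i + k), A.gr j).comap (LinearMap.applyₗ (R := K) x) := by
      refine iSup_le fun j => iSup_le fun hj g hg => ?_
      exact Submodule.mem_iSup_of_mem (i + j) (Submodule.mem_iSup_of_mem (by omega) (hg i x hx))
    exact this hf'
  sgn_apply k f hf := by
    rw [← psgn_intCast]
    exact homSgn_of_isPar (isPar_of_mem_gr hf)
  multilinear n := ⟨convLM τ C A.toDerAlg n, fun f => (convLM_apply τ C A.toDerAlg n f).symm⟩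
  l_zero f := by
    rw [convLInfty_l, convL, dif_neg (by omega), add_zero]
    exact convOp_zero τ C hP A.toGrAlg f
  l_mem n e f hf i x hx := convL_mem τ C A.toDerAlg hf i x hx
  l_symm n e f σ hf := by
    have h := convOp_symm τ C n (fun i => (e i : ZMod 2)) σ A.toGrAlg f
      (fun i => isPar_of_mem_gr (hf i))
    rw [convLInfty_l, convLInfty_l, convL, convL, smul_add]
    refine congrArg₂ (· + ·) h ?_
    by_cases hn : n = 1
    · subst hn
      have h1 : koszulSign σ (fun i => (e i : ZMod 2)) = 1 := by
        rw [Subsingleton.elim σ 1]; simp [koszulSign]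
      rw [dif_pos rfl, dif_pos rfl, h1, one_smul]
      congr 2
      exact Subsingleton.elim _ _
    · rw [dif_neg hn, dif_neg hn, smul_zero]
  jacobi n e f hf := by
    have h := jacobi_par τ C hP (fun i => (e i : ZMod 2)) A.toDerAlg f
      (fun i => isPar_of_mem_gr (hf i))
    have h0 : (A.toDerAlg.d ∘ₗ A.toDerAlg.d : A.carrier →ₗ[K] A.carrier) = 0 :=
      LinearMap.ext fun x => A.d_d x
    have h1 : (if h : n = 1 then A.toDerAlg.d ∘ₗ A.toDerAlg.d ∘ₗ f ⟨0, by omega⟩ else 0) = 0 := by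
      split_ifs
      · rw [← LinearMap.comp_assoc, h0, LinearMap.zero_comp]
      · rfl
    rw [h1] at h
    rw [← h]
    refine Finset.sum_congr rfl fun S _ => ?_
    have h2 : unshuffleSign e S = unshSign (fun i => (e i : ZMod 2)) S := by
      simp only [unshuffleSign, unshSign, zmod_cast_eq_one_iff]
    rw [h2]
    rfl
  fil_anti N M h f hf x hx := hf x (C.coradical_mono h hx)
  fil_zero := by
    rw [eq_top_iff]
    intro f _ x hx
    rw [C.eq_zero_of_mem_coradical_zero hx, map_zero]
  fil_separated := by
    rw [eq_bot_iff]
    intro f hf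
    rw [Submodule.mem_bot]
    ext x
    obtain ⟨r, hr⟩ := C.exists_mem_coradical x
    exact (Submodule.mem_iInf _).1 hf r x hr
  fil_complete k f hf hfil := by
    obtain ⟨g, hg⟩ := C.exists_glue f fun N x hx => sub_eq_zero.1 (hfil N x hx)
    refine ⟨g, fun i x hx => ?_, fun N x hx => ?_⟩
    · obtain ⟨r, hr⟩ := C.exists_mem_coradical x
      rw [hg r x hr]
      exact hf r i x hx
    · rw [LinearMap.sub_apply, hg N x hx, sub_self]
  l_fil n N f := fun ⟨i, hi⟩ _ hx => convL_eq_zero τ C A.toDerAlg i hi hx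
  l_conv N := by
    refine ⟨N + 2, fun n hn f x hx => ?_⟩
    rw [convLInfty_l, convL, dif_neg (by omega), add_zero]
    exact convOp_eq_zero_of_lt τ C A.toGrAlg (by omega) f hx

omit [CharZero K] in
theorem homPart_comp_left {V W W' : GrMod K} {g : W →ₗ[K] W'}
    (hg : ∀ k, ∀ x ∈ W.gr k, g x ∈ W'.gr k) (b : ZMod 2) (f : V →ₗ[K] W) :
    homPart V W' b (g ∘ₗ f) = g ∘ₗ homPart V W b f := by
  have h : ∀ b x, W'.part b (g x) = g (W.part b x) := fun b x => by
    induction x using W.homogeneous_induction with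
    | hom k x hx =>
      rw [W'.part_of_mem b (hg k x hx), W.part_of_mem b hx]
      split_ifs <;> simp
    | add x y hx hy => simp only [map_add, hx, hy]
  ext x
  simp [homPart, h]

omit [CharZero K] in
theorem homPart_comp_right {V V' W : GrMod K} {h : V' →ₗ[K] V}
    (hh : ∀ k, ∀ x ∈ V'.gr k, h x ∈ V.gr k) (b : ZMod 2) (f : V →ₗ[K] W) :
    homPart V' W b (f ∘ₗ h) = homPart V W b f ∘ₗ h := by
  have h' : ∀ b x, V.part b (h x) = h (V'.part b x) := fun b x => by
    induction x using V'.homogeneous_induction with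
    | hom k x hx =>
      rw [V.part_of_mem b (hh k x hx), V'.part_of_mem b hx]
      split_ifs <;> simp
    | add x y hx hy => simp only [map_add, hx, hy]
  ext x
  simp [homPart, h']

omit [CharZero K] in
theorem sgn_comp_of_degree_zero {W W' : GrMod K} {g : W →ₗ[K] W'}
    (hg : ∀ k, ∀ x ∈ W.gr k, g x ∈ W'.gr k) (x : W) : W'.sgn (g x) = g (W.sgn x) := by
  have := IsPar.of_degree (e := 0) (f := g) (fun k x hx => by rw [add_zero]; exact hg k x hx) x
  simpa using this

omit [CharZero K] in
theorem convOp_comp_hom {A B : GrAlg P} (g : A.carrier →ₗ[K] B.carrier)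
    (hg : ∀ k, ∀ x ∈ A.gr k, g x ∈ B.gr k)
    (hact : ∀ (n : ℕ) (t : P.obj (Fin n) ⊗[K] (⨂[K]^n A.carrier)), g (A.act n t) =
      B.act n (TensorProduct.map LinearMap.id (PiTensorProduct.map (fun _ => g)) t))
    (n : ℕ) (f : Fin n → (C.carrier →ₗ[K] A.carrier)) :
    convOp τ C B n (fun i => g ∘ₗ f i) = g ∘ₗ convOp τ C A n f := by
  ext x
  simp only [convOp, LinearMap.comp_apply, hact]
  congr 1
  simp only [grConvTensor, LinearMap.sum_apply, map_sum]
  refine Finset.sum_congr rfl fun p _ => ?_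
  rw [← LinearMap.comp_apply (TensorProduct.map LinearMap.id _), ← TensorProduct.map_comp,
    LinearMap.id_comp, ← PiTensorProduct.map_comp]
  simp only [homPart_comp_left hg, LinearMap.comp_assoc]

omit [CharZero K] in
theorem derD_comp_hom {A B : DerAlg P} (g : A.carrier →ₗ[K] B.carrier)
    (hg : ∀ k, ∀ x ∈ A.gr k, g x ∈ B.gr k) (hd : ∀ x, g (A.d x) = B.d (g x))
    (f : C.carrier →ₗ[K] A.carrier) : derD C B (g ∘ₗ f) = g ∘ₗ derD C A f := by
  ext x
  change B.d (g (f x)) - B.sgn (g (f (C.sgn (C.d x)))) = g (A.d (f x) - A.sgn (f (C.sgn (C.d x))))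
  rw [sgn_comp_of_degree_zero hg, map_sub, hd]

omit [CharZero K] in
theorem isStrictMorphism_llcomp {A B : DGAlg P} (g : DGAlg.Hom A B) :
    IsStrictMorphism (convLInfty τ C A) (convLInfty τ C B)
      (LinearMap.llcomp K C.carrier A.carrier B.carrier g.toLin) where
  map_gr k f hf i x hx := g.map_mem _ _ (hf i x hx)
  map_fil N f hf x hx := by
    change g.toLin (f x) = 0
    rw [hf x hx, map_zero]
  map_l n f := by
    rw [convLInfty_l, convLInfty_l, convL, convL, map_add]
    refine congrArg₂ (· + ·)
      (convOp_comp_hom τ C (A := A.toGrAlg) (B := B.toGrAlg) g.toLin g.map_mem g.map_act n f).symm ?_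
    by_cases h : n = 1
    · rw [dif_pos h, dif_pos h]
      exact (derD_comp_hom C (A := A.toDerAlg) (B := B.toDerAlg) g.toLin g.map_mem g.map_d _).symm
    · rw [dif_neg h, dif_neg h, map_zero]

omit [CharZero K] in
theorem isStrictMorphism_lcomp {C' : Coalg 𝒞} (A : DGAlg P) (h : Coalg.Hom C' C) :
    IsStrictMorphism (convLInfty τ C A) (convLInfty τ C' A)
      (LinearMap.lcomp K A.carrier h.toLin) where
  map_gr k f hf i x hx := hf i _ (h.map_mem i x hx)
  map_fil N f hf x hx := by
    refine hf _ (C.mem_coradical.2 fun n hn => ?_)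
    rw [h.map_Δ, C'.mem_coradical.1 hx n hn, map_zero]
  map_l n f := by
    have hs := sgn_comp_of_degree_zero h.map_mem
    have hs' : ∀ m : ℕ, h.toLin ∘ₗ (C'.sgn ^ m : Module.End K C'.carrier) =
        (C.sgn ^ m : Module.End K C.carrier) ∘ₗ h.toLin := fun m => by
      induction m with
      | zero => rfl
      | succ m ih =>
        rw [pow_succ, pow_succ, Module.End.mul_eq_comp, Module.End.mul_eq_comp, ← LinearMap.comp_assoc,
          ih]
        ext x
        simp [hs]
    ext x
    change (convL τ C A.toDerAlg n f) (h.toLin x) =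
      (convL τ C' A.toDerAlg n (fun i => f i ∘ₗ h.toLin)) x
    rw [convL, convL, LinearMap.add_apply, LinearMap.add_apply]
    congr 1
    · refine congrArg (A.act n) ?_
      change convTensor τ C A n f (C.Δ n (h.toLin x)) =
        convTensor τ C' A n (fun i => f i ∘ₗ h.toLin) (C'.Δ n x)
      rw [h.map_Δ]
      simp only [convTensor, LinearMap.sum_apply]
      refine Finset.sum_congr rfl fun p _ => ?_
      rw [← LinearMap.comp_apply (TensorProduct.map _ _), ← TensorProduct.map_comp, LinearMap.comp_id,
        ← PiTensorProduct.map_comp]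
      simp only [homPart_comp_right h.map_mem, LinearMap.comp_assoc, hs']
    · by_cases hn : n = 1
      · rw [dif_pos hn, dif_pos hn]
        change A.d (f _ (h.toLin x)) - A.sgn (f _ (C.sgn (C.d (h.toLin x)))) =
          A.d (f _ (h.toLin x)) - A.sgn (f _ (h.toLin (C'.sgn (C'.d x))))
        rw [← hs, h.map_d]
      · rw [dif_neg hn, dif_neg hn]; rfl

/-! ### Curvature -/

/-- The Maurer–Cartan operator for a graded algebra, as a linear map in its last argument. -/
def mcOp (A : GrAlg P) (φ : C.carrier →ₗ[K] A.carrier) : C.carrier →ₗ[K] A.carrier where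
  toFun c := ∑ᶠ n : ℕ, (n.factorial : K)⁻¹ • A.act n
    (TensorProduct.map (τ.toFun (Fin n)) (PiTensorProduct.map (fun _ => φ)) (C.Δ n c))
  map_add' x y := by
    have hfin : ∀ c, (Function.support fun n : ℕ => (n.factorial : K)⁻¹ • A.act n
        (TensorProduct.map (τ.toFun (Fin n)) (PiTensorProduct.map (fun _ => φ)) (C.Δ n c))).Finite := by
      intro c
      obtain ⟨r, hr⟩ := C.conilpotent c
      refine Set.Finite.subset (Set.finite_le_nat r) fun n hn => ?_
      by_contra h
      refine hn ?_
      beta_reduce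
      rw [hr n (not_le.1 h), map_zero, map_zero, smul_zero]
    rw [← finsum_add_distrib (hfin x) (hfin y)]
    simp only [map_add, smul_add]
  map_smul' a x := by
    rw [RingHom.id_apply, smul_finsum]
    simp only [map_smul, smul_comm a]

omit [CharZero K] in
theorem mcOp_eq_sum (A : GrAlg P) (φ : C.carrier →ₗ[K] A.carrier) {r : ℕ} {c : C.carrier}
    (hc : c ∈ C.coradical r) {n : ℕ} (hn : r < n) : mcOp τ C A φ c = ∑ k ∈ Finset.range n,
      (k.factorial : K)⁻¹ • A.act k
        (TensorProduct.map (τ.toFun (Fin k)) (PiTensorProduct.map (fun _ => φ)) (C.Δ k c)) := by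
  refine finsum_eq_finsetSum_of_support_subset _ fun k hk => ?_
  by_contra h
  refine hk ?_
  beta_reduce
  rw [C.mem_coradical.1 hc k (by simp at h; omega), map_zero, map_zero, smul_zero]

/-- The curvature `∂ φ + ⋆_τ(φ)` of a map `φ` of degree `0`. -/
def curv (A : DerAlg P) (φ : C.carrier →ₗ[K] A.carrier) : C.carrier →ₗ[K] A.carrier :=
  A.d ∘ₗ φ - φ ∘ₗ C.d + mcOp τ C A.toGrAlg φ

/-- On each step of the coradical filtration, the curvature is the truncated Maurer–Cartan series.
-/
theorem curv_eq_sum (hP : P.IsConnected) (A : DerAlg P) {φ : C.carrier →ₗ[K] A.carrier}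
    (hφ : IsPar C.toGrMod A.toGrMod 0 φ) {r : ℕ} {c : C.carrier}
    (hc : c ∈ C.coradical r) {n : ℕ} (hn : r ≤ n) (hn0 : 0 < n) : curv τ C A φ c =
      ∑ k ∈ Finset.range n, ((k + 1).factorial : K)⁻¹ • convL τ C A (k + 1) (fun _ => φ) c := by
  have h0 := LinearMap.congr_fun (convOp_zero τ C hP A.toGrAlg (fun _ => φ)) c
  rw [convOp_of_even τ C A.toGrAlg (fun _ => hφ)] at h0
  simp only [LinearMap.comp_apply, LinearMap.zero_apply] at h0
  rw [curv, LinearMap.add_apply, mcOp_eq_sum τ C A.toGrAlg φ hc (Nat.lt_succ_of_le hn),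
    Finset.sum_range_succ', h0, smul_zero, add_zero]
  simp only [convL, LinearMap.add_apply, smul_add, Finset.sum_add_distrib]
  rw [add_comm]
  congr 1
  · refine Finset.sum_congr rfl fun k _ => ?_
    rw [convOp_of_even τ C A.toGrAlg (fun _ => hφ)]
    rfl
  · rw [Finset.sum_eq_single 0]
    · rw [dif_pos rfl, derD_of_even C A hφ]; simp
    · intro k _ hk
      rw [dif_neg (by omega)]; simp
    · intro h; simp at h; omega

/-- The Maurer–Cartan series of the complete filtered algebra converges to the curvature, since it
is a finite sum on each step of the coradical filtration. -/
theorem isMaurerCartan_iff (hP : P.IsConnected) (A : DGAlg P) (φ : C.carrier →ₗ[K] A.carrier) :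
    IsMaurerCartan (convLInfty τ C A) φ ↔
      (∀ k, ∀ x ∈ C.gr k, φ x ∈ A.gr k) ∧ curv τ C A.toDerAlg φ = 0 := by
  have hgr : φ ∈ (convLInfty τ C A).gr 0 ↔ ∀ k, ∀ x ∈ C.gr k, φ x ∈ A.gr k := by
    constructor
    · intro h k x hx
      have := h k x hx
      rwa [add_zero] at this
    · intro h k x hx
      rw [add_zero]; exact h k x hx
  rw [IsMaurerCartan, hgr]
  refine and_congr_right fun hφ => ?_
  have hpar : IsPar C.toGrMod A.toGrMod 0 φ := by simpa using isPar_of_mem_gr (hgr.2 hφ)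
  have hs : ∀ n c, (∑ k ∈ Finset.range n, ((k + 1).factorial : K)⁻¹ •
      (convLInfty τ C A).l (k + 1) (fun _ => φ)) c = ∑ k ∈ Finset.range n,
        ((k + 1).factorial : K)⁻¹ • convL τ C A.toDerAlg (k + 1) (fun _ => φ) c := fun n c => by
    rw [LinearMap.sum_apply]; rfl
  constructor
  · intro h
    ext c
    obtain ⟨r, hr⟩ := C.exists_mem_coradical c
    obtain ⟨n₀, hn⟩ := h r
    have := hn (max n₀ (r + 1)) (le_max_left _ _) c hr
    rw [hs] at this
    rw [curv_eq_sum τ C hP A.toDerAlg hpar hr (n := max n₀ (r + 1)) (by omega) (by omega), this]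
    rfl
  · intro h N
    refine ⟨N + 1, fun n hn c hc => ?_⟩
    rw [hs, ← curv_eq_sum τ C hP A.toDerAlg hpar hc (by omega) (by omega), h]
    rfl

theorem isMaurerCartan_iff_isTwisting (hP : P.IsConnected) (A : DGAlg P)
    (φ : C.carrier →ₗ[K] A.carrier) :
    IsMaurerCartan (convLInfty τ C A) φ ↔ IsTwisting τ C A φ := by
  rw [isMaurerCartan_iff τ C hP, IsTwisting]
  refine and_congr Iff.rfl ?_
  constructor
  · intro h c
    exact LinearMap.congr_fun h c
  · intro h
    ext c
    exact h c

end Structure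

/-! ### The Bianchi identity -/

section Bianchi

variable {𝒞 : Cooperad K} {P : Operad K} (τ : TwistingMorphism 𝒞 P) (C : Coalg 𝒞)

theorem convL_cons_smul (A : DerAlg P) {m : ℕ} (z : K) (u : C.carrier →ₗ[K] A.carrier)
    (a : Fin m → (C.carrier →ₗ[K] A.carrier)) :
    convL τ C A (m + 1) (Fin.cons (z • u) a : Fin (m + 1) → _) =
      z • convL τ C A (m + 1) (Fin.cons u a : Fin (m + 1) → _) := by
  rw [← convLM_apply, MultilinearMap.cons_smul, convLM_apply]

theorem convL_cons_sub (A : DerAlg P) {m : ℕ} (u v : C.carrier →ₗ[K] A.carrier)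
    (a : Fin m → (C.carrier →ₗ[K] A.carrier)) :
    convL τ C A (m + 1) (Fin.cons (u - v) a : Fin (m + 1) → _) =
      convL τ C A (m + 1) (Fin.cons u a : Fin (m + 1) → _) -
        convL τ C A (m + 1) (Fin.cons v a : Fin (m + 1) → _) := by
  rw [sub_eq_add_neg, ← convLM_apply, MultilinearMap.cons_add, convLM_apply, convLM_apply,
    ← neg_one_smul K v, convL_cons_smul, neg_one_smul, ← sub_eq_add_neg]

theorem convL_cons_sum (A : DerAlg P) {m : ℕ} {ι : Type*} (s : Finset ι)
    (u : ι → (C.carrier →ₗ[K] A.carrier)) (a : Fin m → (C.carrier →ₗ[K] A.carrier)) :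
    convL τ C A (m + 1) (Fin.cons (∑ i ∈ s, u i) a : Fin (m + 1) → _) =
      ∑ i ∈ s, convL τ C A (m + 1) (Fin.cons (u i) a : Fin (m + 1) → _) := by
  classical
  induction s using Finset.induction_on with
  | empty =>
    rw [Finset.sum_empty, Finset.sum_empty, ← convLM_apply]
    exact MultilinearMap.map_coord_zero _ 0 rfl
  | insert i s hi ih =>
    rw [Finset.sum_insert hi, Finset.sum_insert hi, ← ih, ← convLM_apply, MultilinearMap.cons_add,
      convLM_apply, convLM_apply]

variable [CharZero K]

/-- `l_{j+1}(l_s(φ, …, φ), φ, …, φ)`. -/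
def jacConst (A : DerAlg P) (φ : C.carrier →ₗ[K] A.carrier) (s j : ℕ) :
    C.carrier →ₗ[K] A.carrier :=
  convL τ C A (j + 1) (Fin.cons (convL τ C A s (fun _ => φ)) (fun _ => φ) : Fin (j + 1) → _)

/-- The Jacobi identity for `q + 1` equal inputs of degree `0`: subsets are counted by their
cardinality, and `(q + 1)!` is divided out. -/
theorem sum_jacConst (hP : P.IsConnected) (A : DerAlg P) {φ : C.carrier →ₗ[K] A.carrier}
    (hφ : IsPar C.toGrMod A.toGrMod 0 φ) (q : ℕ) :
    ∑ p ∈ Finset.HasAntidiagonal.antidiagonal q, (((p.1 + 1).factorial : K)⁻¹ * (p.2.factorial : K)⁻¹) •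
      jacConst τ C A φ (p.1 + 1) p.2 = if q = 0 then A.d ∘ₗ A.d ∘ₗ φ else 0 := by
  have h := jacobi_even τ C hP A (n := q + 1) (f := fun _ => φ) (fun _ => hφ)
  have h1 : ∑ S : Finset (Fin (q + 1)) with S.Nonempty, jacTerm τ C A (fun _ => φ) S =
      ∑ S ∈ (Finset.univ : Finset (Fin (q + 1))).powerset,
        (fun s => if s = 0 then 0 else jacConst τ C A φ s (q + 1 - s)) S.card := by
    rw [Finset.sum_filter, Finset.powerset_univ]
    refine Finset.sum_congr rfl fun S _ => ?_
    have hS : Sᶜ.card = q + 1 - S.card := by rw [Finset.card_compl, Fintype.card_fin]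
    simp only [← Finset.card_pos]
    by_cases h0 : S.card = 0
    · rw [if_neg (by omega), if_pos h0]
    · rw [if_pos (by omega), if_neg h0, ← hS]
      rfl
  rw [h1, Finset.sum_powerset_apply_card
    (fun s => if s = 0 then 0 else jacConst τ C A φ s (q + 1 - s)), Finset.card_univ, Fintype.card_fin,
    Finset.sum_range_succ'] at h
  simp only [if_true, smul_zero, add_zero, Nat.add_eq_zero_iff, one_ne_zero, and_false, if_false] at h
  have h2 := congrArg (fun u => ((q + 1).factorial : K)⁻¹ • u) h
  rw [Finset.Nat.sum_antidiagonal_eq_sum_range_succ_mk]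
  beta_reduce at h2
  rw [Finset.smul_sum] at h2
  refine Eq.trans ?_ (h2.trans ?_)
  · refine Finset.sum_congr rfl fun s hs => ?_
    have hs' : s ≤ q := Nat.lt_succ_iff.1 (Finset.mem_range.1 hs)
    have e1 : q + 1 - (s + 1) = q - s := by omega
    rw [e1, ← Nat.cast_smul_eq_nsmul K, smul_smul]
    congr 1
    have e2 := Nat.add_choose_mul_factorial_mul_factorial (q - s) (s + 1)
    rw [show q - s + (s + 1) = q + 1 by omega] at e2
    have e3 : ((q + 1).factorial : K) ≠ 0 := Nat.cast_ne_zero.2 (Nat.factorial_ne_zero _)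
    have e4 : ((s + 1).factorial : K) ≠ 0 := Nat.cast_ne_zero.2 (Nat.factorial_ne_zero _)
    have e5 : ((q - s).factorial : K) ≠ 0 := Nat.cast_ne_zero.2 (Nat.factorial_ne_zero _)
    have e6 : ((q + 1).choose (s + 1) : K) * ((q - s).factorial : K) * ((s + 1).factorial : K) =
        ((q + 1).factorial : K) := by exact_mod_cast e2
    field_simp
    rw [← e6]
    ring
  · by_cases hq : q = 0
    · subst hq; simp
    · rw [dif_neg (by omega), if_neg hq, smul_zero]

theorem curv_apply_eq (hP : P.IsConnected) (A : DerAlg P) {φ : C.carrier →ₗ[K] A.carrier}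
    (hφ : IsPar C.toGrMod A.toGrMod 0 φ) {M N : ℕ} (hN : M < N) {c : C.carrier}
    (hc : c ∈ C.coradical M) : (curv τ C A φ - ∑ s ∈ Finset.range N, ((s + 1).factorial : K)⁻¹ •
      convL τ C A (s + 1) (fun _ => φ)) c = 0 := by
  rw [LinearMap.sub_apply, curv_eq_sum τ C hP A hφ hc (n := N) (by omega) (by omega),
    LinearMap.sum_apply]
  simp

/-- The Bianchi identity for the curvature of a map of degree `0`, whose right hand side vanishes
if the derivation of the target is a differential. -/
theorem bianchi (hP : P.IsConnected) (A : DerAlg P) {φ : C.carrier →ₗ[K] A.carrier}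
    (hφ : IsPar C.toGrMod A.toGrMod 0 φ) {M N : ℕ} (hN : M + 1 < N) {c : C.carrier}
    (hc : c ∈ C.coradical M) : ∑ j ∈ Finset.range N, (j.factorial : K)⁻¹ •
      convL τ C A (j + 1) (Fin.cons (curv τ C A φ) (fun _ => φ) : Fin (j + 1) → _) c =
        A.d (A.d (φ c)) := by
  have h1 : ∀ j, convL τ C A (j + 1) (Fin.cons (curv τ C A φ) (fun _ => φ) : Fin (j + 1) → _) c =
      ∑ s ∈ Finset.range N, ((s + 1).factorial : K)⁻¹ • jacConst τ C A φ (s + 1) j c := fun j => by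
    have h2 := convL_eq_zero τ C A (n := j + 1) (N := M)
      (f := Fin.cons (curv τ C A φ - ∑ s ∈ Finset.range N, ((s + 1).factorial : K)⁻¹ •
      convL τ C A (s + 1) (fun _ => φ)) (fun _ => φ)) 0
      (fun x hx => by rw [Fin.cons_zero]; exact curv_apply_eq τ C hP A hφ (by omega) hx) hc
    rw [convL_cons_sub, LinearMap.sub_apply, sub_eq_zero] at h2
    rw [h2, convL_cons_sum, LinearMap.sum_apply]
    refine Finset.sum_congr rfl fun s _ => ?_
    rw [convL_cons_smul]
    rfl
  set T : ℕ × ℕ → A.carrier := fun p => (((p.1 + 1).factorial : K)⁻¹ * (p.2.factorial : K)⁻¹) •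
      jacConst τ C A φ (p.1 + 1) p.2 c with hT
  have hT1 : ∀ p : ℕ × ℕ, N ≤ p.1 → T p = 0 := fun p hp => by
    rw [hT]
    beta_reduce
    rw [jacConst, convL_eq_zero τ C A (N := M) 0 (fun x hx => ?_) hc, smul_zero]
    rw [Fin.cons_zero, convL, dif_neg (by omega), add_zero]
    exact convOp_eq_zero_of_lt τ C A.toGrAlg (by omega) _ hx
  have hT2 : ∀ p : ℕ × ℕ, N ≤ p.2 → T p = 0 := fun p hp => by
    rw [hT]
    beta_reduce
    rw [jacConst, convL, dif_neg (by omega), add_zero,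
      convOp_eq_zero_of_lt τ C A.toGrAlg (by omega) _ hc, smul_zero]
  have h3 : ∑ p ∈ Finset.range N ×ˢ Finset.range N, T p =
      ∑ q ∈ Finset.range (2 * N), ∑ p ∈ Finset.HasAntidiagonal.antidiagonal q, T p := by
    rw [← Finset.sum_fiberwise_of_maps_to (t := Finset.range (2 * N)) (g := fun p => p.1 + p.2)
      (fun p hp => by simp at hp ⊢; omega)]
    refine Finset.sum_congr rfl fun q _ => ?_
    refine Finset.sum_subset (fun p hp => by simp at hp ⊢; omega) fun p hp hp' => ?_
    rw [Finset.HasAntidiagonal.mem_antidiagonal] at hp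
    simp only [Finset.mem_filter, Finset.mem_product, Finset.mem_range, hp, and_true, not_and_or,
      not_lt] at hp'
    exact hp'.elim (hT1 p) (hT2 p)
  have h4 : ∀ q, ∑ p ∈ Finset.HasAntidiagonal.antidiagonal q, T p = if q = 0 then A.d (A.d (φ c)) else 0 := fun q => by
    have := LinearMap.congr_fun (sum_jacConst τ C hP A hφ q) c
    rw [LinearMap.sum_apply] at this
    refine this.trans ?_
    split_ifs <;> rfl
  have h5 : ∑ q ∈ Finset.range (2 * N), ∑ p ∈ Finset.HasAntidiagonal.antidiagonal q, T p = A.d (A.d (φ c)) := by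
    rw [Finset.sum_congr rfl fun q _ => h4 q, Finset.sum_ite_eq', if_pos]
    rw [Finset.mem_range]; omega
  rw [← h5, ← h3, Finset.sum_product_right]
  refine Finset.sum_congr rfl fun j _ => ?_
  rw [h1, Finset.smul_sum]
  refine Finset.sum_congr rfl fun s _ => ?_
  rw [smul_smul, mul_comm]

end Bianchi

/-! ### Algebras detected by families of maps -/

section Family

variable {P : Operad K}

/-- A jointly injective family of maps to `P`-algebras which is compatible with given operations
makes its source a `P`-algebra. -/
abbrev GrAlg.ofFamily [CharZero K] (V : GrMod K)
    (act : (n : ℕ) → (P.obj (Fin n) ⊗[K] (⨂[K]^n V) →ₗ[K] V))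
    (act_mem : ∀ (n : ℕ) (k : ℤ) (t : P.obj (Fin n) ⊗[K] (⨂[K]^n V)),
      t ∈ opGr (P.obj (Fin n)).toGrMod V n k → act n t ∈ V.gr k)
    {ι : Type*} (B : ι → GrAlg P) (ev : ∀ i, V →ₗ[K] (B i).carrier)
    (ev_par : ∀ i, IsPar V (B i).toGrMod 0 (ev i))
    (inj : ∀ x y, (∀ i, ev i x = ev i y) → x = y)
    (ev_act : ∀ i n t, ev i (act n t) =
      (B i).act n (TensorProduct.map LinearMap.id (PiTensorProduct.map fun _ => ev i) t)) :
    GrAlg P where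
  toGrMod := V
  act := act
  act_mem := act_mem
  act_perm n σ t := by
    refine inj _ _ fun i => ?_
    rw [ev_act, ev_act, map_map_comm (f := LinearMap.id) (a := P.map σ) (f' := LinearMap.id)
      (a' := P.map σ) (fun _ => rfl)
      (fun x => (koszulPerm_map (ev_par i) σ x).symm), (B i).act_perm]
  act_one a := by
    refine inj _ _ fun i => ?_
    rw [ev_act, TensorProduct.map_tmul, PiTensorProduct.map_tprod]
    exact (B i).act_one _
  act_comp m n μ ν b a := by
    refine inj _ _ fun i => ?_
    rw [ev_act, ev_act]
    simp only [TensorProduct.map_tmul, PiTensorProduct.map_tprod, fin_append_comp, fin_cons_comp,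
      ev_act]
    exact (B i).act_comp m n μ ν _ _

/-- The linear map on `P(n) ⊗ V^{⊗ n}` given by a map which is multilinear in all variables. -/
def actOfMultilinear {M V W : Type*} [AddCommGroup M] [Module K M] [AddCommGroup V] [Module K V]
    [AddCommGroup W] [Module K W] {n : ℕ} (φ : M →ₗ[K] MultilinearMap K (fun _ : Fin n => V) W) :
    M ⊗[K] (⨂[K]^n V) →ₗ[K] W :=
  TensorProduct.lift ((PiTensorProduct.lift (R := K) (s := fun _ : Fin n => V)).toLinearMap ∘ₗ φ)

theorem actOfMultilinear_tprod {M V W : Type*} [AddCommGroup M] [Module K M] [AddCommGroup V]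
    [Module K V] [AddCommGroup W] [Module K W] {n : ℕ}
    (φ : M →ₗ[K] MultilinearMap K (fun _ : Fin n => V) W) (m : M) (v : Fin n → V) :
    actOfMultilinear φ (m ⊗ₜ[K] PiTensorProduct.tprod K v) = φ m v := by
  simp [actOfMultilinear]

end Family

/-! ### Free algebras -/

section Free

variable (P : Operad K) (V : GrMod K)

/-- Formal expressions in the operations of `P` and the elements of `V`. -/
inductive FreeTerm : Type u
  | gen : V → FreeTerm
  | op : (n : ℕ) → P.obj (Fin n) → (Fin n → FreeTerm) → FreeTerm
  | add : FreeTerm → FreeTerm → FreeTerm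
  | smul : K → FreeTerm → FreeTerm
  | zero : FreeTerm

/-- A graded `P`-algebra with a map from `V` of degree `0`. -/
structure AlgUnder where
  alg : GrAlg P
  map : V →ₗ[K] alg.carrier
  map_mem : ∀ (k : ℤ) (x : V), x ∈ V.gr k → map x ∈ alg.gr k

variable {P V}

/-- The value of an expression in a `P`-algebra under `V`. -/
def FreeTerm.eval (i : AlgUnder P V) : FreeTerm P V → i.alg.carrier
  | gen c => i.map c
  | op n μ t => i.alg.act n (μ ⊗ₜ[K] PiTensorProduct.tprod K (fun j => (t j).eval i))
  | add s t => s.eval i + t.eval i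
  | smul a t => a • t.eval i
  | zero => 0

/-- Expressions which are homogeneous of a given degree. -/
inductive FreeTerm.IsHom : ℤ → FreeTerm P V → Prop
  | gen (k : ℤ) (c : V) : c ∈ V.gr k → IsHom k (.gen c)
  | op (n : ℕ) (p : ℤ) (e : Fin n → ℤ) (μ : P.obj (Fin n)) (t : Fin n → FreeTerm P V) :
      μ ∈ (P.obj (Fin n)).gr p → (∀ j, IsHom (e j) (t j)) → IsHom (p + ∑ j, e j) (.op n μ t)
  | add (k : ℤ) (s t : FreeTerm P V) : IsHom k s → IsHom k t → IsHom k (.add s t)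
  | smul (k : ℤ) (a : K) (t : FreeTerm P V) : IsHom k t → IsHom k (.smul a t)
  | zero (k : ℤ) : IsHom k .zero

theorem FreeTerm.IsHom.eval_mem (i : AlgUnder P V) {k : ℤ} {t : FreeTerm P V} (h : t.IsHom k) :
    t.eval i ∈ i.alg.gr k := by
  induction h with
  | gen k c hc => exact i.map_mem k c hc
  | op n p e μ t hμ _ ih => exact i.alg.act_mem _ _ _ (tmul_mem_opGr rfl hμ ih)
  | add k s t _ _ hs ht => exact Submodule.add_mem _ hs ht
  | smul k a t _ ht => exact Submodule.smul_mem _ a ht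
  | zero k => exact Submodule.zero_mem _

/-- Expressions are identified if they have the same value in every `P`-algebra under `V`. -/
instance FreeTerm.setoid : Setoid (FreeTerm P V) where
  r s t := ∀ i : AlgUnder P V, s.eval i = t.eval i
  iseqv := ⟨fun _ _ => rfl, fun h i => (h i).symm, fun h h' i => (h i).trans (h' i)⟩

variable (P V) in
/-- The underlying vector space of the free `P`-algebra on `V`: expressions modulo identities which
hold in every `P`-algebra. -/
def FreeCarrier : Type u := Quotient (FreeTerm.setoid (P := P) (V := V))

namespace FreeCarrier

/-- The class of an expression. -/
def mk (t : FreeTerm P V) : FreeCarrier P V := Quotient.mk _ t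

/-- The value of an element of the free algebra. -/
def evalFun (i : AlgUnder P V) (x : FreeCarrier P V) : i.alg.carrier := (Quotient.out x).eval i

theorem evalFun_mk (i : AlgUnder P V) (t : FreeTerm P V) : evalFun i (mk t) = t.eval i :=
  Quotient.mk_out (s := FreeTerm.setoid) t i

theorem mk_out (x : FreeCarrier P V) : mk (Quotient.out x) = x := Quotient.out_eq x

theorem eq_of_evalFun {x y : FreeCarrier P V} (h : ∀ i, evalFun i x = evalFun i y) : x = y := by
  rw [← mk_out x, ← mk_out y]
  exact Quotient.sound h

instance : Zero (FreeCarrier P V) := ⟨mk .zero⟩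
instance : Add (FreeCarrier P V) := ⟨fun x y => mk (.add (Quotient.out x) (Quotient.out y))⟩
instance : SMul K (FreeCarrier P V) := ⟨fun a x => mk (.smul a (Quotient.out x))⟩
instance : Neg (FreeCarrier P V) := ⟨fun x => (-1 : K) • x⟩
instance : Sub (FreeCarrier P V) := ⟨fun x y => x + -y⟩
instance : SMul ℕ (FreeCarrier P V) := ⟨fun n x => (n : K) • x⟩
instance : SMul ℤ (FreeCarrier P V) := ⟨fun n x => (n : K) • x⟩

theorem evalFun_add (i : AlgUnder P V) (x y : FreeCarrier P V) :
    evalFun i (x + y) = evalFun i x + evalFun i y := evalFun_mk i _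

theorem evalFun_smul (i : AlgUnder P V) (a : K) (x : FreeCarrier P V) :
    evalFun i (a • x) = a • evalFun i x := evalFun_mk i _

instance : AddCommGroup (FreeCarrier P V) :=
  Function.Injective.addCommGroup (fun x (i : AlgUnder P V) => evalFun i x)
    (fun _ _ h => eq_of_evalFun (congrFun h))
    (funext fun i => evalFun_mk i _) (fun x y => funext fun i => evalFun_add i x y)
    (fun x => funext fun i => (evalFun_smul i _ x).trans (neg_one_smul _ _))
    (fun x y => funext fun i => by
      refine (evalFun_add i x (-y)).trans ?_
      rw [sub_eq_add_neg]
      exact congrArg _ ((evalFun_smul i _ y).trans (neg_one_smul _ _)))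
    (fun x n => funext fun i => (evalFun_smul i _ x).trans (Nat.cast_smul_eq_nsmul K n _))
    (fun x n => funext fun i => (evalFun_smul i _ x).trans (Int.cast_smul_eq_zsmul K n _))

instance : Module K (FreeCarrier P V) :=
  Function.Injective.module K
    (AddMonoidHom.mk' (fun x (i : AlgUnder P V) => evalFun i x)
      (fun x y => funext fun i => evalFun_add i x y))
    (fun _ _ h => eq_of_evalFun (congrFun h)) (fun a x => funext fun i => evalFun_smul i a x)

/-- Evaluation as a linear map. -/
def eval (i : AlgUnder P V) : FreeCarrier P V →ₗ[K] i.alg.carrier where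
  toFun := evalFun i
  map_add' := evalFun_add i
  map_smul' := evalFun_smul i

theorem eval_mk (i : AlgUnder P V) (t : FreeTerm P V) : eval i (mk t) = t.eval i := evalFun_mk i t

theorem ext {x y : FreeCarrier P V} (h : ∀ i, eval i x = eval i y) : x = y := eq_of_evalFun h

theorem mk_add (s t : FreeTerm P V) : mk (.add s t) = mk s + mk t :=
  ext fun i => by rw [map_add, eval_mk, eval_mk, eval_mk]; rfl

theorem mk_smul (a : K) (t : FreeTerm P V) : mk (.smul a t) = a • mk t :=
  ext fun i => by rw [map_smul, eval_mk, eval_mk]; rfl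

/-- The operations of the free algebra. -/
def opM (n : ℕ) : P.obj (Fin n) →ₗ[K]
    MultilinearMap K (fun _ : Fin n => FreeCarrier P V) (FreeCarrier P V) where
  toFun μ :=
    { toFun := fun v => mk (.op n μ fun j => Quotient.out (v j))
      map_update_add' := fun v j x y => ext fun i => by
        have h : ∀ v : Fin n → FreeCarrier P V,
            eval i (mk (.op n μ fun j => Quotient.out (v j))) =
              i.alg.act n (μ ⊗ₜ[K] PiTensorProduct.tprod K (fun j => eval i (v j))) :=
          fun v => eval_mk i _
        rw [map_add, h, h, h]
        simp only [Function.apply_update (fun _ => eval i), map_add, MultilinearMap.map_update_add,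
          TensorProduct.tmul_add]
      map_update_smul' := fun v j a x => ext fun i => by
        have h : ∀ v : Fin n → FreeCarrier P V,
            eval i (mk (.op n μ fun j => Quotient.out (v j))) =
              i.alg.act n (μ ⊗ₜ[K] PiTensorProduct.tprod K (fun j => eval i (v j))) :=
          fun v => eval_mk i _
        rw [map_smul, h, h]
        simp only [Function.apply_update (fun _ => eval i), map_smul,
          MultilinearMap.map_update_smul, TensorProduct.tmul_smul] }
  map_add' μ ν := MultilinearMap.ext fun v => ext fun i => by
    rw [add_apply, map_add]
    refine (eval_mk i _).trans (Eq.trans ?_ (congrArg₂ (· + ·) (eval_mk i _) (eval_mk i _)).symm)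
    simp only [FreeTerm.eval, TensorProduct.add_tmul, map_add]
  map_smul' a μ := MultilinearMap.ext fun v => ext fun i => by
    rw [smul_apply, map_smul]
    refine (eval_mk i _).trans (Eq.trans ?_ (congrArg (a • ·) (eval_mk i _)).symm)
    simp only [FreeTerm.eval, ← TensorProduct.smul_tmul', map_smul]

theorem eval_opM (i : AlgUnder P V) {n : ℕ} (μ : P.obj (Fin n)) (v : Fin n → FreeCarrier P V) :
    eval i (opM n μ v) = i.alg.act n (μ ⊗ₜ[K] PiTensorProduct.tprod K (fun j => eval i (v j))) :=
  eval_mk i _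

theorem mk_op {n : ℕ} (μ : P.obj (Fin n)) (t : Fin n → FreeTerm P V) :
    mk (.op n μ t) = opM n μ (fun j => mk (t j)) :=
  ext fun i => by
    rw [eval_opM, eval_mk]
    simp only [eval_mk]
    rfl

/-- The homogeneous elements of degree `k`. -/
def gr (k : ℤ) : Submodule K (FreeCarrier P V) where
  carrier := {x | ∃ t : FreeTerm P V, t.IsHom k ∧ mk t = x}
  add_mem' := by
    rintro _ _ ⟨s, hs, rfl⟩ ⟨t, ht, rfl⟩
    exact ⟨_, .add k s t hs ht, mk_add s t⟩
  zero_mem' := ⟨_, .zero k, rfl⟩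
  smul_mem' := by
    rintro a _ ⟨t, ht, rfl⟩
    exact ⟨_, .smul k a t ht, mk_smul a t⟩

theorem opM_mem {n : ℕ} {p : ℤ} {e : Fin n → ℤ} {μ : P.obj (Fin n)} {v : Fin n → FreeCarrier P V}
    (hμ : μ ∈ (P.obj (Fin n)).gr p) (hv : ∀ j, v j ∈ gr (e j)) :
    opM n μ v ∈ gr (P := P) (V := V) (p + ∑ j, e j) := by
  choose t ht hv using hv
  exact ⟨_, .op n p e μ t hμ ht, by rw [mk_op]; simp only [hv]⟩

theorem mem_iSup_gr (x : FreeCarrier P V) : x ∈ ⨆ k, gr (P := P) (V := V) k := by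
  rw [← mk_out x]
  induction Quotient.out x with
  | gen c =>
    induction c using V.homogeneous_induction with
    | hom k c hc => exact Submodule.mem_iSup_of_mem k ⟨_, .gen k c hc, rfl⟩
    | add a b ha hb =>
      have : mk (.gen (a + b) : FreeTerm P V) = mk (.gen a) + mk (.gen b) := ext fun i => by
        rw [map_add, eval_mk, eval_mk, eval_mk]
        exact map_add i.map a b
      rw [this]
      exact Submodule.add_mem _ ha hb
  | op n μ t ih =>
    rw [mk_op]
    induction μ using GrMod.homogeneous_induction with
    | hom p μ hμ =>
      refine MultilinearMap.mem_of_mem_span (H := {x | ∃ k, x ∈ gr (P := P) (V := V) k}) _ _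
        (fun v hv => ?_) _ (fun j => ?_)
      · choose e he using hv
        exact Submodule.mem_iSup_of_mem _ (opM_mem hμ he)
      · refine (iSup_le fun k y hy => ?_ :
          (⨆ k, gr (P := P) (V := V) k) ≤ Submodule.span K {x | ∃ k, x ∈ gr (P := P) (V := V) k}) (ih j)
        exact Submodule.subset_span ⟨k, hy⟩
    | add μ ν hμ hν =>
      rw [map_add]
      exact Submodule.add_mem _ hμ hν
  | add s t hs ht => rw [mk_add]; exact Submodule.add_mem _ hs ht
  | smul a t ht => rw [mk_smul]; exact Submodule.smul_mem _ a ht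
  | zero => exact Submodule.zero_mem _

end FreeCarrier

variable (P V) in
/-- The graded vector space underlying the free algebra. -/
abbrev freeGrMod : GrMod K where
  carrier := FreeCarrier P V
  gr := FreeCarrier.gr
  internal := isInternal_of_coordinates (fun i : AlgUnder P V => i.alg.toGrMod)
    (fun i => FreeCarrier.eval i) (fun _ => 0)
    (fun i k x hx => by
      obtain ⟨t, ht, rfl⟩ := hx
      rw [FreeCarrier.eval_mk, add_zero]
      exact ht.eval_mem i)
    (fun x h => FreeCarrier.ext fun i => by rw [h i, map_zero]) FreeCarrier.mem_iSup_gr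

theorem FreeCarrier.eval_mem (i : AlgUnder P V) {k : ℤ} {x : FreeCarrier P V}
    (hx : x ∈ (freeGrMod P V).gr k) : eval i x ∈ i.alg.gr k := by
  obtain ⟨t, ht, rfl⟩ := hx
  rw [FreeCarrier.eval_mk]
  exact ht.eval_mem i

variable [CharZero K]

omit [CharZero K] in
theorem FreeCarrier.eval_act (i : AlgUnder P V) (n : ℕ)
    (t : P.obj (Fin n) ⊗[K] (⨂[K]^n (FreeCarrier P V))) :
    eval i (actOfMultilinear (opM n) t) = i.alg.act n (TensorProduct.map LinearMap.id
      (PiTensorProduct.map fun _ => eval i) t) := by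
  refine LinearMap.congr_fun (f := eval i ∘ₗ actOfMultilinear (opM n)) (g := i.alg.act n ∘ₗ
    TensorProduct.map LinearMap.id (PiTensorProduct.map fun _ => eval i))
    (tens_ext fun μ v => ?_) t
  simp only [LinearMap.comp_apply, actOfMultilinear_tprod, eval_opM, TensorProduct.map_tmul,
    PiTensorProduct.map_tprod]
  rfl

variable (P V) in
/-- The free `P`-algebra on `V`. -/
abbrev freeAlg : GrAlg P :=
  GrAlg.ofFamily (freeGrMod P V) (fun n => actOfMultilinear (FreeCarrier.opM n))
    (fun n k t ht => opGr_le (fun p e μ v h hμ hv => by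
      rw [actOfMultilinear_tprod, ← h]
      exact FreeCarrier.opM_mem hμ hv) ht)
    (fun i : AlgUnder P V => i.alg) (fun i => FreeCarrier.eval i)
    (fun i => by
      simpa using IsPar.of_degree (e := 0) (V := freeGrMod P V) (W := i.alg.toGrMod)
        (f := FreeCarrier.eval i) (fun k x hx => by
          rw [add_zero]; exact FreeCarrier.eval_mem i hx))
    (fun x y h => FreeCarrier.ext h) (fun i n t => FreeCarrier.eval_act i n t)

variable (P V) in
/-- The inclusion of the generators. -/
def freeι : V →ₗ[K] (freeAlg P V).carrier where
  toFun c := FreeCarrier.mk (.gen c)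
  map_add' a b := FreeCarrier.ext fun i => by
    rw [map_add, FreeCarrier.eval_mk, FreeCarrier.eval_mk, FreeCarrier.eval_mk]
    exact map_add i.map a b
  map_smul' r a := FreeCarrier.ext fun i => by
    rw [map_smul, FreeCarrier.eval_mk, FreeCarrier.eval_mk]
    exact map_smul i.map r a

theorem freeι_mem {k : ℤ} {c : V} (hc : c ∈ V.gr k) : freeι P V c ∈ (freeAlg P V).gr k :=
  ⟨_, .gen k c hc, rfl⟩

theorem freeAlg_induction (S : Submodule K (freeAlg P V).carrier) (gen : ∀ c, freeι P V c ∈ S)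
    (op : ∀ (n : ℕ) (μ : P.obj (Fin n)) (v : Fin n → (freeAlg P V).carrier), (∀ i, v i ∈ S) →
      (freeAlg P V).act n (μ ⊗ₜ[K] PiTensorProduct.tprod K v) ∈ S) (x : (freeAlg P V).carrier) :
    x ∈ S := by
  rw [← FreeCarrier.mk_out x]
  induction Quotient.out x with
  | gen c => exact gen c
  | op n μ t ih =>
    rw [FreeCarrier.mk_op, ← actOfMultilinear_tprod]
    exact op n μ _ ih
  | add s t hs ht => rw [FreeCarrier.mk_add]; exact S.add_mem hs ht
  | smul a t ht => rw [FreeCarrier.mk_smul]; exact S.smul_mem a ht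
  | zero => exact S.zero_mem

/-- The homomorphism from the free algebra given by its values on generators. -/
def freeLift (B : GrAlg P) (f : V →ₗ[K] B.carrier)
    (hf : ∀ (k : ℤ) (x : V), x ∈ V.gr k → f x ∈ B.gr k) : GrAlg.Hom (freeAlg P V) B where
  toLin := FreeCarrier.eval ⟨B, f, hf⟩
  map_mem _ _ hx := FreeCarrier.eval_mem ⟨B, f, hf⟩ hx
  map_act n t := FreeCarrier.eval_act ⟨B, f, hf⟩ n t

theorem freeLift_comp_ι (B : GrAlg P) (f : V →ₗ[K] B.carrier)
    (hf : ∀ (k : ℤ) (x : V), x ∈ V.gr k → f x ∈ B.gr k) :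
    (freeLift B f hf).toLin ∘ₗ freeι P V = f := by
  ext c
  exact FreeCarrier.eval_mk _ _

theorem freeAlg_hom_ext {B : GrAlg P} {g h : GrAlg.Hom (freeAlg P V) B}
    (hgh : g.toLin ∘ₗ freeι P V = h.toLin ∘ₗ freeι P V) : g = h := by
  have : g.toLin = h.toLin := by
    ext x
    refine freeAlg_induction (LinearMap.eqLocus g.toLin h.toLin) (LinearMap.congr_fun hgh)
      (fun n μ v hv => ?_) x
    rw [LinearMap.mem_eqLocus, g.map_act, h.map_act, TensorProduct.map_tmul, TensorProduct.map_tmul,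
      PiTensorProduct.map_tprod, PiTensorProduct.map_tprod]
    congr 3
    ext i
    exact hv i
  cases g; cases h; congr

end Free

/-! ### Derivations as homomorphisms and the cobar construction -/

section Cobar

variable {P : Operad K}

/-- The composite of two morphisms of graded algebras. -/
def GrAlg.Hom.comp {A B D : GrAlg P} (g : GrAlg.Hom B D) (f : GrAlg.Hom A B) : GrAlg.Hom A D where
  toLin := g.toLin ∘ₗ f.toLin
  map_mem k x hx := g.map_mem k _ (f.map_mem k x hx)
  map_act n t := by
    rw [LinearMap.comp_apply, f.map_act, g.map_act, TensorProduct.map_map,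
      ← PiTensorProduct.map_comp, LinearMap.id_comp]

/-- The identity morphism of a graded algebra. -/
def GrAlg.Hom.id (A : GrAlg P) : GrAlg.Hom A A where
  toLin := LinearMap.id
  map_mem _ _ h := h
  map_act n t := by simp [PiTensorProduct.map_id]

theorem GrAlg.Hom.isPar {A B : GrAlg P} (g : GrAlg.Hom A B) : IsPar A.toGrMod B.toGrMod 0 g.toLin := by
  simpa using IsPar.of_degree (e := 0) (f := g.toLin) (fun k x hx => by
    rw [add_zero]; exact g.map_mem k x hx)

variable [CharZero K]

/-- The projection `a + ε b ↦ a`. -/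
def epsFstHom (A : GrAlg P) (e : ℤ) (he : Odd e) (c : K) (hc : c ≠ 0 → e = 1) :
    GrAlg.Hom (A.eps e he c hc) A where
  toLin := epsFst A.toGrMod e
  map_mem _ _ hx := (mem_eps.1 hx).1
  map_act n t := fst_epsAct A e c n t

/-- A derivation `d` gives the homomorphism `x ↦ x + ε d x`. -/
def DerAlg.toEps (A : DerAlg P) :
    GrAlg.Hom A.toGrAlg (A.toGrAlg.eps 1 odd_one 1 (fun _ => rfl)) where
  toLin := epsInl A.toGrMod 1 + epsInr A.toGrMod 1 ∘ₗ A.d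
  map_mem k x hx := by
    refine mem_eps.2 ⟨?_, ?_⟩
    · simpa using hx
    · simpa using A.d_mem k x hx
  map_act n t := by
    have h1 : ∀ x, epsFst A.toGrMod 1 ((epsInl A.toGrMod 1 + epsInr A.toGrMod 1 ∘ₗ A.d) x) = x :=
      fun x => by simp
    have h2 : ∀ x, epsSnd A.toGrMod 1 ((epsInl A.toGrMod 1 + epsInr A.toGrMod 1 ∘ₗ A.d) x) = A.d x :=
      fun x => by simp
    refine eps_ext ?_ ?_
    · rw [h1, fst_epsAct, TensorProduct.map_map, ← PiTensorProduct.map_comp, LinearMap.id_comp]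
      have : epsFst A.toGrMod 1 ∘ₗ (epsInl A.toGrMod 1 + epsInr A.toGrMod 1 ∘ₗ A.d) = LinearMap.id :=
        LinearMap.ext h1
      simp only [this, PiTensorProduct.map_id, TensorProduct.map_id, LinearMap.id_apply]
    · rw [h2, snd_epsAct, TensorProduct.map_map, TensorProduct.map_map, insSum_comp,
        ← PiTensorProduct.map_comp, one_smul, A.act_d]
      have e1 : epsFst A.toGrMod 1 ∘ₗ (epsInl A.toGrMod 1 + epsInr A.toGrMod 1 ∘ₗ A.d) = LinearMap.id :=
        LinearMap.ext h1
      have e2 : epsSnd A.toGrMod 1 ∘ₗ (epsInl A.toGrMod 1 + epsInr A.toGrMod 1 ∘ₗ A.d) = A.d :=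
        LinearMap.ext h2
      simp only [LinearMap.comp_assoc, e1, e2, PiTensorProduct.map_id, LinearMap.comp_id]

/-- The homomorphism `A + ε A → B + ε B` induced by a homomorphism `A → B`. -/
def GrAlg.Hom.eps {A B : GrAlg P} (g : GrAlg.Hom A B) (e : ℤ) (he : Odd e) (c : K)
    (hc : c ≠ 0 → e = 1) : GrAlg.Hom (A.eps e he c hc) (B.eps e he c hc) where
  toLin := epsInl B.toGrMod e ∘ₗ g.toLin ∘ₗ epsFst A.toGrMod e +
    epsInr B.toGrMod e ∘ₗ g.toLin ∘ₗ epsSnd A.toGrMod e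
  map_mem k x hx := by
    refine mem_eps.2 ⟨?_, ?_⟩
    · simpa using g.map_mem _ _ (mem_eps.1 hx).1
    · simpa using g.map_mem _ _ (mem_eps.1 hx).2
  map_act n t := by
    set G : A.toGrMod.eps e →ₗ[K] B.toGrMod.eps e := epsInl B.toGrMod e ∘ₗ g.toLin ∘ₗ epsFst A.toGrMod e +
      epsInr B.toGrMod e ∘ₗ g.toLin ∘ₗ epsSnd A.toGrMod e with hG
    have e1 : epsFst B.toGrMod e ∘ₗ G = g.toLin ∘ₗ epsFst A.toGrMod e := LinearMap.ext fun x => by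
      simp [hG]
    have e2 : epsSnd B.toGrMod e ∘ₗ G = g.toLin ∘ₗ epsSnd A.toGrMod e := LinearMap.ext fun x => by
      simp [hG]
    have h1 := fun x => LinearMap.congr_fun e1 x
    have h2 := fun x => LinearMap.congr_fun e2 x
    simp only [LinearMap.comp_apply] at h1 h2
    refine eps_ext ?_ ?_
    · rw [h1, fst_epsAct, fst_epsAct, g.map_act, TensorProduct.map_map, TensorProduct.map_map,
        ← PiTensorProduct.map_comp, ← PiTensorProduct.map_comp]
      simp only [e1]
    · rw [h2, snd_epsAct, snd_epsAct, map_add, map_smul, g.map_act, g.map_act, TensorProduct.map_map,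
        TensorProduct.map_map, TensorProduct.map_map, TensorProduct.map_map, insSum_comp,
        comp_insSum, ← PiTensorProduct.map_comp, ← PiTensorProduct.map_comp]
      have e3 : B.sgn ∘ₗ g.toLin = g.toLin ∘ₗ A.sgn := by
        simpa using g.isPar.sgn_comp
      simp only [e1, e2, LinearMap.comp_assoc, LinearMap.id_comp, LinearMap.comp_id]
      rw [← LinearMap.comp_assoc (epsFst A.toGrMod e) A.sgn, ← e3, LinearMap.comp_assoc]

omit [CharZero K] in
theorem epsFst_pair {U : Type u} [AddCommGroup U] [Module K U] (W : GrMod K) (e : ℤ)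
    (f g : U →ₗ[K] W) (x : U) :
    epsFst W e ((epsInl W e ∘ₗ f + epsInr W e ∘ₗ g) x) = f x := by
  simp

omit [CharZero K] in
theorem epsSnd_pair {U : Type u} [AddCommGroup U] [Module K U] (W : GrMod K) (e : ℤ)
    (f g : U →ₗ[K] W) (x : U) :
    epsSnd W e ((epsInl W e ∘ₗ f + epsInr W e ∘ₗ g) x) = g x := by
  simp

/-- The derivation of the free algebra with given values on the generators. -/
def freeDer {V : GrMod K} (δ : V →ₗ[K] (freeAlg P V).carrier)
    (hδ : ∀ (k : ℤ) (x : V), x ∈ V.gr k → δ x ∈ (freeAlg P V).gr (k - 1)) : DerAlg P :=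
  have h : ∀ (k : ℤ) (x : V), x ∈ V.gr k → (epsInl (freeAlg P V).toGrMod 1 ∘ₗ freeι P V +
      epsInr (freeAlg P V).toGrMod 1 ∘ₗ δ) x ∈ ((freeAlg P V).toGrMod.eps 1).gr k := fun k x hx => by
    refine mem_eps.2 ⟨?_, ?_⟩
    · rw [epsFst_pair]
      exact freeι_mem hx
    · rw [epsSnd_pair]
      exact hδ k x hx
  let g := freeLift ((freeAlg P V).eps 1 odd_one 1 (fun _ => rfl)) _ h
  have hg : epsFst (freeAlg P V).toGrMod 1 ∘ₗ g.toLin = LinearMap.id := by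
    have : GrAlg.Hom.comp (epsFstHom (freeAlg P V) 1 odd_one 1 (fun _ => rfl)) g =
        GrAlg.Hom.id (freeAlg P V) := by
      refine freeAlg_hom_ext ?_
      change epsFst (freeAlg P V).toGrMod 1 ∘ₗ (g.toLin ∘ₗ freeι P V) = freeι P V
      rw [freeLift_comp_ι]
      exact LinearMap.ext fun x => epsFst_pair _ _ _ _ _
    exact congrArg GrAlg.Hom.toLin this
  { toGrAlg := freeAlg P V
    d := epsSnd (freeAlg P V).toGrMod 1 ∘ₗ g.toLin
    d_mem := fun k x hx => (mem_eps.1 (g.map_mem k x hx)).2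
    act_d := fun n t => by
      rw [LinearMap.comp_apply, g.map_act, snd_epsAct, TensorProduct.map_map, TensorProduct.map_map,
        insSum_comp, ← PiTensorProduct.map_comp, one_smul]
      simp only [LinearMap.comp_assoc, hg, PiTensorProduct.map_id, LinearMap.comp_id] }

theorem freeDer_ι {V : GrMod K} (δ : V →ₗ[K] (freeAlg P V).carrier)
    (hδ : ∀ (k : ℤ) (x : V), x ∈ V.gr k → δ x ∈ (freeAlg P V).gr (k - 1)) (c : V) :
    (freeDer δ hδ).d (freeι P V c) = δ c := by
  have h : ∀ (k : ℤ) (x : V), x ∈ V.gr k → (epsInl (freeAlg P V).toGrMod 1 ∘ₗ freeι P V +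
      epsInr (freeAlg P V).toGrMod 1 ∘ₗ δ) x ∈ ((freeAlg P V).toGrMod.eps 1).gr k := fun k x hx => by
    refine mem_eps.2 ⟨?_, ?_⟩
    · rw [epsFst_pair]
      exact freeι_mem hx
    · rw [epsSnd_pair]
      exact hδ k x hx
  have := LinearMap.congr_fun (freeLift_comp_ι ((freeAlg P V).eps 1 odd_one 1 (fun _ => rfl)) _ h) c
  change epsSnd (freeAlg P V).toGrMod 1
    ((freeLift ((freeAlg P V).eps 1 odd_one 1 (fun _ => rfl)) _ h).toLin (freeι P V c)) = _
  rw [LinearMap.comp_apply] at this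
  rw [this]
  exact epsSnd_pair _ _ _ _ _

/-- If the square of the derivation of `A` vanishes on the inputs of an operation, it vanishes on
its value. -/
theorem DerAlg.d_d_act (A : DerAlg P) {n : ℕ} (μ : P.obj (Fin n)) (v : Fin n → A.carrier)
    (hv : ∀ i, A.d (A.d (v i)) = 0) :
    A.d (A.d (A.act n (μ ⊗ₜ[K] PiTensorProduct.tprod K v))) = 0 := by
  have hsd : (P.obj (Fin n)).d ((P.obj (Fin n)).sgn μ) = - (P.obj (Fin n)).sgn ((P.obj (Fin n)).d μ) := by
    have := (P.obj (Fin n)).isPar_d μ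
    rw [this]; simp
  have h0 := insSum_insSum_tprod (IsPar.id (V := A.toGrMod)) A.isPar_d A.isPar_d v (fun _ => rfl)
    (fun i => by rw [hv]; simp)
  rw [LinearMap.comp_id] at h0
  have h1 : insSum A.sgn A.d LinearMap.id n (insSum A.sgn A.d LinearMap.id n
      (PiTensorProduct.tprod K v)) = 0 := by
    have h2 : (2 : K) ≠ 0 := two_ne_zero
    refine smul_right_injective _ h2 ?_
    beta_reduce
    rw [smul_zero, two_smul]
    nth_rw 2 [h0]
    rw [neg_one_smul, add_neg_cancel]
  rw [A.act_d, map_add, A.act_d, A.act_d]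
  simp only [TensorProduct.map_tmul, LinearMap.id_apply, h1, TensorProduct.tmul_zero, map_zero,
    add_zero, (P.obj (Fin n)).d_d, TensorProduct.zero_tmul, zero_add, hsd, TensorProduct.neg_tmul,
    map_neg, add_neg_cancel]

/-- An algebra with a derivation of square zero. -/
abbrev DerAlg.toDGAlg (A : DerAlg P) (h : ∀ x, A.d (A.d x) = 0) : DGAlg P where
  toGrAlg := A.toGrAlg
  d := A.d
  d_mem := A.d_mem
  d_d := h
  act_d n t := by
    rw [A.act_d, opD, LinearMap.add_apply, map_add]
    rfl

variable {𝒞 : Cooperad K} (τ : TwistingMorphism 𝒞 P) (C : Coalg 𝒞)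

omit [CharZero K] in
theorem mcOp_mem (A : GrAlg P) {φ : C.carrier →ₗ[K] A.carrier}
    (hφ : ∀ k, ∀ x ∈ C.gr k, φ x ∈ A.gr k) (k : ℤ) (x : C.carrier) (hx : x ∈ C.gr k) :
    mcOp τ C A φ x ∈ A.gr (k - 1) := by
  obtain ⟨r, hr⟩ := C.exists_mem_coradical x
  rw [mcOp_eq_sum τ C A φ hr (Nat.lt_succ_self r)]
  refine Submodule.sum_mem _ fun n _ => Submodule.smul_mem _ _ (A.act_mem n _ _ ?_)
  refine opGr_le (fun p q m v h hm hv => ?_) (C.Δ_mem n k x hx)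
  rw [TensorProduct.map_tmul, PiTensorProduct.map_tprod]
  exact tmul_mem_opGr (e := q) (by omega) (τ.degree _ _ _ hm) (fun j => hφ _ _ (hv j))

omit [CharZero K] in
theorem mcOp_comp_hom {A B : GrAlg P} (g : A.carrier →ₗ[K] B.carrier)
    (hact : ∀ (n : ℕ) (t : P.obj (Fin n) ⊗[K] (⨂[K]^n A.carrier)), g (A.act n t) =
      B.act n (TensorProduct.map LinearMap.id (PiTensorProduct.map (fun _ => g)) t))
    (φ : C.carrier →ₗ[K] A.carrier) :
    mcOp τ C B (g ∘ₗ φ) = g ∘ₗ mcOp τ C A φ := by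
  ext x
  obtain ⟨r, hr⟩ := C.exists_mem_coradical x
  rw [LinearMap.comp_apply, mcOp_eq_sum τ C A φ hr (Nat.lt_succ_self r),
    mcOp_eq_sum τ C B _ hr (Nat.lt_succ_self r), map_sum]
  refine Finset.sum_congr rfl fun n _ => ?_
  rw [map_smul, hact, TensorProduct.map_map, ← PiTensorProduct.map_comp, LinearMap.id_comp]

omit [CharZero K] in
theorem curv_comp_hom {A B : DerAlg P} (g : A.carrier →ₗ[K] B.carrier)
    (hd : ∀ x, g (A.d x) = B.d (g x))
    (hact : ∀ (n : ℕ) (t : P.obj (Fin n) ⊗[K] (⨂[K]^n A.carrier)), g (A.act n t) =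
      B.act n (TensorProduct.map LinearMap.id (PiTensorProduct.map (fun _ => g)) t))
    (φ : C.carrier →ₗ[K] A.carrier) : curv τ C B (g ∘ₗ φ) = g ∘ₗ curv τ C A φ := by
  rw [curv, mcOp_comp_hom τ C g hact]
  ext x
  simp [curv, hd]

omit [CharZero K] in
theorem isPar_of_degree_zero {V W : GrMod K} {φ : V →ₗ[K] W}
    (hφ : ∀ k, ∀ x ∈ V.gr k, φ x ∈ W.gr k) : IsPar V W 0 φ := by
  simpa using IsPar.of_degree (e := 0) (f := φ) (fun k x hx => by
    rw [add_zero]; exact hφ k x hx)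

/-- If the curvature of `φ` vanishes, then the Bianchi identity leaves only the square of the
derivation of the target. -/
theorem d_d_eq_zero_of_curv_eq_zero (hP : P.IsConnected) (A : DerAlg P)
    {φ : C.carrier →ₗ[K] A.carrier} (hφ : IsPar C.toGrMod A.toGrMod 0 φ) (h : curv τ C A φ = 0)
    (c : C.carrier) : A.d (A.d (φ c)) = 0 := by
  obtain ⟨r, hr⟩ := C.exists_mem_coradical c
  rw [← bianchi τ C hP A hφ (N := r + 2) (by omega) hr, h]
  refine Finset.sum_eq_zero fun j _ => ?_
  rw [convL_eq_zero τ C A 0 (fun x _ => by rw [Fin.cons_zero]; rfl) hr, smul_zero]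

/-- The derivation of the cobar construction. -/
def cobarDer : DerAlg P :=
  freeDer (freeι P C.toGrMod ∘ₗ C.d - mcOp τ C (freeAlg P C.toGrMod) (freeι P C.toGrMod))
    (fun k x hx => Submodule.sub_mem _ (freeι_mem (C.d_mem k x hx))
      (mcOp_mem τ C _ (fun _ _ hx => freeι_mem hx) k x hx))

theorem cobarDer_ι (c : C.carrier) : (cobarDer τ C).d (freeι P C.toGrMod c) =
    freeι P C.toGrMod (C.d c) - mcOp τ C (freeAlg P C.toGrMod) (freeι P C.toGrMod) c :=
  freeDer_ι _ _ c

/-- The generators have curvature `0` by the formula for the differential on generators, so the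
differential squares to zero on them; its square is a derivation, hence zero everywhere. -/
theorem cobarDer_d_d (hP : P.IsConnected) (x : (cobarDer τ C).carrier) :
    (cobarDer τ C).d ((cobarDer τ C).d x) = 0 := by
  have hpar : IsPar C.toGrMod (freeAlg P C.toGrMod).toGrMod 0 (freeι P C.toGrMod) :=
    isPar_of_degree_zero fun _ _ hx => freeι_mem hx
  refine freeAlg_induction (P := P) (V := C.toGrMod)
    (LinearMap.ker ((cobarDer τ C).d ∘ₗ (cobarDer τ C).d)) (fun c => ?_) (fun n μ v hv => ?_) x
  · refine d_d_eq_zero_of_curv_eq_zero τ C hP (cobarDer τ C) hpar ?_ c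
    ext c
    have key : ∀ a b c' : (freeAlg P C.toGrMod).carrier, a = b - c' → a - b + c' = 0 := by
      rintro _ b c' rfl
      abel
    exact key _ _ _ (cobarDer_ι τ C c)
  · exact (cobarDer τ C).d_d_act μ v hv

/-- The cobar construction. -/
def cobar (hP : P.IsConnected) : CobarConstruction τ C where
  alg := (cobarDer τ C).toDGAlg (cobarDer_d_d τ C hP)
  ι := freeι P C.toGrMod
  ι_mem _ _ hx := freeι_mem hx
  free B f hf := ⟨freeLift B f hf, freeLift_comp_ι B f hf, fun _ hg =>
    freeAlg_hom_ext (hg.trans (freeLift_comp_ι B f hf).symm)⟩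
  d_ι c := cobarDer_ι τ C c

/-! ### Maps out of the cobar construction -/

variable {τ C}

omit [CharZero K] in
theorem CobarConstruction.curv_ι (Ω : CobarConstruction τ C) :
    curv τ C Ω.alg.toDerAlg Ω.ι = 0 := by
  ext c
  change Ω.alg.d (Ω.ι c) - Ω.ι (C.d c) + mcOperator τ C Ω.alg Ω.ι c = 0
  rw [Ω.d_ι]
  abel

theorem CobarConstruction.isMaurerCartan_comp (hP : P.IsConnected) (Ω : CobarConstruction τ C)
    {A : DGAlg P} (f : DGAlg.Hom Ω.alg A) :
    IsMaurerCartan (convLInfty τ C A) (f.toLin ∘ₗ Ω.ι) := by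
  rw [isMaurerCartan_iff τ C hP]
  refine ⟨fun k x hx => f.map_mem k _ (Ω.ι_mem k x hx), ?_⟩
  rw [curv_comp_hom τ C (A := Ω.alg.toDerAlg) (B := A.toDerAlg) f.toLin f.map_d f.map_act, Ω.curv_ι,
    LinearMap.comp_zero]

/-- A map of degree `0` extends uniquely to the free algebra; the extension commutes with the
differentials if it does so on generators, which says that the curvature vanishes. -/
theorem CobarConstruction.existsUnique_hom (hP : P.IsConnected) (Ω : CobarConstruction τ C)
    {A : DGAlg P} {φ : C.carrier →ₗ[K] A.carrier} (hφ : IsMaurerCartan (convLInfty τ C A) φ) :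
    ∃! f : DGAlg.Hom Ω.alg A, f.toLin ∘ₗ Ω.ι = φ := by
  rw [isMaurerCartan_iff τ C hP] at hφ
  obtain ⟨hdeg, hcurv⟩ := hφ
  obtain ⟨g, hg, huniq⟩ := Ω.free A.toGrAlg φ hdeg
  -- both `x ↦ g x + ε d (g x)` and `x ↦ g x + ε g (d x)` are homomorphisms
  set h₁ := GrAlg.Hom.comp A.toDerAlg.toEps g with hh₁
  set h₂ := GrAlg.Hom.comp (g.eps 1 odd_one 1 (fun _ => rfl)) Ω.alg.toDerAlg.toEps with hh₂
  have hg' : ∀ c, g.toLin (Ω.ι c) = φ c := LinearMap.congr_fun hg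
  have hdι : ∀ c, A.d (g.toLin (Ω.ι c)) = g.toLin (Ω.alg.d (Ω.ι c)) := fun c => by
    have h3 := LinearMap.congr_fun (mcOp_comp_hom τ C (A := Ω.alg.toGrAlg) (B := A.toGrAlg) g.toLin
      g.map_act Ω.ι) c
    have h4 : A.d (φ c) - φ (C.d c) + mcOp τ C A.toGrAlg φ c = 0 := LinearMap.congr_fun hcurv c
    rw [hg, LinearMap.comp_apply] at h3
    rw [Ω.d_ι, map_sub, hg', hg']
    change _ = _ - g.toLin (mcOp τ C Ω.alg.toGrAlg Ω.ι c)
    rw [← h3, eq_sub_iff_add_eq, ← sub_eq_zero, ← h4]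
    abel
  have h12 : h₁ = h₂ := by
    refine (Ω.free (A.toGrAlg.eps 1 odd_one 1 (fun _ => rfl)) (h₁.toLin ∘ₗ Ω.ι)
      (fun k x hx => h₁.map_mem k _ (Ω.ι_mem k x hx))).unique rfl ?_
    ext c
    refine eps_ext ?_ ?_
    · simp [hh₁, hh₂, GrAlg.Hom.comp, DerAlg.toEps, GrAlg.Hom.eps]
    · simp [hh₁, hh₂, GrAlg.Hom.comp, DerAlg.toEps, GrAlg.Hom.eps, hdι]
  refine ⟨⟨g.toLin, g.map_mem, fun x => ?_, g.map_act⟩, hg, fun f hf => ?_⟩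
  · have := congrArg (epsSnd A.toGrMod 1) (LinearMap.congr_fun (congrArg GrAlg.Hom.toLin h12) x)
    simp only [hh₁, hh₂, GrAlg.Hom.comp, DerAlg.toEps, GrAlg.Hom.eps, LinearMap.comp_apply,
      LinearMap.add_apply, map_add, epsSnd_inl, epsSnd_inr, epsFst_inl, epsFst_inr, zero_add,
      map_zero, add_zero] at this
    exact this.symm
  · have := huniq ⟨f.toLin, f.map_mem, f.map_act⟩ hf
    ext x
    exact LinearMap.congr_fun (congrArg GrAlg.Hom.toLin this) x

end Cobar

/-! ### Homogeneous components -/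

section Homogeneous

/-- The linear map which is `f k` on the part of degree `k`. -/
def GrMod.gather (V : GrMod K) {W : Type*} [AddCommGroup W] [Module K W] (f : ℤ → V →ₗ[K] W) :
    V →ₗ[K] W :=
  DirectSum.toModule K ℤ W (fun k => f k ∘ₗ (V.gr k).subtype) ∘ₗ
    (LinearEquiv.ofBijective (DirectSum.coeLinearMap V.gr) V.bijective_coeLinearMap).symm.toLinearMap

theorem GrMod.gather_of_mem (V : GrMod K) {W : Type*} [AddCommGroup W] [Module K W]
    (f : ℤ → V →ₗ[K] W) {k : ℤ} {x : V} (hx : x ∈ V.gr k) : V.gather f x = f k x := by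
  have : (LinearEquiv.ofBijective (DirectSum.coeLinearMap V.gr) V.bijective_coeLinearMap).symm x
      = DirectSum.lof K ℤ (fun k => V.gr k) k ⟨x, hx⟩ := by
    rw [LinearEquiv.symm_apply_eq]
    simp
  rw [gather, LinearMap.comp_apply, LinearEquiv.coe_coe, this, DirectSum.toModule_lof]
  rfl

/-- The component of degree `k`. -/
def GrMod.proj (V : GrMod K) (k : ℤ) : V →ₗ[K] V :=
  V.gather fun j => if j = k then LinearMap.id else 0

theorem GrMod.proj_of_mem (V : GrMod K) (k : ℤ) {j : ℤ} {x : V} (hx : x ∈ V.gr j) :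
    V.proj k x = if j = k then x else 0 := by
  rw [proj, V.gather_of_mem _ hx]
  split_ifs <;> rfl

theorem GrMod.proj_mem (V : GrMod K) (k : ℤ) (x : V) : V.proj k x ∈ V.gr k := by
  induction x using V.homogeneous_induction with
  | hom j x hx =>
    rw [V.proj_of_mem k hx]
    split_ifs with h
    · exact h ▸ hx
    · exact Submodule.zero_mem _
  | add x y hx hy => rw [map_add]; exact Submodule.add_mem _ hx hy

theorem proj_comp_of_degree {V W : GrMod K} {f : V →ₗ[K] W} {s : ℤ}
    (hf : ∀ k, ∀ x ∈ V.gr k, f x ∈ W.gr (k + s)) (k : ℤ) (x : V) :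
    W.proj (k + s) (f x) = f (V.proj k x) := by
  induction x using V.homogeneous_induction with
  | hom j x hx =>
    rw [W.proj_of_mem _ (hf j x hx), V.proj_of_mem k hx]
    by_cases h : j = k
    · simp [h]
    · simp [h]
  | add x y hx hy => rw [map_add, map_add, map_add, map_add, hx, hy]

end Homogeneous

/-! ### Polynomials with coefficients in an algebra -/

section Poly

/-- `V ⊗ K[t]`. -/
def GrMod.poly (V : GrMod K) : GrMod K where
  carrier := ℕ →₀ V
  gr k := ⨅ m, (V.gr k).comap (Finsupp.lapply m)
  internal := by
    refine isInternal_of_coordinates (ι := ℕ) (fun _ => V) (fun m => Finsupp.lapply m) (fun _ => 0)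
      (fun m k x hx => ?_) (fun x hx => Finsupp.ext hx) fun x => ?_
    · rw [add_zero]; exact (Submodule.mem_iInf _).1 hx m
    · induction x using Finsupp.induction_linear with
      | zero => exact Submodule.zero_mem _
      | add x y hx hy => exact Submodule.add_mem _ hx hy
      | single m a =>
        induction a using V.homogeneous_induction with
        | hom k a ha =>
          refine Submodule.mem_iSup_of_mem k ((Submodule.mem_iInf _).2 fun j => ?_)
          simp only [Submodule.mem_comap, Finsupp.lapply_apply, Finsupp.single_apply]
          split_ifs
          exacts [ha, Submodule.zero_mem _]
        | add x y hx hy => rw [Finsupp.single_add]; exact Submodule.add_mem _ hx hy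

/-- The coefficient of `tᵐ`. -/
def polyCoef (V : GrMod K) (m : ℕ) : V.poly →ₗ[K] V := Finsupp.lapply m

/-- `a ↦ a tᵐ`. -/
def polySingle (V : GrMod K) (m : ℕ) : V →ₗ[K] V.poly := Finsupp.lsingle m

/-- The value at `t = s`. -/
def polyEv (V : GrMod K) (s : K) : V.poly →ₗ[K] V :=
  Finsupp.lsum K fun m => (s ^ m) • (LinearMap.id : V →ₗ[K] V)

/-- Application of a linear map to the coefficients. -/
def polyMap {V W : GrMod K} (f : V →ₗ[K] W) : V.poly →ₗ[K] W.poly := Finsupp.mapRange.linearMap f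

/-- The derivative `d / dt`. -/
def polyDer (V : GrMod K) : V.poly →ₗ[K] V.poly :=
  Finsupp.lsum K fun m => (m : K) • (Finsupp.lsingle (m - 1) : V →ₗ[K] ℕ →₀ V)

section

variable {V W : GrMod K}

theorem poly_ext {x y : V.poly} (h : ∀ m, polyCoef V m x = polyCoef V m y) : x = y := Finsupp.ext h

theorem poly_hom_ext {X : Type*} [AddCommGroup X] [Module K X] {f g : V.poly →ₗ[K] X}
    (h : ∀ m a, f (polySingle V m a) = g (polySingle V m a)) : f = g :=
  LinearMap.ext fun x => by
    have : ∀ x : ℕ →₀ V, f x = g x := fun x => by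
      induction x using Finsupp.induction_linear with
      | zero => exact (map_zero f).trans (map_zero g).symm
      | add y z hy hz => exact ((map_add f y z).trans (congrArg₂ _ hy hz)).trans (map_add g y z).symm
      | single m a => exact h m a
    exact this x

theorem mem_poly {k : ℤ} {x : V.poly} : x ∈ V.poly.gr k ↔ ∀ m, polyCoef V m x ∈ V.gr k :=
  Submodule.mem_iInf (R := K) (M := ℕ →₀ V) (fun m => (V.gr k).comap (Finsupp.lapply m))

theorem exists_polyCoef_eq_zero (x : V.poly) : ∃ N, ∀ m, N ≤ m → polyCoef V m x = 0 := by
  refine ⟨Finset.sup (Finsupp.support x) id + 1, fun m hm => ?_⟩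
  by_contra h
  have := Finset.le_sup (f := id) (Finsupp.mem_support_iff.2 h)
  simp only [id_eq] at this
  omega

theorem polyCoef_single (m j : ℕ) (a : V) :
    polyCoef V m (polySingle V j a) = if j = m then a else 0 := Finsupp.single_apply

@[simp] theorem polyEv_single (s : K) (m : ℕ) (a : V) :
    polyEv V s (polySingle V m a) = s ^ m • a := by
  exact Finsupp.lsum_single K _ m a

theorem polyEv_zero (x : V.poly) : polyEv V 0 x = polyCoef V 0 x := by
  refine LinearMap.congr_fun (poly_hom_ext fun m a => ?_) x
  rw [polyEv_single, polyCoef_single]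
  by_cases h : m = 0 <;> simp [h]

theorem polyEv_one (x : V.poly) {N : ℕ} (h : ∀ m, N ≤ m → polyCoef V m x = 0) :
    polyEv V 1 x = ∑ m ∈ Finset.range N, polyCoef V m x := by
  have h1 : polyEv V 1 x = ∑ m ∈ Finsupp.support x, (1 : K) ^ m • polyCoef V m x := rfl
  simp only [one_pow, one_smul] at h1
  rw [h1]
  refine Finset.sum_subset (fun m hm => ?_) fun m _ hm => Finsupp.notMem_support_iff.1 hm
  by_contra h'
  exact (Finsupp.mem_support_iff.1 hm) (h m (by simpa using h'))

@[simp] theorem polyMap_single (f : V →ₗ[K] W) (m : ℕ) (a : V) :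
    polyMap f (polySingle V m a) = polySingle W m (f a) := by
  exact Finsupp.mapRange_single (hf := map_zero f)

@[simp] theorem polyCoef_map (f : V →ₗ[K] W) (m : ℕ) (x : V.poly) :
    polyCoef W m (polyMap f x) = f (polyCoef V m x) := rfl

theorem polyEv_map (f : V →ₗ[K] W) (s : K) (x : V.poly) :
    polyEv W s (polyMap f x) = f (polyEv V s x) := by
  refine LinearMap.congr_fun (f := polyEv W s ∘ₗ polyMap f) (g := f ∘ₗ polyEv V s)
    (poly_hom_ext fun m a => ?_) x
  simp

theorem polyDer_single (m : ℕ) (a : V) :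
    polyDer V (polySingle V m a) = (m : K) • polySingle V (m - 1) a := by
  exact Finsupp.lsum_single K _ m a

theorem polyCoef_der (m : ℕ) (x : V.poly) :
    polyCoef V m (polyDer V x) = (m + 1 : K) • polyCoef V (m + 1) x := by
  refine LinearMap.congr_fun (f := polyCoef V m ∘ₗ polyDer V)
    (g := (m + 1 : K) • polyCoef V (m + 1)) (poly_hom_ext fun j a => ?_) x
  rw [LinearMap.comp_apply, LinearMap.smul_apply, polyDer_single, map_smul, polyCoef_single,
    polyCoef_single]
  rcases j with _ | j
  · simp
  · by_cases h : j = m <;> simp [h]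

theorem polyEv_mem (s : K) {k : ℤ} {x : V.poly} (hx : x ∈ V.poly.gr k) : polyEv V s x ∈ V.gr k :=
  Submodule.sum_mem _ fun m _ => Submodule.smul_mem _ _ (mem_poly.1 hx m)

theorem polySingle_mem (m : ℕ) {k : ℤ} {a : V} (ha : a ∈ V.gr k) :
    polySingle V m a ∈ V.poly.gr k := mem_poly.2 fun j => by
  rw [polyCoef_single]
  split_ifs
  exacts [ha, Submodule.zero_mem _]

theorem polyCoef_sgn (m : ℕ) (x : V.poly) : polyCoef V m (V.poly.sgn x) = V.sgn (polyCoef V m x) := by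
  have := isPar_of_degree_zero (V := V.poly) (W := V) (φ := polyCoef V m)
    (fun k x hx => mem_poly.1 hx m) x
  rw [this, psgn_zero, one_smul]

theorem sgn_polySingle (m : ℕ) (a : V) : V.poly.sgn (polySingle V m a) = polySingle V m (V.sgn a) :=
  poly_ext fun j => by
    rw [polyCoef_sgn, polyCoef_single, polyCoef_single]
    split_ifs <;> simp

/-- A polynomial over an infinite field is determined by its values. -/
theorem polyEv_injective [CharZero K] {x y : V.poly} (h : ∀ s, polyEv V s x = polyEv V s y) :
    x = y := by
  refine poly_ext fun m => ?_
  rw [← sub_eq_zero, ← map_sub, ← Module.forall_dual_apply_eq_zero_iff K]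
  intro φ
  set p : Polynomial K := ∑ j ∈ (x - y : ℕ →₀ V).support,
    Polynomial.monomial j (φ (polyCoef V j (x - y))) with hp
  have hp0 : p = 0 := Polynomial.funext fun s => by
    have h1 : polyEv V s (x - y) = 0 := by rw [map_sub, h, sub_self]
    have h2 : polyEv V s (x - y) = ∑ j ∈ (x - y : ℕ →₀ V).support, s ^ j • polyCoef V j (x - y) := rfl
    rw [hp, Polynomial.eval_finsetSum, Polynomial.eval_zero, ← map_zero φ, ← h1, h2, map_sum]
    refine Finset.sum_congr rfl fun j _ => ?_
    rw [Polynomial.eval_monomial, map_smul, smul_eq_mul, mul_comm]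
  have h3 : p.coeff m = φ (polyCoef V m (x - y)) := by
    rw [hp, Polynomial.finsetSum_coeff]
    simp only [Polynomial.coeff_monomial]
    rw [Finset.sum_ite_eq' (x - y : ℕ →₀ V).support m]
    split_ifs with h4
    · rfl
    · rw [Finsupp.notMem_support_iff.1 h4 |> fun h5 => (show polyCoef V m (x - y) = 0 from h5), map_zero]
  rw [← h3, hp0, Polynomial.coeff_zero]

theorem polyTens_ext {M X : Type*} [AddCommGroup M] [Module K M] [AddCommGroup X] [Module K X]
    {n : ℕ} {f g : M ⊗[K] (⨂[K]^n V.poly) →ₗ[K] X}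
    (h : ∀ (m : M) (k : Fin n → ℕ) (a : Fin n → V),
      f (m ⊗ₜ PiTensorProduct.tprod K (fun i => polySingle V (k i) (a i))) =
        g (m ⊗ₜ PiTensorProduct.tprod K (fun i => polySingle V (k i) (a i)))) : f = g := by
  refine tens_ext fun m v => ?_
  have hspan : Submodule.span K {x : V.poly | ∃ j a, x = polySingle V j a} = ⊤ := by
    rw [eq_top_iff]
    rintro (x : ℕ →₀ V) _
    induction x using Finsupp.induction_linear with
    | zero => exact Submodule.zero_mem _
    | add x y hx hy => exact Submodule.add_mem _ (hx trivial) (hy trivial)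
    | single j a => exact Submodule.subset_span ⟨j, a, rfl⟩
  have := MultilinearMap.mem_of_span hspan
    (((f - g) ∘ₗ TensorProduct.mk K M _ m).compMultilinearMap (PiTensorProduct.tprod K)) ⊥
    (fun v hv => by
      choose k a hk using hv
      obtain rfl : v = fun i => polySingle V (k i) (a i) := funext hk
      simpa [sub_eq_zero] using h m k a) v
  simpa [sub_eq_zero] using this

end

variable {P : Operad K}

/-- The coefficient of `tᵐ` in the operations of `A ⊗ K[t]`. -/
def polyActCoef (A : GrAlg P) (n m : ℕ) : P.obj (Fin n) ⊗[K] (⨂[K]^n A.toGrMod.poly) →ₗ[K] A.carrier :=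
  ∑ k ∈ Finset.piAntidiag (Finset.univ : Finset (Fin n)) m,
    A.act n ∘ₗ TensorProduct.map LinearMap.id
      (PiTensorProduct.map fun i => polyCoef A.toGrMod (k i))

theorem polyActCoef_tprod (A : GrAlg P) (n m : ℕ) (μ : P.obj (Fin n))
    (v : Fin n → A.toGrMod.poly) : polyActCoef A n m (μ ⊗ₜ[K] PiTensorProduct.tprod K v) =
      ∑ k ∈ Finset.piAntidiag (Finset.univ : Finset (Fin n)) m, A.act n (μ ⊗ₜ[K]
        PiTensorProduct.tprod K fun i => polyCoef A.toGrMod (k i) (v i)) := by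
  simp [polyActCoef]

theorem exists_polyActCoef_eq_zero (A : GrAlg P) (n : ℕ)
    (t : P.obj (Fin n) ⊗[K] (⨂[K]^n A.toGrMod.poly)) :
    ∃ N, ∀ m, N ≤ m → polyActCoef A n m t = 0 := by
  let S : Submodule K (P.obj (Fin n) ⊗[K] (⨂[K]^n A.toGrMod.poly)) :=
    { carrier := {t | ∃ N, ∀ m, N ≤ m → polyActCoef A n m t = 0}
      add_mem' := by
        rintro x y ⟨N, hN⟩ ⟨N', hN'⟩
        exact ⟨max N N', fun m hm => by
          rw [map_add, hN m (le_trans (le_max_left _ _) hm), hN' m (le_trans (le_max_right _ _) hm),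
            add_zero]⟩
      zero_mem' := ⟨0, fun m _ => map_zero _⟩
      smul_mem' := by
        rintro c x ⟨N, hN⟩
        exact ⟨N, fun m hm => by rw [map_smul, hN m hm, smul_zero]⟩ }
  have h : S.mkQ = 0 := tens_ext fun μ v => by
    rw [LinearMap.zero_apply, Submodule.mkQ_apply, Submodule.Quotient.mk_eq_zero]
    choose b hb using fun i => exists_polyCoef_eq_zero (v i)
    refine ⟨∑ i, b i + 1, fun m hm => ?_⟩
    rw [polyActCoef_tprod]
    refine Finset.sum_eq_zero fun k hk => ?_
    obtain ⟨i, hi⟩ : ∃ i, b i ≤ k i := by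
      by_contra! h'
      have h1 := Finset.sum_le_sum fun i (_ : i ∈ Finset.univ) => (h' i).le
      rw [(Finset.mem_piAntidiag.1 hk).1] at h1
      omega
    rw [MultilinearMap.map_coord_zero _ i (hb i _ hi), TensorProduct.tmul_zero, map_zero]
  have := LinearMap.congr_fun h t
  rwa [LinearMap.zero_apply, Submodule.mkQ_apply, Submodule.Quotient.mk_eq_zero] at this

/-- The operations of `A ⊗ K[t]`. -/
def polyAct (A : GrAlg P) (n : ℕ) :
    P.obj (Fin n) ⊗[K] (⨂[K]^n A.toGrMod.poly) →ₗ[K] A.toGrMod.poly where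
  toFun t := Finsupp.ofSupportFinite (fun m => polyActCoef A n m t) (by
    obtain ⟨N, hN⟩ := exists_polyActCoef_eq_zero A n t
    refine (Set.finite_lt_nat N).subset fun m hm => ?_
    by_contra h
    exact hm (hN m (not_lt.1 h)))
  map_add' x y := Finsupp.ext fun m => map_add (polyActCoef A n m) x y
  map_smul' c x := Finsupp.ext fun m => map_smul (polyActCoef A n m) c x

theorem polyCoef_act (A : GrAlg P) (n m : ℕ) (t : P.obj (Fin n) ⊗[K] (⨂[K]^n A.toGrMod.poly)) :
    polyCoef A.toGrMod m (polyAct A n t) = polyActCoef A n m t := rfl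

theorem polyAct_single (A : GrAlg P) (n : ℕ) (μ : P.obj (Fin n)) (k : Fin n → ℕ)
    (a : Fin n → A.carrier) : polyAct A n (μ ⊗ₜ[K] PiTensorProduct.tprod K
      (fun i => polySingle A.toGrMod (k i) (a i))) =
      polySingle A.toGrMod (∑ i, k i) (A.act n (μ ⊗ₜ[K] PiTensorProduct.tprod K a)) := by
  refine poly_ext fun m => ?_
  rw [polyCoef_act, polyActCoef_tprod, polyCoef_single]
  have h0 : ∀ k' ∈ Finset.piAntidiag (Finset.univ : Finset (Fin n)) m, k' ≠ k →
      A.act n (μ ⊗ₜ[K] PiTensorProduct.tprod K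
        fun i => polyCoef A.toGrMod (k' i) (polySingle A.toGrMod (k i) (a i))) = 0 := by
    intro k' _ hk'
    obtain ⟨i, hi⟩ := Function.ne_iff.1 hk'
    rw [MultilinearMap.map_coord_zero _ i (by rw [polyCoef_single, if_neg hi.symm]),
      TensorProduct.tmul_zero, map_zero]
  have h1 : (fun i => polyCoef A.toGrMod (k i) (polySingle A.toGrMod (k i) (a i))) = a :=
    funext fun i => by rw [polyCoef_single, if_pos rfl]
  split_ifs with h
  · rw [Finset.sum_eq_single_of_mem k (Finset.mem_piAntidiag.2 ⟨h, by simp⟩) h0, h1]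
  · refine Finset.sum_eq_zero fun k' hk' => h0 k' hk' ?_
    rintro rfl
    exact h (Finset.mem_piAntidiag.1 hk').1

theorem polyEv_act (A : GrAlg P) (s : K) (n : ℕ)
    (t : P.obj (Fin n) ⊗[K] (⨂[K]^n A.toGrMod.poly)) :
    polyEv A.toGrMod s (polyAct A n t) = A.act n (TensorProduct.map LinearMap.id
      (PiTensorProduct.map fun _ => polyEv A.toGrMod s) t) := by
  refine LinearMap.congr_fun (f := polyEv A.toGrMod s ∘ₗ polyAct A n) (g := A.act n ∘ₗ
    TensorProduct.map LinearMap.id (PiTensorProduct.map fun _ => polyEv A.toGrMod s))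
    (polyTens_ext fun μ k a => ?_) t
  simp only [LinearMap.comp_apply, polyAct_single, TensorProduct.map_tmul, LinearMap.id_apply,
    PiTensorProduct.map_tprod, polyEv_single, MultilinearMap.map_smul_univ,
    TensorProduct.tmul_smul, map_smul, Finset.prod_pow_eq_pow_sum]

/-- `A ⊗ K[t]`. -/
abbrev GrAlg.poly [CharZero K] (A : GrAlg P) : GrAlg P :=
  GrAlg.ofFamily A.toGrMod.poly (polyAct A)
    (fun n k t ht => opGr_le (fun p q μ v h hμ hv => mem_poly.2 fun m => by
      rw [polyCoef_act, polyActCoef_tprod]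
      exact Submodule.sum_mem _ fun k _ => A.act_mem _ _ _
        (tmul_mem_opGr h hμ fun i => mem_poly.1 (hv i) _)) ht)
    (fun _ : K => A) (polyEv A.toGrMod)
    (fun s => isPar_of_degree_zero fun _ _ hx => polyEv_mem s hx)
    (fun _ _ h => polyEv_injective h)
    (polyEv_act A)

end Poly

/-! ### Paths in an algebra -/

section Path

variable {P : Operad K}

theorem insFun_self {V W : Type*} [AddCommGroup V] [Module K V] [AddCommGroup W] [Module K W]
    (s D π : V →ₗ[K] W) {n : ℕ} (i : Fin n) (v : Fin n → V) : insFun s D π i v i = D (v i) := by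
  simp [insFun]

theorem insFun_of_ne {V W : Type*} [AddCommGroup V] [Module K V] [AddCommGroup W] [Module K W]
    (s D π : V →ₗ[K] W) {n : ℕ} {i j : Fin n} (h : j ≠ i) (v : Fin n → V) :
    insFun s D π i v j = if j < i then s (v j) else π (v j) := by
  simp [insFun, h]

theorem insFun_eq_update {V W : Type*} [AddCommGroup V] [Module K V] [AddCommGroup W] [Module K W]
    (s D π : V →ₗ[K] W) {n : ℕ} (i : Fin n) (v : Fin n → V) :
    insFun s D π i v = Function.update (insFun s 0 π i v) i (D (v i)) := by
  ext1 j
  by_cases h : j = i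
  · subst h
    rw [insFun_self, Function.update_self]
  · rw [Function.update_of_ne h, insFun_of_ne _ _ _ h, insFun_of_ne _ _ _ h]

theorem insSum_add {V W : Type*} [AddCommGroup V] [Module K V] [AddCommGroup W] [Module K W]
    (s D D' π : V →ₗ[K] W) (n : ℕ) :
    insSum s (D + D') π n = insSum s D π n + insSum s D' π n := by
  refine PiTensorProduct.ext (MultilinearMap.ext fun v => ?_)
  simp only [LinearMap.compMultilinearMap_apply, LinearMap.add_apply, insSum_tprod]
  rw [← Finset.sum_add_distrib]
  refine Finset.sum_congr rfl fun i _ => ?_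
  rw [insFun_eq_update s (D + D'), insFun_eq_update s D, insFun_eq_update s D',
    LinearMap.add_apply, MultilinearMap.map_update_add]

theorem insFun_polySingle {V : GrMod K} (D : V →ₗ[K] V) {n : ℕ} (k : Fin n → ℕ) (a : Fin n → V)
    (i : Fin n) : insFun V.poly.sgn (polyMap D) LinearMap.id i (fun j => polySingle V (k j) (a j)) =
      fun j => polySingle V (k j) (insFun V.sgn D LinearMap.id i a j) := by
  ext1 j
  unfold insFun
  split_ifs
  · exact sgn_polySingle _ _
  · exact polyMap_single _ _ _
  · rfl

/-- The coefficientwise extension of a derivation to polynomials is a derivation. -/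
theorem polyMap_d_act [CharZero K] (B : DerAlg P) (n : ℕ)
    (t : P.obj (Fin n) ⊗[K] (⨂[K]^n B.toGrMod.poly)) :
    polyMap B.d (polyAct B.toGrAlg n t) =
      polyAct B.toGrAlg n (TensorProduct.map (P.obj (Fin n)).d LinearMap.id t) +
      polyAct B.toGrAlg n (TensorProduct.map (P.obj (Fin n)).sgn
        (insSum B.toGrMod.poly.sgn (polyMap B.d) LinearMap.id n) t) := by
  refine LinearMap.congr_fun (f := polyMap B.d ∘ₗ polyAct B.toGrAlg n)
    (g := polyAct B.toGrAlg n ∘ₗ TensorProduct.map (P.obj (Fin n)).d LinearMap.id +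
      polyAct B.toGrAlg n ∘ₗ TensorProduct.map (P.obj (Fin n)).sgn
        (insSum B.toGrMod.poly.sgn (polyMap B.d) LinearMap.id n))
    (polyTens_ext fun μ k a => ?_) t
  simp only [LinearMap.comp_apply, LinearMap.add_apply, TensorProduct.map_tmul, LinearMap.id_apply,
    insSum_tprod, TensorProduct.tmul_sum, map_sum, insFun_polySingle, polyAct_single, polyMap_single,
    B.act_d, map_add]

/-- If `θ` commutes with the operations up to sign, `θ (d / dt)` is a derivation. -/
theorem polyMap_polyDer_act (B : GrAlg P) (θ : B.carrier →ₗ[K] B.carrier) {n : ℕ}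
    (hθ : ∀ (μ : P.obj (Fin n)) (a : Fin n → B.carrier) (i : Fin n),
      θ (B.act n (μ ⊗ₜ[K] PiTensorProduct.tprod K a)) = B.act n ((P.obj (Fin n)).sgn μ ⊗ₜ[K]
        PiTensorProduct.tprod K (insFun B.sgn θ LinearMap.id i a)))
    (t : P.obj (Fin n) ⊗[K] (⨂[K]^n B.toGrMod.poly)) :
    polyMap θ (polyDer B.toGrMod (polyAct B n t)) =
      polyAct B n (TensorProduct.map (P.obj (Fin n)).sgn
        (insSum B.toGrMod.poly.sgn (polyMap θ ∘ₗ polyDer B.toGrMod) LinearMap.id n) t) := by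
  refine LinearMap.congr_fun (f := polyMap θ ∘ₗ polyDer B.toGrMod ∘ₗ polyAct B n)
    (g := polyAct B n ∘ₗ TensorProduct.map (P.obj (Fin n)).sgn
        (insSum B.toGrMod.poly.sgn (polyMap θ ∘ₗ polyDer B.toGrMod) LinearMap.id n))
    (polyTens_ext fun μ k a => ?_) t
  simp only [LinearMap.comp_apply, TensorProduct.map_tmul, insSum_tprod, TensorProduct.tmul_sum,
    map_sum, polyAct_single, polyDer_single, map_smul, polyMap_single]
  rw [Nat.cast_sum, Finset.sum_smul]
  refine Finset.sum_congr rfl fun i _ => ?_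
  have h1 : insFun B.toGrMod.poly.sgn (polyMap θ ∘ₗ polyDer B.toGrMod) LinearMap.id i
      (fun j => polySingle B.toGrMod (k j) (a j)) =
      Function.update (fun j => polySingle B.toGrMod (Function.update k i (k i - 1) j)
        (insFun B.sgn θ LinearMap.id i a j)) i ((k i : K) •
          polySingle B.toGrMod (Function.update k i (k i - 1) i)
            (insFun B.sgn θ LinearMap.id i a i)) := by
    ext1 j
    by_cases h : j = i
    · subst h
      simp [insFun_self, polyDer_single]
    · rw [Function.update_of_ne h, Function.update_of_ne h, insFun_of_ne _ _ _ h,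
        insFun_of_ne _ _ _ h]
      split_ifs
      · exact sgn_polySingle _ _
      · rfl
  rw [h1, MultilinearMap.map_update_smul, Function.update_eq_self, TensorProduct.tmul_smul, map_smul,
    polyAct_single, ← hθ]
  rcases Nat.eq_zero_or_pos (k i) with h0 | h0
  · simp [h0]
  · congr 3
    rw [Finset.sum_update_of_mem (Finset.mem_univ i), ← Finset.add_sum_erase _ k (Finset.mem_univ i),
      Finset.sdiff_singleton_eq_erase]
    omega

theorem odd_neg_one : Odd (-1 : ℤ) := ⟨-1, rfl⟩

/-- Multiplication by `ε`. -/
def epsMul (V : GrMod K) (e : ℤ) : V.eps e →ₗ[K] V.eps e := epsInr V e ∘ₗ epsFst V e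

theorem epsMul_act [CharZero K] (A : GrAlg P) (e : ℤ) {n : ℕ} (μ : P.obj (Fin n))
    (a : Fin n → A.toGrMod.eps e) (i : Fin n) :
    epsMul A.toGrMod e (epsAct A e 0 n (μ ⊗ₜ[K] PiTensorProduct.tprod K a)) =
      epsAct A e 0 n ((P.obj (Fin n)).sgn μ ⊗ₜ[K]
        PiTensorProduct.tprod K (insFun (A.toGrMod.eps e).sgn (epsMul A.toGrMod e) LinearMap.id i a)) := by
  refine eps_ext ?_ ?_
  · refine Eq.trans (b := 0) rfl (Eq.symm ?_)
    rw [fst_epsAct, TensorProduct.map_tmul, PiTensorProduct.map_tprod,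
      MultilinearMap.map_coord_zero _ i, TensorProduct.tmul_zero, map_zero]
    rw [insFun_self]
    rfl
  · rw [snd_epsAct_tprod, zero_smul, zero_add, Finset.sum_eq_single i]
    · rw [GrMod.sgn_sgn]
      simp only [epsMul, LinearMap.comp_apply, epsSnd_inr]
      rw [fst_epsAct, TensorProduct.map_tmul, PiTensorProduct.map_tprod, LinearMap.id_apply]
      congr 3
      ext1 j
      by_cases h : j = i
      · subst h
        rw [insFun_self, insFun_self]
        rfl
      · rw [insFun_of_ne _ _ _ h, insFun_of_ne _ _ _ h]
        split_ifs
        · exact (A.sgn_sgn _).symm.trans (congrArg A.sgn (epsFst_sgn _).symm)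
        · rfl
    · intro j _ hj
      rw [MultilinearMap.map_coord_zero _ i, TensorProduct.tmul_zero, map_zero]
      rw [insFun_of_ne _ _ _ hj.symm, insFun_self]
      split_ifs
      · exact map_zero A.sgn
      · rfl
    · simp

/-- The operations of `A + ε A` restricted to `A`. -/
theorem epsAct_inl (A : GrAlg P) (e : ℤ) {n : ℕ} (μ : P.obj (Fin n)) (a : Fin n → A.carrier) :
    epsAct A e 0 n (μ ⊗ₜ[K] PiTensorProduct.tprod K fun i => epsInl A.toGrMod e (a i)) =
      epsInl A.toGrMod e (A.act n (μ ⊗ₜ[K] PiTensorProduct.tprod K a)) := by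
  refine eps_ext ?_ ?_
  · rw [fst_epsAct, TensorProduct.map_tmul, PiTensorProduct.map_tprod]
    rfl
  · rw [snd_epsAct_tprod, zero_smul, zero_add, epsSnd_inl]
    refine Finset.sum_eq_zero fun i _ => ?_
    rw [MultilinearMap.map_coord_zero _ i, TensorProduct.tmul_zero, map_zero]
    simp [insFun]

variable [CharZero K]

/-- `A → A + ε A`. -/
def epsInlHom (A : GrAlg P) (e : ℤ) (he : Odd e) : GrAlg.Hom A (A.eps e he 0 (by simp)) where
  toLin := epsInl A.toGrMod e
  map_mem _ _ hx := mem_eps.2 ⟨hx, Submodule.zero_mem _⟩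
  map_act n t := by
    refine LinearMap.congr_fun (f := epsInl A.toGrMod e ∘ₗ A.act n) (g := epsAct A e 0 n ∘ₗ
      TensorProduct.map LinearMap.id (PiTensorProduct.map fun _ => epsInl A.toGrMod e))
      (tens_ext fun μ a => ?_) t
    simp only [LinearMap.comp_apply, TensorProduct.map_tmul, PiTensorProduct.map_tprod,
      LinearMap.id_apply]
    exact (epsAct_inl A e μ a).symm

/-- The morphism `A ⊗ K[t] → B ⊗ K[t]` induced by a morphism `A → B`. -/
def GrAlg.Hom.poly {A B : GrAlg P} (g : GrAlg.Hom A B) : GrAlg.Hom A.poly B.poly where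
  toLin := polyMap g.toLin
  map_mem k x hx := mem_poly.2 fun m => g.map_mem k _ (mem_poly.1 hx m)
  map_act n t := by
    refine LinearMap.congr_fun (f := polyMap g.toLin ∘ₗ polyAct A n) (g := polyAct B n ∘ₗ
      TensorProduct.map LinearMap.id (PiTensorProduct.map fun _ => polyMap g.toLin))
      (polyTens_ext fun μ k a => ?_) t
    simp only [LinearMap.comp_apply, TensorProduct.map_tmul, PiTensorProduct.map_tprod,
      LinearMap.id_apply, polyAct_single, polyMap_single, g.map_act]

/-- `A → A ⊗ K[t]`. -/
def polyConstHom (A : GrAlg P) : GrAlg.Hom A A.poly where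
  toLin := polySingle A.toGrMod 0
  map_mem _ _ hx := polySingle_mem 0 hx
  map_act n t := by
    refine LinearMap.congr_fun (f := polySingle A.toGrMod 0 ∘ₗ A.act n) (g := polyAct A n ∘ₗ
      TensorProduct.map LinearMap.id (PiTensorProduct.map fun _ => polySingle A.toGrMod 0))
      (tens_ext fun μ a => ?_) t
    simp only [LinearMap.comp_apply, TensorProduct.map_tmul, PiTensorProduct.map_tprod,
      LinearMap.id_apply]
    rw [polyAct_single A n μ (fun _ => 0) a, Finset.sum_const_zero]

/-- Evaluation `A ⊗ K[t] → A`. -/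
def polyEvHom (A : GrAlg P) (s : K) : GrAlg.Hom A.poly A where
  toLin := polyEv A.toGrMod s
  map_mem _ _ hx := polyEv_mem s hx
  map_act := polyEv_act A s

/-- The derivation of the algebra of polynomial paths. -/
def pathD {V : GrMod K} (d : V →ₗ[K] V) : (V.eps (-1)).poly →ₗ[K] (V.eps (-1)).poly :=
  polyMap (epsD (-1) d) + polyMap (epsMul V (-1)) ∘ₗ polyDer (V.eps (-1))

/-- The coefficient of `tᵐ` of a path. -/
def pathFst (V : GrMod K) (m : ℕ) : (V.eps (-1)).poly →ₗ[K] V := epsFst V (-1) ∘ₗ polyCoef _ m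

/-- The coefficient of `dt tᵐ` of a path. -/
def pathSnd (V : GrMod K) (m : ℕ) : (V.eps (-1)).poly →ₗ[K] V := epsSnd V (-1) ∘ₗ polyCoef _ m

section

variable {V W : GrMod K}

omit [CharZero K] in
theorem path_ext {x y : (V.eps (-1)).poly} (h1 : ∀ m, pathFst V m x = pathFst V m y)
    (h2 : ∀ m, pathSnd V m x = pathSnd V m y) : x = y :=
  poly_ext fun m => eps_ext (h1 m) (h2 m)

omit [CharZero K] in
theorem mem_path {k : ℤ} {x : (V.eps (-1)).poly} : x ∈ (V.eps (-1)).poly.gr k ↔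
    (∀ m, pathFst V m x ∈ V.gr k) ∧ ∀ m, pathSnd V m x ∈ V.gr (k + 1) := by
  rw [mem_poly, ← forall_and]
  exact forall_congr' fun m => mem_eps.trans (by rw [sub_neg_eq_add]; rfl)

omit [CharZero K] in
theorem pathFst_pathD (d : V →ₗ[K] V) (m : ℕ) (x : (V.eps (-1)).poly) :
    pathFst V m (pathD d x) = d (pathFst V m x) := by
  simp [pathFst, pathD, epsMul]

omit [CharZero K] in
theorem pathSnd_pathD (d : V →ₗ[K] V) (m : ℕ) (x : (V.eps (-1)).poly) :
    pathSnd V m (pathD d x) = (m + 1 : K) • pathFst V (m + 1) x - d (pathSnd V m x) := by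
  simp [pathFst, pathSnd, pathD, epsMul, polyCoef_der]
  abel

end

/-- `A ⊗ Ω₁`, for an algebra with a derivation. -/
abbrev DerAlg.path (A : DerAlg P) : DerAlg P where
  toGrAlg := (A.toGrAlg.eps (-1) odd_neg_one 0 (by simp)).poly
  d := pathD A.d
  d_mem k x hx := by
    rw [mem_path] at hx ⊢
    refine ⟨fun m => ?_, fun m => ?_⟩
    · rw [pathFst_pathD]
      exact A.d_mem _ _ (hx.1 m)
    · rw [pathSnd_pathD]
      refine Submodule.sub_mem _ (Submodule.smul_mem _ _ ?_) ?_
      · simpa using hx.1 (m + 1)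
      · have := A.d_mem _ _ (hx.2 m)
        rwa [add_sub_right_comm] at this
  act_d n t := by
    have h1 := polyMap_d_act (A.eps (-1) odd_neg_one) n t
    have h2 := polyMap_polyDer_act (A.toGrAlg.eps (-1) odd_neg_one 0 (by simp))
      (epsMul A.toGrMod (-1)) (epsMul_act A.toGrAlg (-1)) t
    have h3 := insSum_add (A.toGrMod.eps (-1)).poly.sgn (polyMap (epsD (-1) A.d))
      (polyMap (epsMul A.toGrMod (-1)) ∘ₗ polyDer (A.toGrMod.eps (-1))) LinearMap.id n
    change polyMap _ _ + polyMap _ (polyDer _ _) = _ + _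
    rw [pathD, h3, TensorProduct.map_add_right, LinearMap.add_apply, map_add, ← add_assoc]
    exact congrArg₂ _ h1 h2

/-- The algebra `A ⊗ Ω₁` of polynomial paths in `A`. -/
abbrev DGAlg.path (A : DGAlg P) : DGAlg P :=
  A.toDerAlg.path.toDGAlg fun x => by
    refine path_ext (fun m => ?_) (fun m => ?_)
    · rw [pathFst_pathD, pathFst_pathD, A.d_d, map_zero]
    · rw [pathSnd_pathD, pathFst_pathD, pathSnd_pathD, map_sub, A.d_d, map_smul, map_zero, sub_zero,
        sub_self]

omit [CharZero K] in
theorem GrAlg.Hom.comp_map_act {A B D : GrAlg P} (g : GrAlg.Hom B D) (f : GrAlg.Hom A B) (n : ℕ)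
    (t : P.obj (Fin n) ⊗[K] (⨂[K]^n A.carrier)) : g.toLin (f.toLin (A.act n t)) =
      D.act n (TensorProduct.map LinearMap.id
        (PiTensorProduct.map fun _ => g.toLin ∘ₗ f.toLin) t) :=
  (g.comp f).map_act n t

/-- Evaluation of paths at `t = s`. -/
def DGAlg.pathEv (A : DGAlg P) (s : K) : DGAlg.Hom A.path A where
  toLin := epsFst A.toGrMod (-1) ∘ₗ polyEv _ s
  map_mem k x hx := (mem_eps.1 (polyEv_mem s hx)).1
  map_d x := by
    change epsFst _ _ (polyEv _ s (polyMap _ _ + polyMap _ _)) = _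
    rw [map_add, polyEv_map, polyEv_map]
    exact (map_add _ _ _).trans ((congrArg₂ (· + ·) (epsFst_epsD (-1) A.d _)
      (epsFst_inr (V := A.toGrMod) (e := -1) _)).trans (add_zero _))
  map_act n t := GrAlg.Hom.comp_map_act (epsFstHom A.toGrAlg (-1) odd_neg_one 0 (by simp))
    (polyEvHom _ s) n t

/-- Constant paths. -/
def DGAlg.pathConst (A : DGAlg P) : DGAlg.Hom A A.path where
  toLin := polySingle _ 0 ∘ₗ epsInl A.toGrMod (-1)
  map_mem k x hx := polySingle_mem 0 (mem_eps.2 ⟨hx, Submodule.zero_mem _⟩)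
  map_d x := by
    change _ = polyMap _ (polySingle _ _ _) + polyMap _ (polyDer _ (polySingle _ _ _))
    rw [polyDer_single, polyMap_single, Nat.cast_zero, zero_smul, map_zero, add_zero]
    have h : epsInl A.toGrMod (-1) (A.d x) = epsD (-1) A.d (epsInl A.toGrMod (-1) x) :=
      eps_ext (by rw [epsFst_epsD]; rfl) (by rw [epsSnd_epsD]; simp)
    exact congrArg (polySingle (A.toGrMod.eps (-1)) 0) h
  map_act n t := GrAlg.Hom.comp_map_act (polyConstHom _) (epsInlHom A.toGrAlg (-1) odd_neg_one) n t

/-- The morphism of graded algebras underlying a morphism of dg algebras. -/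
abbrev DGAlg.Hom.toGrHom {A B : DGAlg P} (f : DGAlg.Hom A B) : GrAlg.Hom A.toGrAlg B.toGrAlg :=
  ⟨f.toLin, f.map_mem, f.map_act⟩

/-- The morphism of path algebras induced by a morphism. -/
def DGAlg.Hom.path {A B : DGAlg P} (f : DGAlg.Hom A B) : DGAlg.Hom A.path B.path where
  toLin := (f.toGrHom.eps (-1) odd_neg_one 0 (by simp)).poly.toLin
  map_mem := (f.toGrHom.eps (-1) odd_neg_one 0 (by simp)).poly.map_mem
  map_act := (f.toGrHom.eps (-1) odd_neg_one 0 (by simp)).poly.map_act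
  map_d x := by
    have h1 : ∀ m y, pathFst B.toGrMod m
        ((f.toGrHom.eps (-1) odd_neg_one 0 (by simp)).poly.toLin y) = f.toLin (pathFst A.toGrMod m y) :=
      fun m y => add_zero _
    have h2 : ∀ m y, pathSnd B.toGrMod m
        ((f.toGrHom.eps (-1) odd_neg_one 0 (by simp)).poly.toLin y) = f.toLin (pathSnd A.toGrMod m y) :=
      fun m y => zero_add _
    refine path_ext (fun m => ?_) (fun m => ?_)
    · rw [h1, pathFst_pathD, pathFst_pathD, h1, f.map_d]
    · rw [h2, pathSnd_pathD, pathSnd_pathD, h1, h2, map_sub, map_smul, f.map_d]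

end Path

/-! ### Integration, and the path object -/

section Integration

variable {P : Operad K} [CharZero K]

/-- `a tᵐ ↦ a tᵐ⁺¹ / (m + 1)`. -/
def polyInt (V : GrMod K) : V.poly →ₗ[K] V.poly :=
  Finsupp.lsum K fun m => ((m : K) + 1)⁻¹ • (Finsupp.lsingle (m + 1) : V →ₗ[K] ℕ →₀ V)

omit [CharZero K] in
theorem polyInt_single (V : GrMod K) (m : ℕ) (a : V) :
    polyInt V (polySingle V m a) = ((m : K) + 1)⁻¹ • polySingle V (m + 1) a := by
  exact Finsupp.lsum_single K _ m a

omit [CharZero K] in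
theorem polyCoef_int_zero (V : GrMod K) (x : V.poly) : polyCoef V 0 (polyInt V x) = 0 := by
  refine LinearMap.congr_fun (f := polyCoef V 0 ∘ₗ polyInt V) (g := 0)
    (poly_hom_ext fun j a => ?_) x
  rw [LinearMap.comp_apply, polyInt_single, map_smul, polyCoef_single, if_neg (by omega), smul_zero,
    LinearMap.zero_apply]

omit [CharZero K] in
theorem polyCoef_int_succ (V : GrMod K) (m : ℕ) (x : V.poly) :
    polyCoef V (m + 1) (polyInt V x) = ((m : K) + 1)⁻¹ • polyCoef V m x := by
  refine LinearMap.congr_fun (f := polyCoef V (m + 1) ∘ₗ polyInt V)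
    (g := ((m : K) + 1)⁻¹ • polyCoef V m) (poly_hom_ext fun j a => ?_) x
  rw [LinearMap.comp_apply, LinearMap.smul_apply, polyInt_single, map_smul, polyCoef_single,
    polyCoef_single]
  by_cases h : j = m <;> simp [h]

/-- Integration of paths from `t = 0`. -/
def pathInt (V : GrMod K) : (V.eps (-1)).poly →ₗ[K] (V.eps (-1)).poly :=
  polyInt _ ∘ₗ polyMap (epsInl V (-1) ∘ₗ epsSnd V (-1))

section

variable {V : GrMod K}

omit [CharZero K]

theorem pathFst_int_zero (x : (V.eps (-1)).poly) : pathFst V 0 (pathInt V x) = 0 := by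
  rw [pathFst, pathInt, LinearMap.comp_apply, LinearMap.comp_apply, polyCoef_int_zero, map_zero]

theorem pathFst_int_succ (m : ℕ) (x : (V.eps (-1)).poly) :
    pathFst V (m + 1) (pathInt V x) = ((m : K) + 1)⁻¹ • pathSnd V m x := by
  rw [pathFst, pathInt, LinearMap.comp_apply, LinearMap.comp_apply, polyCoef_int_succ, map_smul]
  rfl

theorem pathSnd_int (m : ℕ) (x : (V.eps (-1)).poly) : pathSnd V m (pathInt V x) = 0 := by
  rcases m with _ | m
  · rw [pathSnd, pathInt, LinearMap.comp_apply, LinearMap.comp_apply, polyCoef_int_zero, map_zero]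
  · rw [pathSnd, pathInt, LinearMap.comp_apply, LinearMap.comp_apply, polyCoef_int_succ, map_smul,
      polyCoef_map, LinearMap.comp_apply, epsSnd_inl, smul_zero]

end

theorem pathFst_const (A : DGAlg P) (m : ℕ) (a : A.carrier) :
    pathFst A.toGrMod m (A.pathConst.toLin a) = if m = 0 then a else 0 := by
  change epsFst _ _ (polyCoef _ m (polySingle _ 0 _)) = _
  rw [polyCoef_single]
  by_cases h : m = 0
  · rw [if_pos h.symm, if_pos h]; rfl
  · rw [if_neg (Ne.symm h), if_neg h]; rfl

theorem pathSnd_const (A : DGAlg P) (m : ℕ) (a : A.carrier) :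
    pathSnd A.toGrMod m (A.pathConst.toLin a) = 0 := by
  change epsSnd _ _ (polyCoef _ m (polySingle _ 0 _)) = _
  rw [polyCoef_single]
  split_ifs <;> rfl

theorem pathEv_zero (A : DGAlg P) (x : A.path.carrier) :
    (A.pathEv 0).toLin x = pathFst A.toGrMod 0 x := by
  change epsFst _ _ (polyEv _ _ _) = _
  rw [polyEv_zero]
  rfl

theorem pathEv_one (A : DGAlg P) (x : A.path.carrier) {N : ℕ}
    (h : ∀ m, N ≤ m → pathFst A.toGrMod m x = 0 ∧ pathSnd A.toGrMod m x = 0) :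
    (A.pathEv 1).toLin x = ∑ m ∈ Finset.range N, pathFst A.toGrMod m x := by
  change epsFst _ _ (polyEv _ _ _) = _
  rw [polyEv_one x fun m hm => eps_ext ((h m hm).1.trans (map_zero _).symm)
    ((h m hm).2.trans (map_zero _).symm), map_sum]
  rfl

theorem pathEv_const (A : DGAlg P) (s : K) (a : A.carrier) :
    (A.pathEv s).toLin (A.pathConst.toLin a) = a := by
  change epsFst _ _ (polyEv _ _ (polySingle _ 0 _)) = _
  rw [polyEv_single, pow_zero, one_smul]
  rfl

/-- Integration is a homotopy between the identity and the retraction to constant paths. -/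
theorem pathD_int (A : DGAlg P) (x : A.path.carrier) :
    A.path.d (pathInt A.toGrMod x) + pathInt A.toGrMod (A.path.d x) =
      x - A.pathConst.toLin ((A.pathEv 0).toLin x) := by
  refine path_ext (fun m => ?_) (fun m => ?_)
  · rw [map_add, map_sub, pathFst_pathD, pathFst_const, pathEv_zero]
    rcases m with _ | m
    · rw [pathFst_int_zero, pathFst_int_zero, map_zero, if_pos rfl, add_zero, sub_self]
    · rw [pathFst_int_succ, pathFst_int_succ, pathSnd_pathD, if_neg (by omega), sub_zero, smul_sub,
        smul_smul, inv_mul_cancel₀ (Nat.cast_add_one_ne_zero m), one_smul, map_smul]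
      abel
  · rw [map_add, map_sub, pathSnd_pathD, pathSnd_const, pathSnd_int, pathSnd_int, pathFst_int_succ,
      smul_smul, mul_inv_cancel₀ (Nat.cast_add_one_ne_zero m), one_smul, map_zero, add_zero]

theorem isQuasiIso_pathConst (A : DGAlg P) : A.pathConst.IsQuasiIso := by
  refine ⟨fun x _ ⟨y, hy⟩ => ⟨(A.pathEv 0).toLin y, ?_⟩, fun y hy =>
    ⟨(A.pathEv 0).toLin y, pathInt A.toGrMod y, ?_, ?_⟩⟩
  · rw [← (A.pathEv 0).map_d, ← hy, pathEv_const]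
  · rw [← (A.pathEv 0).map_d, hy, map_zero]
  · have h := pathD_int A y
    rw [hy, map_zero, add_zero] at h
    rw [h]
    exact (add_sub_cancel _ _).symm

/-- The polynomial path object. -/
def DGAlg.pathObject (A : DGAlg P) : HomotopicalAlgebra.PathObject A where
  P := A.path
  p₀ := A.pathEv 0
  p₁ := A.pathEv 1
  ι := A.pathConst
  ι_p₀ := DGAlg.Hom.ext (LinearMap.ext fun a => pathEv_const A 0 a)
  ι_p₁ := DGAlg.Hom.ext (LinearMap.ext fun a => pathEv_const A 1 a)
  weakEquivalence_ι := ⟨isQuasiIso_pathConst A⟩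

end Integration

/-! ### Maps to path algebras and the completed tensor product with `Ω₁` -/

section Interval

variable {𝒞 : Cooperad K} {P : Operad K} (τ : TwistingMorphism 𝒞 P) (C : Coalg 𝒞) [CharZero K]

/-- The coefficient of `tᵐ` in the value of an operation collects all ways to write `m` as a sum
of degrees. -/
theorem polyCoef_convOp (B : GrAlg P) {n : ℕ} {f : Fin n → (C.carrier →ₗ[K] B.toGrMod.poly)}
    (hf : ∀ i, IsPar C.toGrMod B.toGrMod.poly 0 (f i)) (m : ℕ) (c : C.carrier) :
    polyCoef B.toGrMod m (convOp τ C B.poly n f c) =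
      ∑ k ∈ Finset.piAntidiag (Finset.univ : Finset (Fin n)) m,
        convOp τ C B n (fun i => polyCoef B.toGrMod (k i) ∘ₗ f i) c := by
  rw [convOp_of_even τ C B.poly hf]
  have h : ∀ (k : Fin n → ℕ) i, IsPar C.toGrMod B.toGrMod 0 (polyCoef B.toGrMod (k i) ∘ₗ f i) :=
    fun k i => by
      simpa using IsPar.comp (isPar_of_degree_zero (V := B.toGrMod.poly) (W := B.toGrMod)
        (φ := polyCoef B.toGrMod (k i)) (fun _ _ hx => mem_poly.1 hx _)) (hf i)
  simp only [fun k => convOp_of_even τ C B (h k)]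
  change polyActCoef B n m _ = _
  rw [polyActCoef, LinearMap.sum_apply]
  refine Finset.sum_congr rfl fun k _ => ?_
  rw [LinearMap.comp_apply, LinearMap.comp_apply, TensorProduct.map_map,
    ← PiTensorProduct.map_comp, LinearMap.id_comp]
  rfl

theorem epsFst_convOp (A : GrAlg P) {e : ℤ} (he : Odd e) {n : ℕ}
    {f : Fin n → (C.carrier →ₗ[K] A.toGrMod.eps e)}
    (hf : ∀ i, IsPar C.toGrMod (A.toGrMod.eps e) 0 (f i)) (c : C.carrier) :
    epsFst A.toGrMod e (convOp τ C (A.eps e he 0 (by simp)) n f c) =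
      convOp τ C A n (fun i => epsFst A.toGrMod e ∘ₗ f i) c := by
  rw [convOp_of_even τ C (A.eps e he 0 (by simp)) hf, convOp_of_even τ C A (fun i => by
    simpa using isPar_epsFst.comp (hf i))]
  refine (fst_epsAct A e 0 n _).trans ?_
  rw [LinearMap.comp_apply, TensorProduct.map_map, ← PiTensorProduct.map_comp, LinearMap.id_comp]
  rfl

/-- The `ε`-component of the value of an operation; the sign comes from moving `ε` past `τ`, the
other inputs being even. -/
theorem epsSnd_convOp (A : GrAlg P) {e : ℤ} (he : Odd e) {n : ℕ}
    {f : Fin n → (C.carrier →ₗ[K] A.toGrMod.eps e)}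
    (hf : ∀ i, IsPar C.toGrMod (A.toGrMod.eps e) 0 (f i)) (c : C.carrier) :
    epsSnd A.toGrMod e (convOp τ C (A.eps e he 0 (by simp)) n f c) =
      - ∑ j, convOp τ C A n
        (fun i => if i = j then epsSnd A.toGrMod e ∘ₗ f i else epsFst A.toGrMod e ∘ₗ f i) c := by
  have h0 : ∀ i, IsPar C.toGrMod A.toGrMod 0 (epsFst A.toGrMod e ∘ₗ f i) := fun i => by
    simpa using isPar_epsFst.comp (hf i)
  have hpar : ∀ j i, IsPar C.toGrMod A.toGrMod (if i = j then 1 else 0)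
      (if i = j then epsSnd A.toGrMod e ∘ₗ f i else epsFst A.toGrMod e ∘ₗ f i) := fun j i => by
    split_ifs
    · simpa using (isPar_epsSnd he).comp (hf i)
    · exact h0 i
  have hτ : ∀ x, (P.obj (Fin n)).sgn (τ.toFun (Fin n) x) =
      - τ.toFun (Fin n) ((𝒞.obj (Fin n)).sgn x) := fun x => by
    rw [TwistingMorphism.isPar (τ := τ) x]; simp
  rw [convOp_of_even τ C (A.eps e he 0 (by simp)) hf]
  simp only [fun j => convOp_of_isPar τ C A (hpar j)]
  refine (snd_epsAct A e 0 n _).trans ?_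
  rw [zero_smul, zero_add, ← Finset.sum_neg_distrib]
  simp only [LinearMap.comp_apply]
  refine LinearMap.congr_fun (f := A.act n ∘ₗ TensorProduct.map (P.obj (Fin n)).sgn
      (insSum (A.sgn ∘ₗ epsFst A.toGrMod e) (epsSnd A.toGrMod e) (epsFst A.toGrMod e) n) ∘ₗ
      TensorProduct.map (τ.toFun (Fin n)) (PiTensorProduct.map f))
    (g := ∑ j, - (A.act n ∘ₗ TensorProduct.map
      (τ.toFun (Fin n) ∘ₗ (𝒞.obj (Fin n)).toGrMod.sgnP (∑ i, if i = j then 1 else 0))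
      (PiTensorProduct.map (fun i =>
        (if i = j then epsSnd A.toGrMod e ∘ₗ f i else epsFst A.toGrMod e ∘ₗ f i) ∘ₗ
        C.toGrMod.sgnP (∑ l ∈ Finset.Ioi i, if l = j then 1 else 0)))))
    (tens_ext fun μ v => ?_) (C.Δ n c) |>.trans ?_
  · simp only [LinearMap.comp_apply, LinearMap.sum_apply, LinearMap.neg_apply,
      TensorProduct.map_tmul, PiTensorProduct.map_tprod, insSum_tprod, TensorProduct.tmul_sum,
      map_sum, hτ, TensorProduct.neg_tmul, map_neg]
    refine Finset.sum_congr rfl fun j _ => ?_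
    rw [Finset.sum_ite_eq' Finset.univ j, if_pos (Finset.mem_univ j), GrMod.sgnP_one]
    congr 4
    ext1 i
    rw [Finset.sum_ite_eq']
    by_cases hij : i = j
    · subst hij
      rw [insFun_self]
      simp
    · rw [insFun_of_ne _ _ _ hij, if_neg hij]
      by_cases hlt : i < j
      · rw [if_pos hlt, if_pos (Finset.mem_Ioi.2 hlt), GrMod.sgnP_one]
        have := h0 i (v i)
        rw [psgn_zero, one_smul] at this
        exact this
      · rw [if_neg hlt, if_neg (by simpa using hlt), GrMod.sgnP_zero]
        rfl
  · rw [LinearMap.sum_apply]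
    rfl

variable {τ C}

omit [CharZero K] in
theorem sum_piAntidiag_fin_one {W : Type*} [AddCommMonoid W] (m : ℕ) (g : (Fin 1 → ℕ) → W) :
    ∑ k ∈ Finset.piAntidiag (Finset.univ : Finset (Fin 1)) m, g k = g fun _ => m := by
  rw [Finset.sum_eq_single_of_mem (fun _ => m) (by simp [Finset.mem_piAntidiag])]
  intro k hk hne
  refine absurd (funext fun i => ?_) hne
  have := (Finset.mem_piAntidiag.1 hk).1
  rw [Fin.sum_univ_one] at this
  rw [Subsingleton.elim i 0, this]

/-- The pair of sequences in the convolution algebra given by the coefficients of a map to a path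
algebra; the sign is that of `f dt = - dt f` for `f` of odd degree. -/
def pathSeq {A : DGAlg P} (Z : C.carrier →ₗ[K] A.path.carrier) :
    (ℕ → (C.carrier →ₗ[K] A.carrier)) × (ℕ → (C.carrier →ₗ[K] A.carrier)) :=
  (fun m => pathFst A.toGrMod m ∘ₗ Z, fun m => - (pathSnd A.toGrMod m ∘ₗ Z))

/-- The operations of the path algebra and those over `Ω₁` agree: the coefficient of `tᵐ`. -/
theorem interval_l_pathSeq_fst (A : DGAlg P) {Z : C.carrier →ₗ[K] A.path.carrier}
    (hZ : IsPar C.toGrMod A.path.toGrMod 0 Z) (n m : ℕ) (c : C.carrier) :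
    ((convLInfty τ C A).interval.l n (fun _ => pathSeq Z)).1 m c =
      pathFst A.toGrMod m (convL τ C A.path.toDerAlg n (fun _ => Z) c) := by
  have h1 : pathFst A.toGrMod m (convOp τ C A.path.toGrAlg n (fun _ => Z) c) =
      ∑ k ∈ Finset.piAntidiag (Finset.univ : Finset (Fin n)) m,
        convOp τ C A.toGrAlg n (fun i => pathFst A.toGrMod (k i) ∘ₗ Z) c := by
    have h := polyCoef_convOp τ C (A.toGrAlg.eps (-1) odd_neg_one 0 (by simp)) (n := n)
      (f := fun _ => Z) (fun _ => hZ) m c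
    refine (congrArg (epsFst A.toGrMod (-1)) h).trans ?_
    rw [map_sum]
    refine Finset.sum_congr rfl fun k _ => ?_
    refine (epsFst_convOp τ C A.toGrAlg odd_neg_one (fun i => ?_) c).trans rfl
    simpa using IsPar.comp (isPar_of_degree_zero (V := (A.toGrMod.eps (-1)).poly)
      (W := A.toGrMod.eps (-1)) (φ := polyCoef _ (k i)) (fun _ _ hx => mem_poly.1 hx _)) hZ
  change (∑ k ∈ Finset.piAntidiag (Finset.univ : Finset (Fin n)) m,
    convL τ C A.toDerAlg n (fun i => pathFst A.toGrMod (k i) ∘ₗ Z)) c = _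
  rw [LinearMap.sum_apply]
  simp only [convL, LinearMap.add_apply, map_add, Finset.sum_add_distrib]
  refine congrArg₂ (· + ·) h1.symm ?_
  by_cases hn : n = 1
  · subst hn
    simp only [dite_true]
    rw [sum_piAntidiag_fin_one, derD_of_even C A.toDerAlg, derD_of_even C A.path.toDerAlg hZ]
    · change A.d (pathFst A.toGrMod m (Z c)) - pathFst A.toGrMod m (Z (C.d c)) =
        pathFst A.toGrMod m (pathD A.d (Z c) - Z (C.d c))
      rw [map_sub, pathFst_pathD]
    · have := IsPar.comp (isPar_of_degree_zero (V := (A.toGrMod.eps (-1)).poly)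
        (W := A.toGrMod) (φ := pathFst A.toGrMod m) (fun _ _ hx => (mem_path.1 hx).1 _)) hZ
      rw [add_zero] at this
      exact this
  · simp only [dif_neg hn, LinearMap.zero_apply, map_zero, Finset.sum_const_zero]

/-- The operations of the path algebra and those over `Ω₁` agree: the coefficient of `tᵐ dt`. -/
theorem interval_l_pathSeq_snd (A : DGAlg P) {Z : C.carrier →ₗ[K] A.path.carrier}
    (hZ : IsPar C.toGrMod A.path.toGrMod 0 Z) (n m : ℕ) (c : C.carrier) :
    ((convLInfty τ C A).interval.l n (fun _ => pathSeq Z)).2 m c =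
      pathSnd A.toGrMod m (convL τ C A.path.toDerAlg n (fun _ => Z) c) := by
  have hpar : ∀ m, IsPar C.toGrMod (A.toGrMod.eps (-1)) 0 (polyCoef _ m ∘ₗ Z) := fun m => by
    simpa using IsPar.comp (isPar_of_degree_zero (V := (A.toGrMod.eps (-1)).poly)
      (W := A.toGrMod.eps (-1)) (φ := polyCoef _ m) (fun _ _ hx => mem_poly.1 hx _)) hZ
  have hpar1 : ∀ m, IsPar C.toGrMod A.toGrMod 0 (pathFst A.toGrMod m ∘ₗ Z) := fun m => by
    have := isPar_epsFst.comp (hpar m)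
    rw [add_zero] at this
    exact this
  have hpar2 : ∀ m, IsPar C.toGrMod A.toGrMod 1 (pathSnd A.toGrMod m ∘ₗ Z) := fun m => by
    have := (isPar_epsSnd odd_neg_one).comp (hpar m)
    rw [add_zero] at this
    exact this
  have hsgn : ∀ m, homSgn C.toGrMod A.toGrMod (pathFst A.toGrMod m ∘ₗ Z) =
      pathFst A.toGrMod m ∘ₗ Z := fun m => by
    rw [homSgn_of_isPar (hpar1 m), psgn_zero, one_smul]
  have h1 : pathSnd A.toGrMod m (convOp τ C A.path.toGrAlg n (fun _ => Z) c) =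
      ∑ j : Fin n, ∑ k ∈ Finset.piAntidiag (Finset.univ : Finset (Fin n)) m,
        convOp τ C A.toGrAlg n (fun i => if i < j then pathFst A.toGrMod (k i) ∘ₗ Z else
          if i = j then - (pathSnd A.toGrMod (k i) ∘ₗ Z) else
            homSgn C.toGrMod A.toGrMod (pathFst A.toGrMod (k i) ∘ₗ Z)) c := by
    have h := polyCoef_convOp τ C (A.toGrAlg.eps (-1) odd_neg_one 0 (by simp)) (n := n)
      (f := fun _ => Z) (fun _ => hZ) m c
    refine (congrArg (epsSnd A.toGrMod (-1)) h).trans ?_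
    rw [map_sum, Finset.sum_comm]
    refine Finset.sum_congr rfl fun k _ => ?_
    refine (epsSnd_convOp τ C A.toGrAlg odd_neg_one (fun i => hpar _) c).trans ?_
    rw [← Finset.sum_neg_distrib]
    refine Finset.sum_congr rfl fun j _ => ?_
    have h2 : (fun i => if i < j then pathFst A.toGrMod (k i) ∘ₗ Z else
          if i = j then - (pathSnd A.toGrMod (k i) ∘ₗ Z) else
            homSgn C.toGrMod A.toGrMod (pathFst A.toGrMod (k i) ∘ₗ Z)) =
        Function.update (fun i => if i = j then pathSnd A.toGrMod (k i) ∘ₗ Z else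
          pathFst A.toGrMod (k i) ∘ₗ Z) j ((-1 : K) • (if j = j then pathSnd A.toGrMod (k j) ∘ₗ Z else
          pathFst A.toGrMod (k j) ∘ₗ Z)) := by
      ext1 i
      by_cases hij : i = j
      · subst hij; simp
      · rw [Function.update_of_ne hij, if_neg hij, if_neg hij, hsgn, ite_self]
    have h3 := (convOpM τ C A.toGrAlg n).map_update_smul (fun i => if i = j then
      pathSnd A.toGrMod (k i) ∘ₗ Z else pathFst A.toGrMod (k i) ∘ₗ Z) j (-1)
      (if j = j then pathSnd A.toGrMod (k j) ∘ₗ Z else pathFst A.toGrMod (k j) ∘ₗ Z)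
    rw [Function.update_eq_self, convOpM_apply, convOpM_apply] at h3
    rw [h2]
    exact (neg_one_smul K _).symm.trans (LinearMap.congr_fun h3 c).symm
  change ((∑ j : Fin n, ∑ k ∈ Finset.piAntidiag (Finset.univ : Finset (Fin n)) m,
    convL τ C A.toDerAlg n (fun i => if i < j then pathFst A.toGrMod (k i) ∘ₗ Z else
          if i = j then - (pathSnd A.toGrMod (k i) ∘ₗ Z) else
            homSgn C.toGrMod A.toGrMod (pathFst A.toGrMod (k i) ∘ₗ Z))) +
    if h : n = 1 then (m + 1) • homSgn C.toGrMod A.toGrMod (pathFst A.toGrMod (m + 1) ∘ₗ Z) else 0) c = _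
  simp only [LinearMap.add_apply, LinearMap.sum_apply, convL, map_add, Finset.sum_add_distrib]
  rw [add_assoc]
  refine congrArg₂ (· + ·) h1.symm ?_
  by_cases hn : n = 1
  · subst hn
    simp only [dite_true]
    rw [Fin.sum_univ_one, sum_piAntidiag_fin_one, hsgn, hsgn, derD_of_even C A.path.toDerAlg hZ,
      if_neg (by simp), if_pos (Subsingleton.elim _ _), derD_of_odd C A.toDerAlg]
    swap
    · simpa using (hpar2 m).smul (-1)
    change A.d (- pathSnd A.toGrMod m (Z c)) + - pathSnd A.toGrMod m (Z (C.d c)) +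
      ((m + 1) • pathFst A.toGrMod (m + 1) ∘ₗ Z) c =
        pathSnd A.toGrMod m (pathD A.d (Z c) - Z (C.d c))
    rw [map_sub, pathSnd_pathD, map_neg, ← Nat.cast_smul_eq_nsmul K, Nat.cast_add, Nat.cast_one,
      LinearMap.smul_apply, LinearMap.comp_apply]
    abel
  · simp only [dif_neg hn, LinearMap.zero_apply, map_zero, Finset.sum_const_zero, add_zero]

/-- On each step of the coradical filtration, the values of `Z` are polynomials of bounded degree.
-/
def IsBounded {A : DGAlg P} (Z : C.carrier →ₗ[K] A.path.carrier) : Prop :=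
  ∀ r, ∃ D, ∀ m, D ≤ m → ∀ c ∈ C.coradical r, polyCoef (A.toGrMod.eps (-1)) m (Z c) = 0

/-- A map to the path algebra whose values are polynomials of bounded degree on each step of the
coradical filtration is Maurer–Cartan over `Ω₁` exactly if it is a twisting morphism. -/
theorem isMaurerCartan_interval_iff (hP : P.IsConnected) (A : DGAlg P)
    {Z : C.carrier →ₗ[K] A.path.carrier} (hZ : ∀ k, ∀ x ∈ C.gr k, Z x ∈ A.path.gr k)
    (hb : IsBounded Z) : IsMaurerCartan (convLInfty τ C A).interval (pathSeq Z) ↔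
      curv τ C A.path.toDerAlg Z = 0 := by
  have hpar : IsPar C.toGrMod A.path.toGrMod 0 Z := isPar_of_degree_zero hZ
  have hgr : pathSeq Z ∈ (convLInfty τ C A).interval.gr 0 := by
    refine ⟨⟨fun m k x hx => ?_, fun m k x hx => ?_⟩, fun N => ?_, fun N => ?_⟩
    · rw [add_zero]
      exact (mem_path.1 (hZ k x hx)).1 m
    · rw [zero_add]
      exact Submodule.neg_mem _ ((mem_path.1 (hZ k x hx)).2 m)
    · obtain ⟨D, hD⟩ := hb N
      refine ⟨D, fun m hm c hc => ?_⟩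
      exact (congrArg (epsFst A.toGrMod (-1)) (hD m hm c hc)).trans (map_zero _)
    · obtain ⟨D, hD⟩ := hb N
      refine ⟨D, fun m hm c hc => ?_⟩
      exact (congrArg (fun y => - epsSnd A.toGrMod (-1) y) (hD m hm c hc)).trans
        ((congrArg Neg.neg (map_zero _)).trans neg_zero)
  have hs1 : ∀ n m c, (∑ k ∈ Finset.range n, ((k + 1).factorial : K)⁻¹ •
      (convLInfty τ C A).interval.l (k + 1) (fun _ => pathSeq Z)).1 m c =
      pathFst A.toGrMod m (∑ k ∈ Finset.range n,
        ((k + 1).factorial : K)⁻¹ • convL τ C A.path.toDerAlg (k + 1) (fun _ => Z) c) :=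
    fun n m c => by
      rw [Prod.fst_sum, Finset.sum_apply, LinearMap.sum_apply, map_sum]
      refine Finset.sum_congr rfl fun k _ => ?_
      rw [map_smul, ← interval_l_pathSeq_fst A hpar]
      rfl
  have hs2 : ∀ n m c, (∑ k ∈ Finset.range n, ((k + 1).factorial : K)⁻¹ •
      (convLInfty τ C A).interval.l (k + 1) (fun _ => pathSeq Z)).2 m c =
      pathSnd A.toGrMod m (∑ k ∈ Finset.range n,
        ((k + 1).factorial : K)⁻¹ • convL τ C A.path.toDerAlg (k + 1) (fun _ => Z) c) :=
    fun n m c => by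
      rw [Prod.snd_sum, Finset.sum_apply, LinearMap.sum_apply, map_sum]
      refine Finset.sum_congr rfl fun k _ => ?_
      rw [map_smul, ← interval_l_pathSeq_snd A hpar]
      rfl
  rw [IsMaurerCartan, and_iff_right hgr]
  constructor
  · intro h
    ext c
    obtain ⟨r, hr⟩ := C.exists_mem_coradical c
    obtain ⟨n₀, hn⟩ := h r
    obtain ⟨h1, h2⟩ := hn (max n₀ (r + 1)) (le_max_left _ _)
    rw [curv_eq_sum τ C hP A.path.toDerAlg hpar hr (n := max n₀ (r + 1)) (by omega) (by omega)]
    refine path_ext (fun m => ?_) (fun m => ?_)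
    · rw [← hs1, h1 m c hr]; exact (map_zero _).symm
    · rw [← hs2, h2 m c hr]; exact (map_zero _).symm
  · intro h N
    refine ⟨N + 1, fun n hn => ⟨fun m c hc => ?_, fun m c hc => ?_⟩⟩
    · rw [hs1, ← curv_eq_sum τ C hP A.path.toDerAlg hpar hc (by omega) (by omega), h]
      exact map_zero _
    · rw [hs2, ← curv_eq_sum τ C hP A.path.toDerAlg hpar hc (by omega) (by omega), h]
      exact map_zero _

/-- Elements of degree `0` of the completed tensor product with `Ω₁` are maps to the path algebra.
-/
theorem exists_eq_pathSeq (A : DGAlg P) {z : (ℕ → (C.carrier →ₗ[K] A.carrier)) ×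
    (ℕ → (C.carrier →ₗ[K] A.carrier))} (hz : z ∈ (convLInfty τ C A).interval.gr 0) :
    ∃ Z : C.carrier →ₗ[K] A.path.carrier, (∀ k, ∀ x ∈ C.gr k, Z x ∈ A.path.gr k) ∧ IsBounded Z ∧
      pathSeq Z = z := by
  obtain ⟨⟨h1, h2⟩, h3, h4⟩ := hz
  have hb : ∀ r, ∃ D, ∀ m, D ≤ m → ∀ c ∈ C.coradical r, z.1 m c = 0 ∧ z.2 m c = 0 := fun r => by
    obtain ⟨D, hD⟩ := h3 r
    obtain ⟨D', hD'⟩ := h4 r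
    exact ⟨max D D', fun m hm c hc => ⟨hD m (le_trans (le_max_left _ _) hm) c hc,
      hD' m (le_trans (le_max_right _ _) hm) c hc⟩⟩
  let Z : C.carrier →ₗ[K] A.path.carrier :=
    { toFun := fun c => Finsupp.ofSupportFinite
        (fun m => epsInl A.toGrMod (-1) (z.1 m c) + epsInr A.toGrMod (-1) (- z.2 m c)) (by
          obtain ⟨r, hr⟩ := C.exists_mem_coradical c
          obtain ⟨D, hD⟩ := hb r
          refine (Set.finite_lt_nat D).subset fun m hm => ?_
          by_contra h
          obtain ⟨h5, h6⟩ := hD m (not_lt.1 h) c hr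
          refine hm ?_
          beta_reduce
          rw [h5, h6, neg_zero, map_zero, map_zero, add_zero])
      map_add' := fun x y => Finsupp.ext fun m => by
        change epsInl A.toGrMod (-1) (z.1 m (x + y)) + epsInr A.toGrMod (-1) (- z.2 m (x + y)) =
          (epsInl A.toGrMod (-1) (z.1 m x) + epsInr A.toGrMod (-1) (- z.2 m x)) +
          (epsInl A.toGrMod (-1) (z.1 m y) + epsInr A.toGrMod (-1) (- z.2 m y))
        simp only [map_add, neg_add]
        abel
      map_smul' := fun a x => Finsupp.ext fun m => by
        change epsInl A.toGrMod (-1) (z.1 m (a • x)) + epsInr A.toGrMod (-1) (- z.2 m (a • x)) =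
          a • (epsInl A.toGrMod (-1) (z.1 m x) + epsInr A.toGrMod (-1) (- z.2 m x))
        simp only [map_smul, map_neg, smul_add, smul_neg] }
  have hfst : ∀ m c, pathFst A.toGrMod m (Z c) = z.1 m c := fun m c => add_zero _
  have hsnd : ∀ m c, pathSnd A.toGrMod m (Z c) = - z.2 m c := fun m c => zero_add _
  refine ⟨Z, fun k x hx => mem_path.2 ⟨fun m => ?_, fun m => ?_⟩, fun r => ?_, ?_⟩
  · rw [hfst]
    have := h1 m k x hx
    rwa [add_zero] at this
  · rw [hsnd]
    have := h2 m k x hx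
    rw [zero_add] at this
    exact Submodule.neg_mem _ this
  · obtain ⟨D, hD⟩ := hb r
    refine ⟨D, fun m hm c hc => eps_ext ?_ ?_⟩
    · exact (hfst m c).trans ((hD m hm c hc).1.trans (map_zero _).symm)
    · exact (hsnd m c).trans ((congrArg Neg.neg (hD m hm c hc).2).trans
        (neg_zero.trans (map_zero _).symm))
  · refine Prod.ext (funext fun m => LinearMap.ext fun c => hfst m c)
      (funext fun m => LinearMap.ext fun c => ?_)
    change - pathSnd A.toGrMod m (Z c) = _
    rw [hsnd, neg_neg]

/-- Gauge equivalences are twisting morphisms to the path algebra which are bounded on each step of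
the coradical filtration. -/
theorem gaugeEquiv_iff (hP : P.IsConnected) (A : DGAlg P) (φ ψ : C.carrier →ₗ[K] A.carrier) :
    GaugeEquiv (convLInfty τ C A) φ ψ ↔ ∃ Z : C.carrier →ₗ[K] A.path.carrier,
      (∀ k, ∀ x ∈ C.gr k, Z x ∈ A.path.gr k) ∧ IsBounded Z ∧ curv τ C A.path.toDerAlg Z = 0 ∧
      (A.pathEv 0).toLin ∘ₗ Z = φ ∧ (A.pathEv 1).toLin ∘ₗ Z = ψ := by
  have h0 : ∀ Z : C.carrier →ₗ[K] A.path.carrier,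
      (pathSeq Z).1 0 = φ ↔ (A.pathEv 0).toLin ∘ₗ Z = φ := fun Z => by
    have : (A.pathEv 0).toLin ∘ₗ Z = (pathSeq Z).1 0 := LinearMap.ext fun c => pathEv_zero A (Z c)
    rw [this]
  have h1 : ∀ Z : C.carrier →ₗ[K] A.path.carrier, IsBounded Z →
      ((convLInfty τ C A).IsNull (fun j => ∑ i ∈ Finset.range j, (pathSeq Z).1 i - ψ) ↔
        (A.pathEv 1).toLin ∘ₗ Z = ψ) := fun Z hb => by
    have hs : ∀ r, ∃ D, ∀ j, D ≤ j → ∀ c ∈ C.coradical r,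
        (∑ i ∈ Finset.range j, (pathSeq Z).1 i) c = (A.pathEv 1).toLin (Z c) := fun r => by
      obtain ⟨D, hD⟩ := hb r
      refine ⟨D, fun j hj c hc => ?_⟩
      rw [pathEv_one A (Z c) (N := j), LinearMap.sum_apply]
      · rfl
      · intro m hm
        have := hD m (le_trans hj hm) c hc
        exact ⟨(congrArg (epsFst A.toGrMod (-1)) this).trans (map_zero _),
          (congrArg (epsSnd A.toGrMod (-1)) this).trans (map_zero _)⟩
    constructor
    · intro h
      ext c
      obtain ⟨r, hr⟩ := C.exists_mem_coradical c
      obtain ⟨D, hD⟩ := hs r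
      obtain ⟨j₀, hj⟩ := h r
      have := hj (max D j₀) (le_max_right _ _) c hr
      rw [LinearMap.sub_apply, hD _ (le_max_left _ _) c hr, sub_eq_zero] at this
      exact this
    · rintro rfl r
      obtain ⟨D, hD⟩ := hs r
      refine ⟨D, fun j hj c hc => ?_⟩
      rw [LinearMap.sub_apply, hD j hj c hc]
      exact sub_self _
  constructor
  · rintro ⟨z, hz, hz0, hz1⟩
    obtain ⟨Z, hdeg, hb, rfl⟩ := exists_eq_pathSeq A hz.1
    exact ⟨Z, hdeg, hb, (isMaurerCartan_interval_iff hP A hdeg hb).1 hz, (h0 Z).1 hz0,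
      (h1 Z hb).1 hz1⟩
  · rintro ⟨Z, hdeg, hb, hc, hz0, hz1⟩
    exact ⟨pathSeq Z, (isMaurerCartan_interval_iff hP A hdeg hb).2 hc, (h0 Z).2 hz0,
      (h1 Z hb).2 hz1⟩

end Interval

/-! ### Lifting twisting morphisms -/

section Lifting

variable {𝒞 : Cooperad K} {P : Operad K}

theorem TwistingMorphism.zero_eq_zero (τ : TwistingMorphism 𝒞 P) (hP : P.IsConnected) :
    τ.toFun (Fin 0) = 0 := by
  have := hP.subsingleton_zero
  exact LinearMap.ext fun _ => Subsingleton.elim _ _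

/-- A twisting morphism vanishes in arity one for degree reasons, since `𝒞(1)` and `P(1)` are
concentrated in degree `0`. -/
theorem TwistingMorphism.one_eq_zero (τ : TwistingMorphism 𝒞 P) (h𝒞 : 𝒞.IsConnected)
    (hP : P.IsConnected) : τ.toFun (Fin 1) = 0 := by
  have hP1 : ∀ y ∈ (P.obj Unit).gr (-1), y = 0 := fun y hy => by
    obtain ⟨a, rfl⟩ := hP.one.2 y
    have h0 := (P.obj Unit).toGrMod.proj_of_mem (-1) ((P.obj Unit).gr 0 |>.smul_mem a P.one_mem)
    rw [if_neg (by decide), (P.obj Unit).toGrMod.proj_of_mem (-1) hy, if_pos rfl] at h0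
    exact h0
  have h1 : τ.toFun Unit = 0 := GrMod.hom_ext fun k x hx => by
    rw [LinearMap.zero_apply]
    by_cases hk : k = 0
    · subst hk
      exact hP1 _ (by simpa using τ.degree Unit 0 x hx)
    · rw [h𝒞.one.1 ((𝒞.counit_gr k x hk hx).trans (map_zero 𝒞.counit).symm), map_zero]
  ext x
  have h2 := τ.natural _ _ finOneUnit x
  rw [h1, LinearMap.zero_apply] at h2
  have h3 := congrArg (P.map finOneUnit.symm) h2
  rw [← P.map_trans, Equiv.self_trans_symm, P.map_refl, map_zero] at h3
  exact h3.symm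

variable [CharZero K]

theorem Coalg.map_Δ_congr (C : Coalg 𝒞) {M' W : Type*} [AddCommGroup M'] [Module K M']
    [AddCommGroup W] [Module K W] {n N M : ℕ} (h : M < n + N) (α : 𝒞.obj (Fin n) →ₗ[K] M')
    {f g : Fin n → (C.carrier →ₗ[K] W)} (hfg : ∀ i, ∀ x ∈ C.coradical N, f i x = g i x)
    {x : C.carrier} (hx : x ∈ C.coradical M) :
    TensorProduct.map α (PiTensorProduct.map f) (C.Δ n x) =
      TensorProduct.map α (PiTensorProduct.map g) (C.Δ n x) := by
  suffices ∀ s : Finset (Fin n), TensorProduct.map α (PiTensorProduct.map f) (C.Δ n x) =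
      TensorProduct.map α (PiTensorProduct.map (s.piecewise g f)) (C.Δ n x) by
    simpa using this Finset.univ
  intro s
  induction s using Finset.induction_on with
  | empty => simp
  | insert a s ha ih =>
    rw [ih, Finset.piecewise_insert, ← sub_eq_zero, ← LinearMap.sub_apply,
      ← TensorProduct.mapBilinear_apply, ← TensorProduct.mapBilinear_apply, ← map_sub]
    have h1 := (PiTensorProduct.mapMultilinear K (fun _ : Fin n => C.carrier)
      (fun _ : Fin n => W)).map_update_sub (s.piecewise g f) a (s.piecewise g f a) (g a)
    rw [Function.update_eq_self] at h1
    simp only [PiTensorProduct.mapMultilinear_apply] at h1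
    rw [← h1, TensorProduct.mapBilinear_apply]
    refine C.map_map_Δ_eq_zero h α a (fun y hy => ?_) hx
    rw [Function.update_self, Finset.piecewise_eq_of_notMem _ _ _ ha, LinearMap.sub_apply,
      hfg a y hy, sub_self]

variable (τ : TwistingMorphism 𝒞 P) (C : Coalg 𝒞)

/-- The value of `⋆_τ(φ)` on a step of the coradical filtration depends only on the values of `φ`
on the previous step, since `τ` vanishes in the arities `0` and `1`. -/
theorem mcOp_congr (h𝒞 : 𝒞.IsConnected) (hP : P.IsConnected) (A : GrAlg P)
    {φ ψ : C.carrier →ₗ[K] A.carrier} {N : ℕ} (h : ∀ x ∈ C.coradical N, φ x = ψ x) {c : C.carrier}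
    (hc : c ∈ C.coradical (N + 1)) : mcOp τ C A φ c = mcOp τ C A ψ c := by
  rw [mcOp_eq_sum τ C A φ hc (Nat.lt_succ_self _), mcOp_eq_sum τ C A ψ hc (Nat.lt_succ_self _)]
  refine Finset.sum_congr rfl fun n _ => ?_
  rcases n with _ | _ | n
  · simp only [τ.zero_eq_zero hP, TensorProduct.map_zero_left, LinearMap.zero_apply]
  · simp only [τ.one_eq_zero h𝒞 hP, TensorProduct.map_zero_left, LinearMap.zero_apply]
  · rw [C.map_Δ_congr (N := N) (by omega) _ (fun _ => h) hc]

/-- The curvature on `F_N C` depends only on the restriction of the map to `F_N C`. -/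
theorem curv_congr (h𝒞 : 𝒞.IsConnected) (hP : P.IsConnected) (A : DerAlg P)
    {φ ψ : C.carrier →ₗ[K] A.carrier} {N : ℕ} (h : ∀ x ∈ C.coradical N, φ x = ψ x) {c : C.carrier}
    (hc : c ∈ C.coradical N) : curv τ C A φ c = curv τ C A ψ c := by
  have h1 := mcOp_congr τ C h𝒞 hP A.toGrAlg h (C.coradical_mono (Nat.le_succ N) hc)
  change A.d (φ c) - φ (C.d c) + mcOp τ C A.toGrAlg φ c =
    A.d (ψ c) - ψ (C.d c) + mcOp τ C A.toGrAlg ψ c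
  rw [h1, h c hc, h _ (C.d_mem_coradical hc)]

/-- On `F_r C` at most `r` inputs are combined, so bounds for a multiplicative filtration grow at
most by the factor `r`. -/
theorem mcOp_mem_filtration (h𝒞 : 𝒞.IsConnected) (hP : P.IsConnected) (A : GrAlg P)
    {S : ℕ → Submodule K A.carrier} (hS : Monotone S)
    (hact : ∀ (n : ℕ) (μ : P.obj (Fin n)) (v : Fin n → A.carrier) (D : ℕ), (∀ i, v i ∈ S D) →
      A.act n (μ ⊗ₜ[K] PiTensorProduct.tprod K v) ∈ S (n * D))
    {φ : C.carrier →ₗ[K] A.carrier} {r D : ℕ} (hφ : ∀ x ∈ C.coradical r, φ x ∈ S D)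
    {c : C.carrier} (hc : c ∈ C.coradical r) : mcOp τ C A φ c ∈ S (r * D) := by
  obtain ⟨g, hg⟩ := LinearMap.exists_extend (LinearMap.id : S D →ₗ[K] S D)
  have h1 : ∀ x ∈ C.coradical r, φ x = ((S D).subtype ∘ₗ g ∘ₗ φ) x := fun x hx => by
    have := LinearMap.congr_fun hg ⟨φ x, hφ x hx⟩
    exact (congrArg Subtype.val this).symm
  rw [mcOp_congr τ C h𝒞 hP A h1 (C.coradical_mono (Nat.le_succ r) hc),
    mcOp_eq_sum τ C A _ hc (Nat.lt_succ_self r)]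
  refine Submodule.sum_mem _ fun n hn => Submodule.smul_mem _ _ ?_
  have h2 : (S (n * D)).mkQ ∘ₗ A.act n ∘ₗ TensorProduct.map (τ.toFun (Fin n))
      (PiTensorProduct.map fun _ => (S D).subtype ∘ₗ g ∘ₗ φ) = 0 := tens_ext fun μ v => by
    rw [LinearMap.comp_apply, LinearMap.comp_apply, TensorProduct.map_tmul,
      PiTensorProduct.map_tprod, LinearMap.zero_apply, Submodule.mkQ_apply,
      Submodule.Quotient.mk_eq_zero]
    exact hact n _ _ D fun i => (g (φ (v i))).2
  have h3 := LinearMap.congr_fun h2 (C.Δ n c)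
  rw [LinearMap.comp_apply, LinearMap.zero_apply, Submodule.mkQ_apply,
    Submodule.Quotient.mk_eq_zero] at h3
  exact hS (Nat.mul_le_mul_right D (Nat.lt_succ_iff.1 (Finset.mem_range.1 hn))) h3

/-- The lowest order part of the Bianchi identity: on the first step of the coradical filtration
where the curvature does not vanish, it is closed. -/
theorem d_curv_add_curv_d (h𝒞 : 𝒞.IsConnected) (hP : P.IsConnected) (A : DGAlg P)
    {φ : C.carrier →ₗ[K] A.carrier} (hφ : ∀ k, ∀ x ∈ C.gr k, φ x ∈ A.gr k) {N : ℕ}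
    (h : ∀ x ∈ C.coradical N, curv τ C A.toDerAlg φ x = 0) {c : C.carrier}
    (hc : c ∈ C.coradical (N + 1)) :
    A.d (curv τ C A.toDerAlg φ c) + curv τ C A.toDerAlg φ (C.d c) = 0 := by
  have hpar : IsPar C.toGrMod A.toGrMod 0 φ := isPar_of_degree_zero hφ
  have hpar1 : IsPar C.toGrMod A.toGrMod 1 (curv τ C A.toDerAlg φ) := by
    have := IsPar.of_degree (V := C.toGrMod) (W := A.toGrMod) (e := -1)
      (f := curv τ C A.toDerAlg φ) fun k x hx => ?_
    · exact this
    exact Submodule.add_mem _ (Submodule.sub_mem _ (A.d_mem _ _ (hφ k x hx))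
      (hφ _ _ (C.d_mem k x hx))) (mcOp_mem τ C A.toGrAlg hφ k x hx)
  have hb := bianchi τ C hP A.toDerAlg hpar (N := N + 3) (by omega) hc
  rw [A.d_d, Finset.sum_range_succ', Finset.sum_eq_zero, zero_add] at hb
  · rw [← derD_of_odd C A.toDerAlg hpar1]
    simp only [Nat.factorial_zero, Nat.cast_one, inv_one, one_smul, zero_add, convL,
      LinearMap.add_apply, dite_true] at hb
    rw [convOp_of_isPar τ C A.toGrAlg (p := fun _ => 1) (fun i => by
      obtain rfl : i = 0 := Fin.fin_one_eq_zero i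
      exact hpar1)] at hb
    simp only [τ.one_eq_zero h𝒞 hP, LinearMap.zero_comp, TensorProduct.map_zero_left,
      LinearMap.comp_zero, LinearMap.zero_apply, zero_add] at hb
    exact hb
  · intro j _
    rw [convL, dif_neg (by omega), add_zero, convOp_eq_zero τ C A.toGrAlg (N := N) (by omega) 0
      (fun x hx => by rw [Fin.cons_zero]; exact h x hx) hc, smul_zero]

/-- Twisting morphisms are constructed by successive approximation: if the curvature `R` of `φ`
vanishes on a term of the coradical filtration and takes values in a subspace `N` with a contraction
`h`, then the curvature of `φ - h R` vanishes on the next term. For the common kernel `N` of some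
morphisms this means that twisting morphisms lift along acyclic fibrations. Bounds on the initial
map and on the contraction for a multiplicative filtration `S` are inherited by the limit. -/
theorem exists_curv_eq_zero (h𝒞 : 𝒞.IsConnected) (hP : P.IsConnected) {E : DGAlg P}
    {N : Submodule K E.carrier} {h : E.carrier →ₗ[K] E.carrier}
    (hh : ∀ k, ∀ x ∈ E.gr k, h x ∈ E.gr (k + 1)) (hhN : ∀ y ∈ N, h y ∈ N)
    (hdh : ∀ y ∈ N, E.d (h y) + h (E.d y) = y)
    {S : ℕ → Submodule K E.carrier} (hS : Monotone S)
    (hact : ∀ (n : ℕ) (μ : P.obj (Fin n)) (v : Fin n → E.carrier) (D : ℕ), (∀ i, v i ∈ S D) →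
      E.act n (μ ⊗ₜ[K] PiTensorProduct.tprod K v) ∈ S (n * D))
    (hSd : ∀ D, ∀ x ∈ S D, E.d x ∈ S D) (hSh : ∀ D, ∀ x ∈ S D, h x ∈ S D)
    {φ : C.carrier →ₗ[K] E.carrier} (hφ : ∀ k, ∀ x ∈ C.gr k, φ x ∈ E.gr k)
    {D₀ : ℕ} (hSφ : ∀ c, φ c ∈ S D₀)
    (hN : ∀ ψ : C.carrier →ₗ[K] E.carrier, (∀ c, ψ c - φ c ∈ N) →
      ∀ c, curv τ C E.toDerAlg ψ c ∈ N) :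
    ∃ Φ : C.carrier →ₗ[K] E.carrier, (∀ k, ∀ x ∈ C.gr k, Φ x ∈ E.gr k) ∧
      curv τ C E.toDerAlg Φ = 0 ∧ (∀ c, Φ c - φ c ∈ N) ∧
      ∀ r, ∃ D, ∀ c ∈ C.coradical r, Φ c ∈ S D := by
  let F : ℕ → (C.carrier →ₗ[K] E.carrier) := fun k =>
    Nat.rec φ (fun _ Φ => Φ - h ∘ₗ curv τ C E.toDerAlg Φ) k
  have hF : ∀ k, F (k + 1) = F k - h ∘ₗ curv τ C E.toDerAlg (F k) := fun _ => rfl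
  have hcd : ∀ (Φ : C.carrier →ₗ[K] E.carrier), (∀ k, ∀ x ∈ C.gr k, Φ x ∈ E.gr k) →
      ∀ k, ∀ x ∈ C.gr k, curv τ C E.toDerAlg Φ x ∈ E.gr (k - 1) := fun Φ hΦ k x hx =>
    Submodule.add_mem _ (Submodule.sub_mem _ (E.d_mem _ _ (hΦ k x hx))
      (hΦ _ _ (C.d_mem k x hx))) (mcOp_mem τ C E.toGrAlg hΦ k x hx)
  have key : ∀ k, (∀ i, ∀ x ∈ C.gr i, F k x ∈ E.gr i) ∧ (∀ c, F k c - φ c ∈ N) ∧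
      (∀ x ∈ C.coradical k, curv τ C E.toDerAlg (F k) x = 0) ∧
      ∀ r, ∃ D, ∀ c ∈ C.coradical r, F k c ∈ S D := fun k => by
    induction k with
    | zero =>
      refine ⟨hφ, fun c => ?_, fun x hx => ?_, fun r => ⟨D₀, fun c _ => hSφ c⟩⟩
      · change φ c - φ c ∈ N
        rw [sub_self]
        exact N.zero_mem
      · rw [C.eq_zero_of_mem_coradical_zero hx, map_zero]
    | succ k ih =>
      obtain ⟨h1, h2, h3, h4⟩ := ih
      refine ⟨fun i x hx => ?_, fun c => ?_, fun c hc => ?_, fun r => ?_⟩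
      · have := hh _ _ (hcd _ h1 i x hx)
        rw [sub_add_cancel] at this
        exact Submodule.sub_mem _ (h1 i x hx) this
      · rw [hF, LinearMap.sub_apply, sub_right_comm]
        exact Submodule.sub_mem _ (h2 c) (hhN _ (hN _ h2 c))
      · have h5 := mcOp_congr τ C h𝒞 hP E.toGrAlg (φ := F (k + 1)) (ψ := F k) (N := k)
          (fun x hx => by
            rw [hF, LinearMap.sub_apply, LinearMap.comp_apply, h3 x hx, map_zero, sub_zero]) hc
        -- `⋆_τ` is unaffected by the correction `h R`, so the curvature changes by `∂ (h R)`, which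
        -- equals `R` since `R` is closed
        have h6 := d_curv_add_curv_d τ C h𝒞 hP E h1 h3 hc
        have h7 := hdh _ (hN _ h2 c)
        set R := curv τ C E.toDerAlg (F k) with hR
        have h8 : R c = E.d (F k c) - F k (C.d c) + mcOp τ C E.toGrAlg (F k) c := rfl
        change E.d (F k c - h (R c)) - (F k (C.d c) - h (R (C.d c))) +
          mcOp τ C E.toGrAlg (F (k + 1)) c = 0
        have h9 : R (C.d c) = - E.d (R c) := by
          rw [eq_neg_iff_add_eq_zero, add_comm]
          exact h6
        rw [h5, h9, map_sub, map_neg]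
        calc _ = R c - (E.d (h (R c)) + h (E.d (R c))) := by rw [h8]; abel
          _ = 0 := by rw [h7, sub_self]
      · obtain ⟨D, hD⟩ := h4 r
        refine ⟨max D (r * D), fun c hc => ?_⟩
        have hm := hS (le_max_left D (r * D))
        refine Submodule.sub_mem _ (hm (hD c hc)) (hSh _ _ ?_)
        exact Submodule.add_mem _ (Submodule.sub_mem _ (hSd _ _ (hm (hD c hc)))
          (hm (hD _ (C.d_mem_coradical hc)))) (hS (le_max_right D (r * D))
            (mcOp_mem_filtration τ C h𝒞 hP E.toGrAlg hS hact hD hc))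
  obtain ⟨Φ, hΦ⟩ := C.exists_glue F fun k x hx => by
    rw [hF, LinearMap.sub_apply, LinearMap.comp_apply, (key k).2.2.1 x hx, map_zero, sub_zero]
  refine ⟨Φ, fun i x hx => ?_, ?_, fun c => ?_, fun r => ?_⟩
  · obtain ⟨r, hr⟩ := C.exists_mem_coradical x
    rw [hΦ r x hr]
    exact (key r).1 i x hx
  · ext c
    obtain ⟨r, hr⟩ := C.exists_mem_coradical c
    rw [curv_congr τ C h𝒞 hP E.toDerAlg (hΦ r) hr, (key r).2.2.1 c hr]
    rfl
  · obtain ⟨r, hr⟩ := C.exists_mem_coradical c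
    rw [hΦ r c hr]
    exact (key r).2.1 c
  · obtain ⟨D, hD⟩ := (key r).2.2.2 r
    exact ⟨D, fun c hc => by rw [hΦ r c hc]; exact hD c hc⟩

end Lifting

/-! ### Homotopies of morphisms and paths of twisting morphisms -/

section Contraction

/-- The image of an idempotent endomorphism of a complex is contractible if it is acyclic. -/
theorem GrMod.exists_contraction (V : GrMod K) {d e : V →ₗ[K] V}
    (hd : ∀ k, ∀ x ∈ V.gr k, d x ∈ V.gr (k - 1)) (hdd : ∀ x, d (d x) = 0)
    (he : ∀ k, ∀ x ∈ V.gr k, e x ∈ V.gr k) (hee : ∀ x, e (e x) = e x)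
    (hed : ∀ x, e (d x) = d (e x)) (hac : ∀ x, d x = 0 → e x = x → ∃ y, d y = x) :
    ∃ h : V →ₗ[K] V, (∀ k, ∀ x ∈ V.gr k, h x ∈ V.gr (k + 1)) ∧ (∀ x, e (h x) = h x) ∧
      ∀ x, e x = x → d (h x) + h (d x) = x := by
  have h1 : ∀ k : ℤ, ∃ s : V →ₗ[K] V, (∀ x, s x ∈ V.gr (k + 1)) ∧ (∀ x, e (s x) = s x) ∧
      ∀ x ∈ V.gr k, d x = 0 → e x = x → d (s x) = x := fun k => by
    set D : V.gr (k + 1) →ₗ[K] V := d ∘ₗ e ∘ₗ (V.gr (k + 1)).subtype with hD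
    obtain ⟨r, hr⟩ := D.rangeRestrict.exists_rightInverse_of_surjective D.range_rangeRestrict
    obtain ⟨g, hg⟩ := LinearMap.exists_extend r
    refine ⟨e ∘ₗ (V.gr (k + 1)).subtype ∘ₗ g, fun x => he _ _ (g x).2, fun x => hee _,
      fun x hx hdx hex => ?_⟩
    obtain ⟨y, hy⟩ := hac x hdx hex
    have hmem : x ∈ LinearMap.range D := by
      refine ⟨⟨V.proj (k + 1) y, V.proj_mem _ y⟩, ?_⟩
      have h2 := proj_comp_of_degree (s := -1) hd (k + 1) y
      rw [add_neg_cancel_right, hy, V.proj_of_mem k hx, if_pos rfl] at h2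
      change d (e (V.proj (k + 1) y)) = x
      rw [← hed, ← h2, hex]
    have h3 := congrArg Subtype.val (LinearMap.congr_fun hr ⟨x, hmem⟩)
    have h4 := LinearMap.congr_fun hg ⟨x, hmem⟩
    change d (e (g x)) = x
    rw [LinearMap.comp_apply, Submodule.subtype_apply] at h4
    rw [h4]
    exact h3
  choose s hs hes hds using h1
  set t := V.gather s with ht
  have het : ∀ x, e (t x) = t x := fun x => by
    induction x using V.homogeneous_induction with
    | hom k x hx => rw [ht, V.gather_of_mem _ hx, hes]
    | add x y hx hy => rw [map_add, map_add, hx, hy]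
  have hdeg : ∀ k, ∀ x ∈ V.gr k, t x ∈ V.gr (k + 1) := fun k x hx => by
    rw [ht, V.gather_of_mem _ hx]
    exact hs k x
  have htd : ∀ k, ∀ x ∈ V.gr k, d x = 0 → e x = x → d (t x) = x := fun k x hx => by
    rw [ht, V.gather_of_mem _ hx]
    exact hds k x hx
  have hdh : ∀ x, d (t (e x - t (d (e x)))) + t (d (e x) - t (d (d (e x)))) = e x := fun x => by
    induction x using V.homogeneous_induction with
    | hom k x hx =>
      have h2 := htd (k - 1) _ (hd _ _ (he _ _ hx)) (hdd _) (by rw [hed, hee])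
      have h3 := hdeg _ _ (hd _ _ (he _ _ hx))
      rw [sub_add_cancel] at h3
      rw [htd k _ (Submodule.sub_mem _ (he _ _ hx) h3) (by rw [map_sub, h2, sub_self])
        (by rw [map_sub, het, hee]), hdd, map_zero, sub_zero, sub_add_cancel]
    | add x y hx hy =>
      have := congrArg₂ (· + ·) hx hy
      simp only [map_add, map_sub, hdd, map_zero, sub_zero] at this ⊢
      rw [← this]
      abel
  refine ⟨t ∘ₗ (LinearMap.id - t ∘ₗ d), fun k x hx => ?_, fun x => het _, fun x hx => ?_⟩
  · have h3 := hdeg _ _ (hd _ _ hx)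
    rw [sub_add_cancel] at h3
    exact hdeg _ _ (Submodule.sub_mem _ hx h3)
  · have := hdh x
    rw [hx] at this
    exact this

variable {P : Operad K}

/-- The kernel of a retraction of a quasi-isomorphism is contractible. -/
theorem DGAlg.Hom.IsQuasiIso.exists_contraction {A B : DGAlg P} {s : DGAlg.Hom A B}
    (hs : s.IsQuasiIso) (p : DGAlg.Hom B A) (hps : ∀ a, p.toLin (s.toLin a) = a) :
    ∃ h : B.carrier →ₗ[K] B.carrier, (∀ k, ∀ x ∈ B.gr k, h x ∈ B.gr (k + 1)) ∧
      (∀ x, p.toLin (h x) = 0) ∧ ∀ x, p.toLin x = 0 → B.d (h x) + h (B.d x) = x := by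
  have hp : ∀ x, p.toLin (x - s.toLin (p.toLin x)) = 0 := fun x => by rw [map_sub, hps, sub_self]
  obtain ⟨h, h1, h2, h3⟩ := B.toGrMod.exists_contraction (d := B.d)
    (e := LinearMap.id - s.toLin ∘ₗ p.toLin) B.d_mem B.d_d
    (fun k x hx => Submodule.sub_mem _ hx (s.map_mem _ _ (p.map_mem _ _ hx)))
    (fun x => by
      change (x - s.toLin (p.toLin x)) - s.toLin (p.toLin (x - s.toLin (p.toLin x))) = _
      rw [hp, map_zero, sub_zero]
      rfl)
    (fun x => by
      change B.d x - s.toLin (p.toLin (B.d x)) = B.d (x - s.toLin (p.toLin x))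
      rw [p.map_d, s.map_d, map_sub])
    (fun x hx hex => by
      have hpx : p.toLin x = 0 := by rw [← hex]; exact hp x
      obtain ⟨z, w, hz, hw⟩ := hs.2 x hx
      have h4 : z = - A.d (p.toLin w) := by
        rw [hw, map_add, hps, p.map_d] at hpx
        exact eq_neg_of_add_eq_zero_left hpx
      refine ⟨w - s.toLin (p.toLin w), ?_⟩
      rw [hw, h4, map_sub, map_neg, s.map_d]
      abel)
  refine ⟨h, h1, fun x => by rw [← h2]; exact hp _, fun x hx => h3 x ?_⟩
  change x - s.toLin (p.toLin x) = x
  rw [hx, map_zero, sub_zero]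

variable [CharZero K]

/-- The paths which are polynomials of degree at most `D`. -/
def pathDegreeLE (V : GrMod K) (D : ℕ) : Submodule K (V.eps (-1)).poly :=
  ⨅ m ∈ Set.Ioi D, LinearMap.ker (polyCoef (V.eps (-1)) m)

omit [CharZero K] in
theorem mem_pathDegreeLE {V : GrMod K} {D : ℕ} {x : (V.eps (-1)).poly} :
    x ∈ pathDegreeLE V D ↔ ∀ m, D < m → polyCoef (V.eps (-1)) m x = 0 := by
  simp [pathDegreeLE]

theorem act_mem_pathDegreeLE (A : DGAlg P) (n : ℕ) (μ : P.obj (Fin n))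
    (v : Fin n → A.path.carrier) (D : ℕ) (hv : ∀ i, v i ∈ pathDegreeLE A.toGrMod D) :
    A.path.act n (μ ⊗ₜ[K] PiTensorProduct.tprod K v) ∈ pathDegreeLE A.toGrMod (n * D) := by
  refine mem_pathDegreeLE.2 fun m hm => ?_
  refine (polyActCoef_tprod _ n m μ v).trans (Finset.sum_eq_zero fun k hk => ?_)
  obtain ⟨i, hi⟩ : ∃ i, D < k i := by
    by_contra! h
    have h1 := Finset.sum_le_sum fun i (_ : i ∈ Finset.univ) => h i
    rw [(Finset.mem_piAntidiag.1 hk).1] at h1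
    simp at h1
    omega
  rw [MultilinearMap.map_coord_zero _ i (mem_pathDegreeLE.1 (hv i) _ hi), TensorProduct.tmul_zero,
    map_zero]

theorem d_mem_pathDegreeLE (A : DGAlg P) (D : ℕ) (x : A.path.carrier)
    (hx : x ∈ pathDegreeLE A.toGrMod D) : A.path.d x ∈ pathDegreeLE A.toGrMod D := by
  rw [mem_pathDegreeLE] at hx ⊢
  intro m hm
  have h1 : polyCoef (A.toGrMod.eps (-1)) m (A.path.d x) = epsD (-1) A.d (polyCoef _ m x) +
      epsMul A.toGrMod (-1) (polyCoef _ m (polyDer _ x)) := rfl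
  rw [h1, polyCoef_der, hx m hm, hx (m + 1) (by omega), smul_zero, map_zero, map_zero, add_zero]

/-- A contraction `h` of `V`, applied to the coefficients of paths. -/
def pathContraction {V : GrMod K} (h : V →ₗ[K] V) : (V.eps (-1)).poly →ₗ[K] (V.eps (-1)).poly :=
  polyMap (epsD (-1) h)

section

variable {V : GrMod K} (h : V →ₗ[K] V)

omit [CharZero K] in
theorem pathFst_contraction (m : ℕ) (x : (V.eps (-1)).poly) :
    pathFst V m (pathContraction h x) = h (pathFst V m x) := by
  simp [pathFst, pathContraction]

omit [CharZero K] in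
theorem pathSnd_contraction (m : ℕ) (x : (V.eps (-1)).poly) :
    pathSnd V m (pathContraction h x) = - h (pathSnd V m x) := by
  simp [pathSnd, pathContraction]

end

theorem pathEv_contraction (A : DGAlg P) (h : A.carrier →ₗ[K] A.carrier) (s : K)
    (x : A.path.carrier) :
    (A.pathEv s).toLin (pathContraction h x) = h ((A.pathEv s).toLin x) := by
  change epsFst _ _ (polyEv _ s (polyMap _ _)) = _
  rw [polyEv_map]
  exact epsFst_epsD (-1) h _

theorem pathFst_path {A B : DGAlg P} (f : DGAlg.Hom A B) (m : ℕ) (x : A.path.carrier) :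
    pathFst B.toGrMod m (f.path.toLin x) = f.toLin (pathFst A.toGrMod m x) := add_zero _

theorem pathSnd_path {A B : DGAlg P} (f : DGAlg.Hom A B) (m : ℕ) (x : A.path.carrier) :
    pathSnd B.toGrMod m (f.path.toLin x) = f.toLin (pathSnd A.toGrMod m x) := zero_add _

theorem pathEv_path {A B : DGAlg P} (f : DGAlg.Hom A B) (s : K) (x : A.path.carrier) :
    (B.pathEv s).toLin (f.path.toLin x) = f.toLin ((A.pathEv s).toLin x) := by
  change epsFst _ _ (polyEv _ s (polyMap _ _)) = f.toLin (epsFst _ _ (polyEv _ s x))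
  rw [polyEv_map]
  exact add_zero _

/-- The path `t ↦ t a`. -/
def pathLine (V : GrMod K) : V →ₗ[K] (V.eps (-1)).poly := polySingle _ 1 ∘ₗ epsInl V (-1)

theorem pathEv_line (A : DGAlg P) (s : K) (a : A.carrier) :
    (A.pathEv s).toLin (pathLine A.toGrMod a) = s • a := by
  change epsFst _ _ (polyEv _ s (polySingle _ 1 _)) = _
  rw [polyEv_single, pow_one, map_smul]
  rfl

theorem path_line {A B : DGAlg P} (f : DGAlg.Hom A B) (a : A.carrier) :
    f.path.toLin (pathLine A.toGrMod a) = pathLine B.toGrMod (f.toLin a) := by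
  change polyMap _ (polySingle _ 1 _) = polySingle _ 1 _
  rw [polyMap_single]
  exact congrArg (polySingle (B.toGrMod.eps (-1)) 1) (eps_ext (add_zero _)
    ((zero_add _).trans (map_zero f.toLin)))

theorem path_const {A B : DGAlg P} (f : DGAlg.Hom A B) (a : A.carrier) :
    f.path.toLin (A.pathConst.toLin a) = B.pathConst.toLin (f.toLin a) :=
  path_ext (fun m => by rw [pathFst_path, pathFst_const, pathFst_const]; split_ifs <;> simp)
    (fun m => by rw [pathSnd_path, pathSnd_const, pathSnd_const, map_zero])

end Contraction

section Homotopy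

variable {𝒞 : Cooperad K} {P : Operad K} [CharZero K] (τ : TwistingMorphism 𝒞 P) (C : Coalg 𝒞)

omit [CharZero K] in
theorem curv_hom_eq_zero {A B : DGAlg P} (q : DGAlg.Hom A B) {φ ψ : C.carrier →ₗ[K] A.carrier}
    (h : ∀ c, q.toLin (ψ c - φ c) = 0) (hφ : curv τ C B.toDerAlg (q.toLin ∘ₗ φ) = 0)
    (c : C.carrier) : q.toLin (curv τ C A.toDerAlg ψ c) = 0 := by
  have h1 : q.toLin ∘ₗ ψ = q.toLin ∘ₗ φ := LinearMap.ext fun c => by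
    rw [← sub_eq_zero, LinearMap.comp_apply, LinearMap.comp_apply, ← map_sub, h]
  have h2 := curv_comp_hom τ C (A := A.toDerAlg) (B := B.toDerAlg) q.toLin q.map_d q.map_act ψ
  rw [h1, hφ] at h2
  exact (LinearMap.congr_fun h2 c).symm

omit [CharZero K] in
theorem curv_comp_eq_zero {A B : DGAlg P} (q : DGAlg.Hom A B) {φ : C.carrier →ₗ[K] A.carrier}
    (hφ : curv τ C A.toDerAlg φ = 0) : curv τ C B.toDerAlg (q.toLin ∘ₗ φ) = 0 := by
  rw [curv_comp_hom τ C (A := A.toDerAlg) (B := B.toDerAlg) q.toLin q.map_d q.map_act φ, hφ,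
    LinearMap.comp_zero]

/-- The two values in `A` of a twisting morphism `φ` to a path object `B` are joined by a polynomial
path. It is the image under `p₁` of a path in `B` from `s p₀ φ` to `φ` which is mapped to a constant
path by `p₀`; such a path exists since the kernel of `p₀` is contractible. -/
theorem exists_path_of_pathObject (h𝒞 : 𝒞.IsConnected) (hP : P.IsConnected) {A B : DGAlg P}
    {s : DGAlg.Hom A B} (hs : s.IsQuasiIso) (p₀ p₁ : DGAlg.Hom B A)
    (hp₀ : ∀ a, p₀.toLin (s.toLin a) = a) (hp₁ : ∀ a, p₁.toLin (s.toLin a) = a)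
    {φ : C.carrier →ₗ[K] B.carrier} (hφ : ∀ k, ∀ x ∈ C.gr k, φ x ∈ B.gr k)
    (hcurv : curv τ C B.toDerAlg φ = 0) :
    ∃ Z : C.carrier →ₗ[K] A.path.carrier, (∀ k, ∀ x ∈ C.gr k, Z x ∈ A.path.gr k) ∧ IsBounded Z ∧
      curv τ C A.path.toDerAlg Z = 0 ∧ (A.pathEv 0).toLin ∘ₗ Z = p₀.toLin ∘ₗ φ ∧
      (A.pathEv 1).toLin ∘ₗ Z = p₁.toLin ∘ₗ φ := by
  obtain ⟨h, hh, hph, hdh⟩ := hs.exists_contraction p₀ hp₀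
  -- the linear path from `s p₀ φ` to `φ`
  let φ₀ : C.carrier →ₗ[K] B.path.carrier := B.pathConst.toLin ∘ₗ s.toLin ∘ₗ p₀.toLin ∘ₗ φ +
    pathLine B.toGrMod ∘ₗ (φ - s.toLin ∘ₗ p₀.toLin ∘ₗ φ)
  have hφ₀ : ∀ c, φ₀ c = B.pathConst.toLin (s.toLin (p₀.toLin (φ c))) +
    pathLine B.toGrMod (φ c - s.toLin (p₀.toLin (φ c))) := fun _ => rfl
  have hev0 : (B.pathEv 0).toLin ∘ₗ φ₀ = s.toLin ∘ₗ p₀.toLin ∘ₗ φ := LinearMap.ext fun c => by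
    rw [LinearMap.comp_apply, hφ₀, map_add, pathEv_const, pathEv_line, zero_smul, add_zero]
    rfl
  have hev1 : (B.pathEv 1).toLin ∘ₗ φ₀ = φ := LinearMap.ext fun c => by
    rw [LinearMap.comp_apply, hφ₀, map_add, pathEv_const, pathEv_line, one_smul, add_sub_cancel]
  have hpath : p₀.path.toLin ∘ₗ φ₀ = A.pathConst.toLin ∘ₗ p₀.toLin ∘ₗ φ :=
    LinearMap.ext fun c => by
      rw [LinearMap.comp_apply, hφ₀, map_add, path_const, hp₀, path_line, map_sub, hp₀, sub_self, map_zero,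
        add_zero]
      rfl
  have hgr : ∀ k, ∀ x ∈ C.gr k, φ₀ x ∈ B.path.gr k := fun k x hx => by
    have h1 := s.map_mem _ _ (p₀.map_mem _ _ (hφ k x hx))
    exact Submodule.add_mem _ (B.pathConst.map_mem _ _ h1)
      (polySingle_mem 1 (mem_eps.2 ⟨Submodule.sub_mem _ (hφ k x hx) h1, Submodule.zero_mem _⟩))
  let N : Submodule K B.path.carrier := LinearMap.ker (B.pathEv 0).toLin ⊓
    LinearMap.ker (B.pathEv 1).toLin ⊓ LinearMap.ker p₀.path.toLin
  have hmem : ∀ y, y ∈ N ↔ ((B.pathEv 0).toLin y = 0 ∧ (B.pathEv 1).toLin y = 0) ∧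
    p₀.path.toLin y = 0 := fun y => Iff.rfl
  obtain ⟨Φ, h1, h2, h3, h4⟩ := exists_curv_eq_zero τ C h𝒞 hP (E := B.path) (N := N)
    (h := pathContraction h) (S := pathDegreeLE B.toGrMod) (φ := φ₀) (D₀ := 1)
    (fun k x hx => by
      rw [mem_path] at hx ⊢
      refine ⟨fun m => ?_, fun m => ?_⟩
      · rw [pathFst_contraction]; exact hh _ _ (hx.1 m)
      · rw [pathSnd_contraction]; exact Submodule.neg_mem _ (hh _ _ (hx.2 m)))
    (fun y hy => by
      rw [hmem] at hy ⊢
      refine ⟨⟨?_, ?_⟩, path_ext (fun m => ?_) (fun m => ?_)⟩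
      · rw [pathEv_contraction, hy.1.1, map_zero]
      · rw [pathEv_contraction, hy.1.2, map_zero]
      · rw [pathFst_path, pathFst_contraction, hph, map_zero]
      · rw [pathSnd_path, pathSnd_contraction, map_neg, hph, neg_zero, map_zero])
    (fun y hy => by
      have hf : ∀ m, p₀.toLin (pathFst B.toGrMod m y) = 0 := fun m => by
        rw [← pathFst_path, hy.2, map_zero]
      have hg : ∀ m, p₀.toLin (pathSnd B.toGrMod m y) = 0 := fun m => by
        rw [← pathSnd_path, hy.2, map_zero]
      refine path_ext (fun m => ?_) (fun m => ?_)
      · rw [map_add, pathFst_pathD, pathFst_contraction, pathFst_contraction, pathFst_pathD,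
          hdh _ (hf m)]
      · rw [map_add, pathSnd_pathD, pathFst_contraction, pathSnd_contraction, pathSnd_contraction,
          pathSnd_pathD, map_sub, map_smul, map_neg]
        refine Eq.trans ?_ (hdh _ (hg m))
        abel)
    (fun i j hij x hx => mem_pathDegreeLE.2 fun m hm => mem_pathDegreeLE.1 hx m (by omega))
    (act_mem_pathDegreeLE B) (d_mem_pathDegreeLE B)
    (fun D x hx => mem_pathDegreeLE.2 fun m hm => by
      rw [pathContraction, polyCoef_map, mem_pathDegreeLE.1 hx m hm, map_zero])
    hgr
    (fun c => mem_pathDegreeLE.2 fun m hm => by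
      change polyCoef _ m (polySingle _ 0 _ + polySingle _ 1 _) = 0
      rw [map_add, polyCoef_single, polyCoef_single, if_neg (by omega), if_neg (by omega), add_zero])
    (fun ψ hψ c => by
      refine (hmem _).2 ⟨⟨curv_hom_eq_zero τ C (B.pathEv 0) (fun c => ((hmem _).1 (hψ c)).1.1) ?_ c,
        curv_hom_eq_zero τ C (B.pathEv 1) (fun c => ((hmem _).1 (hψ c)).1.2) ?_ c⟩,
        curv_hom_eq_zero τ C p₀.path (fun c => ((hmem _).1 (hψ c)).2) ?_ c⟩
      · rw [hev0]
        exact curv_comp_eq_zero τ C s (curv_comp_eq_zero τ C p₀ hcurv)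
      · rw [hev1, hcurv]
      · rw [hpath]
        exact curv_comp_eq_zero τ C A.pathConst (curv_comp_eq_zero τ C p₀ hcurv))
  have hev : ∀ c, (B.pathEv 0).toLin (Φ c) = s.toLin (p₀.toLin (φ c)) ∧
      (B.pathEv 1).toLin (Φ c) = φ c := fun c => by
    have h5 := (hmem _).1 (h3 c)
    rw [map_sub, map_sub, sub_eq_zero, sub_eq_zero] at h5
    exact ⟨h5.1.1.trans (LinearMap.congr_fun hev0 c), h5.1.2.trans (LinearMap.congr_fun hev1 c)⟩
  refine ⟨p₁.path.toLin ∘ₗ Φ, fun k x hx => p₁.path.map_mem _ _ (h1 k x hx), fun r => ?_,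
    curv_comp_eq_zero τ C p₁.path h2, LinearMap.ext fun c => ?_, LinearMap.ext fun c => ?_⟩
  · obtain ⟨D, hD⟩ := h4 r
    refine ⟨D + 1, fun m hm c hc => ?_⟩
    have h5 := mem_pathDegreeLE.1 (hD c hc) m (by omega)
    change (p₁.toGrHom.eps (-1) odd_neg_one 0 (by simp)).toLin (polyCoef _ m (Φ c)) = 0
    rw [h5, map_zero]
  · change (A.pathEv 0).toLin (p₁.path.toLin (Φ c)) = _
    rw [pathEv_path, (hev c).1, hp₁]
    rfl
  · change (A.pathEv 1).toLin (p₁.path.toLin (Φ c)) = _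
    rw [pathEv_path, (hev c).2]
    rfl

end Homotopy

end ConvLInf

end

open ConvLInf

theorem mainTheorem3 {K : Type u} [Field K] [CharZero K] (𝒞 : Cooperad K) (P : Operad K)
    (h𝒞 : 𝒞.IsConnected) (hP : P.IsConnected) (τ : TwistingMorphism 𝒞 P) :
    -- the operations define a complete L-infinity structure on Hom(C, A)
    (∀ (C : Coalg 𝒞) (A : DGAlg P), IsCompleteLInfty (convLInfty τ C A)) ∧
    -- naturality in A and in C
    (∀ (C : Coalg 𝒞) (A B : DGAlg P) (g : A ⟶ B),
      IsStrictMorphism (convLInfty τ C A) (convLInfty τ C B)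
        (LinearMap.llcomp K C.carrier A.carrier B.carrier (DGAlg.Hom.toLin g))) ∧
    (∀ (C C' : Coalg 𝒞) (A : DGAlg P) (h : Coalg.Hom C' C),
      IsStrictMorphism (convLInfty τ C A) (convLInfty τ C' A)
        (LinearMap.lcomp K A.carrier h.toLin)) ∧
    -- the Maurer-Cartan elements are the twisting morphisms relative to τ
    (∀ (C : Coalg 𝒞) (A : DGAlg P) (φ : C.carrier →ₗ[K] A.carrier),
      IsMaurerCartan (convLInfty τ C A) φ ↔ IsTwisting τ C A φ) ∧
    -- the cobar construction exists
    (∀ C : Coalg 𝒞, Nonempty (CobarConstruction τ C)) ∧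
    -- Maurer-Cartan elements correspond to maps out of the cobar construction, and
    -- homotopy of these maps corresponds to gauge equivalence
    (∀ (C : Coalg 𝒞) (Ω : CobarConstruction τ C) (A : DGAlg P),
      (∀ f : Ω.alg ⟶ A, IsMaurerCartan (convLInfty τ C A) (DGAlg.Hom.toLin f ∘ₗ Ω.ι)) ∧
      (∀ φ : C.carrier →ₗ[K] A.carrier, IsMaurerCartan (convLInfty τ C A) φ →
        ∃! f : Ω.alg ⟶ A, DGAlg.Hom.toLin f ∘ₗ Ω.ι = φ) ∧
      (∀ f g : Ω.alg ⟶ A, HomotopicalAlgebra.RightHomotopyRel f g ↔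
        GaugeEquiv (convLInfty τ C A) (DGAlg.Hom.toLin f ∘ₗ Ω.ι) (DGAlg.Hom.toLin g ∘ₗ Ω.ι))) := by
  refine ⟨fun C A => isCompleteLInfty_conv τ C hP A, fun C A B g => isStrictMorphism_llcomp τ C g,
    fun C C' A h => isStrictMorphism_lcomp τ C A h,
    fun C A φ => isMaurerCartan_iff_isTwisting τ C hP A φ, fun C => ⟨cobar τ C hP⟩,
    fun C Ω A => ⟨fun f => Ω.isMaurerCartan_comp hP f, fun φ hφ => Ω.existsUnique_hom hP hφ,
      fun f g => ?_⟩⟩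
  rw [gaugeEquiv_iff hP]
  constructor
  · rintro ⟨Q, ⟨H⟩⟩
    have hH := (isMaurerCartan_iff τ C hP _ _).1 (Ω.isMaurerCartan_comp hP (A := Q.P) H.h)
    obtain ⟨Z, h1, h2, h3, h4, h5⟩ := exists_path_of_pathObject τ C h𝒞 hP (s := Q.ι)
      Q.weakEquivalence_ι.mem Q.p₀ Q.p₁
      (fun a => LinearMap.congr_fun (congrArg DGAlg.Hom.toLin Q.ι_p₀) a)
      (fun a => LinearMap.congr_fun (congrArg DGAlg.Hom.toLin Q.ι_p₁) a) hH.1 hH.2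
    exact ⟨Z, h1, h2, h3,
      h4.trans (congrArg (fun k : Ω.alg ⟶ A => DGAlg.Hom.toLin k ∘ₗ Ω.ι) H.h₀),
      h5.trans (congrArg (fun k : Ω.alg ⟶ A => DGAlg.Hom.toLin k ∘ₗ Ω.ι) H.h₁)⟩
  · rintro ⟨Z, h1, -, h3, h4, h5⟩
    obtain ⟨F, hF, -⟩ := Ω.existsUnique_hom hP (A := A.path)
      ((isMaurerCartan_iff τ C hP A.path Z).2 ⟨h1, h3⟩)
    have huniq : ∀ f' f : Ω.alg ⟶ A, DGAlg.Hom.toLin f' ∘ₗ Ω.ι = DGAlg.Hom.toLin f ∘ₗ Ω.ι → f' = f :=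
      fun f' f h => (Ω.existsUnique_hom hP (Ω.isMaurerCartan_comp hP f)).unique h rfl
    refine ⟨A.pathObject, ⟨⟨F, huniq _ _ ?_, huniq _ _ ?_⟩⟩⟩
    · rw [← h4, ← hF]
      rfl
    · rw [← h5, ← hF]
      rfl
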